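/- Let $(M,I,J,K,g)$ be a hyperkähler manifold (not necessarily compact): $I,J,K=IJ$ are integrable almost complex structures satisfying the quaternionic relations, and the Riemannian metric $g$ is Kähler with respect to each of them. Put $\omega_A(v,w)=g(v,Aw)$ and $\bar\Omega=\omega_J-\sqrt{-1}\,\omega_K\in\Lambda^{0,2}(M,I)$, the complex conjugate of the holomorphic symplectic form $\Omega=\omega_J+\sqrt{-1}\,\omega_K$. Let $B$ be a holomorphic Hermitian vector bundle on $(M,I)$, and $\nabla=\nabla^{1,0}+\bar\partial$ its Chern connection, extended to $B$-valued forms. Let $J$ act multiplicatively on forms by $(J\alpha)(v)=\alpha(J^{-1}v)$ for 1-forms $\alpha$. On smooth $(0,p)$-forms on $(M,I)$ with values in $B$ consider the Dolbeault operator $\bar\partial$ and the operator $\bar\partial_J:=J\circ\nabla^{1,0}\circ J^{-1}$, that is, the extension of $J\circ\nabla^{1,0}:B\to B\otimes\Lambda^{0,1}(M,I)$ by the Leibniz rule; both map $\Lambda^{0,p}(M,I)\otimes B$ to $\Lambda^{0,p+1}(M,I)\otimes B$. Equip $\Lambda^{0,p}(M,I)\otimes B$ with the Hermitian metric induced by that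 of $B$ and by the Hermitian metric on $(TM,I)$ with real part $g$, so that for a unitary frame $(e_i)$ of $(TM,I)$ $$\langle\alpha,\beta\rangle=\sum_{i_1<\dots<i_p}h\big(\alpha(e_{i_1},\dots,e_{i_p}),\beta(e_{i_1},\dots,e_{i_p})\big).$$ Let $\bar\partial^*$, $\bar\partial_J^*$ and $\Lambda_{\bar\Omega}$ be the (formal) Hermitian adjoints of $\bar\partial$, $\bar\partial_J$ and of the exterior multiplication by $\bar\Omega$ with respect to $\int_M\langle\cdot,\cdot\rangle\,d\mathrm{vol}_g$ (these exist). Put $\Delta_{\bar\partial}=\{\bar\partial,\bar\partial^*\}$, $\Delta_{\bar\partial_J}=\{\bar\partial_J,\bar\partial_J^*\}$ and $\Theta_+=\{\bar\partial,\bar\partial_J\}$, where $\{\cdot,\cdot\}$ is the anticommutator. Then, for every $p$, on smooth $B$-valued $(0,p)$-forms $$\Delta_{\bar\partial}-\Delta_{\bar\partial_J}=[\Theta_+,\Lambda_{\bar\Omega}].$$ Moreover, $\Theta_+$ is the exterior multiplication by an $\operatorname{End}(B)$-valued $(0,2)$-form $\Theta$ which corresponds to the $\Lambda^2_+(M)$-part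 of the curvature $R=\nabla^2$ of $B$ (its component of weight 2 with respect to the $SU(2)$-action on 2-forms generated by $I,J,K$), under the isomorphism $\Lambda^{0,2}(M,I)\cong\Lambda^{1,1}_{+,I}(M)$, $\beta\mapsto\frac12\big(\beta(J\cdot,\cdot)+\beta(\cdot,J\cdot)\big)$; that is, $R-\frac12\big(\Theta(J\cdot,\cdot)+\Theta(\cdot,J\cdot)\big)$ is $SU(2)$-invariant. -/

import Mathlib

open scoped Manifold ContDiff
open Bundle MeasureTheory

namespace QuatDolbeault

noncomputable section

/-! ### Linear algebra -/

section LinearAlgebra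

/-- An alternating map on a finite-dimensional normed space is continuous. -/
theorem alternatingMap_continuous {V W : Type*} [NormedAddCommGroup V] [NormedSpace ℝ V]
    [FiniteDimensional ℝ V] [NormedAddCommGroup W] [NormedSpace ℝ W] {p : ℕ}
    (f : V [⋀^Fin p]→ₗ[ℝ] W) : Continuous f := by
  classical
  have key : (f : (Fin p → V) → W) = fun v =>
      ∑ r : Fin p → Fin (Module.finrank ℝ V),
        (∏ i, (Module.finBasis ℝ V).repr (v i) (r i)) •
          f (fun i => Module.finBasis ℝ V (r i)) := by
    funext v
    have h1 : f v = f.toMultilinearMap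
        (fun i => ∑ j, (Module.finBasis ℝ V).repr (v i) j • Module.finBasis ℝ V j) := by
      simp only [Module.Basis.sum_repr]
      rfl
    rw [h1, MultilinearMap.map_sum]
    refine Finset.sum_congr rfl fun r _ => ?_
    rw [MultilinearMap.map_smul_univ]
    rfl
  rw [key]
  refine continuous_finsetSum _ fun r _ => ?_
  refine Continuous.smul ?_ continuous_const
  refine continuous_finsetProd _ fun i _ => ?_
  have h2 : Continuous ((Module.finBasis ℝ V).coord (r i)) :=
    LinearMap.continuous_of_finiteDimensional _
  exact h2.comp (continuous_apply i)

/-- An alternating map on a finite-dimensional space, as an element of the normed space of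
continuous alternating maps. -/
def toCont {V W : Type*} [NormedAddCommGroup V] [NormedSpace ℝ V]
    [FiniteDimensional ℝ V] [NormedAddCommGroup W] [NormedSpace ℝ W] {p : ℕ}
    (f : V [⋀^Fin p]→ₗ[ℝ] W) : V [⋀^Fin p]→L[ℝ] W :=
  { f with cont := alternatingMap_continuous f }

/-- Multiplication by `√-1`, as a real-linear map. -/
def mulI (V : Type*) [NormedAddCommGroup V] [NormedSpace ℂ V] : V →L[ℝ] V :=
  (Complex.I • ContinuousLinearMap.id ℂ V).restrictScalars ℝ

variable {V W : Type*} [NormedAddCommGroup V] [NormedSpace ℂ V] [AddCommGroup W] [Module ℂ W]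

/-- The complex-linear part `v ↦ (L v - √-1 L (√-1 v)) / 2` of a real-linear map. -/
def part10 (L : V →ₗ[ℝ] W) : V →ₗ[ℝ] W :=
  (1 / 2 : ℂ) • (L - Complex.I • (L ∘ₗ (mulI V).toLinearMap))

/-- The conjugate-linear part `v ↦ (L v + √-1 L (√-1 v)) / 2` of a real-linear map. -/
def part01 (L : V →ₗ[ℝ] W) : V →ₗ[ℝ] W :=
  (1 / 2 : ℂ) • (L + Complex.I • (L ∘ₗ (mulI V).toLinearMap))

/-- For an `End(W)`-valued linear form `θ` and a `W`-valued `p`-form `η`, the linear map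
`v ↦ θ(v) ∘ η`; its alternatization is `θ ∧ η`. -/
def compForm {U : Type*} [AddCommGroup U] [Module ℝ U] {p : ℕ} (θ : U →ₗ[ℝ] (W →ₗ[ℂ] W))
    (η : U [⋀^Fin p]→ₗ[ℝ] W) : U →ₗ[ℝ] (U [⋀^Fin p]→ₗ[ℝ] W) where
  toFun v := ((θ v).restrictScalars ℝ).compAlternatingMap η
  map_add' v w := by ext; simp
  map_smul' r v := by ext; simp

/-- The exterior product `θ ∧ η` of an `End(W)`-valued 1-form and a `W`-valued `p`-form:
`(θ ∧ η)(v₀,…,v_p) = ∑ᵢ (-1)ⁱ θ(vᵢ) η(v₀,…,v̂ᵢ,…,v_p)`. -/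
def wedgeOne {U : Type*} [AddCommGroup U] [Module ℝ U] {p : ℕ} (θ : U →ₗ[ℝ] (W →ₗ[ℂ] W))
    (η : U [⋀^Fin p]→ₗ[ℝ] W) : U [⋀^Fin (p + 1)]→ₗ[ℝ] W :=
  AlternatingMap.alternatizeUncurryFin (compForm θ η)

/-- The exterior product `Θ ∧ η` of an `End(W)`-valued 2-form and a `W`-valued `p`-form:
`(Θ ∧ η)(v₀,…,v_{p+1}) = ∑_{i<j} (-1)^{i+j+1} Θ(vᵢ,vⱼ) η(v₀,…,v̂ᵢ,…,v̂ⱼ,…,v_{p+1})`.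
(Alternating twice counts each pair `i < j` two times.) -/
def wedgeTwo {U : Type*} [AddCommGroup U] [Module ℝ U] {p : ℕ}
    (Θ : U →ₗ[ℝ] U →ₗ[ℝ] (W →ₗ[ℂ] W)) (η : U [⋀^Fin p]→ₗ[ℝ] W) :
    U [⋀^Fin (p + 2)]→ₗ[ℝ] W :=
  (1 / 2 : ℂ) • AlternatingMap.alternatizeUncurryFin
    { toFun := fun v => wedgeOne (Θ v) η
      map_add' := fun v w => by
        have : compForm (Θ (v + w)) η = compForm (Θ v) η + compForm (Θ w) η := by
          ext; simp [compForm]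
        simp only [wedgeOne, this, AlternatingMap.alternatizeUncurryFin_add]
      map_smul' := fun r v => by
        have : compForm (Θ (r • v)) η = r • compForm (Θ v) η := by
          ext; simp [compForm]
        simp only [wedgeOne, this, AlternatingMap.alternatizeUncurryFin_smul, RingHom.id_apply] }

end LinearAlgebra

/-! ### Weights of the `SU(2)`-action on 2-forms

`i, j, k` are the three quaternionic structures on a real vector space `U`. -/

section Weights

variable {U W : Type*} [AddCommGroup W]

/-- The infinitesimal action on bilinear forms of an endomorphism `L`:
the derivative at `t = 0` of `β(exp(-tL)v, exp(-tL)w)`. -/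
def infAction [AddCommGroup U] (L : U → U) (β : U → U → W) : U → U → W :=
  fun v w => -β (L v) w - β v (L w)

/-- The Casimir operator of `𝔰𝔲(2) = ⟨i, j, k⟩`. -/
def casimir [AddCommGroup U] (i j k : U → U) (β : U → U → W) : U → U → W :=
  infAction i (infAction i β) + infAction j (infAction j β) + infAction k (infAction k β)

/-- `β` belongs to the sum of all irreducible `SU(2)`-subrepresentations of weight `l`, i.e.
isomorphic to `S^l` of the fundamental one: the Casimir operator, normalized so that `i, j, k`
square to `-1` on the fundamental representation, acts on weight `l` as `-l(l+2)`. -/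
def IsPureWeight [AddCommGroup U] (l : ℕ) (i j k : U → U) (β : U → U → W) : Prop :=
  casimir i j k β = fun v w => -((l * (l + 2)) • β v w)

/-- `β₊` is the `Λ²₊`-part of the 2-form `β`: its component of weight 2 in the decomposition
of 2-forms into weights 2 and 0. -/
def IsPlusPart [AddCommGroup U] (i j k : U → U) (β βplus : U → U → W) : Prop :=
  IsPureWeight 2 i j k βplus ∧ IsPureWeight 0 i j k (β - βplus)

/-- The isomorphism `Λ^{0,2} ≅ Λ^{1,1}₊`, the degree two part of the multiplicative isomorphism
`⨁ S^p ℜ ⊗ Λ^{0,p} ≅ Λ^*₊` given in degree one by `y ⊗ α ↦ α`, `x ⊗ α ↦ J⁻¹α = α ∘ J`, namely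
`xy ⊗ α₁ ∧ α₂ ↦ (J⁻¹α₁ ∧ α₂ + α₁ ∧ J⁻¹α₂) / 2`. -/
def plusIso [Module ℂ W] (j : U → U) (β : U → U → W) : U → U → W :=
  fun v w => (1 / 2 : ℂ) • (β (j v) w + β v (j w))

end Weights

/-! ### Hyperkähler manifolds -/

section Manifold

variable {E : Type*} [NormedAddCommGroup E] [NormedSpace ℂ E]
  {M : Type*} [TopologicalSpace M] [ChartedSpace E M]

/-- The smooth real manifold underlying a complex manifold. -/
instance isManifold_real [IsManifold 𝓘(ℂ, E) ω M] : IsManifold 𝓘(ℝ, E) ∞ M := by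
  refine isManifold_of_contDiffOn _ _ _ fun e e' he he' => ?_
  have h := (contDiffGroupoid ω 𝓘(ℂ, E)).compatible he he'
  rw [contDiffGroupoid, mem_groupoid_of_pregroupoid] at h
  exact (h.1.restrict_scalars ℝ).of_le le_top

/-- The complex structure `I` of a complex manifold, acting on the real tangent space `T_x M`.
(Mathlib identifies `T_x M` with `E` through the preferred chart at `x`; the coordinate changes
are holomorphic.) -/
def tangentI (x : M) : TangentSpace 𝓘(ℝ, E) x →L[ℝ] TangentSpace 𝓘(ℝ, E) x :=
  mulI E

variable [IsManifold 𝓘(ℂ, E) ω M]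

/-- The linear isomorphism from `E` to `T_y M` given by the coordinate frame of the preferred
chart at `x₀`, for `y` in the domain of that chart. -/
def chartFrame (x₀ y : M) : E →ₗ[ℝ] TangentSpace 𝓘(ℝ, E) y :=
  (trivializationAt E (TangentSpace 𝓘(ℝ, E)) x₀).symmₗ ℝ y

/-- The inverse of `chartFrame x₀ y`. -/
def chartCoframe (x₀ y : M) : TangentSpace 𝓘(ℝ, E) y →ₗ[ℝ] E :=
  (trivializationAt E (TangentSpace 𝓘(ℝ, E)) x₀).linearMapAt ℝ y

/-- The point of `M` with coordinates `u` in the preferred chart at `x₀`. -/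
def chartPoint (x₀ : M) (u : E) : M := (extChartAt 𝓘(ℝ, E) x₀).symm u

/-- Smooth real vector fields. -/
def IsSmoothVF (X : ∀ x : M, TangentSpace 𝓘(ℝ, E) x) : Prop :=
  ContMDiff 𝓘(ℝ, E) (𝓘(ℝ, E).prod 𝓘(ℝ, E)) ∞
    (fun x => (TotalSpace.mk' E x (X x) : TangentBundle 𝓘(ℝ, E) M))

/-- The almost complex structure `A` is integrable: its Nijenhuis tensor vanishes. -/
def IsIntegrable (A : ∀ x : M, TangentSpace 𝓘(ℝ, E) x →L[ℝ] TangentSpace 𝓘(ℝ, E) x) : Prop :=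
  ∀ X Y : ∀ x : M, TangentSpace 𝓘(ℝ, E) x, IsSmoothVF X → IsSmoothVF Y → ∀ x : M,
    VectorField.mlieBracket 𝓘(ℝ, E) (fun y => A y (X y)) (fun y => A y (Y y)) x
      - A x (VectorField.mlieBracket 𝓘(ℝ, E) (fun y => A y (X y)) Y x)
      - A x (VectorField.mlieBracket 𝓘(ℝ, E) X (fun y => A y (Y y)) x)
      - VectorField.mlieBracket 𝓘(ℝ, E) X Y x = 0

/-- The 2-form `β` is closed: in local coordinates,
`(dβ)(a,b,c) = ∂_a β(b,c) + ∂_b β(c,a) + ∂_c β(a,b) = 0`. -/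
def IsClosedTwoForm
    (β : ∀ x : M, TangentSpace 𝓘(ℝ, E) x → TangentSpace 𝓘(ℝ, E) x → ℝ) : Prop :=
  ∀ (x₀ : M) (a b c : E),
    let β' : E → E → E → ℝ := fun b c u =>
      β (chartPoint x₀ u) (chartFrame x₀ (chartPoint x₀ u) b) (chartFrame x₀ (chartPoint x₀ u) c)
    let u₀ : E := extChartAt 𝓘(ℝ, E) x₀ x₀
    fderiv ℝ (β' b c) u₀ a + fderiv ℝ (β' c a) u₀ b + fderiv ℝ (β' a b) u₀ c = 0

/-- Smooth Riemannian metrics on `M`. -/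
abbrev Metric (E : Type*) [NormedAddCommGroup E] [NormedSpace ℂ E]
    (M : Type*) [TopologicalSpace M] [ChartedSpace E M] [IsManifold 𝓘(ℂ, E) ω M] :=
  ContMDiffRiemannianMetric 𝓘(ℝ, E) ∞ E (fun x : M => TangentSpace 𝓘(ℝ, E) x)

/-- The form `ω_A(v, w) = g(v, A w)`. -/
def kahlerForm (g : Metric E M)
    (A : ∀ x : M, TangentSpace 𝓘(ℝ, E) x →L[ℝ] TangentSpace 𝓘(ℝ, E) x) (x : M)
    (v w : TangentSpace 𝓘(ℝ, E) x) : ℝ :=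
  g.inner x v (A x w)

/-- The metric `g` is Kähler with respect to `A`: `A` is an integrable almost complex structure,
orthogonal for `g`, and the form `ω_A` is closed. -/
structure IsKahler (g : Metric E M)
    (A : ∀ x : M, TangentSpace 𝓘(ℝ, E) x →L[ℝ] TangentSpace 𝓘(ℝ, E) x) : Prop where
  smooth : ContMDiff 𝓘(ℝ, E) (𝓘(ℝ, E).prod 𝓘(ℝ, E →L[ℝ] E)) ∞
    (fun x => TotalSpace.mk' (E →L[ℝ] E)
      (E := fun x : M => TangentSpace 𝓘(ℝ, E) x →L[ℝ] TangentSpace 𝓘(ℝ, E) x) x (A x))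
  square : ∀ x v, A x (A x v) = -v
  integrable : IsIntegrable A
  orthogonal : ∀ x v w, g.inner x (A x v) (A x w) = g.inner x v w
  closed : IsClosedTwoForm (kahlerForm g A)

/-- A hyperkähler structure `(I, J, K, g)` on `M`, whose complex structure `I` is the one of the
given complex manifold `M`; here `K = I J`. -/
structure Hyperkahler (E : Type*) [NormedAddCommGroup E] [NormedSpace ℂ E]
    (M : Type*) [TopologicalSpace M] [ChartedSpace E M] [IsManifold 𝓘(ℂ, E) ω M] where
  g : Metric E M
  J : ∀ x : M, TangentSpace 𝓘(ℝ, E) x →L[ℝ] TangentSpace 𝓘(ℝ, E) x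
  anticommute : ∀ x v, tangentI x (J x v) = -J x (tangentI x v)
  kahler_I : IsKahler g tangentI
  kahler_J : IsKahler g J
  kahler_K : IsKahler g (fun x => tangentI x ∘L J x)

/-- The third complex structure `K = I J`. -/
def Hyperkahler.K (X : Hyperkahler E M) (x : M) :
    TangentSpace 𝓘(ℝ, E) x →L[ℝ] TangentSpace 𝓘(ℝ, E) x :=
  tangentI x ∘L X.J x

/-- The `(0,2)`-form `Ω̄ = ω_J - √-1 ω_K`, conjugate to the holomorphic symplectic form
`Ω = ω_J + √-1 ω_K`. -/
def Hyperkahler.OmegaBar (X : Hyperkahler E M) (x : M) :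
    TangentSpace 𝓘(ℝ, E) x →ₗ[ℝ] TangentSpace 𝓘(ℝ, E) x →ₗ[ℝ] ℂ :=
  LinearMap.mk₂ ℝ
    (fun v w => (kahlerForm X.g X.J x v w : ℂ) - Complex.I * (kahlerForm X.g X.K x v w : ℂ))
    (fun v v' w => by simp [kahlerForm]; ring)
    (fun r v w => by simp [kahlerForm]; ring)
    (fun v w w' => by simp [kahlerForm]; ring)
    (fun r v w => by simp [kahlerForm]; ring)

/-- The Riemannian measure of `(M, g)`. In the preferred chart at each point `x₀` it is the
Lebesgue measure, normalized by a basis `b` of `E`, with density `√det(g(bᵢ, bⱼ))`; these measures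
(each extended by zero outside its chart) agree on the intersections of charts, and the Riemannian
measure is the least measure that dominates them all. -/
def riemannianMeasure [FiniteDimensional ℂ E] [MeasurableSpace E] [BorelSpace E]
    [MeasurableSpace M] (g : Metric E M) : Measure M :=
  ⨆ x₀ : M, Measure.map (chartPoint (E := E) x₀)
    (((Module.finBasis ℝ E).addHaar.withDensity fun u =>
      ENNReal.ofReal (Real.sqrt (Matrix.det (Matrix.of fun i j =>
        g.inner (chartPoint x₀ u)
          (chartFrame x₀ (chartPoint x₀ u) (Module.finBasis ℝ E i))
          (chartFrame x₀ (chartPoint x₀ u) (Module.finBasis ℝ E j)))))).restrict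
      (extChartAt 𝓘(ℝ, E) x₀).target)

/-- The Gram matrix, in a complex basis `b` of `(T_x M, I)`, of the Hermitian metric
`g(v, w) - √-1 g(v, I w)` with real part `g` (conjugate-linear in `v`, linear in `w`). -/
def hermitianGram [FiniteDimensional ℂ E] (g : Metric E M) (x : M) :
    Matrix (Fin (Module.finrank ℂ E)) (Fin (Module.finrank ℂ E)) ℂ :=
  Matrix.of fun i j =>
    (g.inner x (Module.finBasis ℂ E i : E) (Module.finBasis ℂ E j : E) : ℂ)
      - Complex.I *
        (g.inner x (Module.finBasis ℂ E i : E) (tangentI x (Module.finBasis ℂ E j : E)) : ℂ)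

end Manifold

/-! ### Forms with values in a holomorphic Hermitian vector bundle -/

section Bundle

/-- `p`-forms on `M` with values in the complex vector bundle `B` (not necessarily smooth). -/
abbrev Form (E : Type*) [NormedAddCommGroup E] [NormedSpace ℂ E]
    {M : Type*} [TopologicalSpace M] [ChartedSpace E M]
    (B : M → Type*) [∀ x, AddCommGroup (B x)] [∀ x, Module ℂ (B x)] (p : ℕ) :=
  ∀ x : M, TangentSpace 𝓘(ℝ, E) x [⋀^Fin p]→ₗ[ℝ] B x

variable {E : Type*} [NormedAddCommGroup E] [NormedSpace ℂ E]
  {M : Type*} [TopologicalSpace M] [ChartedSpace E M] [IsManifold 𝓘(ℂ, E) ω M]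
  {F : Type*} [NormedAddCommGroup F] [NormedSpace ℂ F]
  {B : M → Type*} [TopologicalSpace (TotalSpace F B)]
  [∀ x, AddCommGroup (B x)] [∀ x, Module ℂ (B x)] [∀ x, TopologicalSpace (B x)]
  [FiberBundle F B] [VectorBundle ℂ F B]
  {p q : ℕ}

/-- A smooth Hermitian metric on the complex vector bundle `B`, conjugate-linear in the first
argument and linear in the second one. -/
structure HermitianMetric (E : Type*) [NormedAddCommGroup E] [NormedSpace ℂ E]
    {M : Type*} [TopologicalSpace M] [ChartedSpace E M]
    (F : Type*) [NormedAddCommGroup F] [NormedSpace ℂ F]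
    (B : M → Type*) [TopologicalSpace (TotalSpace F B)]
    [∀ x, AddCommGroup (B x)] [∀ x, Module ℂ (B x)] [∀ x, TopologicalSpace (B x)]
    [FiberBundle F B] [VectorBundle ℂ F B] where
  inner : ∀ x : M, B x →ₗ⋆[ℂ] B x →ₗ[ℂ] ℂ
  symm : ∀ x v w, inner x v w = star (inner x w v)
  pos : ∀ x v, v ≠ 0 → 0 < (inner x v v).re
  smooth : ∀ (x₀ : M) (a b : F), ContMDiffOn 𝓘(ℝ, E) 𝓘(ℝ, ℂ) ∞
    (fun x => inner x ((trivializationAt F B x₀).symmₗ ℂ x a)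
      ((trivializationAt F B x₀).symmₗ ℂ x b)) (trivializationAt F B x₀).baseSet

/-- The expression of a `B`-valued form in the preferred chart and the preferred trivialization
at `x₀`. -/
def localForm (F : Type*) [NormedAddCommGroup F] [NormedSpace ℂ F]
    {B : M → Type*} [TopologicalSpace (TotalSpace F B)]
    [∀ x, AddCommGroup (B x)] [∀ x, Module ℂ (B x)] [∀ x, TopologicalSpace (B x)]
    [FiberBundle F B] [VectorBundle ℂ F B]
    (η : Form E B p) (x₀ : M) (u : E) : E [⋀^Fin p]→ₗ[ℝ] F :=
  (((trivializationAt F B x₀).linearMapAt ℂ (chartPoint x₀ u)).restrictScalars ℝ).compAlternatingMap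
    ((η (chartPoint x₀ u)).compLinearMap (chartFrame x₀ (chartPoint x₀ u)))

/-- The value at `x₀` of the form with the given local expression there. -/
def ofLocal {B : M → Type*} [TopologicalSpace (TotalSpace F B)]
    [∀ x, AddCommGroup (B x)] [∀ x, Module ℂ (B x)] [∀ x, TopologicalSpace (B x)]
    [FiberBundle F B] [VectorBundle ℂ F B]
    (x₀ : M) (α : E [⋀^Fin p]→ₗ[ℝ] F) : TangentSpace 𝓘(ℝ, E) x₀ [⋀^Fin p]→ₗ[ℝ] B x₀ :=
  (((trivializationAt F B x₀).symmₗ ℂ x₀).restrictScalars ℝ).compAlternatingMap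
    (α.compLinearMap (chartCoframe x₀ x₀))

/-- `η` is of Hodge type `(0,p)` with respect to `I`. -/
def IsZeroType (η : Form E B p) : Prop :=
  ∀ (x : M) (v : Fin p → TangentSpace 𝓘(ℝ, E) x) (i : Fin p),
    η x (Function.update v i (tangentI x (v i))) = -(Complex.I • η x v)

variable [FiniteDimensional ℂ E]

variable (F) in
/-- `η` is smooth. -/
def IsSmoothForm (η : Form E B p) : Prop :=
  ∀ x₀ : M, ContDiffAt ℝ ∞ (fun u => toCont (localForm F η x₀ u)) (extChartAt 𝓘(ℝ, E) x₀ x₀)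

variable (F) in
/-- `η` is a smooth section of `Λ^{0,p}(M,I) ⊗ B`. -/
def IsDolbeaultForm (η : Form E B p) : Prop :=
  IsSmoothForm F η ∧ IsZeroType η

variable (F) in
/-- The derivative at `x₀` of the local expression of `η`, coefficient by coefficient. -/
def localDeriv (η : Form E B p) (x₀ : M) : E →ₗ[ℝ] (E [⋀^Fin p]→ₗ[ℝ] F) :=
  ContinuousAlternatingMap.toAlternatingMapLinear (R := ℝ) ∘ₗ
    (fderiv ℝ (fun u => toCont (localForm F η x₀ u)) (extChartAt 𝓘(ℝ, E) x₀ x₀)).toLinearMap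

variable (F) in
/-- The Dolbeault operator `∂̄` with coefficients in the holomorphic bundle `B`: in holomorphic
coordinates and in a holomorphic trivialization, it is the operator `∂̄` applied to each
component. -/
def dbar (p : ℕ) (η : Form E B p) : Form E B (p + 1) := fun x =>
  ofLocal (F := F) x (AlternatingMap.alternatizeUncurryFin (part01 (localDeriv F η x)))

variable [FiniteDimensional ℂ F]

/-- The connection form `H⁻¹ ∂H` of the Chern connection of `(B, h)` in the preferred
trivialization at `x₀`, where `Hᵢⱼ = h(fᵢ, fⱼ)` is the Gram matrix of a holomorphic frame. -/
def chernForm (h : HermitianMetric E F B) (x₀ : M) (u : E) : E →ₗ[ℝ] (F →ₗ[ℂ] F) :=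
  let b := Module.finBasis ℂ F
  let H : E → Matrix (Fin (Module.finrank ℂ F)) (Fin (Module.finrank ℂ F)) ℂ := fun u =>
    Matrix.of fun i j => h.inner (chartPoint x₀ u)
      ((trivializationAt F B x₀).symmₗ ℂ (chartPoint x₀ u) (b i))
      ((trivializationAt F B x₀).symmₗ ℂ (chartPoint x₀ u) (b j))
  { toFun := fun v => Matrix.toLin b b
      ((H u)⁻¹ * Matrix.of fun i j => part10 (fderiv ℝ (fun u => H u i j) u).toLinearMap v)
    map_add' := fun v w => by
      rw [← map_add, ← Matrix.mul_add]
      congr 2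
      ext i j
      simp
    map_smul' := fun r v => by
      rw [RingHom.id_apply, ← Complex.coe_smul r (Matrix.toLin b b _),
        ← LinearEquiv.map_smul (Matrix.toLin b b) (r : ℂ), ← Matrix.mul_smul]
      congr 2
      ext i j
      simp }

/-- The operator `∇^{1,0}`: the `(1,0)`-part of the Chern connection `∇ = ∇^{1,0} + ∂̄` of
`(B, h)`, extended to `B`-valued forms; locally, `∇^{1,0} η = ∂η + H⁻¹∂H ∧ η`. -/
def nabla10 (h : HermitianMetric E F B) (p : ℕ) (η : Form E B p) : Form E B (p + 1) := fun x =>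
  ofLocal (F := F) x
    (AlternatingMap.alternatizeUncurryFin (part10 (localDeriv F η x))
      + wedgeOne (chernForm h x (extChartAt 𝓘(ℝ, E) x x))
          (localForm F η x (extChartAt 𝓘(ℝ, E) x x)))

/-- The curvature `∇²` of the Chern connection of `(B, h)`, an `End(B)`-valued 2-form;
locally, it is `dθ + θ ∧ θ` with `θ = H⁻¹∂H`. -/
def chernCurvature (h : HermitianMetric E F B) (x : M) (v w : TangentSpace 𝓘(ℝ, E) x) :
    B x →ₗ[ℂ] B x :=
  let u₀ : E := extChartAt 𝓘(ℝ, E) x x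
  let θ := chernForm h x
  let v' : E := chartCoframe x x v
  let w' : E := chartCoframe x x w
  let dθ : E → E → (F →L[ℂ] F) := fun a b =>
    fderiv ℝ (fun u => LinearMap.toContinuousLinearMap (θ u b)) u₀ a
  (trivializationAt F B x).symmₗ ℂ x ∘ₗ
    ((dθ v' w' - dθ w' v').toLinearMap + θ u₀ v' ∘ₗ θ u₀ w' - θ u₀ w' ∘ₗ θ u₀ v') ∘ₗ
      (trivializationAt F B x).linearMapAt ℂ x

/-- The operator `∂̄_J = J ∘ ∇^{1,0} ∘ J⁻¹` on `B`-valued `(0,p)`-forms, where `J` acts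
multiplicatively on forms by `(Jα)(v) = α(J⁻¹v)`, `J⁻¹ = -J`. On sections of `B` it is
`J ∘ ∇^{1,0}`, and it satisfies the Leibniz rule. -/
def dbarJ (X : Hyperkahler E M) (h : HermitianMetric E F B) (p : ℕ) (η : Form E B p) :
    Form E B (p + 1) := fun x =>
  (nabla10 h p (fun y => (η y).compLinearMap (X.J y).toLinearMap) x).compLinearMap
    (-(X.J x).toLinearMap)

/-- The operator `Θ₊ = {∂̄, ∂̄_J}` (anticommutator). -/
def thetaPlus (X : Hyperkahler E M) (h : HermitianMetric E F B) (p : ℕ) (η : Form E B p) :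
    Form E B (p + 2) :=
  dbar F (p + 1) (dbarJ X h p η) + dbarJ X h (p + 1) (dbar F p η)

/-- The operator `L_Ω̄` of exterior multiplication by `Ω̄`. -/
def lefschetz (X : Hyperkahler E M) (p : ℕ) (η : Form E B p) : Form E B (p + 2) := fun x =>
  wedgeTwo
    (LinearMap.mk₂ ℝ (fun v w => X.OmegaBar x v w • (LinearMap.id : B x →ₗ[ℂ] B x))
      (fun v v' w => by simp [add_smul])
      (fun r v w => by simp [mul_smul])
      (fun v w w' => by simp [add_smul])
      (fun r v w => by simp [mul_smul])) (η x)

/-- The pointwise Hermitian product on `Λ^{0,p} ⊗ B` induced by `h` and by the Hermitian metric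
`G` on `(TM, I)` with real part `g`, conjugate-linear in the first argument. In terms of a basis
`b` of `(T_x M, I)` it is
`(1/p!) ∑ (G⁻¹)_{i₁j₁} ⋯ (G⁻¹)_{i_pj_p} h(α(b_{i₁},…,b_{i_p}), β(b_{j₁},…,b_{j_p}))`; for a unitary
basis this is `∑_{i₁<…<i_p} h(α(b_{i₁},…,b_{i_p}), β(b_{i₁},…,b_{i_p}))`. -/
def formInner (g : Metric E M) (h : HermitianMetric E F B) (α β : Form E B p) (x : M) : ℂ :=
  (1 / (p.factorial : ℂ)) *
    ∑ i : Fin p → Fin (Module.finrank ℂ E), ∑ j : Fin p → Fin (Module.finrank ℂ E),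
      (∏ k, (hermitianGram g x)⁻¹ (i k) (j k)) *
        h.inner x (α x fun k => (Module.finBasis ℂ E (i k) : E))
          (β x fun k => (Module.finBasis ℂ E (j k) : E))

variable [MeasurableSpace E] [BorelSpace E] [MeasurableSpace M]

/-- The global Hermitian product `∫_M (α, β) dvol`. -/
def globalInner (g : Metric E M) (h : HermitianMetric E F B) (α β : Form E B p) : ℂ :=
  ∫ x, formInner g h α β x ∂(riemannianMeasure g)

/-- `Q` is the Hermitian adjoint of the operator `P : Λ^{0,p} ⊗ B → Λ^{0,q} ⊗ B`: both operators
preserve smoothness and Hodge type `(0,·)`, and `⟨Pα, β⟩ = ⟨α, Qβ⟩` for all smooth `α`, `β` with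
`α` compactly supported. (The values on other forms are irrelevant.) -/
def IsHermitianAdjoint (g : Metric E M) (h : HermitianMetric E F B)
    (P : Form E B p → Form E B q) (Q : Form E B q → Form E B p) : Prop :=
  (∀ α, IsDolbeaultForm F α → IsDolbeaultForm F (P α)) ∧
  (∀ β, IsDolbeaultForm F β → IsDolbeaultForm F (Q β)) ∧
  ∀ (α : Form E B p) (β : Form E B q), IsDolbeaultForm F α → IsDolbeaultForm F β →
    (∃ C : Set M, IsCompact C ∧ ∀ x ∉ C, α x = 0) →
    globalInner g h (P α) β = globalInner g h α (Q β)

open Classical in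
/-- The Hermitian adjoint of an operator (determined on smooth forms of type `(0,q)`); it is `0`
by convention when there is none. -/
def hermitianAdjoint (g : Metric E M) (h : HermitianMetric E F B)
    (P : Form E B p → Form E B q) : Form E B q → Form E B p :=
  if H : ∃ Q, IsHermitianAdjoint g h P Q then H.choose else 0

/-- The Laplacian `{P, P*} = P P* + P* P` of a family of operators
`P : Λ^{0,p} ⊗ B → Λ^{0,p+1} ⊗ B`; on sections (`p = 0`) it is `P* P`. -/
def laplacian (g : Metric E M) (h : HermitianMetric E F B)
    (P : ∀ p : ℕ, Form E B p → Form E B (p + 1)) : ∀ p : ℕ, Form E B p → Form E B p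
  | 0, η => hermitianAdjoint g h (P 0) (P 0 η)
  | p + 1, η =>
    P p (hermitianAdjoint g h (P p) η) + hermitianAdjoint g h (P (p + 1)) (P (p + 1) η)

/-- The operator `Λ_Ω̄`, Hermitian adjoint to `L_Ω̄`. -/
def lambdaOmegaBar (X : Hyperkahler E M) (h : HermitianMetric E F B) (p : ℕ) :
    Form E B (p + 2) → Form E B p :=
  hermitianAdjoint X.g h (lefschetz X p)

/-- The commutator `[Θ₊, Λ_Ω̄] = Θ₊ Λ_Ω̄ - Λ_Ω̄ Θ₊` on `(0,p)`-forms, where `Λ_Ω̄` vanishes on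
`(0,p)`-forms with `p < 2`. -/
def thetaLambda (X : Hyperkahler E M) (h : HermitianMetric E F B) :
    ∀ p : ℕ, Form E B p → Form E B p
  | 0, η => -lambdaOmegaBar X h 0 (thetaPlus X h 0 η)
  | 1, η => -lambdaOmegaBar X h 1 (thetaPlus X h 1 η)
  | p + 2, η => thetaPlus X h p (lambdaOmegaBar X h p η)
      - lambdaOmegaBar X h (p + 2) (thetaPlus X h (p + 2) η)


end Bundle

end

end QuatDolbeault

open scoped Manifold ContDiff
open Bundle MeasureTheory
namespace QuatDolbeault
noncomputable section

set_option maxSynthPendingDepth 3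
set_option synthInstance.maxHeartbeats 200000
set_option linter.unusedSectionVars false

/-! ### Exterior algebra: contraction, alternatization, derivations of forms. -/

section FormAlgebra

variable {E F G : Type*} [NormedAddCommGroup E] [NormedSpace ℝ E]
  [NormedAddCommGroup F] [NormedSpace ℝ F] [NormedAddCommGroup G] [NormedSpace ℝ G] {p : ℕ}

/-! Everything rests on two identities of Kähler type, ∂̄* = -[Λ, ∂̄_J] and ∂̄_J* = [Λ, ∂̄], where Λ
= Λ_Ω̄. When they are substituted into the two Laplacians, the cross terms ∂̄Λ∂̄_J and ∂̄_JΛ∂̄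
cancel and Θ₊Λ - ΛΘ₊ remains (`laplacian_sub_add_two`). This step is pure algebra.

The identities are local and express parallelism. In a holomorphic chart the Chern connection Γ of
(TM, I, g) is torsion-free because dω_I = 0 (`LocalHK.Gam_symm`), and J is parallel because moreover
dω_J = dω_K = 0 (`LocalHK.dJ_eq`). Together with the Chern form θ of B it gives a connection ∇ on
B-valued forms. For a parallel endomorphism A put D_A = ∑ eᵃ ∧ ∇_{A e_a}; then ∂̄ = (D_1 + iD_I)/2
and ∂̄_J = (iD_K - D_J)/2. Up to a constant Λ is ∑ ι_{J b_a} ι_{bᵃ}, again parallel, so moving it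
past D_A is Cartan's formula and leaves one metric trace of ∇η (`LocalHK.lam_alt`,
`LocalBundle.qL_eq`, `LocalBundle.qJL_eq`).

That trace is the formal adjoint by the divergence theorem. The logarithmic derivative of √det g is
tr Γ (`LocalHK.fderiv_rho`) and the pointwise product of forms is parallel
(`LocalBundle.fderiv_ip`), so the difference of the two pairings is a divergence
(`LocalBundle.div_eq`). A partition of unity makes this global, and testing against a bump function
shows that an adjoint is unique on Dolbeault forms, so that the arbitrarily chosen
`hermitianAdjoint` is the explicit operator.

For Θ₊, the anticommutator of D_A and D_A' only sees the antisymmetrized second covariant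
derivative, that is, the curvature of B and the Riemannian curvature. The latter is invariant under
I, J, K by pair symmetry (`LocalHK.Riem_par`) and drops out. Since the curvature R of B has type
(1,1), the four remaining terms reduce to two, and the 2-form obtained corresponds under `plusIso`
to (R - R(J·,J·))/2. This form is I-invariant and J-, K-anti-invariant, which is weight 2, while the
complementary half (R + R(J·,J·))/2 is fixed by I, J and K.

The operators are defined at each point in the chart centred at that point. Naturality under
holomorphic changes of chart and frame (`dbarL_transition`, `nabla10L_transition`) provides one
formula valid on a whole chart, which is what allows them to be composed. -/

/-- Interior product with `v`, as a continuous linear map on forms. -/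
def contr (p : ℕ) (v : E) : (E [⋀^Fin (p + 1)]→L[ℝ] F) →L[ℝ] (E [⋀^Fin p]→L[ℝ] F) :=
  (ContinuousLinearMap.apply ℝ (E [⋀^Fin p]→L[ℝ] F) v) ∘L
    (ContinuousAlternatingMap.curryLeftLI (𝕜 := ℝ) (E := E) (F := F)
      (n := p)).toContinuousLinearMap

@[simp]
theorem contr_apply (v : E) (η : E [⋀^Fin (p + 1)]→L[ℝ] F) : contr p v η = η.curryLeft v := rfl

/-- The alternatization `(E →L Λ^p) → Λ^{p+1}`. -/
def alt (p : ℕ) : (E →L[ℝ] E [⋀^Fin p]→L[ℝ] F) →L[ℝ] (E [⋀^Fin (p + 1)]→L[ℝ] F) :=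
  ContinuousAlternatingMap.alternatizeUncurryFinCLM ℝ E F

theorem alt_eq (ψ : E →L[ℝ] E [⋀^Fin p]→L[ℝ] F) :
    alt p ψ = ContinuousAlternatingMap.alternatizeUncurryFin ψ := rfl

theorem alt_apply (ψ : E →L[ℝ] E [⋀^Fin p]→L[ℝ] F) (v : Fin (p + 1) → E) :
    alt p ψ v = ∑ i : Fin (p + 1), (-1) ^ (i : ℕ) • ψ (v i) (Fin.removeNth i v) :=
  ContinuousAlternatingMap.alternatizeUncurryFin_apply ψ v

theorem alt_add (ψ χ : E →L[ℝ] E [⋀^Fin p]→L[ℝ] F) : alt p (ψ + χ) = alt p ψ + alt p χ :=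
  ContinuousLinearMap.map_add _ ψ χ

theorem alt_neg (ψ : E →L[ℝ] E [⋀^Fin p]→L[ℝ] F) : alt p (-ψ) = -alt p ψ :=
  ContinuousLinearMap.map_neg _ ψ

theorem alt_sub (ψ χ : E →L[ℝ] E [⋀^Fin p]→L[ℝ] F) : alt p (ψ - χ) = alt p ψ - alt p χ :=
  ContinuousLinearMap.map_sub _ ψ χ

theorem alt_smul {S : Type*} [Monoid S] [DistribMulAction S F] [ContinuousConstSMul S F]
    [SMulCommClass ℝ S F] (c : S) (ψ : E →L[ℝ] E [⋀^Fin p]→L[ℝ] F) :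
    alt p (c • ψ) = c • alt p ψ :=
  ContinuousAlternatingMap.alternatizeUncurryFin_smul c ψ

/-- Inductions on the degree run through this: contracting both sides with an arbitrary vector and
applying Cartan's formula lowers the degree by one. -/
theorem form_ext {α β : E [⋀^Fin (p + 1)]→L[ℝ] F} (h : ∀ v, α.curryLeft v = β.curryLeft v) :
    α = β := by
  ext v
  have := congrArg (fun f => f (Matrix.vecTail v)) (h (Matrix.vecHead v))
  simpa using this

/-- Polarization of ι_v ι_v = 0 at v + w. -/
theorem curryLeft_curryLeft_comm (η : E [⋀^Fin (p + 2)]→L[ℝ] F) (v w : E) :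
    (η.curryLeft v).curryLeft w = -((η.curryLeft w).curryLeft v) := by
  have h := η.curryLeft_same (v + w)
  have hv := η.curryLeft_same v
  have hw := η.curryLeft_same w
  simp only [map_add, add_apply,
    ContinuousAlternatingMap.curryLeft_add] at h hv hw
  rw [hv, hw, zero_add, add_zero] at h
  rw [eq_neg_iff_add_eq_zero, add_comm]
  exact h

/-- Cartan's formula `ι_v (alt _ ψ) = ψ v - alt _ (ι_v ψ)`. -/
theorem curryLeft_alt (ψ : E →L[ℝ] E [⋀^Fin (p + 1)]→L[ℝ] F) (v : E) :
    (alt _ ψ).curryLeft v = ψ v - alt _ (contr p v ∘L ψ) := by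
  ext m
  simp only [ContinuousAlternatingMap.curryLeft_apply_apply,
    alt_apply, ContinuousAlternatingMap.sub_apply,
    ContinuousLinearMap.comp_apply, contr_apply]
  rw [Fin.sum_univ_succ]
  simp only [Fin.val_zero, pow_zero, one_smul, Matrix.cons_val_zero, sub_eq_add_neg,
    ← Finset.sum_neg_distrib]
  congr 1
  refine Finset.sum_congr rfl fun i _ => ?_
  simp only [Fin.val_succ, pow_succ, mul_neg, mul_one, neg_smul, Matrix.cons_val_succ]
  congr 3
  funext j
  refine Fin.cases ?_ (fun j => ?_) j <;> simp [Fin.removeNth]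

theorem curryLeft_alt_zero (ψ : E →L[ℝ] E [⋀^Fin 0]→L[ℝ] F) (v : E) :
    (alt _ ψ).curryLeft v = ψ v := by
  ext m
  simp only [ContinuousAlternatingMap.curryLeft_apply_apply,
    alt_apply]
  simp only [Fin.sum_univ_succ, Fin.val_zero, pow_zero, one_smul, Matrix.cons_val_zero,
    Finset.univ_eq_empty, Finset.sum_empty, add_zero]
  congr 1

theorem alt_compContinuousLinearMap (ψ : E →L[ℝ] E [⋀^Fin p]→L[ℝ] F) (f : E →L[ℝ] E) :
    (alt _ ψ).compContinuousLinearMap f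
      = alt _ (ContinuousAlternatingMap.compContinuousLinearMapCLM f ∘L ψ ∘L f) := by
  ext v
  simp +unfoldPartialApp [alt_apply, Fin.removeNth,
    Function.comp_def]

theorem compContinuousAlternatingMap_alt (f : F →L[ℝ] G) (ψ : E →L[ℝ] E [⋀^Fin p]→L[ℝ] F) :
    f.compContinuousAlternatingMap (alt _ ψ)
      = alt _ (ContinuousLinearMap.compContinuousAlternatingMapCLM ℝ E F G (Fin p) f ∘L ψ) := by
  ext v
  simp [alt_apply]

/-- The derivation of the algebra of forms induced by an endomorphism of `E`:
`(der Γ η)(w₁,…) = ∑ η(…,Γ wᵢ,…)`. -/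
def der (p : ℕ) : (E →L[ℝ] E) →L[ℝ] (E [⋀^Fin p]→L[ℝ] F) →L[ℝ] (E [⋀^Fin p]→L[ℝ] F) :=
  (ContinuousAlternatingMap.fderivCompContinuousLinearMapCLM F (ContinuousLinearMap.id ℝ E)).flip

theorem der_apply (A : E →L[ℝ] E) (η : E [⋀^Fin p]→L[ℝ] F) :
    der p A η = η.fderivCompContinuousLinearMap (ContinuousLinearMap.id ℝ E) A := rfl

theorem der_zero_form (A : E →L[ℝ] E) (η : E [⋀^Fin 0]→L[ℝ] F) : der 0 A η = 0 := by
  ext v; simp [der_apply]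

/-- This is der A = ∑ eᵃ ∧ ι_{A e_a}; in this form Cartan's formula applies to `der`. -/
theorem der_eq_alt (A : E →L[ℝ] E) (η : E [⋀^Fin (p + 1)]→L[ℝ] F) :
    der (p + 1) A η = alt _ (η.curryLeft ∘L A) := by
  rw [der_apply, alt_eq, ContinuousAlternatingMap.fderivCompContinuousLinearMap_eq_alternatizeUncurryFin]
  simp only [ContinuousLinearMap.comp_apply, ContinuousAlternatingMap.alternatizeUncurryFinCLM_apply]
  congr 1

theorem curryLeft_der (A : E →L[ℝ] E) (η : E [⋀^Fin (p + 1)]→L[ℝ] F) (w : E) :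
    (der (p + 1) A η).curryLeft w = der p A (η.curryLeft w) + η.curryLeft (A w) := by
  cases p with
  | zero => rw [der_eq_alt, curryLeft_alt_zero, der_zero_form, zero_add]; rfl
  | succ p =>
    rw [der_eq_alt, curryLeft_alt]
    have : contr p w ∘L η.curryLeft ∘L A = -((η.curryLeft w).curryLeft ∘L A) := by
      ext1 v
      simp only [ContinuousLinearMap.comp_apply, contr_apply, neg_apply]
      exact curryLeft_curryLeft_comm η (A v) w
    rw [this, alt_neg, sub_neg_eq_add, der_eq_alt]
    exact add_comm _ _

/-- Leibniz rule: in ∑ eᵃ ∧ ψ(e_a) the derivation acts on the form ψ(e_a) and on the covector eᵃ,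
and the latter action is the insertion of `A` in the argument of ψ. After contraction with `w`, the
terms containing ι_{Aw} cancel and the lower degree remains. -/
theorem der_alt (A : E →L[ℝ] E) (ψ : E →L[ℝ] E [⋀^Fin p]→L[ℝ] F) :
    der (p + 1) A (alt _ ψ) = alt _ (der p A ∘L ψ + ψ ∘L A) := by
  induction p with
  | zero =>
    refine form_ext fun w => ?_
    rw [curryLeft_der, curryLeft_alt_zero, curryLeft_alt_zero, curryLeft_alt_zero]
    rfl
  | succ p ih =>
    refine form_ext fun w => ?_
    rw [curryLeft_der, curryLeft_alt, curryLeft_alt, curryLeft_alt, map_sub, ih]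
    have : contr p w ∘L (der (p + 1) A ∘L ψ + ψ ∘L A)
        = (der p A ∘L contr p w ∘L ψ + (contr p w ∘L ψ) ∘L A) + contr p (A w) ∘L ψ := by
      ext1 v
      simp only [ContinuousLinearMap.comp_apply, add_apply, contr_apply,
        curryLeft_der, ContinuousAlternatingMap.curryLeft_add]
      abel
    rw [this]
    simp only [alt_add, ContinuousLinearMap.comp_apply, add_apply]
    abel

/-- Forms are contravariant, so `der` reverses commutators. Both sides vanish in degree 0 and have
the same commutator with every contraction. -/
theorem der_der_sub (A B : E →L[ℝ] E) (η : E [⋀^Fin p]→L[ℝ] F) :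
    der p A (der p B η) - der p B (der p A η) = der p (B ∘L A - A ∘L B) η := by
  induction p with
  | zero => rw [der_zero_form, der_zero_form, der_zero_form, sub_zero]
  | succ p ih =>
    refine form_ext fun w => ?_
    have h : ∀ (α β : E [⋀^Fin (p + 1)]→L[ℝ] F), (α - β).curryLeft w
        = α.curryLeft w - β.curryLeft w := fun _ _ => rfl
    rw [h, curryLeft_der, curryLeft_der, curryLeft_der, curryLeft_der, curryLeft_der,
      curryLeft_der, curryLeft_der, ← ih (η.curryLeft w)]
    simp only [map_add, sub_apply, ContinuousLinearMap.comp_apply, map_sub]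
    abel

theorem der_compContinuousAlternatingMap (A : E →L[ℝ] E) (f : F →L[ℝ] G)
    (η : E [⋀^Fin p]→L[ℝ] F) :
    der p A (f.compContinuousAlternatingMap η) = f.compContinuousAlternatingMap (der p A η) := by
  ext v; simp [der_apply]

/-- `fderivCompContinuousLinearMap f m` sums over the slots, with `m` inserted in one slot and `f`
in all others; precomposition acts on every slot. -/
theorem fderivComp_comp (η : E [⋀^Fin p]→L[ℝ] F) (f m k : E →L[ℝ] E) :
    (η.fderivCompContinuousLinearMap f m).compContinuousLinearMap k
      = η.fderivCompContinuousLinearMap (f ∘L k) (m ∘L k) := by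
  ext v
  simp only [ContinuousAlternatingMap.compContinuousLinearMap_apply,
    ContinuousAlternatingMap.fderivCompContinuousLinearMap_apply]
  refine Finset.sum_congr rfl fun i _ => congrArg η (funext fun j => ?_)
  by_cases h : j = i
  · subst h; simp
  · simp [Function.update_of_ne h]

theorem der_comp (η : E [⋀^Fin p]→L[ℝ] F) (f A : E →L[ℝ] E) :
    der p A (η.compContinuousLinearMap f) = η.fderivCompContinuousLinearMap f (f ∘L A) := by
  ext v
  simp only [der_apply, ContinuousAlternatingMap.compContinuousLinearMap_apply,
    ContinuousAlternatingMap.fderivCompContinuousLinearMap_apply]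
  refine Finset.sum_congr rfl fun i _ => congrArg η (funext fun j => ?_)
  by_cases h : j = i
  · subst h; simp
  · simp [Function.update_of_ne h]

/-- Alternating a symmetric bilinear derivation gives zero. -/
theorem alt_der_symm (η : E [⋀^Fin p]→L[ℝ] F) (S : E →L[ℝ] E →L[ℝ] E)
    (hS : ∀ v w, S v w = S w v) : alt _ ((der p).flip η ∘L S) = 0 :=
  ContinuousAlternatingMap.alternatizeUncurryFin_fderivCompContinuousLinearMap_eq_zero η _ hS

/-- Only the antisymmetric part contributes to a double alternatization. -/
theorem alt_alt_eq_of_sub (f f' : E →L[ℝ] E →L[ℝ] E [⋀^Fin p]→L[ℝ] F)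
    (h : ∀ v w, f v w - f w v = f' v w - f' w v) :
    alt _ (alt p ∘L f)
      = alt _ (alt p ∘L f') := by
  ext v
  simp only [alt, ContinuousAlternatingMap.alternatizeUncurryFinCLM_apply,
    ContinuousAlternatingMap.alternatizeUncurryFin_alternatizeUncurryFinCLM_comp_apply]
  refine Finset.sum_congr rfl fun i _ => Finset.sum_congr rfl fun j _ => ?_
  have := congrArg (fun a => a (j.removeNth (i.castSucc.removeNth v))) (h (v i.castSucc) (v j.succ))
  simp only [ContinuousAlternatingMap.sub_apply] at this
  rw [this]

end FormAlgebra

/-! ### Evaluation of Fréchet derivatives of operator-valued functions. -/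

section Calculus

variable {X V W : Type*} [NormedAddCommGroup X] [NormedSpace ℝ X] [NormedAddCommGroup V]
  [NormedSpace ℝ V] [NormedAddCommGroup W] [NormedSpace ℝ W]

theorem fderiv_apply_const {L : X → V →L[ℝ] W} {u : X} (hL : DifferentiableAt ℝ L u) (b : V)
    (a : X) : fderiv ℝ (fun y => L y b) u a = fderiv ℝ L u a b := by
  rw [fderiv_clm_apply hL (differentiableAt_const b)]
  simp

theorem fderiv_apply_fun {L : X → V →L[ℝ] W} {f : X → V} {u : X} (hL : DifferentiableAt ℝ L u)
    (hf : DifferentiableAt ℝ f u) (a : X) :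
    fderiv ℝ (fun y => L y (f y)) u a = fderiv ℝ L u a (f u) + L u (fderiv ℝ f u a) := by
  rw [fderiv_clm_apply hL hf]
  simp [add_comm]

theorem fderiv_clm_left (T : V →L[ℝ] W) {f : X → V} {u : X} (hf : DifferentiableAt ℝ f u) (a : X) :
    fderiv ℝ (fun y => T (f y)) u a = T (fderiv ℝ f u a) := by
  have := (T.hasFDerivAt.comp u hf.hasFDerivAt).fderiv
  rw [Function.comp_def] at this
  rw [this]; rfl

end Calculus

/-! ### Hyperkähler metrics in a chart: the Levi-Civita connection and parallelism of J. -/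

section LocalGeometry

/-- Kähler metrics on an open subset of a vector space with a constant complex structure `I`,
with a second complex structure `J` that makes them hyperkähler. -/
structure LocalHK (E : Type*) [NormedAddCommGroup E] [NormedSpace ℝ E] where
  U : Set E
  isOpen : IsOpen U
  I : E →L[ℝ] E
  g : E → E →L[ℝ] E →L[ℝ] ℝ
  J : E → E →L[ℝ] E
  g_smooth : ContDiffOn ℝ ∞ g U
  J_smooth : ContDiffOn ℝ ∞ J U
  I_sq : ∀ v, I (I v) = -v
  g_symm : ∀ u ∈ U, ∀ v w, g u v w = g u w v
  g_pos : ∀ u ∈ U, ∀ v, v ≠ 0 → 0 < g u v v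
  g_I : ∀ u ∈ U, ∀ v w, g u (I v) (I w) = g u v w
  J_sq : ∀ u ∈ U, ∀ v, J u (J u v) = -v
  J_I : ∀ u ∈ U, ∀ v, J u (I v) = -I (J u v)
  g_J : ∀ u ∈ U, ∀ v w, g u (J u v) (J u w) = g u v w
  closed_I : ∀ u ∈ U, ∀ a b c, fderiv ℝ g u a b (I c) + fderiv ℝ g u b c (I a)
    + fderiv ℝ g u c a (I b) = 0
  closed_J : ∀ u ∈ U, ∀ a b c,
    (fderiv ℝ g u a b (J u c) + g u b (fderiv ℝ J u a c))
    + (fderiv ℝ g u b c (J u a) + g u c (fderiv ℝ J u b a))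
    + (fderiv ℝ g u c a (J u b) + g u a (fderiv ℝ J u c b)) = 0
  closed_K : ∀ u ∈ U, ∀ a b c,
    (fderiv ℝ g u a b (I (J u c)) + g u b (I (fderiv ℝ J u a c)))
    + (fderiv ℝ g u b c (I (J u a)) + g u c (I (fderiv ℝ J u b a)))
    + (fderiv ℝ g u c a (I (J u b)) + g u a (I (fderiv ℝ J u c b))) = 0


attribute [simp] LocalHK.I_sq

variable {E : Type*} [NormedAddCommGroup E] [NormedSpace ℝ E]

namespace LocalHK

variable (D : LocalHK E) {u : E}

theorem g_diff (hu : u ∈ D.U) : DifferentiableAt ℝ D.g u :=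
  (D.g_smooth.contDiffAt (D.isOpen.mem_nhds hu)).differentiableAt (by simp)

theorem J_diff (hu : u ∈ D.U) : DifferentiableAt ℝ D.J u :=
  (D.J_smooth.contDiffAt (D.isOpen.mem_nhds hu)).differentiableAt (by simp)

/-- Differentiate an identity between functions valid on `U`. -/
theorem fderiv_congr {W : Type*} [NormedAddCommGroup W] [NormedSpace ℝ W] {f f' : E → W}
    (h : ∀ u ∈ D.U, f u = f' u) (hu : u ∈ D.U) : fderiv ℝ f u = fderiv ℝ f' u :=
  Filter.EventuallyEq.fderiv_eq (Filter.eventually_of_mem (D.isOpen.mem_nhds hu) h)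

theorem fderiv_g (hu : u ∈ D.U) (a b c : E) :
    fderiv ℝ (fun u => D.g u b c) u a = fderiv ℝ D.g u a b c := by
  rw [fderiv_apply_const ((D.g_diff hu).clm_apply (differentiableAt_const b)),
    fderiv_apply_const (D.g_diff hu)]

theorem dg_symm (hu : u ∈ D.U) (a b c : E) :
    fderiv ℝ D.g u a b c = fderiv ℝ D.g u a c b := by
  rw [← D.fderiv_g hu, ← D.fderiv_g hu, D.fderiv_congr (fun u hu => D.g_symm u hu b c) hu]

theorem dg_I (hu : u ∈ D.U) (a b c : E) :
    fderiv ℝ D.g u a (D.I b) (D.I c) = fderiv ℝ D.g u a b c := by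
  rw [← D.fderiv_g hu, ← D.fderiv_g hu, D.fderiv_congr (fun u hu => D.g_I u hu b c) hu]

theorem dg_I_left (hu : u ∈ D.U) (a b c : E) :
    fderiv ℝ D.g u a (D.I b) c = -fderiv ℝ D.g u a b (D.I c) := by
  rw [← D.dg_I hu a b (D.I c)]; simp

theorem g_I_left (hu : u ∈ D.U) (b c : E) : D.g u (D.I b) c = -D.g u b (D.I c) := by
  rw [← D.g_I u hu b (D.I c)]; simp

theorem g_J_left (hu : u ∈ D.U) (b c : E) : D.g u (D.J u b) c = -D.g u b (D.J u c) := by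
  rw [← D.g_J u hu b (D.J u c), D.J_sq u hu]; simp

theorem nondeg (hu : u ∈ D.U) {v w : E} (h : ∀ z, D.g u v z = D.g u w z) : v = w := by
  by_contra hne
  have h1 := D.g_pos u hu (v - w) (sub_ne_zero.2 hne)
  have h2 : D.g u (v - w) (v - w) = 0 := by
    have h3 := h (v - w)
    rw [map_sub (D.g u), sub_apply, h3, sub_self]
  exact h1.ne' h2

variable [FiniteDimensional ℝ E]

theorem exists_equiv (hu : u ∈ D.U) : ∃ e : E ≃L[ℝ] (E →L[ℝ] ℝ),
    (e : E →L[ℝ] (E →L[ℝ] ℝ)) = D.g u := by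
  have hinj : Function.Injective (D.g u).toLinearMap := fun v w h =>
    D.nondeg hu fun z => congrArg (fun f : E →L[ℝ] ℝ => f z) h
  have hdim : Module.finrank ℝ E = Module.finrank ℝ (E →L[ℝ] ℝ) := by
    rw [← (LinearMap.toContinuousLinearMap (𝕜 := ℝ) (E := E) (F' := ℝ)).finrank_eq]
    exact (Subspace.dual_finrank_eq (K := ℝ) (V := E)).symm
  exact ⟨(LinearEquiv.ofInjectiveOfFinrankEq _ hinj hdim).toContinuousLinearEquiv, by ext; rfl⟩

/-- The inverse of the isomorphism `E → E^*` given by the metric. -/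
def sharp (u : E) : (E →L[ℝ] ℝ) →L[ℝ] E := (D.g u).inverse

theorem g_sharp (hu : u ∈ D.U) (ξ : E →L[ℝ] ℝ) (w : E) : D.g u (D.sharp u ξ) w = ξ w := by
  obtain ⟨e, he⟩ := D.exists_equiv hu
  rw [sharp, ← he, ContinuousLinearMap.inverse_equiv]
  simp

theorem sharp_smooth : ContDiffOn ℝ ∞ D.sharp D.U := by
  have : CompleteSpace E := FiniteDimensional.complete ℝ E
  intro u hu
  obtain ⟨e, he⟩ := D.exists_equiv hu
  have h1 : ContDiffAt ℝ ∞ ContinuousLinearMap.inverse (D.g u) := he ▸ contDiffAt_map_inverse e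
  exact h1.comp_contDiffWithinAt u (D.g_smooth u hu)

/-- The connection form of the Levi-Civita connection, which is the Chern connection of the
tangent bundle. -/
def Gam (u : E) : E →L[ℝ] E →L[ℝ] E :=
  (ContinuousLinearMap.compL ℝ E (E →L[ℝ] ℝ) E (D.sharp u)) ∘L
    ((1 / 2 : ℝ) • (fderiv ℝ D.g u
      + (ContinuousLinearMap.compL ℝ E (E →L[ℝ] ℝ) (E →L[ℝ] ℝ)
          ((ContinuousLinearMap.compL ℝ E E ℝ).flip D.I)) ∘L (fderiv ℝ D.g u) ∘L D.I))

/-- This is the real form of H⁻¹∂H for the Hermitian metric g - i g(·, I·). Metricity, I-linearity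
and, with dω_I = 0, symmetry are read off from it. -/
theorem two_g_Gam (hu : u ∈ D.U) (v w z : E) : 2 * D.g u (D.Gam u v w) z =
    fderiv ℝ D.g u v w z + fderiv ℝ D.g u (D.I v) w (D.I z) := by
  simp [Gam, D.g_sharp hu]
  ring

theorem dg_smooth : ContDiffOn ℝ ∞ (fderiv ℝ D.g) D.U :=
  D.g_smooth.fderiv_of_isOpen D.isOpen (by simp)

theorem Gam_smooth : ContDiffOn ℝ ∞ D.Gam D.U := by
  unfold Gam
  refine ContDiffOn.clm_comp ?_ ?_
  · exact (ContinuousLinearMap.contDiff _).comp_contDiffOn D.sharp_smooth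
  · refine ContDiffOn.const_smul _ (D.dg_smooth.add ?_)
    exact contDiffOn_const.clm_comp (D.dg_smooth.clm_comp contDiffOn_const)

theorem Gam_diff (hu : u ∈ D.U) : DifferentiableAt ℝ D.Gam u :=
  (D.Gam_smooth.contDiffAt (D.isOpen.mem_nhds hu)).differentiableAt (by simp)

/-- The connection is metric. -/
theorem dg_eq (hu : u ∈ D.U) (v a b : E) :
    fderiv ℝ D.g u v a b = D.g u (D.Gam u v a) b + D.g u a (D.Gam u v b) := by
  have h1 := D.two_g_Gam hu v a b
  have h2 := D.two_g_Gam hu v b a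
  rw [D.g_symm u hu a]
  have h3 := D.dg_symm hu v a b
  have h4 := D.dg_I_left hu (D.I v) b a
  have h5 := D.dg_symm hu (D.I v) a (D.I b)
  linarith

theorem Gam_I (hu : u ∈ D.U) (v w : E) : D.Gam u v (D.I w) = D.I (D.Gam u v w) := by
  refine D.nondeg hu fun z => ?_
  have h1 := D.two_g_Gam hu v (D.I w) z
  have h2 := D.two_g_Gam hu v w (D.I z)
  rw [D.g_I_left hu]
  have h3 := D.dg_I_left hu v w z
  have h4 := D.dg_I_left hu (D.I v) w (D.I z)
  simp only [D.I_sq, map_neg] at *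
  linarith

/-- The torsion is a combination of dω_I(v, w, Iz) and dω_I(Iv, Iw, Iz), so this is where the Kähler
condition for I enters. -/
theorem Gam_symm (hu : u ∈ D.U) (v w : E) : D.Gam u v w = D.Gam u w v := by
  refine D.nondeg hu fun z => ?_
  have h1 := D.two_g_Gam hu v w z
  have h2 := D.two_g_Gam hu w v z
  have h3 := D.closed_I u hu v w (D.I z)
  have h4 := D.closed_I u hu (D.I v) (D.I w) (D.I z)
  have h5 := D.dg_symm hu w z v
  have h6 := D.dg_I hu w z v
  have h7 := D.dg_I hu (D.I v) w (D.I z)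
  have h8 := D.dg_symm hu (D.I w) z (D.I v)
  have h9 := D.dg_I_left hu (D.I w) z v
  have h10 := D.dg_I hu (D.I z) v w
  have h11 := D.dg_symm hu (D.I w) v (D.I z)
  have h12 := D.dg_I_left hu (D.I z) v w
  simp only [D.I_sq, map_neg] at *
  linarith

theorem Gam_I_left (hu : u ∈ D.U) (v w : E) : D.Gam u (D.I v) w = D.I (D.Gam u v w) := by
  rw [D.Gam_symm hu, D.Gam_I hu, D.Gam_symm hu]

/-- The complex structure `J` is parallel. -/
theorem dJ_eq (hu : u ∈ D.U) (v w : E) :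
    fderiv ℝ D.J u v w = D.J u (D.Gam u v w) - D.Gam u v (D.J u w) := by
  have hJ := D.J_diff hu
  -- Derivatives of the three algebraic identities J² = -1, JI = -IJ and g(J·,·) = -g(·,J·).
  have dJJ : ∀ a b, fderiv ℝ D.J u a (D.J u b) + D.J u (fderiv ℝ D.J u a b) = 0 := fun a b => by
    have h := congrArg (fun f => f a) (D.fderiv_congr (fun u hu => D.J_sq u hu b) hu)
    rw [fderiv_apply_fun hJ (hJ.clm_apply (differentiableAt_const b)),
      fderiv_apply_const hJ] at h
    simpa using h
  have dJI : ∀ a b, fderiv ℝ D.J u a (D.I b) = -D.I (fderiv ℝ D.J u a b) := fun a b => by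
    have h := congrArg (fun f => f a) (D.fderiv_congr (fun u hu => D.J_I u hu b) hu)
    rw [fderiv_apply_const hJ] at h
    rw [h, fderiv_fun_neg, neg_apply,
      fderiv_clm_left D.I (hJ.clm_apply (differentiableAt_const b)), fderiv_apply_const hJ]
  have dgJ : ∀ a b c, fderiv ℝ D.g u a b (D.J u c) + D.g u b (fderiv ℝ D.J u a c)
      = -(fderiv ℝ D.g u a (D.J u b) c + D.g u (fderiv ℝ D.J u a b) c) := fun a b c => by
    have h := congrArg (fun f => f a) (D.fderiv_congr
      (fun u hu => (D.g_J_left hu b c : (fun u => D.g u (D.J u b) c) u = _)) hu)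
    have hJb := hJ.clm_apply (differentiableAt_const b)
    have hJc := hJ.clm_apply (differentiableAt_const c)
    have e1 := fderiv_apply_const (L := fun u => D.g u (D.J u b)) ((D.g_diff hu).clm_apply hJb) c a
    have e2 := fderiv_apply_fun (D.g_diff hu) hJb a
    rw [fderiv_fun_neg, neg_apply,
      fderiv_apply_fun ((D.g_diff hu).clm_apply (differentiableAt_const b)) hJc,
      fderiv_apply_const (D.g_diff hu), fderiv_apply_const hJ, e1, e2, fderiv_apply_const hJ] at h
    simp only [add_apply] at h
    linarith
  -- the covariant derivative of `J`
  set T : E → E → E → ℝ := fun a b c =>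
    D.g u (fderiv ℝ D.J u a b - (D.J u (D.Gam u a b) - D.Gam u a (D.J u b))) c with hT
  have T_def : ∀ a b c, T a b c = D.g u (fderiv ℝ D.J u a b) c - D.g u (D.J u (D.Gam u a b)) c
      + D.g u (D.Gam u a (D.J u b)) c := fun a b c => by
    simp only [hT, map_sub, sub_apply]; ring
  have T_alt : ∀ a b c, T a b c = D.g u c (fderiv ℝ D.J u a b) + fderiv ℝ D.g u a c (D.J u b)
      + D.g u (D.J u c) (D.Gam u a b) - D.g u (D.Gam u a c) (D.J u b) := fun a b c => by
    rw [T_def, D.dg_eq hu, D.g_symm u hu c, D.g_J_left hu, D.g_symm u hu c,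
      D.g_symm u hu (D.J u c)]; ring
  -- J is skew for g and ∇g = 0, hence ∇_a J is skew as well.
  have T_skew : ∀ a b c, T a b c = -T a c b := fun a b c => by
    rw [T_alt a b c, T_alt a c b]
    have h1 := dgJ a c b
    have h2 := D.dg_symm hu a (D.J u c) b
    have h3 := D.g_symm u hu (fderiv ℝ D.J u a c) b
    have h4 := D.g_symm u hu (D.J u c) (D.Gam u a b)
    have h5 := D.g_symm u hu (D.J u b) (D.Gam u a c)
    linarith
  have T_J : ∀ a b c, T a (D.J u b) c = T a b (D.J u c) := fun a b c => by
    have h1 := congrArg (fun z => D.g u z c) (dJJ a b)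
    simp only [map_add, add_apply, map_zero, zero_apply] at h1
    rw [T_def, T_def]
    have h2 := D.g_J_left hu (fderiv ℝ D.J u a b) c
    have h3 := D.g_J u hu (D.Gam u a b) c
    have h4 := D.g_J_left hu (D.Gam u a (D.J u b)) c
    rw [D.J_sq u hu, map_neg, map_neg, neg_apply]
    linarith
  have T_I : ∀ a b c, T a (D.I b) c = T a b (D.I c) := fun a b c => by
    rw [T_def, T_def, dJI, D.Gam_I hu, D.J_I u hu, D.J_I u hu, map_neg, map_neg, map_neg, map_neg,
      D.Gam_I hu]
    simp only [neg_apply]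
    rw [D.g_I_left hu, D.g_I_left hu, D.g_I_left hu]
    ring
  -- For a torsion-free metric connection the cyclic sum of (∇_a ω_J)(b, c) is dω_J up to sign;
  -- below, the same is done for ω_K.
  have T_cyc : ∀ a b c, T a b c + T b c a + T c a b = 0 := fun a b c => by
    rw [T_alt a b c, T_alt b c a, T_alt c a b]
    have h1 := D.closed_J u hu a c b
    have s1 := D.Gam_symm hu a b
    have s2 := D.Gam_symm hu a c
    have s3 := D.Gam_symm hu b c
    have s4 := D.g_symm u hu (D.J u c) (D.Gam u a b)
    have s5 := D.g_symm u hu (D.J u a) (D.Gam u b c)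
    have s6 := D.g_symm u hu (D.J u b) (D.Gam u c a)
    rw [s1] at *; rw [s2] at *; rw [s3] at *
    linarith
  have T_alt_I : ∀ a b c, T a b (D.I c) = -(D.g u c (D.I (fderiv ℝ D.J u a b))
      + fderiv ℝ D.g u a c (D.I (D.J u b))
      + D.g u (D.I (D.J u c)) (D.Gam u a b) - D.g u (D.Gam u a c) (D.I (D.J u b))) :=
    fun a b c => by
    rw [T_alt, D.J_I u hu, D.Gam_I hu, D.dg_I_left hu, D.g_I_left hu c, D.g_I_left hu (D.Gam u a c),
      map_neg, neg_apply]
    ring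
  have T_cyc_I : ∀ a b c, T a b (D.I c) + T b c (D.I a) + T c a (D.I b) = 0 :=
    fun a b c => by
    rw [T_alt_I a b c, T_alt_I b c a, T_alt_I c a b]
    have h1 := D.closed_K u hu a c b
    have s1 := D.Gam_symm hu a b
    have s2 := D.Gam_symm hu a c
    have s3 := D.Gam_symm hu b c
    have s4 := D.g_symm u hu (D.I (D.J u c)) (D.Gam u a b)
    have s5 := D.g_symm u hu (D.I (D.J u a)) (D.Gam u b c)
    have s6 := D.g_symm u hu (D.I (D.J u b)) (D.Gam u c a)
    rw [s1] at *; rw [s2] at *; rw [s3] at *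
    linarith
  -- The cyclic identity at (b, c, Ia) minus the one for K at (b, c, a): after moving I between the
  -- last two slots only the two terms with a in the first slot survive.
  have T_I_left : ∀ a b c, T (D.I a) b c = T a b (D.I c) := fun a b c => by
    have h1 := T_cyc b c (D.I a)
    have h2 := T_cyc_I b c a
    rw [← T_I b c] at h1
    have h3 := T_I c a b
    have h4 := T_I b c a
    have h5 := T_I a b c
    linarith
  have T_neg : ∀ a b c, T a b (-c) = -T a b c := fun a b c => by rw [hT]; exact map_neg _ c
  have T_zero : ∀ a b c, T a b c = 0 := fun a b c => by
    -- Going once around: T(Ix, y, Jz) = T(x, y, IJz) = -T(x, y, JIz) = -T(x, Jy, Iz) = T(x, Iz, Jy)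
    -- = T(x, z, IJy) = T(Ix, z, Jy) = T(Ix, Jz, y) = -T(Ix, y, Jz). The expression equals its
    -- negative.
    have key : ∀ x y z, T (D.I x) y (D.J u z) = 0 := fun x y z => by
      have h1 := T_I_left x y (D.J u z)
      have h2 := T_skew x y (D.I (D.J u z))
      have h3 : T x y (D.I (D.J u z)) = -T x y (D.J u (D.I z)) := by
        rw [D.J_I u hu, T_neg, neg_neg]
      have h4 := T_J x y (D.I z)
      have h5 := T_skew x (D.J u y) (D.I z)
      have h6 := T_I x z (D.J u y)
      have h7 := T_I_left x z (D.J u y)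
      have h8 := T_J (D.I x) z y
      have h9 := T_skew (D.I x) (D.J u z) y
      linarith
    -- Since I(-Ia) = a and J(-Jc) = c, this choice gives an arbitrary value of T.
    have h1 := key (-D.I a) b (-D.J u c)
    simpa only [map_neg, D.I_sq, neg_neg, D.J_sq u hu] using h1
  refine sub_eq_zero.1 (D.nondeg hu fun z => ?_)
  rw [map_zero, zero_apply]
  exact T_zero v w z

end LocalHK

end LocalGeometry

/-! ### Curvature: Riemannian symmetries, SU(2)-invariance, type (1,1) for the Chern connection. -/

section Curvature

variable {E V W : Type*} [NormedAddCommGroup E] [NormedSpace ℝ E] [NormedAddCommGroup V]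
  [NormedSpace ℝ V] [NormedAddCommGroup W] [NormedSpace ℝ W]

/-- The curvature of the connection with connection form `θ`. -/
def curv (θ : E → E →L[ℝ] V →L[ℝ] V) (u v w : E) : V →L[ℝ] V :=
  fderiv ℝ θ u v w - fderiv ℝ θ u w v + (θ u v ∘L θ u w - θ u w ∘L θ u v)

theorem curv_apply (θ : E → E →L[ℝ] V →L[ℝ] V) (u v w : E) (x : V) : curv θ u v w x =
    fderiv ℝ θ u v w x - fderiv ℝ θ u w v x + (θ u v (θ u w x) - θ u w (θ u v x)) := rfl

theorem curv_swap (θ : E → E →L[ℝ] V →L[ℝ] V) (u v w : E) : curv θ u w v = -curv θ u v w := by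
  ext x
  simp only [curv_apply, neg_apply]
  abel

theorem snd_fderiv_symm {f : E → W} {u : E} (hf : ContDiffAt ℝ ∞ f u) (v w : E) :
    fderiv ℝ (fderiv ℝ f) u v w = fderiv ℝ (fderiv ℝ f) u w v := by
  have : IsSymmSndFDerivAt ℝ f u := hf.isSymmSndFDerivAt
    (by simpa using WithTop.coe_le_coe.2 (le_top : (2 : ℕ∞) ≤ ⊤))
  exact this v w

theorem differentiableAt_fderiv {f : E → W} {u : E} (hf : ContDiffAt ℝ ∞ f u) :
    DifferentiableAt ℝ (fderiv ℝ f) u :=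
  (hf.fderiv_right (m := ∞) (by simp)).differentiableAt (by simp)

/-- The curvature of a metric connection is skew. -/
theorem curv_skew {G : E → V →L[ℝ] V →L[ℝ] W} {θ : E → E →L[ℝ] V →L[ℝ] V} {U : Set E}
    (hU : IsOpen U) (hG : ContDiffOn ℝ ∞ G U) (hθ : ContDiffOn ℝ ∞ θ U)
    (h : ∀ u ∈ U, ∀ v a b, fderiv ℝ G u v a b = G u (θ u v a) b + G u a (θ u v b))
    {u : E} (hu : u ∈ U) (v w : E) (a b : V) :
    G u (curv θ u v w a) b + G u a (curv θ u v w b) = 0 := by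
  have hGu := hG.contDiffAt (hU.mem_nhds hu)
  have hGd : DifferentiableAt ℝ G u := hGu.differentiableAt (by simp)
  have hθd : DifferentiableAt ℝ θ u :=
    (hθ.contDiffAt (hU.mem_nhds hu)).differentiableAt (by simp)
  have hdG := differentiableAt_fderiv hGu
  -- Differentiate ∇G = 0 once more and eliminate the first derivatives of G. The second derivative
  -- is symmetric in v, w, and the antisymmetric part of the right-hand side is the claim.
  have key : ∀ v w, fderiv ℝ (fderiv ℝ G) u v w a b
      = G u (θ u v (θ u w a)) b + G u (θ u w a) (θ u v b) + G u (fderiv ℝ θ u v w a) b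
        + (G u (θ u v a) (θ u w b) + G u a (θ u v (θ u w b)) + G u a (fderiv ℝ θ u v w b)) := by
    intro v w
    have hθa : ∀ a, DifferentiableAt ℝ (fun u => θ u w a) u := fun a =>
      (hθd.clm_apply (differentiableAt_const w)).clm_apply (differentiableAt_const a)
    have e : ∀ a, fderiv ℝ (fun u => θ u w a) u v = fderiv ℝ θ u v w a := fun a => by
      rw [fderiv_apply_const (hθd.clm_apply (differentiableAt_const w)), fderiv_apply_const hθd]
    have h1 : fderiv ℝ (fun u => fderiv ℝ G u w a b) u
        = fderiv ℝ (fun u => G u (θ u w a) b + G u a (θ u w b)) u :=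
      Filter.EventuallyEq.fderiv_eq
        (Filter.eventually_of_mem (hU.mem_nhds hu) fun u hu => h u hu w a b)
    have h2 := congrArg (fun f => f v) h1
    have d1 : DifferentiableAt ℝ (fun u => G u (θ u w a)) u := hGd.clm_apply (hθa a)
    have d2 : DifferentiableAt ℝ (fun u => G u a) u := hGd.clm_apply (differentiableAt_const a)
    have d3 : DifferentiableAt ℝ (fun u => fderiv ℝ G u w) u :=
      hdG.clm_apply (differentiableAt_const w)
    have d4 : DifferentiableAt ℝ (fun u => fderiv ℝ G u w a) u :=
      d3.clm_apply (differentiableAt_const a)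
    rw [fderiv_apply_const d4, fderiv_apply_const d3, fderiv_apply_const hdG,
      fderiv_fun_add (d1.clm_apply (differentiableAt_const b)) (d2.clm_apply (hθa b)), add_apply,
      fderiv_apply_const d1, fderiv_apply_fun d2 (hθa b), fderiv_apply_fun hGd (hθa a),
      fderiv_apply_const hGd, e, e, add_apply, h u hu, h u hu] at h2
    exact h2
  have h1 := key v w
  rw [snd_fderiv_symm hGu, key w v] at h1
  simp only [curv_apply, map_sub, map_add, add_apply, sub_apply]
  rw [← sub_eq_zero] at h1
  rw [← neg_eq_zero, ← h1]
  abel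

/-- A parallel endomorphism commutes with the curvature. -/
theorem curv_comm {A : E → V →L[ℝ] V} {θ : E → E →L[ℝ] V →L[ℝ] V} {U : Set E}
    (hU : IsOpen U) (hA : ContDiffOn ℝ ∞ A U) (hθ : ContDiffOn ℝ ∞ θ U)
    (h : ∀ u ∈ U, ∀ v a, fderiv ℝ A u v a = A u (θ u v a) - θ u v (A u a))
    {u : E} (hu : u ∈ U) (v w : E) (x : V) :
    curv θ u v w (A u x) = A u (curv θ u v w x) := by
  have hAu := hA.contDiffAt (hU.mem_nhds hu)
  have hAd : DifferentiableAt ℝ A u := hAu.differentiableAt (by simp)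
  have hθd : DifferentiableAt ℝ θ u :=
    (hθ.contDiffAt (hU.mem_nhds hu)).differentiableAt (by simp)
  have hdA := differentiableAt_fderiv hAu
  -- The same argument applied to ∇A = 0: antisymmetrizing in v, w leaves the commutator of A with
  -- the curvature.
  have key : ∀ v w, fderiv ℝ (fderiv ℝ A) u v w x
      = A u (θ u v (θ u w x)) - θ u v (A u (θ u w x)) + A u (fderiv ℝ θ u v w x)
        - (fderiv ℝ θ u v w (A u x) + (θ u w (A u (θ u v x)) - θ u w (θ u v (A u x)))) := by
    intro v w
    have hθw : DifferentiableAt ℝ (fun u => θ u w) u := hθd.clm_apply (differentiableAt_const w)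
    have hθx := hθw.clm_apply (differentiableAt_const x)
    have hAx := hAd.clm_apply (differentiableAt_const x)
    have h1 : fderiv ℝ (fun u => fderiv ℝ A u w x) u
        = fderiv ℝ (fun u => A u (θ u w x) - θ u w (A u x)) u :=
      Filter.EventuallyEq.fderiv_eq
        (Filter.eventually_of_mem (hU.mem_nhds hu) fun u hu => h u hu w x)
    have h2 := congrArg (fun f => f v) h1
    have d3 : DifferentiableAt ℝ (fun u => fderiv ℝ A u w) u :=
      hdA.clm_apply (differentiableAt_const w)
    rw [fderiv_apply_const d3, fderiv_apply_const hdA,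
      fderiv_fun_sub (hAd.clm_apply hθx) (hθw.clm_apply hAx), sub_apply,
      fderiv_apply_fun hAd hθx, fderiv_apply_fun hθw hAx, fderiv_apply_const hθw,
      fderiv_apply_const hθd, fderiv_apply_const hAd, h u hu, h u hu, map_sub] at h2
    exact h2
  have h1 := key v w
  rw [snd_fderiv_symm hAu, key w v] at h1
  simp only [curv_apply, map_sub, map_add]
  rw [← sub_eq_zero] at h1
  rw [← sub_eq_zero, ← h1]
  abel

namespace LocalHK

variable (D : LocalHK E) {u : E} [FiniteDimensional ℝ E]

/-- A smooth parallel endomorphism of the tangent bundle. -/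
structure Par (A : E → E →L[ℝ] E) : Prop where
  smooth : ContDiffOn ℝ ∞ A D.U
  par : ∀ u ∈ D.U, ∀ v w, fderiv ℝ A u v w = A u (D.Gam u v w) - D.Gam u v (A u w)

variable {D}

theorem Par.diff {A : E → E →L[ℝ] E} (hA : D.Par A) (hu : u ∈ D.U) : DifferentiableAt ℝ A u :=
  (hA.smooth.contDiffAt (D.isOpen.mem_nhds hu)).differentiableAt (by simp)

theorem Par.comp {A B : E → E →L[ℝ] E} (hA : D.Par A) (hB : D.Par B) :
    D.Par fun u => A u ∘L B u where
  smooth := hA.smooth.clm_comp hB.smooth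
  par u hu v w := by
    rw [fderiv_clm_comp (hA.diff hu) (hB.diff hu)]
    simp [hA.par u hu, hB.par u hu]

variable (D)

theorem par_id : D.Par fun _ : E => ContinuousLinearMap.id ℝ E where
  smooth := contDiffOn_const
  par _ _ v w := by simp

theorem par_I : D.Par fun _ => D.I where
  smooth := contDiffOn_const
  par u hu v w := by simp [D.Gam_I hu]

theorem par_J : D.Par D.J where
  smooth := D.J_smooth
  par u hu v w := D.dJ_eq hu v w

/-- The third complex structure. -/
def K (u : E) : E →L[ℝ] E := D.I ∘L D.J u

theorem K_apply (u v : E) : D.K u v = D.I (D.J u v) := rfl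

theorem par_K : D.Par D.K := D.par_I.comp D.par_J

theorem K_sq (hu : u ∈ D.U) (v : E) : D.K u (D.K u v) = -v := by
  simp [K_apply, D.J_I u hu, D.J_sq u hu]

theorem g_K (hu : u ∈ D.U) (v w : E) : D.g u (D.K u v) (D.K u w) = D.g u v w := by
  rw [K_apply, K_apply, D.g_I u hu, D.g_J u hu]

/-- The Riemannian curvature. -/
abbrev Riem (u : E) : E → E → E →L[ℝ] E := curv D.Gam u

/-- The connection is torsion-free, so both Γ and its derivatives are symmetric in the two vector
slots, and the cyclic sum cancels in pairs. -/
theorem Riem_bianchi (hu : u ∈ D.U) (v w x : E) :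
    D.Riem u v w x + D.Riem u w x v + D.Riem u x v w = 0 := by
  have h : ∀ v w x, fderiv ℝ D.Gam u v w x = fderiv ℝ D.Gam u v x w := fun v w x => by
    have hd := D.Gam_diff hu
    rw [← fderiv_apply_const hd, ← fderiv_apply_const (hd.clm_apply (differentiableAt_const w)),
      ← fderiv_apply_const hd, ← fderiv_apply_const (hd.clm_apply (differentiableAt_const x)),
      D.fderiv_congr (fun u hu => D.Gam_symm hu w x) hu]
  simp only [curv_apply]
  rw [h v w x, h w x v, h x v w, D.Gam_symm hu w x, D.Gam_symm hu x v, D.Gam_symm hu v w]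
  abel

theorem Riem_skew (hu : u ∈ D.U) (v w a b : E) :
    D.g u (D.Riem u v w a) b + D.g u a (D.Riem u v w b) = 0 :=
  curv_skew D.isOpen D.g_smooth D.Gam_smooth (fun _ hu v a b => D.dg_eq hu v a b) hu v w a b

/-- The classical octahedron argument: combine four Bianchi identities and cancel with the two skew
symmetries. -/
theorem Riem_pair (hu : u ∈ D.U) (v w a b : E) :
    D.g u (D.Riem u v w a) b = D.g u (D.Riem u a b v) w := by
  have h1 : ∀ v w a b, D.g u (D.Riem u v w a) b = -D.g u (D.Riem u w v a) b :=
    fun v w a b => by rw [Riem, curv_swap]; simp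
  have h2 : ∀ v w a b, D.g u (D.Riem u v w a) b = -D.g u (D.Riem u v w b) a := fun v w a b => by
    have := D.Riem_skew hu v w a b
    rw [D.g_symm u hu a] at this
    linarith
  have h3 : ∀ v w a b, D.g u (D.Riem u v w a) b + D.g u (D.Riem u w a v) b
      + D.g u (D.Riem u a v w) b = 0 := fun v w a b => by
    have := congrArg (fun z => D.g u z b) (D.Riem_bianchi hu v w a)
    simpa using this
  have a1 := h3 v w a b
  have a2 := h3 w a b v
  have a3 := h3 a b v w
  have a4 := h3 b v w a
  have b1 := h2 w a b v
  have b2 := h2 a b w v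
  have b3 := h2 b w a v
  have b4 := h2 b v a w
  have b5 := h2 v a b w
  have b6 := h2 v w b a
  have b7 := h2 w b v a
  have b8 := h1 a v w b
  have b9 := h1 b w v a
  have b10 := h2 w b a v
  have b11 := h1 b w a v
  have b12 := h2 v a w b
  have b13 := h1 v b w a
  have b14 := h2 v b w a
  have b15 := h1 v b a w
  linarith

/-- A parallel endomorphism commutes with the values of the curvature. Pair symmetry exchanges the
values with the 2-form slots, and orthogonality of `A` then removes it from there. -/
theorem Riem_par {A : E → E →L[ℝ] E} (hA : D.Par A) (hu : u ∈ D.U)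
    (hg : ∀ v w, D.g u (A u v) (A u w) = D.g u v w) (v w : E) :
    D.Riem u (A u v) (A u w) = D.Riem u v w := by
  ext a
  refine D.nondeg hu fun b => ?_
  rw [D.Riem_pair hu, curv_comm D.isOpen hA.smooth D.Gam_smooth hA.par hu, hg, D.Riem_pair hu]

theorem Riem_I (hu : u ∈ D.U) (v w : E) : D.Riem u (D.I v) (D.I w) = D.Riem u v w :=
  D.Riem_par D.par_I hu (D.g_I u hu) v w

theorem Riem_J (hu : u ∈ D.U) (v w : E) : D.Riem u (D.J u v) (D.J u w) = D.Riem u v w :=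
  D.Riem_par D.par_J hu (D.g_J u hu) v w

theorem Riem_K (hu : u ∈ D.U) (v w : E) : D.Riem u (D.K u v) (D.K u w) = D.Riem u v w :=
  D.Riem_par D.par_K hu (D.g_K hu) v w

end LocalHK

/-- A Hermitian bundle over the base of a local hyperkähler metric, trivialized holomorphically,
with the connection form of its Chern connection. -/
structure LocalBundle {E : Type*} [NormedAddCommGroup E] [NormedSpace ℝ E] (D : LocalHK E)
    (F : Type*) [NormedAddCommGroup F] [NormedSpace ℂ F] where
  H : E → F →L[ℝ] F →L[ℝ] ℂ
  θ : E → E →L[ℝ] F →L[ℝ] F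
  H_smooth : ContDiffOn ℝ ∞ H D.U
  θ_smooth : ContDiffOn ℝ ∞ θ D.U
  H_smul : ∀ u ∈ D.U, ∀ (c : ℂ) a b, H u a (c • b) = c * H u a b
  H_symm : ∀ u ∈ D.U, ∀ a b, H u a b = star (H u b a)
  H_pos : ∀ u ∈ D.U, ∀ a, a ≠ 0 → 0 < (H u a a).re
  H_θ : ∀ u ∈ D.U, ∀ v a b, H u a (θ u v b)
    = (1 / 2 : ℂ) * (fderiv ℝ H u v a b - Complex.I * fderiv ℝ H u (D.I v) a b)

namespace LocalBundle

variable {F : Type*} [NormedAddCommGroup F] [NormedSpace ℂ F] {D : LocalHK E}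
  (B : LocalBundle D F) {u : E}

theorem H_diff (hu : u ∈ D.U) : DifferentiableAt ℝ B.H u :=
  (B.H_smooth.contDiffAt (D.isOpen.mem_nhds hu)).differentiableAt (by simp)

theorem θ_diff (hu : u ∈ D.U) : DifferentiableAt ℝ B.θ u :=
  (B.θ_smooth.contDiffAt (D.isOpen.mem_nhds hu)).differentiableAt (by simp)

theorem H_smul_left (hu : u ∈ D.U) (c : ℂ) (a b : F) :
    B.H u (c • a) b = star c * B.H u a b := by
  rw [B.H_symm u hu, B.H_smul u hu, B.H_symm u hu a b]
  simp

theorem nondeg (hu : u ∈ D.U) {a b : F} (h : ∀ c, B.H u c a = B.H u c b) : a = b := by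
  by_contra hne
  have h1 := B.H_pos u hu (a - b) (sub_ne_zero.2 hne)
  rw [map_sub, h, sub_self] at h1
  simp at h1

theorem fderiv_H (hu : u ∈ D.U) (v : E) (a b : F) :
    fderiv ℝ (fun u => B.H u a b) u v = fderiv ℝ B.H u v a b := by
  rw [fderiv_apply_const ((B.H_diff hu).clm_apply (differentiableAt_const a)),
    fderiv_apply_const (B.H_diff hu)]

theorem dH_smul (hu : u ∈ D.U) (v : E) (c : ℂ) (a b : F) :
    fderiv ℝ B.H u v a (c • b) = c * fderiv ℝ B.H u v a b := by
  have hd : DifferentiableAt ℝ (fun u => B.H u a b) u :=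
    ((B.H_diff hu).clm_apply (differentiableAt_const a)).clm_apply (differentiableAt_const b)
  rw [← B.fderiv_H hu, ← B.fderiv_H hu, D.fderiv_congr (fun u hu => B.H_smul u hu c a b) hu,
    fderiv_const_mul hd]
  simp

theorem dH_symm (hu : u ∈ D.U) (v : E) (a b : F) :
    fderiv ℝ B.H u v a b = star (fderiv ℝ B.H u v b a) := by
  have hd : DifferentiableAt ℝ (fun u => B.H u b a) u :=
    ((B.H_diff hu).clm_apply (differentiableAt_const b)).clm_apply (differentiableAt_const a)
  rw [← B.fderiv_H hu, ← B.fderiv_H hu, D.fderiv_congr (fun u hu => B.H_symm u hu a b) hu]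
  exact fderiv_clm_left (Complex.conjCLE : ℂ →L[ℝ] ℂ) hd v

/-- θ = H⁻¹∂H is of type (1,0): replacing v by Iv in the (1,0)-part of dH multiplies it by i. -/
theorem θ_I (hu : u ∈ D.U) (v : E) (b : F) : B.θ u (D.I v) b = Complex.I • B.θ u v b := by
  refine B.nondeg hu fun a => ?_
  rw [B.H_smul u hu, B.H_θ u hu, B.H_θ u hu, D.I_sq, map_neg, neg_apply, neg_apply]
  ring_nf
  simp
  ring

theorem θ_smul (hu : u ∈ D.U) (v : E) (c : ℂ) (b : F) : B.θ u v (c • b) = c • B.θ u v b := by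
  refine B.nondeg hu fun a => ?_
  rw [B.H_smul u hu, B.H_θ u hu, B.H_θ u hu, B.dH_smul hu, B.dH_smul hu]
  ring

/-- The Chern connection is metric. -/
theorem dH_eq (hu : u ∈ D.U) (v : E) (a b : F) :
    fderiv ℝ B.H u v a b = B.H u (B.θ u v a) b + B.H u a (B.θ u v b) := by
  rw [B.H_symm u hu (B.θ u v a), B.H_θ u hu, B.H_θ u hu, B.dH_symm hu v b a,
    B.dH_symm hu (D.I v) b a]
  simp
  ring

theorem curv_skew (hu : u ∈ D.U) (v w : E) (a b : F) :
    B.H u (curv B.θ u v w a) b + B.H u a (curv B.θ u v w b) = 0 :=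
  QuatDolbeault.curv_skew D.isOpen B.H_smooth B.θ_smooth (fun _ hu v a b => B.dH_eq hu v a b)
    hu v w a b

theorem dθ_I (hu : u ∈ D.U) (v w : E) (b : F) :
    fderiv ℝ B.θ u v (D.I w) b = Complex.I • fderiv ℝ B.θ u v w b := by
  have hw : ∀ w, DifferentiableAt ℝ (fun u => B.θ u w) u := fun w =>
    (B.θ_diff hu).clm_apply (differentiableAt_const w)
  have e : ∀ w, fderiv ℝ (fun u => B.θ u w b) u v = fderiv ℝ B.θ u v w b := fun w => by
    rw [fderiv_apply_const (hw w), fderiv_apply_const (B.θ_diff hu)]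
  rw [← e, ← e, D.fderiv_congr (fun u hu => B.θ_I hu w b) hu,
    fderiv_fun_const_smul ((hw w).clm_apply (differentiableAt_const b))]
  rfl

/-- The curvature of the Chern connection is of type `(1,1)`. -/
theorem curv_I (hu : u ∈ D.U) (v w : E) :
    curv B.θ u (D.I v) (D.I w) = curv B.θ u v w := by
  -- In a holomorphic frame θ has type (1,0), so dθ + θ∧θ has no (0,2)-part; this equation says
  -- exactly that. Skewness for H makes the (2,0)-part the negative adjoint of the (0,2)-part, so it
  -- vanishes too.
  have hZ : ∀ b, curv B.θ u v w b - curv B.θ u (D.I v) (D.I w) b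
      = -(Complex.I • (curv B.θ u (D.I v) w b + curv B.θ u v (D.I w) b)) := fun b => by
    simp only [curv_apply, B.dθ_I hu, B.θ_I hu, B.θ_smul hu, smul_add, smul_sub, smul_smul,
      Complex.I_mul_I]
    simp only [neg_smul, one_smul]
    abel
  ext b
  refine (sub_eq_zero.1 (B.nondeg hu fun a => ?_)).symm
  rw [map_zero]
  have h1 := B.curv_skew hu v w a b
  have h2 := B.curv_skew hu (D.I v) (D.I w) a b
  have h3 := B.curv_skew hu (D.I v) w a b
  have h4 := B.curv_skew hu v (D.I w) a b
  have h5 := congrArg (B.H u a) (hZ b)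
  have h6 := congrArg (fun c => B.H u c b) (hZ a)
  simp only [map_neg, neg_apply, B.H_smul u hu, B.H_smul_left hu, map_add, map_sub, add_apply,
    sub_apply, Complex.star_def, Complex.conj_I] at h5 h6 ⊢
  linear_combination (1 / 2 : ℂ) * h5 - (1 / 2 : ℂ) * h6 + (1 / 2 : ℂ) * h1 - (1 / 2 : ℂ) * h2
    - Complex.I / 2 * (h3 + h4)

end LocalBundle

end Curvature

/-! ### Covariant derivatives of bundle-valued forms and the operators D_A. -/

section LocalForms

variable {E F : Type*} [NormedAddCommGroup E] [NormedSpace ℝ E] [FiniteDimensional ℝ E]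
  [NormedAddCommGroup F] [NormedSpace ℂ F]

/-- The curvature, as a continuous bilinear map. -/
def curvL {V : Type*} [NormedAddCommGroup V] [NormedSpace ℝ V] (θ : E → E →L[ℝ] V →L[ℝ] V)
    (u : E) : E →L[ℝ] E →L[ℝ] V →L[ℝ] V :=
  fderiv ℝ θ u - (fderiv ℝ θ u).flip
    + ((ContinuousLinearMap.compL ℝ V V V).bilinearComp (θ u) (θ u)
      - ((ContinuousLinearMap.compL ℝ V V V).bilinearComp (θ u) (θ u)).flip)

theorem curvL_apply {V : Type*} [NormedAddCommGroup V] [NormedSpace ℝ V]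
    (θ : E → E →L[ℝ] V →L[ℝ] V) (u v w : E) : curvL θ u v w = curv θ u v w := rfl

namespace LocalBundle

variable {D : LocalHK E} (B : LocalBundle D F) {u : E} {p : ℕ}

/-- The connection form on the bundle of `F`-valued `p`-forms. -/
def conn (p : ℕ) (u : E) : E →L[ℝ] (E [⋀^Fin p]→L[ℝ] F) →L[ℝ] (E [⋀^Fin p]→L[ℝ] F) :=
  (ContinuousLinearMap.compContinuousAlternatingMapCLM ℝ E F F (Fin p)) ∘L (B.θ u)
    - (der p) ∘L (D.Gam u)

theorem conn_apply (u v : E) (η : E [⋀^Fin p]→L[ℝ] F) : B.conn p u v η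
    = (B.θ u v).compContinuousAlternatingMap η - der p (D.Gam u v) η := rfl

theorem conn_smooth : ContDiffOn ℝ ∞ (B.conn p) D.U :=
  (contDiffOn_const.clm_comp B.θ_smooth).sub (contDiffOn_const.clm_comp D.Gam_smooth)

theorem conn_diff (hu : u ∈ D.U) : DifferentiableAt ℝ (B.conn p) u :=
  (B.conn_smooth.contDiffAt (D.isOpen.mem_nhds hu)).differentiableAt (by simp)

theorem conn_csmul (hu : u ∈ D.U) (v : E) (c : ℂ) (η : E [⋀^Fin p]→L[ℝ] F) :
    B.conn p u v (c • η) = c • B.conn p u v η := by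
  ext m
  simp [conn_apply, der_apply, B.θ_smul hu, smul_sub, Finset.smul_sum]

/-- The covariant derivative of a form. -/
def nab (p : ℕ) (η : E → E [⋀^Fin p]→L[ℝ] F) (u : E) : E →L[ℝ] E [⋀^Fin p]→L[ℝ] F :=
  fderiv ℝ η u + (B.conn p u).flip (η u)

theorem nab_apply (η : E → E [⋀^Fin p]→L[ℝ] F) (u v : E) : B.nab p η u v
    = fderiv ℝ η u v + B.conn p u v (η u) := rfl

variable {B} {η ζ : E → E [⋀^Fin p]→L[ℝ] F}

theorem _root_.QuatDolbeault.LocalHK.diff {W : Type*} [NormedAddCommGroup W] [NormedSpace ℝ W]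
    {f : E → W} (hf : ContDiffOn ℝ ∞ f D.U) (hu : u ∈ D.U) : DifferentiableAt ℝ f u :=
  (hf.contDiffAt (D.isOpen.mem_nhds hu)).differentiableAt (by simp)

theorem nab_smooth (hη : ContDiffOn ℝ ∞ η D.U) : ContDiffOn ℝ ∞ (B.nab p η) D.U := by
  refine (hη.fderiv_of_isOpen D.isOpen (by simp)).add ?_
  exact ((ContinuousLinearMap.flipₗᵢ ℝ E (E [⋀^Fin p]→L[ℝ] F)
    (E [⋀^Fin p]→L[ℝ] F)).toContinuousLinearEquiv.contDiff.comp_contDiffOn B.conn_smooth).clm_apply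
    hη

theorem nab_add (hη : ContDiffOn ℝ ∞ η D.U) (hζ : ContDiffOn ℝ ∞ ζ D.U) (hu : u ∈ D.U) :
    B.nab p (fun u => η u + ζ u) u = B.nab p η u + B.nab p ζ u := by
  ext1 v
  rw [add_apply, nab_apply, nab_apply, nab_apply,
    fderiv_fun_add (LocalHK.diff hη hu) (LocalHK.diff hζ hu), map_add, add_apply]
  abel

theorem nab_csmul (hη : ContDiffOn ℝ ∞ η D.U) (hu : u ∈ D.U) (c : ℂ) :
    B.nab p (fun u => c • η u) u = c • B.nab p η u := by
  ext1 v
  rw [smul_apply, nab_apply, nab_apply, fderiv_fun_const_smul (LocalHK.diff hη hu),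
    B.conn_csmul hu, smul_add]
  rfl

variable (B)

/-- The operator `∑ eᵃ ∧ ∇_{A e_a}`. -/
def opD (p : ℕ) (A : E → E →L[ℝ] E) (η : E → E [⋀^Fin p]→L[ℝ] F) (u : E) :
    E [⋀^Fin (p + 1)]→L[ℝ] F :=
  alt p (B.nab p η u ∘L A u)

/-- The second covariant derivative of a form. -/
def nab2 (p : ℕ) (η : E → E [⋀^Fin p]→L[ℝ] F) (u : E) : E →L[ℝ] E →L[ℝ] E [⋀^Fin p]→L[ℝ] F :=
  fderiv ℝ (B.nab p η) u
    + ((ContinuousLinearMap.compL ℝ E (E [⋀^Fin p]→L[ℝ] F) (E [⋀^Fin p]→L[ℝ] F)).flip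
        (B.nab p η u)) ∘L (B.conn p u)
    - (ContinuousLinearMap.compL ℝ E E (E [⋀^Fin p]→L[ℝ] F) (B.nab p η u)) ∘L (D.Gam u)

theorem nab2_apply (η : E → E [⋀^Fin p]→L[ℝ] F) (u v w : E) : B.nab2 p η u v w
    = fderiv ℝ (B.nab p η) u v w + B.conn p u v (B.nab p η u w) - B.nab p η u (D.Gam u v w) := rfl

variable {B}

theorem opD_smooth {A : E → E →L[ℝ] E} (hA : D.Par A) (hη : ContDiffOn ℝ ∞ η D.U) :
    ContDiffOn ℝ ∞ (B.opD p A η) D.U := by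
  change ContDiffOn ℝ ∞ (fun u => alt (F := F) p (B.nab p η u ∘L A u)) D.U
  exact (ContinuousLinearMap.contDiff (alt (E := E) (F := F) p)).comp_contDiffOn
    ((nab_smooth (B := B) hη).clm_comp hA.smooth)

theorem opD_add (A : E → E →L[ℝ] E) (hη : ContDiffOn ℝ ∞ η D.U) (hζ : ContDiffOn ℝ ∞ ζ D.U)
    (hu : u ∈ D.U) : B.opD p A (fun u => η u + ζ u) u = B.opD p A η u + B.opD p A ζ u := by
  rw [opD, nab_add hη hζ hu, ContinuousLinearMap.add_comp, alt_add]; rfl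

theorem opD_csmul (A : E → E →L[ℝ] E) (hη : ContDiffOn ℝ ∞ η D.U)
    (hu : u ∈ D.U) (c : ℂ) : B.opD p A (fun u => c • η u) u = c • B.opD p A η u := by
  rw [opD, nab_csmul hη hu, ContinuousLinearMap.smul_comp, alt_smul]; rfl

/-- Alternatization against a parallel `A` commutes with ∇. The Christoffel terms on the alternated
slot are produced by `der_alt`, and ∇A = 0 moves them past `A`. -/
theorem nab_opD {A : E → E →L[ℝ] E} (hA : D.Par A) (hη : ContDiffOn ℝ ∞ η D.U) (hu : u ∈ D.U)
    (w : E) : B.nab (p + 1) (B.opD p A η) u w = alt p (B.nab2 p η u w ∘L A u) := by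
  have hn : DifferentiableAt ℝ (B.nab p η) u := LocalHK.diff (nab_smooth hη) hu
  have h1 : fderiv ℝ (B.opD p A η) u w = alt p (fderiv ℝ (B.nab p η) u w ∘L A u
      + B.nab p η u ∘L fderiv ℝ A u w) := by
    have h := fderiv_clm_left (alt (F := F) p) (hn.clm_comp (hA.diff hu)) w
    rw [fderiv_clm_comp hn (hA.diff hu)] at h
    refine h.trans (congrArg _ ?_)
    ext1 v
    simp [add_comm]
  rw [nab_apply, h1, conn_apply, opD, compContinuousAlternatingMap_alt, der_alt, ← alt_sub,
    ← alt_add]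
  congr 1
  ext1 v
  simp only [add_apply, sub_apply, ContinuousLinearMap.comp_apply, nab2_apply, conn_apply,
    hA.par u hu, map_sub, ContinuousLinearMap.compContinuousAlternatingMapCLM_apply_apply]
  abel

theorem opD_opD {A A' : E → E →L[ℝ] E} (hA' : D.Par A') (hη : ContDiffOn ℝ ∞ η D.U)
    (hu : u ∈ D.U) : B.opD (p + 1) A (B.opD p A' η) u
      = alt (p + 1) (alt p ∘L (B.nab2 p η u).bilinearComp (A u) (A' u)) := by
  rw [opD]
  congr 1
  ext1 v
  rw [ContinuousLinearMap.comp_apply, nab_opD hA' hη hu]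
  rfl

/-- Ricci identity. The term ∇_{Γ_v w} is symmetric and cancels; the Riemannian curvature appears
with a minus sign because it acts on forms by the dual action. -/
theorem nab2_sub (hη : ContDiffOn ℝ ∞ η D.U) (hu : u ∈ D.U) (v w : E) :
    B.nab2 p η u v w - B.nab2 p η u w v
      = (curv B.θ u v w).compContinuousAlternatingMap (η u) - der p (D.Riem u v w) (η u) := by
  have hηu := hη.contDiffAt (D.isOpen.mem_nhds hu)
  have hd := differentiableAt_fderiv hηu
  have hc := B.conn_diff (p := p) hu
  have hη1 := LocalHK.diff hη hu
  have h1 : ∀ v w, fderiv ℝ (B.nab p η) u v w = fderiv ℝ (fderiv ℝ η) u v w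
      + ((fderiv ℝ B.θ u v w).compContinuousAlternatingMap (η u)
          - der p (fderiv ℝ D.Gam u v w) (η u))
      + B.conn p u w (fderiv ℝ η u v) := fun v w => by
    have hn : DifferentiableAt ℝ (B.nab p η) u := LocalHK.diff (nab_smooth hη) hu
    have hcw : DifferentiableAt ℝ (fun u => B.conn p u w) u :=
      hc.clm_apply (differentiableAt_const w)
    rw [← fderiv_apply_const hn]
    have e : fderiv ℝ (fun u => B.nab p η u w) u v
        = fderiv ℝ (fun u => fderiv ℝ η u w + B.conn p u w (η u)) u v := rfl
    rw [e, fderiv_fun_add (hd.clm_apply (differentiableAt_const w)) (hcw.clm_apply hη1), add_apply,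
      fderiv_apply_const hd, fderiv_apply_fun hcw hη1, add_assoc]
    congr 2
    have e2 : fderiv ℝ (fun u => B.conn p u w) u v
        = fderiv ℝ (fun u => ContinuousLinearMap.compContinuousAlternatingMapCLM ℝ E F F (Fin p)
            (B.θ u w) - der p (D.Gam u w)) u v := rfl
    have hθw := (B.θ_diff hu).clm_apply (differentiableAt_const w)
    have hGw := (D.Gam_diff hu).clm_apply (differentiableAt_const w)
    have d1 : DifferentiableAt ℝ (fun u =>
        ContinuousLinearMap.compContinuousAlternatingMapCLM ℝ E F F (Fin p) (B.θ u w)) u :=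
      (ContinuousLinearMap.differentiableAt _).comp u hθw
    have d2 : DifferentiableAt ℝ (fun u => der (F := F) p (D.Gam u w)) u :=
      (ContinuousLinearMap.differentiableAt _).comp u hGw
    rw [e2, fderiv_fun_sub d1 d2, sub_apply, fderiv_clm_left _ hθw,
      fderiv_clm_left _ hGw, fderiv_apply_const (B.θ_diff hu), fderiv_apply_const (D.Gam_diff hu)]
    rfl
  rw [nab2_apply, nab2_apply, h1, h1, snd_fderiv_symm hηu w v,
    D.Gam_symm hu w v]
  simp only [nab_apply, map_add]
  -- The θ-part and the Γ-part of the connection act on values and on arguments, so they commute and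
  -- the mixed terms cancel.
  have h2 : B.conn p u v (B.conn p u w (η u)) - B.conn p u w (B.conn p u v (η u))
      = (B.θ u v ∘L B.θ u w - B.θ u w ∘L B.θ u v).compContinuousAlternatingMap (η u)
        - der p (D.Gam u v ∘L D.Gam u w - D.Gam u w ∘L D.Gam u v) (η u) := by
    have h3 := der_der_sub (D.Gam u w) (D.Gam u v) (η u)
    rw [← h3]
    simp only [conn_apply, map_sub, der_compContinuousAlternatingMap]
    ext m
    simp
    abel
  have h4 : (curv B.θ u v w).compContinuousAlternatingMap (η u) - der p (D.Riem u v w) (η u)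
      = ((fderiv ℝ B.θ u v w).compContinuousAlternatingMap (η u)
          - der p (fderiv ℝ D.Gam u v w) (η u))
        - ((fderiv ℝ B.θ u w v).compContinuousAlternatingMap (η u)
          - der p (fderiv ℝ D.Gam u w v) (η u))
        + (B.conn p u v (B.conn p u w (η u)) - B.conn p u w (B.conn p u v (η u))) := by
    rw [h2, LocalHK.Riem, curv, curv, map_add, map_sub]
    ext m
    simp
    abel
  rw [h4]
  abel

variable (B) in
/-- The 2-form `R(A v, A' w) + R(A' v, A w)` applied to a form. -/
def curvForm (p : ℕ) (A A' : E →L[ℝ] E) (u : E) (η : E [⋀^Fin p]→L[ℝ] F) :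
    E →L[ℝ] E →L[ℝ] E [⋀^Fin p]→L[ℝ] F :=
  (ContinuousLinearMap.compL ℝ E (F →L[ℝ] F) (E [⋀^Fin p]→L[ℝ] F)
    ((ContinuousLinearMap.compContinuousAlternatingMapCLM ℝ E F F (Fin p)).flip η)) ∘L
    ((curvL B.θ u).bilinearComp A A' + (curvL B.θ u).bilinearComp A' A)

theorem curvForm_apply (A A' : E →L[ℝ] E) (u v w : E) (η : E [⋀^Fin p]→L[ℝ] F) :
    B.curvForm p A A' u η v w
      = (curv B.θ u (A v) (A' w) + curv B.θ u (A' v) (A w)).compContinuousAlternatingMap η := rfl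

/-- After double alternatization only the antisymmetric part of ∇²_{Av,A'w} + ∇²_{A'v,Aw} counts,
and by the Ricci identity it is a curvature. The hypothesis `hR` removes its Riemannian part. The
factor 1/2 is there because `curvForm` is already antisymmetric, so its own antisymmetrization
doubles it. -/
theorem anticomm_opD {A A' : E → E →L[ℝ] E} (hA : D.Par A) (hA' : D.Par A')
    (hη : ContDiffOn ℝ ∞ η D.U) (hu : u ∈ D.U)
    (hR : ∀ v w, D.Riem u (A u v) (A' u w) + D.Riem u (A' u v) (A u w) = 0) :
    B.opD (p + 1) A (B.opD p A' η) u + B.opD (p + 1) A' (B.opD p A η) u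
      = (1 / 2 : ℝ) • alt (p + 1) (alt p ∘L B.curvForm p (A u) (A' u) u (η u)) := by
  rw [opD_opD hA' hη hu, opD_opD hA hη hu, ← alt_add, ← alt_smul, ← ContinuousLinearMap.comp_add,
    ← ContinuousLinearMap.comp_smul]
  refine alt_alt_eq_of_sub _ _ fun v w => ?_
  simp only [add_apply, smul_apply, curvForm_apply]
  have h1 := nab2_sub (B := B) hη hu (A u v) (A' u w)
  have h2 := nab2_sub (B := B) hη hu (A' u v) (A u w)
  have e1 : (curv B.θ u (A u w) (A' u v) + curv B.θ u (A' u w) (A u v))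
      = -(curv B.θ u (A u v) (A' u w) + curv B.θ u (A' u v) (A u w)) := by
    rw [curv_swap B.θ u (A' u v), curv_swap B.θ u (A u v)]; abel
  have e3 : (-(curv B.θ u (A u v) (A' u w)
      + curv B.θ u (A' u v) (A u w))).compContinuousAlternatingMap (η u)
      = -(curv B.θ u (A u v) (A' u w)
        + curv B.θ u (A' u v) (A u w)).compContinuousAlternatingMap (η u) := rfl
  have e2 := congrArg (fun T => der p T (η u)) (hR v w)
  simp only [map_add, add_apply, map_zero, zero_apply] at e2
  have e4 : (curv B.θ u (A u v) (A' u w)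
      + curv B.θ u (A' u v) (A u w)).compContinuousAlternatingMap (η u)
      = (curv B.θ u (A u v) (A' u w)).compContinuousAlternatingMap (η u)
        + (curv B.θ u (A' u v) (A u w)).compContinuousAlternatingMap (η u) := rfl
  rw [e1, e3, smul_neg, sub_neg_eq_add, ← add_smul, e4]
  norm_num
  rw [sub_eq_iff_eq_add] at h1 h2
  rw [h1, h2]
  rw [← sub_eq_zero, ← neg_eq_zero, ← e2]
  abel

end LocalBundle

end LocalForms

/-! ### Forms of type (0,p) for a fixed complex structure. -/

section ZeroType

variable {E F : Type*} [NormedAddCommGroup E] [NormedSpace ℝ E]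
  [NormedAddCommGroup F] [NormedSpace ℂ F] {p : ℕ}

/-- The space of forms of type `(0,p)` with respect to `I`. -/
def zForms (F : Type*) [NormedAddCommGroup F] [NormedSpace ℂ F] (I : E →L[ℝ] E) (p : ℕ) :
    Submodule ℂ (E [⋀^Fin p]→L[ℝ] F) where
  carrier := {η | ∀ (v : Fin p → E) (i : Fin p),
    η (Function.update v i (I (v i))) = -(Complex.I • η v)}
  add_mem' {a b} ha hb v i := by
    simp only [ContinuousAlternatingMap.add_apply, ha v i, hb v i, smul_add, neg_add]
  zero_mem' v i := by simp
  smul_mem' c a ha v i := by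
    simp only [ContinuousAlternatingMap.smul_apply, ha v i, smul_neg, smul_comm c]

theorem mem_zForms_zero {I : E →L[ℝ] E} (η : E [⋀^Fin 0]→L[ℝ] F) : η ∈ zForms F I 0 :=
  fun _ i => i.elim0

/-- One slot suffices, since alternation moves any slot to the front up to sign. -/
theorem mem_zForms_succ {I : E →L[ℝ] E} {η : E [⋀^Fin (p + 1)]→L[ℝ] F} :
    η ∈ zForms F I (p + 1) ↔ ∀ w, η.curryLeft (I w) = -(Complex.I • η.curryLeft w) := by
  constructor
  · intro h w
    ext v
    have := h (Matrix.vecCons w v) 0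
    simpa [Matrix.vecCons, Fin.update_cons_zero] using this
  · intro h v i
    have h1 : ∀ x, η (Function.update v i x)
        = (-1) ^ (i : ℕ) • η.curryLeft x (i.removeNth v) := fun x => by
      rw [← Fin.insertNth_removeNth, η.map_insertNth, ContinuousAlternatingMap.curryLeft_apply_apply]
    have h2 := h1 (v i)
    rw [Function.update_eq_self] at h2
    rw [h1, h2, h, ContinuousAlternatingMap.neg_apply, ContinuousAlternatingMap.smul_apply,
      smul_neg, smul_comm]

theorem curryLeft_mem_zForms {I : E →L[ℝ] E} {η : E [⋀^Fin (p + 1)]→L[ℝ] F}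
    (hη : η ∈ zForms F I (p + 1)) (w : E) : η.curryLeft w ∈ zForms F I p := by
  intro v i
  have := hη (Matrix.vecCons w v) i.succ
  simpa [Matrix.vecCons, ← Fin.cons_update] using this

theorem alt_mem_zForms {I : E →L[ℝ] E} {ψ : E →L[ℝ] E [⋀^Fin p]→L[ℝ] F}
    (h1 : ∀ v, ψ v ∈ zForms F I p) (h2 : ∀ v, ψ (I v) = -(Complex.I • ψ v)) :
    alt p ψ ∈ zForms F I (p + 1) := by
  refine mem_zForms_succ.2 fun w => ?_
  cases p with
  | zero => rw [curryLeft_alt_zero, curryLeft_alt_zero, h2]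
  | succ p =>
    rw [curryLeft_alt, curryLeft_alt, h2]
    have : contr p (I w) ∘L ψ = -(Complex.I • (contr p w ∘L ψ)) := by
      ext1 v
      exact mem_zForms_succ.1 (h1 v) w
    rw [this, alt_neg, alt_smul, smul_sub]
    abel

theorem der_csmul (A : E →L[ℝ] E) (c : ℂ) (η : E [⋀^Fin p]→L[ℝ] F) :
    der p A (c • η) = c • der p A η := by
  ext m
  simp [der_apply, Finset.smul_sum]

theorem der_mem_zForms {I A : E →L[ℝ] E} (hA : ∀ v, A (I v) = I (A v))
    {η : E [⋀^Fin p]→L[ℝ] F} (hη : η ∈ zForms F I p) : der p A η ∈ zForms F I p := by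
  cases p with
  | zero => exact mem_zForms_zero _
  | succ p =>
    refine mem_zForms_succ.2 fun w => ?_
    have h := mem_zForms_succ.1 hη
    rw [curryLeft_der, curryLeft_der, hA, h, h, map_neg, der_csmul, smul_add, neg_add]

theorem comp_mem_zForms {I : E →L[ℝ] E} {T : F →L[ℝ] F} (hT : ∀ (c : ℂ) b, T (c • b) = c • T b)
    {η : E [⋀^Fin p]→L[ℝ] F} (hη : η ∈ zForms F I p) :
    T.compContinuousAlternatingMap η ∈ zForms F I p := by
  intro v i
  have := congrArg T (hη v i)
  rw [map_neg, hT] at this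
  exact this

end ZeroType

/-! ### The operators ∂̄ and ∂̄_J in a chart, and their anticommutator. -/

section LocalDolbeault

variable {E F : Type*} [NormedAddCommGroup E] [NormedSpace ℝ E] [FiniteDimensional ℝ E]
  [NormedAddCommGroup F] [NormedSpace ℂ F]

namespace LocalBundle

variable {D : LocalHK E} {B : LocalBundle D F} {u : E} {p : ℕ} {η ζ : E → E [⋀^Fin p]→L[ℝ] F}

/-- The connection preserves type: I is constant in the chart, Γ commutes with I, and θ is
complex-linear on the fibre. -/
theorem nab_mem_zForms (hη : ContDiffOn ℝ ∞ η D.U) (hZ : ∀ u ∈ D.U, η u ∈ zForms F D.I p)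
    (hu : u ∈ D.U) (v : E) : B.nab p η u v ∈ zForms F D.I p := by
  rw [nab_apply, conn_apply]
  refine add_mem ?_ (sub_mem (comp_mem_zForms (fun c b => B.θ_smul hu v c b) (hZ u hu))
    (der_mem_zForms (fun w => D.Gam_I hu v w) (hZ u hu)))
  cases p with
  | zero => exact mem_zForms_zero _
  | succ p =>
    refine mem_zForms_succ.2 fun w => ?_
    have hd := LocalHK.diff hη hu
    have h1 : ∀ w, (fderiv ℝ η u v).curryLeft w = fderiv ℝ (fun u => (η u).curryLeft w) u v :=
      fun w => (fderiv_clm_left (contr p w) hd v).symm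
    rw [h1, h1, D.fderiv_congr (fun u hu => mem_zForms_succ.1 (hZ u hu) w) hu]
    have hd2 : DifferentiableAt ℝ (fun u => (η u).curryLeft w) u :=
      (contr (F := F) p w).differentiableAt.comp u hd
    rw [fderiv_fun_neg, neg_apply, fderiv_fun_const_smul hd2]
    rfl

variable (B)

/-- The local expression of the Dolbeault operator. -/
def dbarL (p : ℕ) (η : E → E [⋀^Fin p]→L[ℝ] F) (u : E) : E [⋀^Fin (p + 1)]→L[ℝ] F :=
  (1 / 2 : ℂ) • (B.opD p (fun _ => ContinuousLinearMap.id ℝ E) η u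
    + Complex.I • B.opD p (fun _ => D.I) η u)

/-- The local expression of the operator `∂̄_J`. -/
def dbarJL (p : ℕ) (η : E → E [⋀^Fin p]→L[ℝ] F) (u : E) : E [⋀^Fin (p + 1)]→L[ℝ] F :=
  (1 / 2 : ℂ) • (Complex.I • B.opD p D.K η u - B.opD p D.J η u)

/-- The symbol of `dbarL`. -/
def psiL (p : ℕ) (η : E → E [⋀^Fin p]→L[ℝ] F) (u : E) : E →L[ℝ] E [⋀^Fin p]→L[ℝ] F :=
  (1 / 2 : ℂ) • (B.nab p η u + Complex.I • (B.nab p η u ∘L D.I))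

/-- The symbol of `dbarJL`. -/
def psiJL (p : ℕ) (η : E → E [⋀^Fin p]→L[ℝ] F) (u : E) : E →L[ℝ] E [⋀^Fin p]→L[ℝ] F :=
  (1 / 2 : ℂ) • (Complex.I • (B.nab p η u ∘L D.K u) - B.nab p η u ∘L D.J u)

theorem dbarL_eq_alt (η : E → E [⋀^Fin p]→L[ℝ] F) (u : E) :
    B.dbarL p η u = alt p (B.psiL p η u) := by
  rw [dbarL, psiL, alt_smul, alt_add, alt_smul]; rfl

theorem dbarJL_eq_alt (η : E → E [⋀^Fin p]→L[ℝ] F) (u : E) :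
    B.dbarJL p η u = alt p (B.psiJL p η u) := by
  rw [dbarJL, psiJL, alt_smul, alt_sub, alt_smul]; rfl

theorem psiL_apply (η : E → E [⋀^Fin p]→L[ℝ] F) (u v : E) : B.psiL p η u v
    = (1 / 2 : ℂ) • (B.nab p η u v + Complex.I • B.nab p η u (D.I v)) := rfl

theorem psiJL_apply (η : E → E [⋀^Fin p]→L[ℝ] F) (u v : E) : B.psiJL p η u v
    = (1 / 2 : ℂ) • (Complex.I • B.nab p η u (D.K u v) - B.nab p η u (D.J u v)) := rfl

variable {B}

theorem dbarL_smooth (hη : ContDiffOn ℝ ∞ η D.U) : ContDiffOn ℝ ∞ (B.dbarL p η) D.U :=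
  ((opD_smooth D.par_id hη).add ((opD_smooth D.par_I hη).const_smul Complex.I)).const_smul _

theorem dbarJL_smooth (hη : ContDiffOn ℝ ∞ η D.U) : ContDiffOn ℝ ∞ (B.dbarJL p η) D.U :=
  (((opD_smooth D.par_K hη).const_smul Complex.I).sub (opD_smooth D.par_J hη)).const_smul _

theorem dbarL_mem_zForms (hη : ContDiffOn ℝ ∞ η D.U) (hZ : ∀ u ∈ D.U, η u ∈ zForms F D.I p)
    (hu : u ∈ D.U) : B.dbarL p η u ∈ zForms F D.I (p + 1) := by
  rw [dbarL_eq_alt]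
  have hn := nab_mem_zForms (B := B) hη hZ hu
  refine alt_mem_zForms (fun v => ?_) fun v => ?_
  · rw [psiL_apply]
    exact Submodule.smul_mem _ _ (add_mem (hn v) (Submodule.smul_mem _ _ (hn _)))
  · rw [psiL_apply, psiL_apply, D.I_sq, map_neg, smul_comm Complex.I, ← smul_neg]
    congr 1
    rw [smul_add, smul_smul, Complex.I_mul_I, neg_smul, one_smul, smul_neg]
    abel

theorem dbarJL_mem_zForms (hη : ContDiffOn ℝ ∞ η D.U) (hZ : ∀ u ∈ D.U, η u ∈ zForms F D.I p)
    (hu : u ∈ D.U) : B.dbarJL p η u ∈ zForms F D.I (p + 1) := by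
  rw [dbarJL_eq_alt]
  have hn := nab_mem_zForms (B := B) hη hZ hu
  refine alt_mem_zForms (fun v => ?_) fun v => ?_
  · rw [psiJL_apply]
    exact Submodule.smul_mem _ _ (sub_mem (Submodule.smul_mem _ _ (hn _)) (hn _))
  · rw [psiJL_apply, psiJL_apply, smul_comm Complex.I, ← smul_neg, D.K_apply, D.J_I u hu, map_neg,
      D.I_sq, neg_neg, map_neg, D.K_apply]
    congr 1
    rw [smul_sub, smul_smul, Complex.I_mul_I, neg_smul, one_smul]
    abel

theorem curv_neg_left {V : Type*} [NormedAddCommGroup V] [NormedSpace ℝ V]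
    (θ : E → E →L[ℝ] V →L[ℝ] V) (u v w : E) : curv θ u (-v) w = -curv θ u v w := by
  rw [← curvL_apply, ← curvL_apply, map_neg]; rfl

theorem curv_neg_right {V : Type*} [NormedAddCommGroup V] [NormedSpace ℝ V]
    (θ : E → E →L[ℝ] V →L[ℝ] V) (u v w : E) : curv θ u v (-w) = -curv θ u v w := by
  rw [← curvL_apply, ← curvL_apply, map_neg]

/-- J-invariance of a bilinear form, together with J² = -1, says that J is skew for it. This is the
vanishing required by `anticomm_opD`. -/
theorem Riem_id_J (hu : u ∈ D.U) (v w : E) : D.Riem u v (D.J u w) + D.Riem u (D.J u v) w = 0 := by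
  rw [← D.Riem_J hu (D.J u v) w, D.J_sq u hu, LocalHK.Riem, curv_neg_left, add_neg_cancel]

theorem Riem_id_K (hu : u ∈ D.U) (v w : E) : D.Riem u v (D.K u w) + D.Riem u (D.K u v) w = 0 := by
  rw [← D.Riem_K hu (D.K u v) w, D.K_sq hu, LocalHK.Riem, curv_neg_left, add_neg_cancel]

variable (B) in
/-- The local expression of `∂̄ ∂̄_J + ∂̄_J ∂̄`, as an `End(F)`-valued 2-form acting on forms. -/
theorem dbarL_dbarJL (hη : ContDiffOn ℝ ∞ η D.U) (hu : u ∈ D.U) :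
    B.dbarL (p + 1) (B.dbarJL p η) u + B.dbarJL (p + 1) (B.dbarL p η) u
      = (1 / 4 : ℂ) • alt (p + 1) (alt p ∘L
        (Complex.I • B.curvForm p (ContinuousLinearMap.id ℝ E) (D.K u) u (η u)
          - B.curvForm p (ContinuousLinearMap.id ℝ E) (D.J u) u (η u))) := by
  have e1 : ∀ A, B.opD (p + 1) A (B.dbarL p η) u = (1 / 2 : ℂ) •
      (B.opD (p + 1) A (B.opD p (fun _ => ContinuousLinearMap.id ℝ E) η) u
        + Complex.I • B.opD (p + 1) A (B.opD p (fun _ => D.I) η) u) := fun A => by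
    have s1 := opD_smooth (B := B) D.par_id hη
    have s2 := opD_smooth (B := B) D.par_I hη
    rw [← opD_csmul A s2 hu, ← opD_add A s1 (s2.const_smul _) hu,
      ← opD_csmul A (s1.add (s2.const_smul _)) hu]
    rfl
  have e2 : ∀ A, B.opD (p + 1) A (B.dbarJL p η) u = (1 / 2 : ℂ) •
      (Complex.I • B.opD (p + 1) A (B.opD p D.K η) u
        - B.opD (p + 1) A (B.opD p D.J η) u) := fun A => by
    have s1 := opD_smooth (B := B) D.par_K hη
    have s2 := opD_smooth (B := B) D.par_J hη
    rw [sub_eq_add_neg, ← neg_one_smul ℂ (B.opD (p + 1) A (B.opD p D.J η) u),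
      ← opD_csmul A s1 hu, ← opD_csmul A s2 hu,
      ← opD_add A (s1.const_smul _) (s2.const_smul _) hu,
      ← opD_csmul A ((s1.const_smul _).add (s2.const_smul _)) hu]
    congr 1
    funext u
    rw [dbarJL, neg_one_smul, ← sub_eq_add_neg]
  -- The product of the two sums expands into the anticommutators of D_1 and D_I with D_J and D_K.
  -- In all four cases the Riemannian curvature cancels.
  have c1 := anticomm_opD (B := B) D.par_id D.par_J hη hu (fun v w => Riem_id_J hu v w)
  have c2 := anticomm_opD (B := B) D.par_id D.par_K hη hu (fun v w => Riem_id_K hu v w)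
  have c3 := anticomm_opD (B := B) D.par_I D.par_J hη hu (fun v w => by
    have h1 := D.Riem_I hu (D.I v) (D.J u w)
    have h2 := D.Riem_I hu (D.J u v) (D.I w)
    have h3 := Riem_id_K hu v w
    rw [← h1, ← h2, D.I_sq, D.I_sq, LocalHK.Riem, curv_neg_left, curv_neg_right, ← neg_add]
    exact neg_eq_zero.2 h3)
  have c4 := anticomm_opD (B := B) D.par_I D.par_K hη hu (fun v w => by
    rw [D.K_apply, D.K_apply, D.Riem_I hu, D.Riem_I hu]
    exact Riem_id_J hu v w)
  -- The curvature of B has type (1,1), so the pair (I, J) contributes minus the pair (1, K), and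
  -- (I, K) contributes the same as (1, J). Four terms become two, each with multiplicity two.
  have f3 : B.curvForm p D.I (D.J u) u (η u)
      = -B.curvForm p (ContinuousLinearMap.id ℝ E) (D.K u) u (η u) := by
    ext v w : 2
    simp only [neg_apply, curvForm_apply, ContinuousLinearMap.id_apply]
    rw [← B.curv_I hu (D.I v) (D.J u w), ← B.curv_I hu (D.J u v) (D.I w), D.I_sq, D.I_sq,
      curv_neg_left, curv_neg_right, ← neg_add]
    rfl
  have f4 : B.curvForm p D.I (D.K u) u (η u)
      = B.curvForm p (ContinuousLinearMap.id ℝ E) (D.J u) u (η u) := by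
    ext v w : 2
    simp only [curvForm_apply, ContinuousLinearMap.id_apply]
    rw [D.K_apply, D.K_apply, B.curv_I hu, B.curv_I hu]
  rw [f3, ContinuousLinearMap.comp_neg, alt_neg] at c3
  rw [f4] at c4
  rw [ContinuousLinearMap.comp_sub, alt_sub]
  have f5 : alt p ∘L (Complex.I • B.curvForm p (ContinuousLinearMap.id ℝ E) (D.K u) u (η u))
      = Complex.I • (alt p ∘L B.curvForm p (ContinuousLinearMap.id ℝ E) (D.K u) u (η u)) := by
    ext1 v
    simp only [ContinuousLinearMap.comp_apply, smul_apply, alt_smul]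
  rw [f5, alt_smul, dbarL, dbarJL, e1, e1, e2, e2]
  have r : ∀ x : E [⋀^Fin (p + 2)]→L[ℝ] F, (1 / 2 : ℝ) • x = (1 / 2 : ℂ) • x := fun x => by
    rw [← Complex.coe_smul]; norm_num
  rw [r] at c1 c2 c3 c4
  set X := alt (p + 1) (alt p ∘L B.curvForm p (ContinuousLinearMap.id ℝ E) (D.J u) u (η u))
  set Y := alt (p + 1) (alt p ∘L B.curvForm p (ContinuousLinearMap.id ℝ E) (D.K u) u (η u))
  rw [← eq_sub_iff_add_eq] at c1 c2 c3 c4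
  rw [c1, c2, c3, c4]
  match_scalars <;> first | ring1 | linear_combination (1 / 8 : ℂ) * Complex.I_sq

end LocalBundle

end LocalDolbeault

/-! ### Metric traces computed in dual frames. -/

section Trace

variable {E : Type*} [NormedAddCommGroup E] [NormedSpace ℝ E]
  {W : Type*} [AddCommGroup W] [Module ℝ W]

/-- Real-bilinear maps. -/
structure IsBilin (f : E → E → W) : Prop where
  add_left : ∀ x x' y, f (x + x') y = f x y + f x' y
  smul_left : ∀ (r : ℝ) x y, f (r • x) y = r • f x y
  add_right : ∀ x y y', f x (y + y') = f x y + f x y'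
  smul_right : ∀ (r : ℝ) x y, f x (r • y) = r • f x y

namespace IsBilin

variable {f : E → E → W} (hf : IsBilin f) {ι : Type*} (t : Finset ι) (c : ι → ℝ) (x : ι → E)
include hf

theorem sum_left (y : E) : f (∑ i ∈ t, c i • x i) y = ∑ i ∈ t, c i • f (x i) y := by
  have := map_sum (LinearMap.mk₂ ℝ f hf.add_left hf.smul_left hf.add_right hf.smul_right)
    (fun i => c i • x i) t
  have h := congrArg (fun k => k y) this
  rw [LinearMap.sum_apply] at h
  exact h.trans (Finset.sum_congr rfl fun i _ => hf.smul_left _ _ _)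

theorem sum_right (y : E) : f y (∑ i ∈ t, c i • x i) = ∑ i ∈ t, c i • f y (x i) := by
  have := map_sum (LinearMap.mk₂ ℝ f hf.add_left hf.smul_left hf.add_right hf.smul_right y)
    (fun i => c i • x i) t
  exact this.trans (Finset.sum_congr rfl fun i _ => hf.smul_right _ _ _)

theorem comp (A B : E →L[ℝ] E) : IsBilin fun x y => f (A x) (B y) :=
  ⟨fun _ _ _ => by rw [map_add, hf.add_left], fun _ _ _ => by rw [map_smul, hf.smul_left],
    fun _ _ _ => by rw [map_add, hf.add_right], fun _ _ _ => by rw [map_smul, hf.smul_right]⟩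

theorem neg_left (x y : E) : f (-x) y = -f x y := by
  rw [← neg_one_smul ℝ x, hf.smul_left, neg_one_smul]

end IsBilin

variable [FiniteDimensional ℝ E]

/-- The index set of the standard basis of `E`. -/
abbrev Idx (E : Type*) [NormedAddCommGroup E] [NormedSpace ℝ E] := Fin (Module.finrank ℝ E)

/-- The standard basis of `E`. -/
def bs (a : Idx E) : E := Module.finBasis ℝ E a

/-- The coordinates with respect to the standard basis. -/
def co (a : Idx E) : E →L[ℝ] ℝ := LinearMap.toContinuousLinearMap ((Module.finBasis ℝ E).coord a)

theorem sum_co (v : E) : ∑ a, co a v • bs a = v := (Module.finBasis ℝ E).sum_repr v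

theorem co_bs (a b : Idx E) : co a (bs b) = if a = b then 1 else 0 := by
  simp [co, bs, Finsupp.single_apply, eq_comm]

namespace LocalHK

variable (D : LocalHK E) {u : E}

/-- The basis dual to `bs` with respect to the metric. -/
def du (u : E) (a : Idx E) : E := D.sharp u (co a)

theorem du_smooth (a : Idx E) : ContDiffOn ℝ ∞ (fun u => D.du u a) D.U :=
  D.sharp_smooth.clm_apply contDiffOn_const

theorem g_du (hu : u ∈ D.U) (a : Idx E) (v : E) : D.g u (D.du u a) v = co a v :=
  D.g_sharp hu _ v

theorem sum_g_bs (hu : u ∈ D.U) (v : E) : ∑ a, D.g u v (bs a) • D.du u a = v := by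
  refine D.nondeg hu fun z => ?_
  conv_rhs => rw [← sum_co z]
  simp [map_sum, D.g_du hu, mul_comm]

/-- The metric trace of a bilinear map can be computed in any pair of dual families. -/
theorem tr_eq {f : E → E → W} (hf : IsBilin f) {ι : Type*} [Fintype ι] {t c : ι → E}
    (h : ∀ v, ∑ i, D.g u v (c i) • t i = v) (hu : u ∈ D.U) :
    ∑ i, f (t i) (c i) = ∑ a, f (D.du u a) (bs a) := by
  have h1 : ∀ i, f (t i) (c i) = ∑ a, D.g u (D.du u a) (c i) • f (t i) (bs a) := fun i => by
    conv_lhs => rw [← sum_co (c i), hf.sum_right]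
    simp only [D.g_du hu]
  have h2 : ∀ a, f (D.du u a) (bs a) = ∑ i, D.g u (D.du u a) (c i) • f (t i) (bs a) := fun a => by
    conv_lhs => rw [← h (D.du u a), hf.sum_left]
  simp only [h1, h2]
  rw [Finset.sum_comm]

theorem tr_swap {f : E → E → W} (hf : IsBilin f) (hu : u ∈ D.U) :
    ∑ a, f (bs a) (D.du u a) = ∑ a, f (D.du u a) (bs a) := by
  refine D.tr_eq hf (fun v => ?_) hu
  conv_rhs => rw [← sum_co v]
  simp only [D.g_symm u hu v, D.g_du hu]

/-- Moving an endomorphism from one argument of a trace to the other replaces it by its metric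
adjoint, here given through its values `s'` on the dual basis. -/
theorem tr_adj {f : E → E → W} (hf : IsBilin f) (hu : u ∈ D.U) {A : E → E} {s' : Idx E → E}
    (h : ∀ a z, D.g u (s' a) z = co a (A z)) :
    ∑ a, f (D.du u a) (A (bs a)) = ∑ a, f (s' a) (bs a) := by
  have h1 : ∀ a, f (D.du u a) (A (bs a)) = ∑ c, co c (A (bs a)) • f (D.du u a) (bs c) :=
    fun a => by
    conv_lhs => rw [← sum_co (A (bs a)), hf.sum_right]
  have h2 : ∀ c, f (s' c) (bs c) = ∑ a, co c (A (bs a)) • f (D.du u a) (bs c) := fun c => by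
    conv_lhs => rw [← D.sum_g_bs hu (s' c), hf.sum_left]
    simp only [h]
  simp only [h1, h2]
  rw [Finset.sum_comm]

theorem tr_skew {f : E → E → W} (hf : IsBilin f) (hu : u ∈ D.U) {A : E →L[ℝ] E}
    (h : ∀ v w, D.g u (A v) w = -D.g u v (A w)) :
    ∑ a, f (D.du u a) (A (bs a)) = -∑ a, f (A (D.du u a)) (bs a) := by
  rw [D.tr_adj hf hu (s' := fun a => -A (D.du u a)) fun a z => by
    rw [map_neg, neg_apply, h, neg_neg, D.g_du hu], ← Finset.sum_neg_distrib]
  simp only [hf.neg_left]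

theorem g_K_left (hu : u ∈ D.U) (v w : E) : D.g u (D.K u v) w = -D.g u v (D.K u w) := by
  rw [← D.g_K hu v (D.K u w), D.K_sq hu]; simp

/-- The covariant derivative of the dual basis. -/
def ndu (u v : E) (a : Idx E) : E := fderiv ℝ (fun u => D.du u a) u v + D.Gam u v (D.du u a)

/-- Differentiate g(bᵃ, z) = co_a(z), whose right-hand side does not depend on the point, and use ∇g
= 0. -/
theorem g_ndu (hu : u ∈ D.U) (v : E) (a : Idx E) (z : E) :
    D.g u (D.ndu u v a) z = -co a (D.Gam u v z) := by
  have hs : DifferentiableAt ℝ (fun u => D.du u a) u :=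
    ((D.du_smooth a).contDiffAt (D.isOpen.mem_nhds hu)).differentiableAt (by simp)
  have h := congrArg (fun k => k v) (D.fderiv_congr (fun u hu => D.g_du hu a z) hu)
  have h1 := fderiv_apply_const (L := fun u => D.g u (D.du u a)) ((D.g_diff hu).clm_apply hs) z v
  rw [fderiv_apply_fun (D.g_diff hu) hs] at h1
  simp only [h1, add_apply, D.dg_eq hu, D.g_du hu, fderiv_fun_const, Pi.zero_apply,
    zero_apply] at h
  rw [ndu, map_add, add_apply]
  linarith

/-- The metric trace is parallel: ∇bᵃ and Γ b_a are opposite under it. Whenever a trace is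
differentiated covariantly, this removes the terms that come from the frame. -/
theorem tr_cancel {f : E → E → W} (hf : IsBilin f) (hu : u ∈ D.U) (v : E) :
    ∑ a, (f (D.ndu u v a) (bs a) + f (D.du u a) (D.Gam u v (bs a))) = 0 := by
  rw [Finset.sum_add_distrib, D.tr_adj hf hu (s' := fun a => -D.ndu u v a) fun a z => by
    rw [map_neg, neg_apply, D.g_ndu hu, neg_neg], ← Finset.sum_add_distrib]
  simp [hf.neg_left]

/-- The trace of the connection form. -/
def trG (u v : E) : ℝ := ∑ a, co a (D.Gam u v (bs a))

/-- The divergence of the dual frame is minus the vector dual to tr Γ, by `g_ndu` and the symmetry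
of Γ. In `div_eq` this cancels the derivative of the volume density. -/
theorem sum_ndu (hu : u ∈ D.U) :
    ∑ a, D.ndu u (bs a) a + ∑ a, D.trG u (bs a) • D.du u a = 0 := by
  refine D.nondeg hu fun z => ?_
  simp only [map_add, map_sum, add_apply, sum_apply, D.g_ndu hu,
    map_zero, zero_apply, map_smul, smul_apply, D.g_du hu]
  have : ∀ c : Idx E, ∑ a, co c (D.Gam u (bs a) (bs c)) • co a z = co c (D.Gam u z (bs c)) :=
    fun c => by
    conv_rhs => rw [← sum_co z]
    simp [map_sum, mul_comm]
  simp only [trG, Finset.sum_smul]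
  rw [Finset.sum_comm]
  simp only [this, D.Gam_symm hu z]
  simp

end LocalHK

end Trace

/-! ### The Riemannian volume density and its derivative. -/

section Density

/-- Jacobi's formula. -/
theorem fderiv_det {X : Type*} [NormedAddCommGroup X] [NormedSpace ℝ X] {n : Type*} [Fintype n]
    [DecidableEq n] {G : X → n → n → ℝ} {u : X} (hG : DifferentiableAt ℝ G u) (v : X) :
    fderiv ℝ (fun u => Matrix.det (Matrix.of (G u))) u v
      = (Matrix.adjugate (Matrix.of (G u)) * Matrix.of (fderiv ℝ G u v)).trace := by
  let d : ContinuousMultilinearMap ℝ (fun _ : n => n → ℝ) ℝ :=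
    { (Matrix.detRowAlternating (n := n) (R := ℝ)).toMultilinearMap with
      cont := by
        change Continuous fun M : Matrix n n ℝ => M.det
        exact continuous_id.matrix_det }
  have h := ((d.hasFDerivAt (G u)).comp u hG.hasFDerivAt).fderiv
  have e : (d ∘ G) = fun u => Matrix.det (Matrix.of (G u)) := rfl
  rw [e] at h
  rw [h, ContinuousLinearMap.comp_apply, ContinuousMultilinearMap.linearDeriv_apply,
    Matrix.trace_mul_comm, Matrix.trace]
  refine Finset.sum_congr rfl fun i _ => ?_
  -- The determinant is linear in each row, and replacing a row is expressed by the adjugate through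
  -- Cramer's rule.
  have h2 := Matrix.cramer_transpose_apply (Matrix.of (G u)) (fderiv ℝ G u v i) i
  rw [Matrix.cramer_eq_adjugate_mulVec, ← Matrix.adjugate_transpose] at h2
  refine h2.symm.trans ?_
  simp [Matrix.mulVec, dotProduct, Matrix.mul_apply, mul_comm]

variable {E : Type*} [NormedAddCommGroup E] [NormedSpace ℝ E] [FiniteDimensional ℝ E]

namespace LocalHK

variable (D : LocalHK E) {u : E}

/-- The Gram matrix of the metric. -/
def gram (u : E) (a b : Idx E) : ℝ := D.g u (bs a) (bs b)

/-- The density of the Riemannian measure. -/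
def rho (u : E) : ℝ := Real.sqrt (Matrix.det (Matrix.of (D.gram u)))

theorem gram_smooth : ContDiffOn ℝ ∞ D.gram D.U := by
  rw [contDiffOn_pi]; intro a
  rw [contDiffOn_pi]; intro b
  exact (D.g_smooth.clm_apply contDiffOn_const).clm_apply contDiffOn_const

theorem det_pos (hu : u ∈ D.U) : 0 < Matrix.det (Matrix.of (D.gram u)) := by
  refine Matrix.PosDef.det_pos (Matrix.PosDef.of_dotProduct_mulVec_pos ?_ fun x hx => ?_)
  · ext a b
    simp [gram, D.g_symm u hu (bs b)]
  · have hne : ∑ a, x a • bs a ≠ (0 : E) := fun h0 => hx <| by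
      funext a
      have := congrArg (co a) h0
      simpa [map_sum, co_bs] using this
    have := D.g_pos u hu _ hne
    simp only [map_sum, map_smul, sum_apply, smul_apply] at this
    refine this.trans_eq ?_
    simp only [dotProduct, Matrix.mulVec, gram, Finset.mul_sum, Matrix.of_apply, smul_eq_mul,
      star_trivial]
    refine Finset.sum_comm.trans (Finset.sum_congr rfl fun a _ => Finset.sum_congr rfl fun b _ => ?_)
    ring

theorem rho_pos (hu : u ∈ D.U) : 0 < D.rho u := Real.sqrt_pos.2 (D.det_pos hu)

theorem det_smooth : ContDiffOn ℝ ∞ (fun u => Matrix.det (Matrix.of (D.gram u))) D.U := by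
  simp only [Matrix.det_apply]
  refine ContDiffOn.sum fun σ _ => ContDiffOn.const_smul _ (contDiffOn_prod fun i _ => ?_)
  exact contDiffOn_pi.1 (contDiffOn_pi.1 D.gram_smooth _) _

theorem rho_smooth : ContDiffOn ℝ ∞ D.rho D.U :=
  D.det_smooth.sqrt fun _ hu => (D.det_pos hu).ne'

/-- The equation ∇g = 0 in matrix form: dG = ΓᵗG + GΓ. -/
theorem fderiv_gram (hu : u ∈ D.U) (v : E) : Matrix.of (fderiv ℝ D.gram u v)
    = (LinearMap.toMatrix (Module.finBasis ℝ E) (Module.finBasis ℝ E)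
        (D.Gam u v).toLinearMap).transpose * Matrix.of (D.gram u)
      + Matrix.of (D.gram u) * LinearMap.toMatrix (Module.finBasis ℝ E) (Module.finBasis ℝ E)
        (D.Gam u v).toLinearMap := by
  have hd : DifferentiableAt ℝ D.gram u :=
    (D.gram_smooth.contDiffAt (D.isOpen.mem_nhds hu)).differentiableAt (by simp)
  ext a b
  have e : fderiv ℝ D.gram u v a b = fderiv ℝ D.g u v (bs a) (bs b) := by
    rw [← D.fderiv_g hu]
    have h1 := hasFDerivAt_pi'.1 hd.hasFDerivAt a
    have h2 := hasFDerivAt_pi'.1 h1 b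
    have h3 := h2.fderiv
    exact (congrArg (fun k => k v) h3).symm
  have h : ∀ w : E, D.Gam u v w = ∑ c, co c (D.Gam u v w) • bs c := fun w => (sum_co _).symm
  rw [Matrix.of_apply, e, D.dg_eq hu, h (bs a), h (bs b)]
  simp only [map_sum, sum_apply, map_smul, smul_apply, smul_eq_mul,
    Matrix.add_apply, Matrix.mul_apply, Matrix.transpose_apply, LinearMap.toMatrix_apply,
    Matrix.of_apply]
  congr 1
  exact Finset.sum_congr rfl fun c _ => mul_comm _ _

/-- By Jacobi's formula both terms of dG = ΓᵗG + GΓ contribute tr Γ to d log det G; the square root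
halves the result. -/
theorem fderiv_rho (hu : u ∈ D.U) (v : E) : fderiv ℝ D.rho u v = D.rho u * D.trG u v := by
  have hd : DifferentiableAt ℝ D.gram u :=
    (D.gram_smooth.contDiffAt (D.isOpen.mem_nhds hu)).differentiableAt (by simp)
  have hdd : DifferentiableAt ℝ (fun u => Matrix.det (Matrix.of (D.gram u))) u :=
    (D.det_smooth.contDiffAt (D.isOpen.mem_nhds hu)).differentiableAt (by simp)
  have hp := D.det_pos hu
  have h1 : fderiv ℝ (fun u => Matrix.det (Matrix.of (D.gram u))) u v
      = 2 * Matrix.det (Matrix.of (D.gram u)) * D.trG u v := by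
    rw [fderiv_det hd, D.fderiv_gram hu, Matrix.mul_add, Matrix.trace_add,
      Matrix.trace_mul_comm, Matrix.mul_assoc, Matrix.mul_adjugate, ← Matrix.mul_assoc,
      Matrix.adjugate_mul]
    have : (LinearMap.toMatrix (Module.finBasis ℝ E) (Module.finBasis ℝ E)
        (D.Gam u v).toLinearMap).trace = D.trG u v := by
      simp [Matrix.trace, LinearMap.toMatrix_apply, trG, co, bs]
    simp [this]
    ring
  unfold rho
  rw [(hdd.hasFDerivAt.sqrt hp.ne').fderiv, smul_apply, h1, smul_eq_mul]
  have := Real.mul_self_sqrt hp.le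
  have h3 := (Real.sqrt_pos.2 hp).ne'
  field_simp
  rw [sq, this]

end LocalHK

end Density

/-! ### The contraction dual to Ω̄ and the Hermitian product of forms. -/

section InnerProduct

variable {E F : Type*} [NormedAddCommGroup E] [NormedSpace ℝ E] [FiniteDimensional ℝ E]
  [NormedAddCommGroup F] [NormedSpace ℂ F]

theorem IsBilin.contr_contr {p : ℕ} (η : E [⋀^Fin (p + 2)]→L[ℝ] F) :
    IsBilin fun x y => (η.curryLeft x).curryLeft y := by
  constructor <;> intros <;> simp

theorem IsBilin.contr_form {p : ℕ} (ψ : E →L[ℝ] E [⋀^Fin (p + 1)]→L[ℝ] F) :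
    IsBilin fun x y => (ψ x).curryLeft y := by
  constructor <;> intros <;> simp

namespace LocalHK

variable (D : LocalHK E) {u : E} {p : ℕ}

/-- The operator `-¼ ∑ ι_{J b_a} ι_{b^a}`, adjoint to the multiplication by `Ω̄`. -/
def lam (F : Type*) [NormedAddCommGroup F] [NormedSpace ℂ F] (p : ℕ) (u : E) :
    (E [⋀^Fin (p + 2)]→L[ℝ] F) →L[ℝ] (E [⋀^Fin p]→L[ℝ] F) :=
  -((1 / 4 : ℝ) • ∑ a, contr p (D.J u (bs a)) ∘L contr (p + 1) (D.du u a))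

theorem lam_apply (η : E [⋀^Fin (p + 2)]→L[ℝ] F) : D.lam F p u η
    = -((1 / 4 : ℝ) • ∑ a, (η.curryLeft (D.du u a)).curryLeft (D.J u (bs a))) := by
  simp [lam, sum_apply]

theorem lam_csmul (c : ℂ) (η : E [⋀^Fin (p + 2)]→L[ℝ] F) :
    D.lam F p u (c • η) = c • D.lam F p u η := by
  rw [lam_apply, lam_apply, smul_neg, smul_comm c, Finset.smul_sum (r := c)]
  rfl

theorem lam_mem_zForms {η : E [⋀^Fin (p + 2)]→L[ℝ] F} (hη : η ∈ zForms F D.I (p + 2)) :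
    D.lam F p u η ∈ zForms F D.I p := by
  rw [lam_apply, ← Complex.coe_smul]
  exact neg_mem (Submodule.smul_mem _ _ (sum_mem fun a _ =>
    curryLeft_mem_zForms (curryLeft_mem_zForms hη _) _))

/-- The commutator of `lam` with an alternatization. -/
theorem lam_alt (hu : u ∈ D.U) (ψ : E →L[ℝ] E [⋀^Fin (p + 2)]→L[ℝ] F) :
    D.lam F (p + 1) u (alt _ ψ) = alt _ (D.lam F p u ∘L ψ)
      - (1 / 2 : ℝ) • ∑ a, (ψ (D.du u a)).curryLeft (D.J u (bs a)) := by
  have hf := IsBilin.contr_form ψ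
  -- Cartan's formula, applied twice, leaves two boundary terms, with the two contractions in
  -- opposite orders. J is skew, so their traces are opposite and they add up in the difference,
  -- turning 1/4 into 1/2.
  have h1 : ∑ a, (ψ (D.J u (bs a))).curryLeft (D.du u a)
      = -∑ a, (ψ (D.du u a)).curryLeft (D.J u (bs a)) := by
    have a1 := D.tr_swap (hf.comp (D.J u) (ContinuousLinearMap.id ℝ E)) hu
    have a2 := D.tr_skew hf hu (D.g_J_left hu)
    simp only [ContinuousLinearMap.id_apply] at a1
    rw [a1, a2, neg_neg]
  have h2 : D.lam F p u ∘L ψ = -((1 / 4 : ℝ) • ∑ a, contr p (D.J u (bs a)) ∘L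
      (contr (p + 1) (D.du u a) ∘L ψ)) := by
    ext1 v
    rw [ContinuousLinearMap.comp_apply, lam_apply]
    simp [sum_apply]
  have h3 : ∀ a, ((alt _ ψ).curryLeft (D.du u a)).curryLeft (D.J u (bs a))
      = (ψ (D.du u a)).curryLeft (D.J u (bs a)) - (ψ (D.J u (bs a))).curryLeft (D.du u a)
        + alt _ (contr p (D.J u (bs a)) ∘L (contr (p + 1) (D.du u a) ∘L ψ)) := fun a => by
    rw [curryLeft_alt]
    have e : ∀ x, ContinuousAlternatingMap.curryLeft x (D.J u (bs a))
      = contr (F := F) (p + 1) (D.J u (bs a)) x := fun _ => rfl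
    rw [e (_ - _), map_sub, contr_apply, contr_apply, curryLeft_alt]
    simp only [ContinuousLinearMap.comp_apply, contr_apply]
    abel
  rw [lam_apply]
  simp only [h3]
  rw [Finset.sum_add_distrib, Finset.sum_sub_distrib, h1, h2, alt_neg, alt_smul, map_sum]
  module

/-- The lowest degree of `lam_alt`: Λ vanishes on 1-forms, so the alternatized term is absent. -/
theorem lam_alt_zero (hu : u ∈ D.U) (ψ : E →L[ℝ] E [⋀^Fin 1]→L[ℝ] F) :
    D.lam F 0 u (alt _ ψ) = -(1 / 2 : ℝ) • ∑ a, (ψ (D.du u a)).curryLeft (D.J u (bs a)) := by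
  have hf := IsBilin.contr_form ψ
  have h1 : ∑ a, (ψ (D.J u (bs a))).curryLeft (D.du u a)
      = -∑ a, (ψ (D.du u a)).curryLeft (D.J u (bs a)) := by
    have a1 := D.tr_swap (hf.comp (D.J u) (ContinuousLinearMap.id ℝ E)) hu
    have a2 := D.tr_skew hf hu (D.g_J_left hu)
    simp only [ContinuousLinearMap.id_apply] at a1
    rw [a1, a2, neg_neg]
  have h3 : ∀ a, ((alt _ ψ).curryLeft (D.du u a)).curryLeft (D.J u (bs a))
      = (ψ (D.du u a)).curryLeft (D.J u (bs a))
        - (ψ (D.J u (bs a))).curryLeft (D.du u a) := fun a => by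
    rw [curryLeft_alt]
    have e : ∀ x, ContinuousAlternatingMap.curryLeft x (D.J u (bs a))
      = contr (F := F) 0 (D.J u (bs a)) x := fun _ => rfl
    rw [e (_ - _), map_sub, contr_apply, contr_apply, curryLeft_alt_zero]
    simp only [ContinuousLinearMap.comp_apply, contr_apply]
  rw [lam_apply]
  simp only [h3]
  rw [Finset.sum_sub_distrib, h1]
  module

end LocalHK

namespace LocalBundle

variable {D : LocalHK E} (B : LocalBundle D F) {u : E} {p : ℕ}

/-- The value of a `0`-form. -/
def _root_.QuatDolbeault.ev0 (F : Type*) [NormedAddCommGroup F] [NormedSpace ℂ F] :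
    (E [⋀^Fin 0]→L[ℝ] F) →L[ℝ] F :=
  (ContinuousAlternatingMap.constOfIsEmptyLIE ℝ E F
    (Fin 0)).symm.toContinuousLinearEquiv.toContinuousLinearMap

/-- The Hermitian product on forms. -/
def ip : ∀ p : ℕ, E → (E [⋀^Fin p]→L[ℝ] F) →L[ℝ] (E [⋀^Fin p]→L[ℝ] F) →L[ℝ] ℂ
  | 0, u => (B.H u).bilinearComp (ev0 F) (ev0 F)
  | p + 1, u => (1 / (2 * (p + 1)) : ℝ) • ∑ a, (ip p u).bilinearComp
      (contr p (D.du u a)) (contr p (bs a))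

theorem ip_zero (α β : E [⋀^Fin 0]→L[ℝ] F) : B.ip 0 u α β = B.H u (α 0) (β 0) := rfl

/-- The 2 compensates for the real frame, which counts every complex direction twice on forms of
type (0,p+1). The p + 1 compensates for singling out one of the p + 1 slots. -/
theorem ip_succ (α β : E [⋀^Fin (p + 1)]→L[ℝ] F) : B.ip (p + 1) u α β
    = (1 / (2 * (p + 1)) : ℝ) • ∑ a, B.ip p u (α.curryLeft (D.du u a)) (β.curryLeft (bs a)) := by
  simp [ip, sum_apply]

theorem ip_csmul_right (hu : u ∈ D.U) (c : ℂ) (α β : E [⋀^Fin p]→L[ℝ] F) :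
    B.ip p u α (c • β) = c * B.ip p u α β := by
  induction p with
  | zero => exact B.H_smul u hu _ _ _
  | succ p ih =>
    rw [ip_succ, ip_succ, mul_smul_comm, Finset.mul_sum]
    simp only [← ih]
    rfl

theorem ip_csmul_left (hu : u ∈ D.U) (c : ℂ) (α β : E [⋀^Fin p]→L[ℝ] F) :
    B.ip p u (c • α) β = star c * B.ip p u α β := by
  induction p with
  | zero => exact B.H_smul_left hu _ _ _
  | succ p ih =>
    rw [ip_succ, ip_succ, mul_smul_comm, Finset.mul_sum]
    simp only [← ih]
    rfl

theorem IsBilin_ip (α β : E [⋀^Fin (p + 1)]→L[ℝ] F) :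
    IsBilin fun x y => B.ip p u (α.curryLeft x) (β.curryLeft y) := by
  constructor <;> intros <;> simp

theorem IsBilin_ip_form (ψ : E →L[ℝ] E [⋀^Fin p]→L[ℝ] F) (β : E [⋀^Fin (p + 1)]→L[ℝ] F) :
    IsBilin fun x y => B.ip p u (ψ x) (β.curryLeft y) := by
  constructor <;> intros <;> simp

theorem ip_eq_of_dual (hu : u ∈ D.U) {ι : Type*} [Fintype ι] {t c : ι → E}
    (h : ∀ v, ∑ i, D.g u v (c i) • t i = v) (α β : E [⋀^Fin (p + 1)]→L[ℝ] F) :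
    B.ip (p + 1) u α β
      = (1 / (2 * (p + 1)) : ℝ) • ∑ i, B.ip p u (α.curryLeft (t i)) (β.curryLeft (c i)) := by
  rw [ip_succ, D.tr_eq (B.IsBilin_ip α β) h hu]

theorem ip_symm (hu : u ∈ D.U) (α β : E [⋀^Fin p]→L[ℝ] F) :
    B.ip p u α β = star (B.ip p u β α) := by
  induction p with
  | zero => exact B.H_symm u hu _ _
  | succ p ih =>
    rw [ip_succ, ip_succ, ← D.tr_swap (B.IsBilin_ip α β) hu, star_smul, star_sum, star_trivial]
    simp only [← ih]

/-- Exterior multiplication is adjoint to contraction. In the inductive step Cartan's formula splits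
off one term equal to the claimed sum, and the other is p + 1 times it after exchanging two
contractions; the total p + 2 cancels the normalization. -/
theorem ip_alt (ψ : E →L[ℝ] E [⋀^Fin p]→L[ℝ] F) (β : E [⋀^Fin (p + 1)]→L[ℝ] F) :
    B.ip (p + 1) u (alt _ ψ) β
      = (1 / 2 : ℝ) • ∑ a, B.ip p u (ψ (D.du u a)) (β.curryLeft (bs a)) := by
  induction p with
  | zero =>
    rw [ip_succ]
    simp [curryLeft_alt_zero]
  | succ p ih =>
    rw [ip_succ]
    have h1 : ∀ a, B.ip (p + 1) u ((alt _ ψ).curryLeft (D.du u a)) (β.curryLeft (bs a))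
        = B.ip (p + 1) u (ψ (D.du u a)) (β.curryLeft (bs a))
          + (1 / 2 : ℝ) • ∑ c, B.ip p u ((ψ (D.du u c)).curryLeft (D.du u a))
              ((β.curryLeft (bs c)).curryLeft (bs a)) := fun a => by
      rw [curryLeft_alt, map_sub, sub_apply, ih, sub_eq_add_neg, ← smul_neg,
        ← Finset.sum_neg_distrib]
      congr 2
      refine Finset.sum_congr rfl fun c _ => ?_
      rw [curryLeft_curryLeft_comm β, map_neg, neg_neg]
      rfl
    have h2 : ∀ c, ∑ a, B.ip p u ((ψ (D.du u c)).curryLeft (D.du u a))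
              ((β.curryLeft (bs c)).curryLeft (bs a))
        = (2 * (p + 1) : ℝ) • B.ip (p + 1) u (ψ (D.du u c)) (β.curryLeft (bs c)) := fun c => by
      rw [ip_succ, smul_smul, mul_one_div_cancel (by positivity), one_smul]
    simp only [h1]
    rw [Finset.sum_add_distrib, ← Finset.smul_sum, Finset.sum_comm]
    simp only [h2]
    rw [← Finset.smul_sum, smul_smul]
    nth_rw 1 [← one_smul ℝ (∑ a, B.ip (p + 1) u (ψ (D.du u a)) (β.curryLeft (bs a)))]
    rw [← add_smul, smul_smul]
    congr 1
    push_cast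
    field_simp
    ring

/-- An orthogonal basis of the tangent space. -/
theorem _root_.QuatDolbeault.LocalHK.exists_dual (D : LocalHK E) (hu : u ∈ D.U) :
    ∃ (c : Module.Basis (Idx E) ℝ E) (r : Idx E → ℝ), (∀ i, 0 < r i) ∧
      ∀ v, ∑ i, D.g u v (c i) • (r i • c i) = v := by
  let b : LinearMap.BilinForm ℝ E := LinearMap.mk₂ ℝ (fun v w => D.g u v w) (by simp) (by simp)
    (by simp) (by simp)
  have hb : LinearMap.IsSymm b := ⟨fun v w => D.g_symm u hu v w⟩
  obtain ⟨c, hc⟩ := LinearMap.BilinForm.exists_orthogonal_basis (B := b) hb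
  have hc0 : ∀ i j, i ≠ j → D.g u (c i) (c j) = 0 := fun i j hij => hc hij
  refine ⟨c, fun i => (D.g u (c i) (c i))⁻¹,
    fun i => inv_pos.2 (D.g_pos u hu _ (c.ne_zero i)), fun v => ?_⟩
  have h1 : ∀ i, D.g u v (c i) = c.repr v i * D.g u (c i) (c i) := fun i => by
    conv_lhs => rw [← c.sum_repr v]
    rw [map_sum, sum_apply, Finset.sum_eq_single i]
    · simp
    · intro j _ hj
      simp [hc0 j i hj]
    · simp
  conv_rhs => rw [← c.sum_repr v]
  refine Finset.sum_congr rfl fun i _ => ?_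
  rw [h1, smul_smul, mul_assoc, mul_inv_cancel₀ (D.g_pos u hu _ (c.ne_zero i)).ne', mul_one]

/-- In a g-orthogonal basis the dual frame is a positive rescaling of the basis, so the product is a
positive combination of squares of contractions, and contractions detect the form. -/
theorem ip_nonneg_pos (hu : u ∈ D.U) (α : E [⋀^Fin p]→L[ℝ] F) :
    0 ≤ (B.ip p u α α).re ∧ ((B.ip p u α α).re = 0 → α = 0) := by
  induction p with
  | zero =>
    rw [ip_zero]
    by_cases h : α 0 = 0
    · refine ⟨by rw [h, map_zero]; simp, fun _ => ?_⟩
      ext v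
      rw [Subsingleton.elim v 0, h]; rfl
    · have := B.H_pos u hu _ h
      exact ⟨this.le, fun h0 => absurd h0 this.ne'⟩
  | succ p ih =>
    obtain ⟨c, r, hr, hc⟩ := D.exists_dual hu
    rw [B.ip_eq_of_dual hu hc]
    have h1 : ∀ i, B.ip p u (α.curryLeft (r i • c i)) (α.curryLeft (c i))
      = r i • B.ip p u (α.curryLeft (c i)) (α.curryLeft (c i)) := fun i => by simp
    simp only [h1, Complex.smul_re, Complex.re_sum, smul_eq_mul]
    have hp : (0 : ℝ) < 1 / (2 * (p + 1)) := by positivity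
    have h2 : ∀ i ∈ Finset.univ, 0 ≤ r i * (B.ip p u (α.curryLeft (c i)) (α.curryLeft (c i))).re :=
      fun i _ => mul_nonneg (hr i).le (ih _).1
    refine ⟨mul_nonneg hp.le (Finset.sum_nonneg h2), fun h => ?_⟩
    rw [mul_eq_zero, or_iff_right hp.ne', Finset.sum_eq_zero_iff_of_nonneg h2] at h
    have h3 : ∀ i, α.curryLeft (c i) = 0 := fun i => by
      have := h i (Finset.mem_univ i)
      rw [mul_eq_zero, or_iff_right (hr i).ne'] at this
      exact (ih _).2 this
    refine form_ext fun v => ?_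
    rw [← c.sum_repr v, map_sum, map_sum]
    simp only [map_smul, h3]
    simp

theorem ip_self_ofReal (hu : u ∈ D.U) (α : E [⋀^Fin p]→L[ℝ] F) :
    B.ip p u α α = ((B.ip p u α α).re : ℂ) :=
  (Complex.conj_eq_iff_re.1 (B.ip_symm hu α α).symm).symm

end LocalBundle

end InnerProduct

/-! ### Formal adjoints in a chart and the Kähler-type identities. -/

section LocalAdjoints

variable {E F : Type*} [NormedAddCommGroup E] [NormedSpace ℝ E] [FiniteDimensional ℝ E]
  [NormedAddCommGroup F] [NormedSpace ℂ F]

theorem curryLeft_smooth {p : ℕ} {U : Set E} {η : E → E [⋀^Fin (p + 1)]→L[ℝ] F} {X : E → E}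
    (hη : ContDiffOn ℝ ∞ η U) (hX : ContDiffOn ℝ ∞ X U) :
    ContDiffOn ℝ ∞ (fun u => (η u).curryLeft (X u)) U :=
  ((ContinuousAlternatingMap.curryLeftLI (𝕜 := ℝ) (E := E) (F := F)
      (n := p)).toContinuousLinearMap.contDiff.comp_contDiffOn hη).clm_apply hX

namespace LocalBundle

variable {D : LocalHK E} {B : LocalBundle D F} {u : E} {p : ℕ}

/-- Leibniz rule for ι_X η; the last argument is the covariant derivative of X. -/
theorem nab_curryLeft {η : E → E [⋀^Fin (p + 1)]→L[ℝ] F} {X : E → E}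
    (hη : ContDiffOn ℝ ∞ η D.U) (hX : ContDiffOn ℝ ∞ X D.U) (hu : u ∈ D.U) (v : E) :
    B.nab p (fun u => (η u).curryLeft (X u)) u v = (B.nab (p + 1) η u v).curryLeft (X u)
      + (η u).curryLeft (fderiv ℝ X u v + D.Gam u v (X u)) := by
  have hd := LocalHK.diff hη hu
  let T := (ContinuousAlternatingMap.curryLeftLI (𝕜 := ℝ) (E := E) (F := F)
      (n := p)).toContinuousLinearMap
  have hT : DifferentiableAt ℝ (fun u => T (η u)) u := T.differentiableAt.comp u hd
  have h1 : fderiv ℝ (fun u => (η u).curryLeft (X u)) u v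
      = (fderiv ℝ η u v).curryLeft (X u) + (η u).curryLeft (fderiv ℝ X u v) := by
    have := fderiv_apply_fun hT (LocalHK.diff hX hu) v
    rw [fderiv_clm_left T hd] at this
    exact this
  rw [nab_apply, nab_apply, h1, conn_apply, conn_apply, map_add]
  have h2 : ∀ α β : E [⋀^Fin (p + 1)]→L[ℝ] F, (α - β).curryLeft (X u)
      = α.curryLeft (X u) - β.curryLeft (X u) := fun α β => rfl
  rw [ContinuousAlternatingMap.curryLeft_add, add_apply, h2, curryLeft_der]
  have h3 : ((B.θ u v).compContinuousAlternatingMap (η u)).curryLeft (X u)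
    = (B.θ u v).compContinuousAlternatingMap ((η u).curryLeft (X u)) := rfl
  rw [h3]
  abel

theorem nab_sum {ι : Type*} (s : Finset ι) {η : ι → E → E [⋀^Fin p]→L[ℝ] F}
    (hη : ∀ i, ContDiffOn ℝ ∞ (η i) D.U) (hu : u ∈ D.U) (v : E) :
    B.nab p (fun u => ∑ i ∈ s, η i u) u v = ∑ i ∈ s, B.nab p (η i) u v := by
  simp only [nab_apply]
  rw [fderiv_fun_sum fun i _ => LocalHK.diff (hη i) hu, map_sum, sum_apply,
    Finset.sum_add_distrib]

theorem nab_rsmul {η : E → E [⋀^Fin p]→L[ℝ] F} (hη : ContDiffOn ℝ ∞ η D.U) (hu : u ∈ D.U) (r : ℝ)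
    (v : E) : B.nab p (fun u => r • η u) u v = r • B.nab p η u v := by
  rw [nab_apply, nab_apply, fderiv_fun_const_smul (LocalHK.diff hη hu), map_smul, smul_add]
  rfl

theorem nab_du {η : E → E [⋀^Fin (p + 1)]→L[ℝ] F} (hη : ContDiffOn ℝ ∞ η D.U) (hu : u ∈ D.U)
    (v : E) (a : Idx E) : B.nab p (fun u => (η u).curryLeft (D.du u a)) u v
      = (B.nab (p + 1) η u v).curryLeft (D.du u a) + (η u).curryLeft (D.ndu u v a) :=
  nab_curryLeft hη (D.du_smooth a) hu v

theorem nab_par {A : E → E →L[ℝ] E} (hA : D.Par A) {η : E → E [⋀^Fin (p + 1)]→L[ℝ] F}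
    (hη : ContDiffOn ℝ ∞ η D.U) (hu : u ∈ D.U) (v w : E) :
    B.nab p (fun u => (η u).curryLeft (A u w)) u v
      = (B.nab (p + 1) η u v).curryLeft (A u w) + (η u).curryLeft (A u (D.Gam u v w)) := by
  rw [nab_curryLeft hη (hA.smooth.clm_apply contDiffOn_const) hu, fderiv_apply_const (hA.diff hu),
    hA.par u hu]
  congr 2
  abel

theorem nab_bs {η : E → E [⋀^Fin (p + 1)]→L[ℝ] F} (hη : ContDiffOn ℝ ∞ η D.U) (hu : u ∈ D.U)
    (v w : E) : B.nab p (fun u => (η u).curryLeft w) u v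
      = (B.nab (p + 1) η u v).curryLeft w + (η u).curryLeft (D.Gam u v w) :=
  nab_par D.par_id hη hu v w

theorem lam_smooth {η : E → E [⋀^Fin (p + 2)]→L[ℝ] F} (hη : ContDiffOn ℝ ∞ η D.U) :
    ContDiffOn ℝ ∞ (fun u => D.lam F p u (η u)) D.U := by
  simp only [D.lam_apply]
  exact (ContDiffOn.const_smul _ (ContDiffOn.sum fun a _ => curryLeft_smooth
    (curryLeft_smooth hη (D.du_smooth a)) (D.J_smooth.clm_apply contDiffOn_const))).neg

/-- The operator `lam` is parallel. -/
theorem nab_lam {η : E → E [⋀^Fin (p + 2)]→L[ℝ] F} (hη : ContDiffOn ℝ ∞ η D.U) (hu : u ∈ D.U) :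
    B.nab p (fun u => D.lam F p u (η u)) u = D.lam F p u ∘L B.nab (p + 2) η u := by
  ext1 v
  rw [ContinuousLinearMap.comp_apply, D.lam_apply]
  have e : (fun u => D.lam F p u (η u)) = fun u => (-(1 / 4) : ℝ) •
      ∑ a, ((η u).curryLeft (D.du u a)).curryLeft (D.J u (bs a)) := by
    funext u
    rw [D.lam_apply, neg_smul]
  have s1 : ∀ a, ContDiffOn ℝ ∞ (fun u => (η u).curryLeft (D.du u a)) D.U := fun a =>
    curryLeft_smooth hη (D.du_smooth a)
  have s2 : ∀ a, ContDiffOn ℝ ∞ (fun u => ((η u).curryLeft (D.du u a)).curryLeft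
      (D.J u (bs a))) D.U := fun a =>
    curryLeft_smooth (s1 a) (D.J_smooth.clm_apply contDiffOn_const)
  have hf := (IsBilin.contr_contr (η u)).comp (ContinuousLinearMap.id ℝ E) (D.J u)
  -- J is parallel, so the derivative acts on the frame and on η only, and the frame terms cancel in
  -- the trace.
  have hc := D.tr_cancel hf hu v
  rw [e, nab_rsmul (ContDiffOn.sum fun a _ => s2 a) hu, nab_sum _ s2 hu, neg_smul]
  congr 2
  rw [← sub_eq_zero, ← Finset.sum_sub_distrib, ← hc]
  refine Finset.sum_congr rfl fun a _ => ?_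
  rw [nab_par D.par_J (s1 a) hu, nab_du hη hu, ContinuousAlternatingMap.curryLeft_add, add_apply]
  simp only [ContinuousLinearMap.id_apply]
  abel

variable (B)

theorem ip_smooth {α β : E → E [⋀^Fin p]→L[ℝ] F} (hα : ContDiffOn ℝ ∞ α D.U)
    (hβ : ContDiffOn ℝ ∞ β D.U) : ContDiffOn ℝ ∞ (fun u => B.ip p u (α u) (β u)) D.U := by
  induction p with
  | zero =>
    simp only [ip_zero]
    have h : ∀ {α : E → E [⋀^Fin 0]→L[ℝ] F}, ContDiffOn ℝ ∞ α D.U →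
        ContDiffOn ℝ ∞ (fun u => α u 0) D.U := fun hα =>
      (ContinuousLinearMap.contDiff (ev0 (E := E) F)).comp_contDiffOn hα
    exact (B.H_smooth.clm_apply (h hα)).clm_apply (h hβ)
  | succ p ih =>
    simp only [ip_succ]
    exact ContDiffOn.const_smul _ (ContDiffOn.sum fun a _ =>
      ih (curryLeft_smooth hα (D.du_smooth a)) (curryLeft_smooth hβ contDiffOn_const))

/-- The Hermitian product is parallel. -/
theorem fderiv_ip {α β : E → E [⋀^Fin p]→L[ℝ] F} (hα : ContDiffOn ℝ ∞ α D.U)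
    (hβ : ContDiffOn ℝ ∞ β D.U) (hu : u ∈ D.U) (v : E) :
    fderiv ℝ (fun u => B.ip p u (α u) (β u)) u v
      = B.ip p u (B.nab p α u v) (β u) + B.ip p u (α u) (B.nab p β u v) := by
  induction p with
  | zero =>
    simp only [ip_zero]
    have hd : ∀ {α : E → E [⋀^Fin 0]→L[ℝ] F}, ContDiffOn ℝ ∞ α D.U →
        DifferentiableAt ℝ (fun u => α u 0) u := fun hα =>
      (ContinuousLinearMap.differentiableAt (ev0 (E := E) F)).comp u (LocalHK.diff hα hu)
    have h1 : ∀ {α : E → E [⋀^Fin 0]→L[ℝ] F}, ContDiffOn ℝ ∞ α D.U →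
        B.nab 0 α u v 0 = fderiv ℝ (fun u => α u 0) u v + B.θ u v (α u 0) := fun {α} hα => by
      have e := fderiv_clm_left (ev0 (E := E) F) (LocalHK.diff hα hu) v
      rw [nab_apply, conn_apply, der_zero_form, sub_zero]
      exact congrArg (· + B.θ u v (α u 0)) e.symm
    have e1 := fderiv_apply_fun ((B.H_diff hu).clm_apply (hd hα)) (hd hβ) v
    have e2 := fderiv_apply_fun (B.H_diff hu) (hd hα) v
    rw [e1, e2, add_apply, B.dH_eq hu, h1 hα, h1 hβ]
    simp only [map_add, add_apply]
    ring
  | succ p ih =>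
    simp only [ip_succ]
    have s1 : ∀ a, ContDiffOn ℝ ∞ (fun u => (α u).curryLeft (D.du u a)) D.U := fun a =>
      curryLeft_smooth hα (D.du_smooth a)
    have s2 : ∀ a, ContDiffOn ℝ ∞ (fun u => (β u).curryLeft (bs a)) D.U := fun a =>
      curryLeft_smooth hβ contDiffOn_const
    have hd : ∀ a, DifferentiableAt ℝ (fun u => B.ip p u ((α u).curryLeft (D.du u a))
      ((β u).curryLeft (bs a))) u := fun a => LocalHK.diff (B.ip_smooth (s1 a) (s2 a)) hu
    rw [fderiv_fun_const_smul (DifferentiableAt.fun_sum fun a _ => hd a),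
      fderiv_fun_sum fun a _ => hd a, smul_apply, sum_apply, ← smul_add,
      ← Finset.sum_add_distrib]
    congr 1
    -- By induction the product of the contracted forms is parallel; the extra terms from
    -- differentiating the dual frame are those of `tr_cancel`.
    rw [← sub_eq_zero, ← Finset.sum_sub_distrib,
      ← D.tr_cancel (B.IsBilin_ip (α u) (β u)) hu v]
    refine Finset.sum_congr rfl fun a _ => ?_
    rw [ih (s1 a) (s2 a), nab_du hα hu, nab_bs hβ hu]
    simp only [map_add, add_apply]
    abel

/-- The formal adjoint of `dbarL`. -/
def qL (p : ℕ) (η : E → E [⋀^Fin (p + 1)]→L[ℝ] F) (u : E) : E [⋀^Fin p]→L[ℝ] F :=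
  -((1 / 2 : ℝ) • ∑ a, (B.nab (p + 1) η u (D.du u a)).curryLeft (bs a))

/-- The formal adjoint of `dbarJL`. -/
def qJL (p : ℕ) (η : E → E [⋀^Fin (p + 1)]→L[ℝ] F) (u : E) : E [⋀^Fin p]→L[ℝ] F :=
  -((1 / 2 : ℝ) • ∑ a, (B.nab (p + 1) η u (D.du u a)).curryLeft (D.J u (bs a)))

variable {B}

section

variable {η : E → E [⋀^Fin (p + 1)]→L[ℝ] F} (hη : ContDiffOn ℝ ∞ η D.U)
  (hZ : ∀ u ∈ D.U, η u ∈ zForms F D.I (p + 1)) (hu : u ∈ D.U)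
include hη hZ hu

/-- I is skew in the trace, and contraction with I x is -i times contraction with x on type (0,p).
Hence the ∇_I-half of the symbol contributes the same as the ∇-half. -/
theorem sum_psiL : (1 / 2 : ℝ) • ∑ a, (B.psiL (p + 1) η u (D.du u a)).curryLeft (D.J u (bs a))
    = -B.qJL p η u := by
  have hf := (IsBilin.contr_form (B.nab (p + 1) η u)).comp (ContinuousLinearMap.id ℝ E) (D.J u)
  have h1 := D.tr_skew hf hu (D.g_I_left hu)
  have h2 : ∀ a, (B.nab (p + 1) η u (D.du u a)).curryLeft (D.J u (D.I (bs a)))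
      = Complex.I • (B.nab (p + 1) η u (D.du u a)).curryLeft (D.J u (bs a)) := fun a => by
    rw [D.J_I u hu, map_neg, mem_zForms_succ.1 (nab_mem_zForms hη hZ hu (D.du u a)), neg_neg]
  simp only [ContinuousLinearMap.id_apply, h2, ← Finset.smul_sum] at h1
  rw [eq_neg_iff_add_eq_zero, add_comm, ← eq_neg_iff_add_eq_zero] at h1
  have h3 : ∀ a, (B.psiL (p + 1) η u (D.du u a)).curryLeft (D.J u (bs a))
      = (1 / 2 : ℂ) • ((B.nab (p + 1) η u (D.du u a)).curryLeft (D.J u (bs a))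
        + Complex.I • (B.nab (p + 1) η u (D.I (D.du u a))).curryLeft (D.J u (bs a))) :=
    fun a => rfl
  simp only [h3]
  rw [← Finset.smul_sum, Finset.sum_add_distrib, ← Finset.smul_sum, h1, smul_neg, smul_smul,
    Complex.I_mul_I, qJL, neg_neg, neg_smul, one_smul, neg_neg, ← two_smul ℂ, smul_smul]
  norm_num

/-- As for `sum_psiL`: moving K and J to the other side of the trace gives JK = I and J² = -1, and
the two halves agree on forms of type (0,p). -/
theorem sum_psiJL : (1 / 2 : ℝ) • ∑ a, (B.psiJL (p + 1) η u (D.du u a)).curryLeft (D.J u (bs a))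
    = B.qL p η u := by
  have hf := (IsBilin.contr_form (B.nab (p + 1) η u)).comp (ContinuousLinearMap.id ℝ E) (D.J u)
  have h1 := D.tr_skew hf hu (D.g_K_left hu)
  have h1' := D.tr_skew hf hu (D.g_J_left hu)
  have h2 : ∀ a, (B.nab (p + 1) η u (D.du u a)).curryLeft (D.J u (D.K u (bs a)))
      = -(Complex.I • (B.nab (p + 1) η u (D.du u a)).curryLeft (bs a)) := fun a => by
    rw [D.K_apply, D.J_I u hu, D.J_sq u hu, map_neg, map_neg, map_neg, neg_neg,
      mem_zForms_succ.1 (nab_mem_zForms hη hZ hu (D.du u a))]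
  have h2' : ∀ a, (B.nab (p + 1) η u (D.du u a)).curryLeft (D.J u (D.J u (bs a)))
      = -(B.nab (p + 1) η u (D.du u a)).curryLeft (bs a) := fun a => by
    rw [D.J_sq u hu, map_neg]
  simp only [ContinuousLinearMap.id_apply, h2, h2', ← Finset.smul_sum,
    Finset.sum_neg_distrib, neg_inj] at h1 h1'
  have h3 : ∀ a, (B.psiJL (p + 1) η u (D.du u a)).curryLeft (D.J u (bs a))
      = (1 / 2 : ℂ) • (Complex.I • (B.nab (p + 1) η u (D.K u (D.du u a))).curryLeft (D.J u (bs a))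
        - (B.nab (p + 1) η u (D.J u (D.du u a))).curryLeft (D.J u (bs a))) :=
    fun a => rfl
  simp only [h3]
  rw [← Finset.smul_sum, Finset.sum_sub_distrib, ← Finset.smul_sum, ← h1, ← h1', smul_smul,
    Complex.I_mul_I, qL, neg_smul, one_smul, ← neg_add', ← two_smul ℂ, smul_neg, smul_neg,
    smul_smul]
  norm_num

end

section

variable {η : E → E [⋀^Fin (p + 2)]→L[ℝ] F} (hη : ContDiffOn ℝ ∞ η D.U)
  (hZ : ∀ u ∈ D.U, η u ∈ zForms F D.I (p + 2)) (hu : u ∈ D.U)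
include hη hZ hu

/-- The identity ∂̄* = -[Λ, ∂̄_J]. Since Λ is parallel, it commutes with the symbol, and the whole
commutator is the boundary term of `lam_alt`, evaluated by `sum_psiJL`. -/
theorem qL_eq : B.qL (p + 1) η u = -D.lam F (p + 1) u (B.dbarJL (p + 2) η u)
    + B.dbarJL p (fun u => D.lam F p u (η u)) u := by
  have h : B.psiJL p (fun u => D.lam F p u (η u)) u = D.lam F p u ∘L B.psiJL (p + 2) η u := by
    ext1 v
    rw [psiJL_apply, nab_lam hη hu]
    simp only [ContinuousLinearMap.comp_apply, psiJL_apply, D.lam_csmul, map_sub]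
  rw [dbarJL_eq_alt, dbarJL_eq_alt, h, D.lam_alt hu, sum_psiJL hη hZ hu]
  abel

/-- The companion identity ∂̄_J* = [Λ, ∂̄], from `sum_psiL`; the opposite sign comes from there. -/
theorem qJL_eq : B.qJL (p + 1) η u = D.lam F (p + 1) u (B.dbarL (p + 2) η u)
    - B.dbarL p (fun u => D.lam F p u (η u)) u := by
  have h : B.psiL p (fun u => D.lam F p u (η u)) u = D.lam F p u ∘L B.psiL (p + 2) η u := by
    ext1 v
    rw [psiL_apply, nab_lam hη hu]
    simp only [ContinuousLinearMap.comp_apply, psiL_apply, D.lam_csmul, map_add]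
  rw [dbarL_eq_alt, dbarL_eq_alt, h, D.lam_alt hu, sum_psiL hη hZ hu]
  abel

end

theorem qL_zero_eq {η : E → E [⋀^Fin 1]→L[ℝ] F} (hη : ContDiffOn ℝ ∞ η D.U)
    (hZ : ∀ u ∈ D.U, η u ∈ zForms F D.I 1) (hu : u ∈ D.U) :
    B.qL 0 η u = -D.lam F 0 u (B.dbarJL 1 η u) := by
  rw [dbarJL_eq_alt, D.lam_alt_zero hu, neg_smul, sum_psiJL hη hZ hu, neg_neg]

theorem qJL_zero_eq {η : E → E [⋀^Fin 1]→L[ℝ] F} (hη : ContDiffOn ℝ ∞ η D.U)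
    (hZ : ∀ u ∈ D.U, η u ∈ zForms F D.I 1) (hu : u ∈ D.U) :
    B.qJL 0 η u = D.lam F 0 u (B.dbarL 1 η u) := by
  rw [dbarL_eq_alt, D.lam_alt_zero hu, neg_smul, sum_psiL hη hZ hu, neg_neg]

section

variable {α : E → E [⋀^Fin p]→L[ℝ] F} {β : E [⋀^Fin (p + 1)]→L[ℝ] F} (hu : u ∈ D.U)
  (hβ : β ∈ zForms F D.I (p + 1))
include hu hβ

/-- Pairing with a form of type (0,p+1) ignores the (1,0)-part of ∇α, so the projection onto the
(0,1)-part can be dropped. -/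
theorem ip_dbarL : B.ip (p + 1) u (B.dbarL p α u) β
    = (1 / 2 : ℝ) • ∑ a, B.ip p u (B.nab p α u (D.du u a)) (β.curryLeft (bs a)) := by
  have h1 := D.tr_skew (B.IsBilin_ip_form (u := u) (B.nab p α u) β) hu (D.g_I_left hu)
  simp only [mem_zForms_succ.1 hβ, map_neg, B.ip_csmul_right hu, Finset.sum_neg_distrib,
    ← Finset.mul_sum, neg_inj] at h1
  rw [dbarL_eq_alt, ip_alt]
  simp only [psiL_apply, B.ip_csmul_left hu, map_add, add_apply, ← Finset.mul_sum,
    Finset.sum_add_distrib]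
  rw [← h1]
  congr 1
  simp only [← mul_assoc]
  simp
  ring

/-- The same principle, with the endomorphisms in the symbol of ∂̄_J moved by skewness to the
contraction of β. -/
theorem ip_dbarJL : B.ip (p + 1) u (B.dbarJL p α u) β
    = (1 / 2 : ℝ) • ∑ a, B.ip p u (B.nab p α u (D.du u a)) (β.curryLeft (D.J u (bs a))) := by
  have h1 := D.tr_skew (B.IsBilin_ip_form (u := u) (B.nab p α u) β) hu (D.g_K_left hu)
  have h2 := D.tr_skew (B.IsBilin_ip_form (u := u) (B.nab p α u) β) hu (D.g_J_left hu)
  simp only [D.K_apply, mem_zForms_succ.1 hβ, map_neg, B.ip_csmul_right hu, Finset.sum_neg_distrib,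
    ← Finset.mul_sum, neg_inj] at h1
  rw [eq_neg_iff_add_eq_zero, add_comm, ← eq_neg_iff_add_eq_zero] at h2
  rw [dbarJL_eq_alt, ip_alt]
  simp only [psiJL_apply, B.ip_csmul_left hu, map_sub, sub_apply, ← Finset.mul_sum,
    Finset.sum_sub_distrib, D.K_apply]
  rw [← h1, h2]
  congr 1
  simp only [← mul_assoc]
  simp
  ring

end

/-- The divergence of the vector field dual to `v ↦ ⟨α, ι_{A v} β⟩`. -/
theorem div_eq {A : E → E →L[ℝ] E} (hA : D.Par A) {α : E → E [⋀^Fin p]→L[ℝ] F}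
    {β : E → E [⋀^Fin (p + 1)]→L[ℝ] F} (hα : ContDiffOn ℝ ∞ α D.U) (hβ : ContDiffOn ℝ ∞ β D.U)
    (hu : u ∈ D.U) :
    ∑ a, fderiv ℝ (fun u => D.rho u • B.ip p u (α u) ((β u).curryLeft (A u (D.du u a)))) u (bs a)
      = D.rho u • (∑ a, B.ip p u (B.nab p α u (D.du u a)) ((β u).curryLeft (A u (bs a)))
        + ∑ a, B.ip p u (α u) ((B.nab (p + 1) β u (D.du u a)).curryLeft (A u (bs a)))) := by
  have s1 : ∀ a, ContDiffOn ℝ ∞ (fun u => A u (D.du u a)) D.U := fun a =>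
    hA.smooth.clm_apply (D.du_smooth a)
  have s2 : ∀ a, ContDiffOn ℝ ∞ (fun u => (β u).curryLeft (A u (D.du u a))) D.U := fun a =>
    curryLeft_smooth hβ (s1 a)
  have s3 : ∀ a, DifferentiableAt ℝ
      (fun u => B.ip p u (α u) ((β u).curryLeft (A u (D.du u a)))) u := fun a =>
    LocalHK.diff (B.ip_smooth hα (s2 a)) hu
  -- Parallelism of A lets the covariant derivative pass to the dual frame.
  have h1 : ∀ a, fderiv ℝ (fun u => A u (D.du u a)) u (bs a) + D.Gam u (bs a) (A u (D.du u a))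
      = A u (D.ndu u (bs a) a) := fun a => by
    rw [fderiv_apply_fun (hA.diff hu) (LocalHK.diff (D.du_smooth a) hu), hA.par u hu,
      LocalHK.ndu, map_add]
    abel
  have h2 : ∀ a, fderiv ℝ (fun u => D.rho u •
      B.ip p u (α u) ((β u).curryLeft (A u (D.du u a)))) u (bs a)
      = D.rho u • (B.ip p u (B.nab p α u (bs a)) ((β u).curryLeft (A u (D.du u a)))
        + B.ip p u (α u) ((B.nab (p + 1) β u (bs a)).curryLeft (A u (D.du u a)))
        + B.ip p u (α u) ((β u).curryLeft
            (A u (D.ndu u (bs a) a + D.trG u (bs a) • D.du u a)))) := fun a => by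
    rw [fderiv_fun_smul (LocalHK.diff D.rho_smooth hu) (s3 a), add_apply, smul_apply,
      ContinuousLinearMap.smulRight_apply, B.fderiv_ip hα (s2 a) hu, D.fderiv_rho hu,
      nab_curryLeft hβ (s1 a) hu, h1]
    simp only [map_add, map_smul, mul_smul, smul_add]
    abel
  simp only [h2]
  rw [← Finset.smul_sum, Finset.sum_add_distrib, Finset.sum_add_distrib]
  -- The derivative of the density and the divergence of the dual frame cancel; this is the only
  -- place where the volume form matters.
  have h3 : ∑ a, B.ip p u (α u) ((β u).curryLeft
      (A u (D.ndu u (bs a) a + D.trG u (bs a) • D.du u a))) = 0 := by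
    rw [← map_sum, ← map_sum, ← map_sum, Finset.sum_add_distrib, D.sum_ndu hu]
    simp
  have f1 := D.tr_swap ((B.IsBilin_ip_form (u := u) (B.nab p α u) (β u)).comp
    (ContinuousLinearMap.id ℝ E) (A u)) hu
  have f2 := D.tr_swap (f := fun x y => B.ip p u (α u) ((B.nab (p + 1) β u x).curryLeft (A u y)))
    (by constructor <;> intros <;> simp) hu
  simp only [ContinuousLinearMap.id_apply] at f1
  rw [h3, add_zero, f1, f2]

/-- `⟨∂̄α, β⟩ - ⟨α, ∂̄^*β⟩` is a divergence. -/
theorem div_dbarL {α : E → E [⋀^Fin p]→L[ℝ] F}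
    {β : E → E [⋀^Fin (p + 1)]→L[ℝ] F} (hα : ContDiffOn ℝ ∞ α D.U) (hβ : ContDiffOn ℝ ∞ β D.U)
    (hZ : ∀ u ∈ D.U, β u ∈ zForms F D.I (p + 1)) (hu : u ∈ D.U) :
    ∑ a, fderiv ℝ (fun u => D.rho u • B.ip p u (α u) ((β u).curryLeft (D.du u a))) u (bs a)
      = (2 * D.rho u) • (B.ip (p + 1) u (B.dbarL p α u) (β u)
        - B.ip p u (α u) (B.qL p β u)) := by
  have h := div_eq (B := B) D.par_id hα hβ hu
  simp only [ContinuousLinearMap.id_apply] at h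
  rw [h, ip_dbarL hu (hZ u hu), qL, map_neg, map_smul, map_sum]
  module

/-- `⟨∂̄_Jα, β⟩ - ⟨α, ∂̄_J^*β⟩` is a divergence. -/
theorem div_dbarJL {α : E → E [⋀^Fin p]→L[ℝ] F}
    {β : E → E [⋀^Fin (p + 1)]→L[ℝ] F} (hα : ContDiffOn ℝ ∞ α D.U) (hβ : ContDiffOn ℝ ∞ β D.U)
    (hZ : ∀ u ∈ D.U, β u ∈ zForms F D.I (p + 1)) (hu : u ∈ D.U) :
    ∑ a, fderiv ℝ (fun u => D.rho u •
        B.ip p u (α u) ((β u).curryLeft (D.J u (D.du u a)))) u (bs a)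
      = (2 * D.rho u) • (B.ip (p + 1) u (B.dbarJL p α u) (β u)
        - B.ip p u (α u) (B.qJL p β u)) := by
  rw [div_eq (B := B) D.par_J hα hβ hu, ip_dbarJL hu (hZ u hu), qJL, map_neg, map_smul, map_sum]
  module

end LocalBundle

end LocalAdjoints

/-! ### Pointwise adjointness of Λ and multiplication by Ω̄. -/

section LefschetzAdjoint

variable {E F : Type*} [NormedAddCommGroup E] [NormedSpace ℝ E] [FiniteDimensional ℝ E]
  [NormedAddCommGroup F] [NormedSpace ℂ F]

namespace LocalHK

variable (D : LocalHK E)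

/-- The form `Ω̄ = ω_J - √-1 ω_K`. -/
def omegaBar (u v w : E) : ℂ := (D.g u v (D.J u w) : ℂ) - Complex.I * (D.g u v (D.K u w) : ℂ)

end LocalHK

namespace LocalBundle

variable {D : LocalHK E} (B : LocalBundle D F) {u : E} {p : ℕ}

/-- This fixes the constant -1/4 in `lam`. Two uses of `ip_alt` and the 1/2 of the wedge product
give 1/8; the ω_J- and ω_K-parts of Ω̄ contribute equally on type (0,p+2), which doubles it; the
sign comes from exchanging the two contractions. -/
theorem ip_lef (hu : u ∈ D.U) {α : E [⋀^Fin p]→L[ℝ] F} {β : E [⋀^Fin (p + 2)]→L[ℝ] F}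
    (hβ : β ∈ zForms F D.I (p + 2)) {S : E →L[ℝ] E →L[ℝ] E [⋀^Fin p]→L[ℝ] F}
    (hS : ∀ v w, S v w = D.omegaBar u v w • α) :
    B.ip (p + 2) u ((1 / 2 : ℂ) • alt (p + 1) (alt p ∘L S)) β = B.ip p u α (D.lam F p u β) := by
  have h1 : ∀ c, ∑ a, B.ip p u (S (D.du u a) (D.du u c)) ((β.curryLeft (bs a)).curryLeft (bs c))
      = 2 * B.ip p u α ((β.curryLeft (D.J u (D.du u c))).curryLeft (bs c)) := fun c => by
    have e : ∀ y, ∑ a, (co a y : ℂ) * B.ip p u α ((β.curryLeft (bs a)).curryLeft (bs c))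
        = B.ip p u α ((β.curryLeft y).curryLeft (bs c)) := fun y => by
      conv_rhs => rw [← sum_co y, (IsBilin.contr_contr β).sum_left, map_sum]
      simp only [map_smul, Complex.real_smul]
    have h2 : ∀ a, B.ip p u (S (D.du u a) (D.du u c)) ((β.curryLeft (bs a)).curryLeft (bs c))
        = (co a (D.J u (D.du u c)) : ℂ) * B.ip p u α ((β.curryLeft (bs a)).curryLeft (bs c))
          + Complex.I * ((co a (D.K u (D.du u c)) : ℂ)
            * B.ip p u α ((β.curryLeft (bs a)).curryLeft (bs c))) := fun a => by
      rw [hS, B.ip_csmul_left hu, LocalHK.omegaBar, D.g_du hu, D.g_du hu]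
      simp
      ring
    simp only [h2]
    rw [Finset.sum_add_distrib, ← Finset.mul_sum, e, e, D.K_apply, mem_zForms_succ.1 hβ]
    have h3 : ∀ x : E [⋀^Fin (p + 1)]→L[ℝ] F, (-(Complex.I • x)).curryLeft (bs c)
        = -(Complex.I • x.curryLeft (bs c)) := fun x => rfl
    rw [h3, map_neg, B.ip_csmul_right hu]
    linear_combination (-B.ip p u α ((β.curryLeft (D.J u (D.du u c))).curryLeft (bs c)))
      * Complex.I_mul_I
  have h4 := D.tr_swap (f := fun x y => B.ip p u α ((β.curryLeft (D.J u x)).curryLeft y))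
    (by constructor <;> intros <;> simp) hu
  rw [B.ip_csmul_left hu, ip_alt]
  simp only [ContinuousLinearMap.comp_apply, ip_alt]
  rw [← Finset.smul_sum, Finset.sum_comm]
  simp only [h1]
  rw [← Finset.mul_sum, ← h4, D.lam_apply, map_neg, map_smul, map_sum]
  have h5 : ∀ a, B.ip p u α ((β.curryLeft (D.J u (bs a))).curryLeft (D.du u a))
      = -B.ip p u α ((β.curryLeft (D.du u a)).curryLeft (D.J u (bs a))) := fun a => by
    rw [curryLeft_curryLeft_comm, map_neg]
  simp only [h5, Finset.sum_neg_distrib, Complex.real_smul]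
  simp
  ring

end LocalBundle

end LefschetzAdjoint

/-! ### The Hermitian product of forms in a complex basis. -/

section HermitianBasis

variable {E F : Type*} [NormedAddCommGroup E] [NormedSpace ℂ E] [FiniteDimensional ℝ E]
  [NormedAddCommGroup F] [NormedSpace ℂ F]

namespace LocalHK

variable (D : LocalHK E) {n : ℕ} (c : Module.Basis (Fin n) ℂ E) {u : E}

/-- The Hermitian metric with real part `g`. -/
def herm (u v w : E) : ℂ := (D.g u v w : ℂ) - Complex.I * (D.g u v (D.I w) : ℂ)

/-- The Gram matrix of the Hermitian metric with real part `g`. -/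
def hermGram (u : E) : Matrix (Fin n) (Fin n) ℂ := Matrix.of fun i j => D.herm u (c i) (c j)

variable (hI : ∀ v, D.I v = Complex.I • v)
include hI

theorem herm_sum (x : Fin n → ℂ) (v : E) :
    D.herm u v (∑ i, x i • c i) = ∑ i, D.herm u v (c i) * x i := by
  have h1 : ∀ w w', D.herm u v (w + w') = D.herm u v w + D.herm u v w' := fun w w' => by
    simp [herm]; ring
  have h2 : ∀ (r : ℝ) w, D.herm u v (r • w) = r * D.herm u v w := fun r w => by
    simp [herm]; ring
  have h3 : ∀ w, D.herm u v (Complex.I • w) = Complex.I * D.herm u v w := fun w => by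
    rw [← hI]
    simp [herm, mul_sub, ← mul_assoc]
    ring
  have h4 : ∀ (z : ℂ) w, D.herm u v (z • w) = z * D.herm u v w := fun z w => by
    have e : z • w = z.re • w + z.im • Complex.I • w := by
      conv_lhs => rw [← Complex.re_add_im z, add_smul, mul_smul]
      simp
    rw [e, h1, h2, h2, h3, ← mul_assoc, ← add_mul, Complex.re_add_im]
  let T : E →+ ℂ := ⟨⟨fun w => D.herm u v w, by simp [herm]⟩, h1⟩
  have := map_sum T (fun i => x i • c i) Finset.univ
  refine this.trans (Finset.sum_congr rfl fun i _ => ?_)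
  rw [mul_comm]
  exact h4 _ _

/-- A vector in the kernel is g-orthogonal to all c_j and I c_j, which span, hence to itself. -/
theorem isUnit_hermGram (hu : u ∈ D.U) : IsUnit (D.hermGram c u) := by
  rw [← Matrix.mulVec_injective_iff_isUnit]
  refine (injective_iff_map_eq_zero (Matrix.mulVecLin (D.hermGram c u))).2 fun x hx => ?_
  set v := ∑ i, x i • c i with hv
  have h1 : ∀ j, D.herm u (c j) v = 0 := fun j => by
    rw [hv, D.herm_sum c hI]
    exact congrFun hx j
  have h2 : ∀ j, D.g u v (c j) = 0 ∧ D.g u v (D.I (c j)) = 0 := fun j => by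
    have h3 := h1 j
    have h4 := D.g_I_left hu v (c j)
    rw [D.g_symm u hu (D.I v)] at h4
    simp only [herm, Complex.ext_iff] at h3
    simp at h3
    rw [D.g_symm u hu v]
    exact ⟨h3.1, by linarith⟩
  have h5 : D.g u v v = 0 := by
    have e : ∀ w, D.g u v w = (D.herm u v w).re := fun w => by simp [herm]
    rw [e]
    nth_rw 2 [hv]
    rw [D.herm_sum c hI, Finset.sum_eq_zero, Complex.zero_re]
    intro j _
    simp [herm, h2]
  have hv0 : v = 0 := by
    by_contra hne
    exact (D.g_pos u hu v hne).ne' h5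
  have := c.linearIndependent
  rw [Fintype.linearIndependent_iff] at this
  exact funext (this x hv0)

/-- The dual family of a complex basis. -/
theorem sum_g_basis (hu : u ∈ D.U) (v : E) :
    ∑ j : Fin n ⊕ Fin n, D.g u v (Sum.elim (fun j => c j) (fun j => D.I (c j)) j) •
      Sum.elim (fun j => ∑ i, (D.hermGram c u)⁻¹ i j • c i)
        (fun j => D.I (∑ i, (D.hermGram c u)⁻¹ i j • c i)) j = v := by
  have hG : (D.hermGram c u)⁻¹ * D.hermGram c u = 1 :=
    Matrix.nonsing_inv_mul _ ((Matrix.isUnit_iff_isUnit_det _).1 (D.isUnit_hermGram c hI hu))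
  rw [Fintype.sum_sum_type]
  simp only [Sum.elim_inl, Sum.elim_inr]
  rw [← Finset.sum_add_distrib]
  have h1 : ∀ j (w : E), D.g u v (c j) • w + D.g u v (D.I (c j)) • D.I w
      = D.herm u (c j) v • w := fun j w => by
    rw [hI w, herm, sub_smul, mul_smul, D.g_symm u hu (c j) v, D.g_symm u hu (c j),
      D.g_I_left hu, smul_comm Complex.I, Complex.coe_smul, Complex.coe_smul, neg_smul,
      sub_neg_eq_add]
  rw [Finset.sum_congr rfl fun j _ => h1 j _]
  simp only [Finset.smul_sum, smul_smul]
  rw [Finset.sum_comm]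
  conv_rhs => rw [← c.sum_repr v]
  refine Finset.sum_congr rfl fun i _ => ?_
  rw [← Finset.sum_smul]
  congr 1
  have h2 : ∀ j, D.herm u (c j) v = ((D.hermGram c u).mulVec (c.repr v)) j := fun j => by
    conv_lhs => rw [← c.sum_repr v]
    rw [D.herm_sum c hI]
    rfl
  have h3 : (c.repr v) i = ((D.hermGram c u)⁻¹ * D.hermGram c u).mulVec (c.repr v) i := by
    rw [hG, Matrix.one_mulVec]
  rw [h3, ← Matrix.mulVec_mulVec]
  simp only [h2]
  exact Finset.sum_congr rfl fun j _ => mul_comm _ _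

end LocalHK

namespace LocalBundle

variable {D : LocalHK E} (B : LocalBundle D F) {u : E} {n : ℕ}

/-- The trace is computed in the real frame (c_j, I c_j). On type (0,p) the two halves are equal,
which cancels the 2 in the normalization, and the factors 1/(p+1) accumulate to 1/p!. -/
theorem ip_eq_sum (c : Module.Basis (Fin n) ℂ E) (hI : ∀ v, D.I v = Complex.I • v) (hu : u ∈ D.U)
    {p : ℕ} {α β : E [⋀^Fin p]→L[ℝ] F} (hα : α ∈ zForms F D.I p) (hβ : β ∈ zForms F D.I p) :
    B.ip p u α β = (1 / (p.factorial : ℂ)) * ∑ i : Fin p → Fin n, ∑ j : Fin p → Fin n,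
      (∏ k, (D.hermGram c u)⁻¹ (i k) (j k)) * B.H u (α fun k => c (i k)) (β fun k => c (j k)) := by
  induction p with
  | zero =>
    rw [ip_zero]
    simp
    congr <;> exact funext fun k => k.elim0
  | succ p ih =>
    rw [B.ip_eq_of_dual hu (D.sum_g_basis c hI hu), Fintype.sum_sum_type]
    simp only [Sum.elim_inl, Sum.elim_inr]
    have h1 : ∀ v w, B.ip p u (α.curryLeft (D.I v)) (β.curryLeft (D.I w))
        = B.ip p u (α.curryLeft v) (β.curryLeft w) := fun v w => by
      rw [mem_zForms_succ.1 hα, mem_zForms_succ.1 hβ, map_neg, map_neg, neg_apply, neg_neg,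
        B.ip_csmul_left hu, B.ip_csmul_right hu, ← mul_assoc]
      simp
    simp only [h1]
    -- A form of type (0,p) is conjugate-linear in its vectors and the product is conjugate-linear
    -- in its first argument, so the inverse Gram matrix appears without conjugation.
    have h2 : ∀ (z : ℂ) v, α.curryLeft (z • v) = star z • α.curryLeft v := fun z v => by
      have e : z • v = z.re • v + z.im • D.I v := by
        rw [hI]
        conv_lhs => rw [← Complex.re_add_im z, add_smul, mul_smul]
        simp
      rw [e, map_add, map_smul, map_smul, mem_zForms_succ.1 hα]
      have e2 : star z = (z.re : ℂ) - z.im * Complex.I := by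
        apply Complex.ext <;> simp
      rw [e2, sub_smul, mul_smul, Complex.coe_smul, Complex.coe_smul, smul_neg, sub_eq_add_neg]
    simp only [map_sum, sum_apply, h2, B.ip_csmul_left hu, star_star]
    rw [← two_smul ℝ, smul_smul]
    simp only [ih (curryLeft_mem_zForms hα _) (curryLeft_mem_zForms hβ _)]
    rw [← (Fin.consEquiv fun _ : Fin (p + 1) => Fin n).sum_comp, Fintype.sum_prod_type]
    simp only [← (Fin.consEquiv fun _ : Fin (p + 1) => Fin n).sum_comp
      (fun j => _ * B.H u _ (β fun k => c (j k))), Fintype.sum_prod_type]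
    rw [Complex.real_smul, Nat.factorial_succ, Finset.sum_comm]
    have h3 : ∀ (γ : E [⋀^Fin (p + 1)]→L[ℝ] F) (i : Fin n) (j : Fin p → Fin n),
        γ (fun k => c (Fin.cons (α := fun _ => Fin n) i j k))
          = γ.curryLeft (c i) fun k => c (j k) := fun γ i j => by
      rw [ContinuousAlternatingMap.curryLeft_apply_apply]
      congr 1
      funext k
      refine Fin.cases ?_ (fun k => ?_) k <;> simp
    simp only [Fin.consEquiv_apply, h3, Fin.prod_univ_succ, Fin.cons_zero, Fin.cons_succ,
      Finset.mul_sum]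
    refine Finset.sum_congr rfl fun a _ => ?_
    rw [Finset.sum_comm]
    refine Finset.sum_congr rfl fun i _ => Finset.sum_congr rfl fun b _ =>
      Finset.sum_congr rfl fun j _ => ?_
    have h4 : (p.factorial : ℂ) ≠ 0 := Nat.cast_ne_zero.2 (Nat.factorial_ne_zero p)
    have h5 : (p : ℂ) + 1 ≠ 0 := Nat.cast_add_one_ne_zero p
    push_cast
    field_simp

end LocalBundle

end HermitianBasis

/-! ### Preferred charts and holomorphic coordinate changes. -/

section Charts

variable {E : Type*} [NormedAddCommGroup E] [NormedSpace ℂ E]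
  {M : Type*} [TopologicalSpace M] [ChartedSpace E M] [IsManifold 𝓘(ℂ, E) ω M]

theorem chartFrame_eq {x₀ y : M} (hy : y ∈ (extChartAt 𝓘(ℝ, E) x₀).source) (v : E) :
    chartFrame x₀ y v = tangentCoordChange 𝓘(ℝ, E) x₀ y y v := by
  rw [extChartAt_source] at hy
  have := TangentBundle.symmL_trivializationAt_eq_core (I := 𝓘(ℝ, E)) (M := M) hy
  exact congrArg (fun f : E →L[ℝ] E => f v) this

theorem chartCoframe_eq {x₀ y : M} (hy : y ∈ (extChartAt 𝓘(ℝ, E) x₀).source)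
    (v : TangentSpace 𝓘(ℝ, E) y) :
    chartCoframe x₀ y v = tangentCoordChange 𝓘(ℝ, E) y x₀ y v := by
  rw [extChartAt_source] at hy
  have := TangentBundle.continuousLinearMapAt_trivializationAt_eq_core (I := 𝓘(ℝ, E)) (M := M) hy
  exact congrArg (fun f : E →L[ℝ] E => f v) this

theorem chartFrame_chartCoframe {x₀ y : M} (hy : y ∈ (extChartAt 𝓘(ℝ, E) x₀).source)
    (v : TangentSpace 𝓘(ℝ, E) y) : chartFrame x₀ y (chartCoframe x₀ y v) = v :=
  Trivialization.symmₗ_linearMapAt _ (by simpa using hy) v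

theorem chartCoframe_chartFrame {x₀ y : M} (hy : y ∈ (extChartAt 𝓘(ℝ, E) x₀).source)
    (v : E) : chartCoframe x₀ y (chartFrame x₀ y v) = v :=
  Trivialization.linearMapAt_symmₗ _ (by simpa using hy) v

theorem chartFrame_self (x : M) (v : E) : chartFrame (E := E) x x v = v := by
  rw [chartFrame_eq (mem_extChartAt_source x)]
  exact tangentCoordChange_self (E := E) (I := 𝓘(ℝ, E)) (mem_extChartAt_source x)

theorem chartCoframe_self (x : M) (v : TangentSpace 𝓘(ℝ, E) x) : chartCoframe x x v = v := by
  rw [chartCoframe_eq (mem_extChartAt_source x)]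
  exact tangentCoordChange_self (E := E) (I := 𝓘(ℝ, E)) (mem_extChartAt_source x)

theorem chartPoint_mem {x₀ : M} {u : E} (hu : u ∈ (extChartAt 𝓘(ℝ, E) x₀).target) :
    chartPoint x₀ u ∈ (extChartAt 𝓘(ℝ, E) x₀).source := (extChartAt 𝓘(ℝ, E) x₀).map_target hu

theorem extChartAt_chartPoint {x₀ : M} {u : E} (hu : u ∈ (extChartAt 𝓘(ℝ, E) x₀).target) :
    extChartAt 𝓘(ℝ, E) x₀ (chartPoint x₀ u) = u := (extChartAt 𝓘(ℝ, E) x₀).right_inv hu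

theorem chartPoint_extChartAt {x₀ y : M} (hy : y ∈ (extChartAt 𝓘(ℝ, E) x₀).source) :
    chartPoint x₀ (extChartAt 𝓘(ℝ, E) x₀ y) = y := (extChartAt 𝓘(ℝ, E) x₀).left_inv hy

theorem chartPoint_center (x₀ : M) : chartPoint x₀ (extChartAt 𝓘(ℝ, E) x₀ x₀) = x₀ :=
  chartPoint_extChartAt (mem_extChartAt_source x₀)

theorem continuousOn_chartPoint (x₀ : M) :
    ContinuousOn (chartPoint x₀) (extChartAt 𝓘(ℝ, E) x₀).target := continuousOn_extChartAt_symm x₀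

/-- The change of coordinates from the chart at `x₀` to the chart at `y`. -/
def transition (x₀ y : M) (u : E) : E := extChartAt 𝓘(ℝ, E) y (chartPoint x₀ u)

section

variable {x₀ y : M} {u : E} (hu : u ∈ (extChartAt 𝓘(ℝ, E) x₀).target)
  (hy : chartPoint x₀ u ∈ (extChartAt 𝓘(ℝ, E) y).source)
include hu hy

theorem transition_holomorphic : ContDiffAt ℂ ω (transition x₀ y : E → E) u := by
  have h := contDiffWithinAt_ext_coord_change (I := 𝓘(ℂ, E)) (n := ω) y x₀ (y := u)
    (by
      rw [PartialEquiv.trans_source]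
      exact ⟨hu, hy⟩)
  rw [modelWithCornersSelf_coe, Set.range_id, contDiffWithinAt_univ] at h
  exact h

theorem hasFDerivAt_transition : HasFDerivAt (transition x₀ y : E → E)
    (tangentCoordChange 𝓘(ℝ, E) x₀ y (chartPoint x₀ u)) u := by
  have h := hasFDerivWithinAt_tangentCoordChange (I := 𝓘(ℝ, E)) (x := x₀) (y := y)
    (z := chartPoint x₀ u) ⟨chartPoint_mem hu, hy⟩
  rw [modelWithCornersSelf_coe, Set.range_id, hasFDerivWithinAt_univ, extChartAt_chartPoint hu] at h
  exact h

theorem fderiv_transition : fderiv ℝ (transition x₀ y : E → E) u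
    = tangentCoordChange 𝓘(ℝ, E) x₀ y (chartPoint x₀ u) := (hasFDerivAt_transition hu hy).fderiv

/-- The coordinate change is holomorphic, so its real derivative is the restriction of its complex
derivative. -/
theorem fderiv_transition_smul (c : ℂ) (v : E) :
    fderiv ℝ (transition x₀ y : E → E) u (c • v)
      = c • fderiv ℝ (transition x₀ y : E → E) u v := by
  have h := (transition_holomorphic hu hy).differentiableAt (by simp)
  rw [(h.hasFDerivAt.restrictScalars ℝ).fderiv]
  exact map_smul (fderiv ℂ (transition x₀ y : E → E) u) c v

theorem chartFrame_transition (v : E) : chartFrame x₀ (chartPoint x₀ u) v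
    = chartFrame y (chartPoint x₀ u) (fderiv ℝ (transition x₀ y : E → E) u v) := by
  rw [fderiv_transition hu hy, chartFrame_eq (chartPoint_mem hu), chartFrame_eq hy]
  exact (tangentCoordChange_comp ⟨⟨chartPoint_mem hu, hy⟩, mem_extChartAt_source _⟩).symm

theorem transition_mem : transition x₀ y u ∈ (extChartAt 𝓘(ℝ, E) y).target :=
  (extChartAt 𝓘(ℝ, E) y).map_source hy

theorem chartPoint_transition : chartPoint y (transition x₀ y u) = chartPoint x₀ u :=
  chartPoint_extChartAt hy

end

/-- The chart centred at the point itself has the identity as frame there; the derivative of the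
change to it is complex-linear. -/
theorem chartFrame_smul {x₀ : M} {u : E} (hu : u ∈ (extChartAt 𝓘(ℝ, E) x₀).target) (c : ℂ) (v : E) :
    chartFrame x₀ (chartPoint x₀ u) (c • v)
      = HSMul.hSMul (β := E) (γ := E) c (chartFrame x₀ (chartPoint x₀ u) v) := by
  have hy := mem_extChartAt_source (I := 𝓘(ℝ, E)) (chartPoint x₀ u)
  rw [chartFrame_transition hu hy, chartFrame_transition hu hy, chartFrame_self, chartFrame_self,
    fderiv_transition_smul hu hy]

theorem chartFrame_I {x₀ : M} {u : E} (hu : u ∈ (extChartAt 𝓘(ℝ, E) x₀).target) (v : E) :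
    chartFrame x₀ (chartPoint x₀ u) (mulI E v)
      = tangentI (chartPoint x₀ u) (chartFrame x₀ (chartPoint x₀ u) v) :=
  chartFrame_smul hu Complex.I v

/-- The frame of a chart is smooth. -/
theorem contMDiffOn_chartFrame (x₀ : M) (v : E) :
    ContMDiffOn 𝓘(ℝ, E) (𝓘(ℝ, E).prod 𝓘(ℝ, E)) ∞
      (fun y => (TotalSpace.mk' E y (chartFrame x₀ y v) : TangentBundle 𝓘(ℝ, E) M))
      (extChartAt 𝓘(ℝ, E) x₀).source := by
  rw [Trivialization.contMDiffOn_iff (e := trivializationAt E (TangentSpace 𝓘(ℝ, E)) x₀)]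
  · refine ⟨contMDiffOn_id, (contMDiffOn_const (c := v)).congr fun y hy => ?_⟩
    have h1 := chartCoframe_chartFrame hy v
    have h2 : y ∈ (trivializationAt E (TangentSpace 𝓘(ℝ, E)) x₀).baseSet := by simpa using hy
    rw [chartCoframe, Trivialization.coe_linearMapAt_of_mem _ h2] at h1
    exact h1
  · intro y hy
    rw [Trivialization.mem_source]
    simpa using hy

/-- Smooth functions near the image of a chart are smooth in the chart. -/
theorem ContMDiffOn.comp_chartPoint {W : Type*} [NormedAddCommGroup W] [NormedSpace ℝ W]
    {f : M → W} {x₀ : M} {s : Set M} {U : Set E} (hf : ContMDiffOn 𝓘(ℝ, E) 𝓘(ℝ, W) ∞ f s)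
    (hU : U ⊆ (extChartAt 𝓘(ℝ, E) x₀).target) (hs : ∀ u ∈ U, chartPoint x₀ u ∈ s) :
    ContDiffOn ℝ ∞ (fun u => f (chartPoint x₀ u)) U := by
  rw [← contMDiffOn_iff_contDiffOn]
  exact hf.comp ((contMDiffOn_extChartAt_symm x₀).mono hU) hs

end Charts

/-! ### The hyperkähler structure expressed in a chart. -/

section LocalStructure

variable {E : Type*} [NormedAddCommGroup E] [NormedSpace ℂ E] [FiniteDimensional ℂ E]
  {M : Type*} [TopologicalSpace M] [ChartedSpace E M] [IsManifold 𝓘(ℂ, E) ω M]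

/-- The expression of a field of endomorphisms in a chart. -/
def locEnd (A : ∀ x : M, TangentSpace 𝓘(ℝ, E) x →L[ℝ] TangentSpace 𝓘(ℝ, E) x) (x₀ : M) (u : E) :
    E →L[ℝ] E :=
  LinearMap.toContinuousLinearMap
    (chartCoframe x₀ (chartPoint x₀ u) ∘ₗ (A (chartPoint x₀ u)).toLinearMap
      ∘ₗ chartFrame x₀ (chartPoint x₀ u))

/-- The expression of a metric in a chart. -/
def locMet (g : Metric E M) (x₀ : M) (u : E) : E →L[ℝ] E →L[ℝ] ℝ :=
  LinearMap.toContinuousBilinearMap (LinearMap.mk₂ ℝ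
    (fun v w => g.inner (chartPoint x₀ u) (chartFrame x₀ (chartPoint x₀ u) v)
      (chartFrame x₀ (chartPoint x₀ u) w))
    (fun v v' w => by simp) (fun r v w => by simp) (fun v v' w => by simp) (fun r v w => by simp))

theorem locMet_apply (g : Metric E M) (x₀ : M) (u v w : E) : locMet g x₀ u v w
    = g.inner (chartPoint x₀ u) (chartFrame x₀ (chartPoint x₀ u) v)
      (chartFrame x₀ (chartPoint x₀ u) w) := rfl

variable {g : Metric E M} {A : ∀ x : M, TangentSpace 𝓘(ℝ, E) x →L[ℝ] TangentSpace 𝓘(ℝ, E) x}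
  {x₀ : M} {u : E}

theorem chartFrame_locEnd (hu : u ∈ (extChartAt 𝓘(ℝ, E) x₀).target) (v : E) :
    chartFrame x₀ (chartPoint x₀ u) (locEnd A x₀ u v)
      = A (chartPoint x₀ u) (chartFrame x₀ (chartPoint x₀ u) v) :=
  chartFrame_chartCoframe (chartPoint_mem hu) _

theorem locEnd_tangentI (hu : u ∈ (extChartAt 𝓘(ℝ, E) x₀).target) :
    locEnd (tangentI (M := M)) x₀ u = mulI E := by
  ext v
  have h := chartFrame_I hu v
  have h2 := congrArg (chartCoframe x₀ (chartPoint x₀ u)) h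
  rw [chartCoframe_chartFrame (chartPoint_mem hu)] at h2
  exact h2.symm

theorem locEnd_comp {A' : ∀ x : M, TangentSpace 𝓘(ℝ, E) x →L[ℝ] TangentSpace 𝓘(ℝ, E) x}
    (hu : u ∈ (extChartAt 𝓘(ℝ, E) x₀).target) :
    locEnd (fun x => A x ∘L A' x) x₀ u = locEnd A x₀ u ∘L locEnd A' x₀ u := by
  ext v
  have h : ∀ v, locEnd A x₀ u v = chartCoframe x₀ (chartPoint x₀ u) (A (chartPoint x₀ u)
    (chartFrame x₀ (chartPoint x₀ u) v)) := fun v => rfl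
  rw [ContinuousLinearMap.comp_apply, h (locEnd A' x₀ u v), chartFrame_locEnd hu]
  rfl

theorem locMet_smooth (g : Metric E M) (x₀ : M) :
    ContDiffOn ℝ ∞ (locMet g x₀) (extChartAt 𝓘(ℝ, E) x₀).target := by
  refine contDiffOn_clm_apply.2 fun v => contDiffOn_clm_apply.2 fun w => ?_
  have h := ContMDiffOn.clm_bundle_apply₂ (E₃ := fun _ : M => ℝ)
    (g.contMDiff.contMDiffOn (s := (extChartAt 𝓘(ℝ, E) x₀).source))
    (contMDiffOn_chartFrame x₀ v) (contMDiffOn_chartFrame x₀ w)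
  have h2 : ContMDiffOn 𝓘(ℝ, E) 𝓘(ℝ, ℝ) ∞ (fun y => g.inner y (chartFrame x₀ y v)
      (chartFrame x₀ y w)) (extChartAt 𝓘(ℝ, E) x₀).source := by
    intro y hy
    exact (contMDiffWithinAt_totalSpace.1 (h y hy)).2
  exact ContMDiffOn.comp_chartPoint h2 subset_rfl fun u hu => chartPoint_mem hu

theorem locEnd_smooth (hA : IsKahler g A) (x₀ : M) :
    ContDiffOn ℝ ∞ (locEnd A x₀) (extChartAt 𝓘(ℝ, E) x₀).target := by
  refine contDiffOn_clm_apply.2 fun v => ?_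
  have h := ContMDiffOn.clm_bundle_apply
    (hA.smooth.contMDiffOn (s := (extChartAt 𝓘(ℝ, E) x₀).source))
    (contMDiffOn_chartFrame x₀ v)
  have h2 : ContMDiffOn 𝓘(ℝ, E) 𝓘(ℝ, E) ∞ (fun y => chartCoframe x₀ y (A y (chartFrame x₀ y v)))
      (extChartAt 𝓘(ℝ, E) x₀).source := by
    rw [Trivialization.contMDiffOn_iff (e := trivializationAt E (TangentSpace 𝓘(ℝ, E)) x₀)] at h
    · refine h.2.congr fun y hy => ?_
      have h2 : y ∈ (trivializationAt E (TangentSpace 𝓘(ℝ, E)) x₀).baseSet := by simpa using hy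
      rw [chartCoframe, Trivialization.coe_linearMapAt_of_mem _ h2]
    · intro y hy
      rw [Trivialization.mem_source]
      simpa using hy
  exact ContMDiffOn.comp_chartPoint h2 subset_rfl fun u hu => chartPoint_mem hu

theorem target_nhds (hu : u ∈ (extChartAt 𝓘(ℝ, E) x₀).target) :
    (extChartAt 𝓘(ℝ, E) x₀).target ∈ nhds u := (isOpen_extChartAt_target x₀).mem_nhds hu

theorem eventually_transition {y : M} (hu : u ∈ (extChartAt 𝓘(ℝ, E) x₀).target)
    (hy : chartPoint x₀ u ∈ (extChartAt 𝓘(ℝ, E) y).source) :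
    ∀ᶠ u' in nhds u, u' ∈ (extChartAt 𝓘(ℝ, E) x₀).target ∧
      chartPoint x₀ u' ∈ (extChartAt 𝓘(ℝ, E) y).source :=
  Filter.Eventually.and (target_nhds hu)
    (((continuousOn_chartPoint x₀).continuousAt (target_nhds hu)).eventually
      ((isOpen_extChartAt_source y).mem_nhds hy))

/-- The Kähler form in a chart. -/
def locForm (g : Metric E M)
    (A : ∀ x : M, TangentSpace 𝓘(ℝ, E) x →L[ℝ] TangentSpace 𝓘(ℝ, E) x) (x₀ : M) (u : E) :
    E →L[ℝ] E →L[ℝ] ℝ :=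
  LinearMap.toContinuousBilinearMap (LinearMap.mk₂ ℝ
    (fun v w => locMet g x₀ u v (locEnd A x₀ u w))
    (fun v v' w => by simp) (fun r v w => by simp) (fun v v' w => by simp) (fun r v w => by simp))

theorem locForm_apply (v w : E) : locForm g A x₀ u v w = locMet g x₀ u v (locEnd A x₀ u w) := rfl

theorem locForm_eq (hu : u ∈ (extChartAt 𝓘(ℝ, E) x₀).target) (v w : E) :
    locForm g A x₀ u v w = kahlerForm g A (chartPoint x₀ u) (chartFrame x₀ (chartPoint x₀ u) v)
      (chartFrame x₀ (chartPoint x₀ u) w) := by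
  rw [locForm_apply, locMet_apply, chartFrame_locEnd hu]; rfl

theorem locForm_smooth (hA : IsKahler g A) (x₀ : M) :
    ContDiffOn ℝ ∞ (locForm g A x₀) (extChartAt 𝓘(ℝ, E) x₀).target :=
  contDiffOn_clm_apply.2 fun v => contDiffOn_clm_apply.2 fun w => by
    have h1 : ContDiffOn ℝ ∞ (fun u => locEnd A x₀ u w) (extChartAt 𝓘(ℝ, E) x₀).target :=
      (locEnd_smooth hA x₀).clm_apply contDiffOn_const
    have h2 : ContDiffOn ℝ ∞ (fun u => locMet g x₀ u v) (extChartAt 𝓘(ℝ, E) x₀).target :=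
      (locMet_smooth g x₀).clm_apply contDiffOn_const
    exact (h2.clm_apply h1).congr fun u _ => locForm_apply v w

theorem locForm_skew (hA : IsKahler g A) (hu : u ∈ (extChartAt 𝓘(ℝ, E) x₀).target) (v w : E) :
    locForm g A x₀ u v w = -locForm g A x₀ u w v := by
  rw [locForm_eq hu, locForm_eq hu, kahlerForm, kahlerForm, g.symm, ← hA.orthogonal _ _ (A _ _),
    hA.square, map_neg, neg_neg]

theorem diffAt {W : Type*} [NormedAddCommGroup W] [NormedSpace ℝ W] {f : E → W} {U : Set E}
    (hf : ContDiffOn ℝ ∞ f U) (hU : U ∈ nhds u) : DifferentiableAt ℝ f u :=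
  (hf.contDiffAt hU).differentiableAt (by simp)

theorem locForm_transition {y : M} (hu : u ∈ (extChartAt 𝓘(ℝ, E) x₀).target)
    (hy : chartPoint x₀ u ∈ (extChartAt 𝓘(ℝ, E) y).source) (v w : E) :
    locForm g A x₀ u v w = locForm g A y (transition x₀ y u)
      (fderiv ℝ (transition x₀ y : E → E) u v) (fderiv ℝ (transition x₀ y : E → E) u w) := by
  rw [locForm_eq hu, locForm_eq (transition_mem hu hy), chartPoint_transition hu hy,
    chartFrame_transition hu hy, chartFrame_transition hu hy]

/-- `IsClosedTwoForm` tests closedness only at the centre of each preferred chart. At another point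
of the chart one passes to the chart centred there; the second derivatives of the coordinate change
cancel in the cyclic sum, since they are symmetric and the form is skew. -/
theorem fderiv_locForm_cyc (hA : IsKahler g A) (hu : u ∈ (extChartAt 𝓘(ℝ, E) x₀).target)
    (a b c : E) : fderiv ℝ (locForm g A x₀) u a b c + fderiv ℝ (locForm g A x₀) u b c a
      + fderiv ℝ (locForm g A x₀) u c a b = 0 := by
  set y := chartPoint x₀ u with hy
  have hyy : chartPoint x₀ u ∈ (extChartAt 𝓘(ℝ, E) y).source := mem_extChartAt_source y
  set φ : E → E := transition x₀ y with hφ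
  have hφu : φ u = extChartAt 𝓘(ℝ, E) y y := rfl
  have hc : ContDiffAt ℝ ∞ φ u := ((transition_holomorphic hu hyy).restrict_scalars ℝ).of_le le_top
  have hφd : DifferentiableAt ℝ φ u := hc.differentiableAt (by simp)
  have hDφ : DifferentiableAt ℝ (fderiv ℝ φ) u := differentiableAt_fderiv hc
  have hm := transition_mem hu hyy
  have hd : DifferentiableAt ℝ (locForm g A y) (φ u) :=
    diffAt (locForm_smooth hA y) (target_nhds hm)
  have hd0 : DifferentiableAt ℝ (locForm g A x₀) u :=
    diffAt (locForm_smooth hA x₀) (target_nhds hu)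
  have key : ∀ a b c, fderiv ℝ (locForm g A x₀) u a b c
      = fderiv ℝ (locForm g A y) (φ u) (fderiv ℝ φ u a) (fderiv ℝ φ u b) (fderiv ℝ φ u c)
        + locForm g A y (φ u) (fderiv ℝ (fderiv ℝ φ) u a b) (fderiv ℝ φ u c)
        + locForm g A y (φ u) (fderiv ℝ φ u b) (fderiv ℝ (fderiv ℝ φ) u a c) := fun a b c => by
    have e1 : fderiv ℝ (fun u => locForm g A x₀ u b c) u a = fderiv ℝ (locForm g A x₀) u a b c := by
      rw [fderiv_apply_const (hd0.clm_apply (differentiableAt_const b)), fderiv_apply_const hd0]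
    have e2 : (fun u => locForm g A x₀ u b c) =ᶠ[nhds u]
        fun u => locForm g A y (φ u) (fderiv ℝ φ u b) (fderiv ℝ φ u c) := by
      filter_upwards [eventually_transition hu hyy] with u' hu'
      exact locForm_transition hu'.1 hu'.2 b c
    have hb : DifferentiableAt ℝ (fun u => fderiv ℝ φ u b) u :=
      hDφ.clm_apply (differentiableAt_const b)
    have hc' : DifferentiableAt ℝ (fun u => fderiv ℝ φ u c) u :=
      hDφ.clm_apply (differentiableAt_const c)
    have hcomp : DifferentiableAt ℝ (fun u => locForm g A y (φ u)) u := hd.comp u hφd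
    have e3 : fderiv ℝ (fun u => locForm g A y (φ u)) u a
        = fderiv ℝ (locForm g A y) (φ u) (fderiv ℝ φ u a) := by
      have := fderiv_comp u hd hφd
      exact congrArg (fun k => k a) this
    have e4 := fderiv_apply_fun (hcomp.clm_apply hb) hc' a
    have e5 := fderiv_apply_fun hcomp hb a
    rw [← e1, e2.fderiv_eq, e4, e5, fderiv_apply_const hDφ, fderiv_apply_const hDφ, e3, add_apply]
  have h := hA.closed y (fderiv ℝ φ u a) (fderiv ℝ φ u b) (fderiv ℝ φ u c)
  have e : ∀ a b c, fderiv ℝ (fun u => kahlerForm g A (chartPoint y u)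
      (chartFrame y (chartPoint y u) b) (chartFrame y (chartPoint y u) c))
      (extChartAt 𝓘(ℝ, E) y y) a = fderiv ℝ (locForm g A y) (φ u) a b c := fun a b c => by
    rw [← hφu, ← fderiv_apply_const hd, ← fderiv_apply_const (hd.clm_apply (differentiableAt_const b))]
    congr 1
    refine Filter.EventuallyEq.fderiv_eq ?_
    filter_upwards [target_nhds hm] with u' hu'
    exact (locForm_eq hu' b c).symm
  simp only [e] at h
  rw [key, key, key]
  have s : ∀ v w, fderiv ℝ (fderiv ℝ φ) u v w = fderiv ℝ (fderiv ℝ φ) u w v :=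
    snd_fderiv_symm hc
  have k1 := locForm_skew hA hm (fderiv ℝ (fderiv ℝ φ) u a b) (fderiv ℝ φ u c)
  have k2 := locForm_skew hA hm (fderiv ℝ φ u b) (fderiv ℝ (fderiv ℝ φ) u a c)
  have k3 := locForm_skew hA hm (fderiv ℝ (fderiv ℝ φ) u b c) (fderiv ℝ φ u a)
  rw [s b a, s c a, s c b]
  linarith

/-- The product rule applied to ω_A = g(·, A·) brings closedness to the form used in `LocalHK`. -/
theorem locForm_closed (hA : IsKahler g A) (hu : u ∈ (extChartAt 𝓘(ℝ, E) x₀).target)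
    (a b c : E) :
    (fderiv ℝ (locMet g x₀) u a b (locEnd A x₀ u c)
        + locMet g x₀ u b (fderiv ℝ (locEnd A x₀) u a c))
      + (fderiv ℝ (locMet g x₀) u b c (locEnd A x₀ u a)
        + locMet g x₀ u c (fderiv ℝ (locEnd A x₀) u b a))
      + (fderiv ℝ (locMet g x₀) u c a (locEnd A x₀ u b)
        + locMet g x₀ u a (fderiv ℝ (locEnd A x₀) u c b)) = 0 := by
  have hd0 : DifferentiableAt ℝ (locForm g A x₀) u :=
    diffAt (locForm_smooth hA x₀) (target_nhds hu)
  have hg : DifferentiableAt ℝ (locMet g x₀) u := diffAt (locMet_smooth g x₀) (target_nhds hu)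
  have hA' : DifferentiableAt ℝ (locEnd A x₀) u := diffAt (locEnd_smooth hA x₀) (target_nhds hu)
  have e : ∀ a b c, fderiv ℝ (locForm g A x₀) u a b c
      = fderiv ℝ (locMet g x₀) u a b (locEnd A x₀ u c)
        + locMet g x₀ u b (fderiv ℝ (locEnd A x₀) u a c) := fun a b c => by
    rw [← fderiv_apply_const hd0, ← fderiv_apply_const (hd0.clm_apply (differentiableAt_const b))]
    have := fderiv_apply_fun (hg.clm_apply (differentiableAt_const b))
      (hA'.clm_apply (differentiableAt_const c)) a
    rw [fderiv_apply_const hg, fderiv_apply_const hA'] at this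
    exact this
  rw [← e, ← e, ← e]
  exact fderiv_locForm_cyc hA hu a b c

/-- The local expression of a hyperkähler structure in a chart. -/
def Hyperkahler.loc (X : Hyperkahler E M) (x₀ : M) (U : Set E) (hU : IsOpen U)
    (hUt : U ⊆ (extChartAt 𝓘(ℝ, E) x₀).target) : LocalHK E where
  U := U
  isOpen := hU
  I := mulI E
  g := locMet X.g x₀
  J := locEnd X.J x₀
  g_smooth := (locMet_smooth X.g x₀).mono hUt
  J_smooth := (locEnd_smooth X.kahler_J x₀).mono hUt
  I_sq v := by simp [mulI, smul_smul]
  g_symm u hu v w := X.g.symm _ _ _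
  g_pos u hu v hv := X.g.pos _ _ fun h => hv <| by
    rw [← chartCoframe_chartFrame (chartPoint_mem (hUt hu)) v, h, map_zero]
  g_I u hu v w := by
    rw [locMet_apply, chartFrame_I (hUt hu), chartFrame_I (hUt hu), X.kahler_I.orthogonal]; rfl
  J_sq u hu v := by
    have h := congrArg (chartCoframe x₀ (chartPoint x₀ u)) (X.kahler_J.square (chartPoint x₀ u)
      (chartFrame x₀ (chartPoint x₀ u) v))
    rw [← chartFrame_locEnd (hUt hu), map_neg, chartCoframe_chartFrame (chartPoint_mem (hUt hu))]
      at h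
    exact h
  J_I u hu v := by
    have h := congrArg (chartCoframe x₀ (chartPoint x₀ u)) (X.anticommute (chartPoint x₀ u)
      (chartFrame x₀ (chartPoint x₀ u) v))
    rw [← chartFrame_locEnd (hUt hu), ← chartFrame_I (hUt hu), ← chartFrame_I (hUt hu), map_neg,
      chartCoframe_chartFrame (chartPoint_mem (hUt hu))] at h
    rw [h, neg_neg]
    rfl
  g_J u hu v w := by
    rw [locMet_apply, chartFrame_locEnd (hUt hu), chartFrame_locEnd (hUt hu),
      X.kahler_J.orthogonal]; rfl
  closed_I u hu a b c := by
    have h := locForm_closed X.kahler_I (hUt hu) a b c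
    -- In a holomorphic chart I is multiplication by i, hence constant.
    have e : fderiv ℝ (locEnd (tangentI (M := M)) x₀) u = 0 := by
      have : locEnd (tangentI (M := M)) x₀ =ᶠ[nhds u] fun _ => mulI E := by
        filter_upwards [target_nhds (hUt hu)] with u' hu'
        exact locEnd_tangentI hu'
      rw [this.fderiv_eq]; simp
    simpa [e, locEnd_tangentI (hUt hu)] using h
  closed_J u hu a b c := locForm_closed X.kahler_J (hUt hu) a b c
  closed_K u hu a b c := by
    have h := locForm_closed X.kahler_K (hUt hu) a b c
    have e0 : ∀ u ∈ (extChartAt 𝓘(ℝ, E) x₀).target,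
        locEnd (fun x => tangentI x ∘L X.J x) x₀ u = mulI E ∘L locEnd X.J x₀ u := fun u hu => by
      rw [locEnd_comp hu, locEnd_tangentI hu]
    have hJ : DifferentiableAt ℝ (locEnd X.J x₀) u :=
      diffAt (locEnd_smooth X.kahler_J x₀) (target_nhds (hUt hu))
    -- K = IJ with I constant, so dK = I dJ.
    have e : ∀ v w, fderiv ℝ (locEnd (fun x => tangentI x ∘L X.J x) x₀) u v w
        = mulI E (fderiv ℝ (locEnd X.J x₀) u v w) := fun v w => by
      have : locEnd (fun x => tangentI x ∘L X.J x) x₀ =ᶠ[nhds u]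
          fun u => (ContinuousLinearMap.compL ℝ E E E (mulI E)) (locEnd X.J x₀ u) := by
        filter_upwards [target_nhds (hUt hu)] with u' hu'
        exact e0 u' hu'
      rw [this.fderiv_eq, fderiv_clm_left _ hJ]
      rfl
    simpa only [e, e0 u (hUt hu), ContinuousLinearMap.comp_apply] using h

end LocalStructure

/-! ### The Hermitian bundle in a chart and a holomorphic trivialization. -/

section LocalHermitian

variable {E : Type*} [NormedAddCommGroup E] [NormedSpace ℂ E] [FiniteDimensional ℂ E]
  {M : Type*} [TopologicalSpace M] [ChartedSpace E M] [IsManifold 𝓘(ℂ, E) ω M]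
  {F : Type*} [NormedAddCommGroup F] [NormedSpace ℂ F] [FiniteDimensional ℂ F]
  {B : M → Type*} [TopologicalSpace (TotalSpace F B)]
  [∀ x, AddCommGroup (B x)] [∀ x, Module ℂ (B x)] [∀ x, TopologicalSpace (B x)]
  [FiberBundle F B] [VectorBundle ℂ F B]

variable (F) in
/-- The isomorphism from `F` to the fibre at `x` given by the preferred trivialization at `x₀`. -/
def bframe (B : M → Type*) [TopologicalSpace (TotalSpace F B)]
    [∀ x, AddCommGroup (B x)] [∀ x, Module ℂ (B x)] [∀ x, TopologicalSpace (B x)]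
    [FiberBundle F B] [VectorBundle ℂ F B] (x₀ x : M) : F →ₗ[ℂ] B x :=
  (trivializationAt F B x₀).symmₗ ℂ x

variable (F) in
/-- The inverse of `bframe`. -/
def bcoframe (B : M → Type*) [TopologicalSpace (TotalSpace F B)]
    [∀ x, AddCommGroup (B x)] [∀ x, Module ℂ (B x)] [∀ x, TopologicalSpace (B x)]
    [FiberBundle F B] [VectorBundle ℂ F B] (x₀ x : M) : B x →ₗ[ℂ] F :=
  (trivializationAt F B x₀).linearMapAt ℂ x

variable (E F B) in
/-- The domain of the preferred chart and trivialization at `x₀`. -/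
def locU (x₀ : M) : Set E := (extChartAt 𝓘(ℝ, E) x₀).target ∩
  chartPoint x₀ ⁻¹' (trivializationAt F B x₀).baseSet

theorem locU_subset (x₀ : M) : locU E F B x₀ ⊆ (extChartAt 𝓘(ℝ, E) x₀).target :=
  Set.inter_subset_left

theorem isOpen_locU (x₀ : M) : IsOpen (locU E F B x₀) :=
  (continuousOn_chartPoint x₀).isOpen_inter_preimage (isOpen_extChartAt_target x₀)
    (trivializationAt F B x₀).open_baseSet

theorem center_mem_locU (x₀ : M) : extChartAt 𝓘(ℝ, E) x₀ x₀ ∈ locU E F B x₀ :=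
  ⟨mem_extChartAt_target x₀, by
    rw [Set.mem_preimage, chartPoint_center]
    exact FiberBundle.mem_baseSet_trivializationAt' x₀⟩

variable {h : HermitianMetric E F B} {x₀ : M} {u : E}

theorem bframe_bcoframe {x : M} (hx : x ∈ (trivializationAt F B x₀).baseSet) (b : B x) :
    bframe F B x₀ x (bcoframe F B x₀ x b) = b := Trivialization.symmₗ_linearMapAt _ hx b

theorem bcoframe_bframe {x : M} (hx : x ∈ (trivializationAt F B x₀).baseSet) (b : F) :
    bcoframe F B x₀ x (bframe F B x₀ x b) = b := Trivialization.linearMapAt_symmₗ _ hx b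

theorem map_real_smul {V W : Type*} [AddCommGroup V] [Module ℂ V] [AddCommGroup W] [Module ℂ W]
    (f : V →ₗ[ℂ] W) (r : ℝ) (v : V) : f (r • v) = r • f v := (f.restrictScalars ℝ).map_smul r v

/-- The expression of a Hermitian metric in a chart and a trivialization. -/
def locH (h : HermitianMetric E F B) (x₀ : M) (u : E) : F →L[ℝ] F →L[ℝ] ℂ :=
  LinearMap.toContinuousBilinearMap (LinearMap.mk₂ ℝ
    (fun a b => h.inner (chartPoint x₀ u) (bframe F B x₀ (chartPoint x₀ u) a)
      (bframe F B x₀ (chartPoint x₀ u) b))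
    (fun v v' w => by simp)
    (fun r v w => by
      rw [← Complex.coe_smul, map_smul, map_smulₛₗ]
      simp)
    (fun v v' w => by simp)
    (fun r v w => by rw [map_real_smul, map_real_smul]))

theorem locH_apply (a b : F) : locH h x₀ u a b
    = h.inner (chartPoint x₀ u) (bframe F B x₀ (chartPoint x₀ u) a)
      (bframe F B x₀ (chartPoint x₀ u) b) := rfl

theorem locH_smul (c : ℂ) (a b : F) : locH h x₀ u a (c • b) = c * locH h x₀ u a b := by
  simp [locH_apply]

theorem locH_smul_left (c : ℂ) (a b : F) : locH h x₀ u (c • a) b = star c * locH h x₀ u a b := by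
  simp [locH_apply]

theorem locH_symm (a b : F) : locH h x₀ u a b = star (locH h x₀ u b a) := h.symm _ _ _

theorem locH_pos (hu : u ∈ locU E F B x₀) {a : F} (ha : a ≠ 0) : 0 < (locH h x₀ u a a).re :=
  h.pos _ _ fun h0 => ha <| by rw [← bcoframe_bframe hu.2 a, h0, map_zero]

theorem locH_smooth (h : HermitianMetric E F B) (x₀ : M) :
    ContDiffOn ℝ ∞ (locH h x₀) (locU E F B x₀) :=
  contDiffOn_clm_apply.2 fun a => contDiffOn_clm_apply.2 fun b =>
    ContMDiffOn.comp_chartPoint (h.smooth x₀ a b) (locU_subset x₀) fun _ hu => hu.2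

theorem locH_fderiv (hu : u ∈ locU E F B x₀) (v : E) (a b : F) :
    fderiv ℝ (fun u => locH h x₀ u a b) u v = fderiv ℝ (locH h x₀) u v a b := by
  have hd : DifferentiableAt ℝ (locH h x₀) u :=
    diffAt (locH_smooth h x₀) ((isOpen_locU x₀).mem_nhds hu)
  rw [fderiv_apply_const (hd.clm_apply (differentiableAt_const a)), fderiv_apply_const hd]

theorem locH_fderiv_smul (hu : u ∈ locU E F B x₀) (v : E) (c : ℂ) (a b : F) :
    fderiv ℝ (locH h x₀) u v a (c • b) = c * fderiv ℝ (locH h x₀) u v a b := by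
  have hd : DifferentiableAt ℝ (locH h x₀) u :=
    diffAt (locH_smooth h x₀) ((isOpen_locU x₀).mem_nhds hu)
  rw [← locH_fderiv hu, ← locH_fderiv hu, funext fun u => locH_smul (h := h) (u := u) c a b,
    fderiv_const_mul ((hd.clm_apply (differentiableAt_const a)).clm_apply
      (differentiableAt_const b))]
  rfl

theorem locH_fderiv_smul_left (hu : u ∈ locU E F B x₀) (v : E) (c : ℂ) (a b : F) :
    fderiv ℝ (locH h x₀) u v (c • a) b = star c * fderiv ℝ (locH h x₀) u v a b := by
  have hd : DifferentiableAt ℝ (locH h x₀) u :=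
    diffAt (locH_smooth h x₀) ((isOpen_locU x₀).mem_nhds hu)
  rw [← locH_fderiv hu, ← locH_fderiv hu, funext fun u => locH_smul_left (h := h) (u := u) c a b,
    fderiv_const_mul ((hd.clm_apply (differentiableAt_const a)).clm_apply
      (differentiableAt_const b))]
  rfl

/-- The Gram matrix of a Hermitian metric in a trivialization. -/
def bgram (h : HermitianMetric E F B) (x₀ : M) (u : E) :
    Matrix (Fin (Module.finrank ℂ F)) (Fin (Module.finrank ℂ F)) ℂ :=
  Matrix.of fun i j => locH h x₀ u (Module.finBasis ℂ F i) (Module.finBasis ℂ F j)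

theorem locH_sum {n : Type*} [Fintype n] (x : n → ℂ) (a : F) (b : n → F) :
    locH h x₀ u a (∑ i, x i • b i) = ∑ i, x i * locH h x₀ u a (b i) := by
  simp only [map_sum, locH_smul]

theorem isUnit_bgram (hu : u ∈ locU E F B x₀) : IsUnit (bgram h x₀ u).det := by
  rw [← Matrix.isUnit_iff_isUnit_det, ← Matrix.mulVec_injective_iff_isUnit]
  refine (injective_iff_map_eq_zero (Matrix.mulVecLin (bgram h x₀ u))).2 fun x hx => ?_
  set v := ∑ i, x i • Module.finBasis ℂ F i with hv
  have h1 : ∀ j, locH h x₀ u (Module.finBasis ℂ F j) v = 0 := fun j => by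
    rw [hv, locH_sum]
    refine Eq.trans (Finset.sum_congr rfl fun i _ => mul_comm _ _) (congrFun hx j)
  have h2 : locH h x₀ u v v = 0 := by
    conv_lhs => rw [locH_symm]; enter [1, 2]; rw [hv]
    rw [locH_sum]
    simp only [locH_symm v, h1]
    simp
  have h3 : v = 0 := by
    by_contra hne
    have := locH_pos (h := h) hu hne
    rw [h2] at this
    simp at this
  exact funext fun i => Fintype.linearIndependent_iff.1 (Module.finBasis ℂ F).linearIndependent x
    (hv ▸ h3) i

/-- The connection form of the Chern connection in a trivialization. -/
def locθ (h : HermitianMetric E F B) (x₀ : M) (u : E) : E →L[ℝ] F →L[ℝ] F :=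
  LinearMap.toContinuousBilinearMap (LinearMap.mk₂ ℝ (fun v b => chernForm h x₀ u v b)
    (fun v v' w => by simp) (fun r v w => by simp) (fun v v' w => by simp)
    (fun r v w => map_real_smul _ r w))

theorem locθ_apply (v : E) (b : F) : locθ h x₀ u v b = chernForm h x₀ u v b := rfl

/-- The matrix of the `(1,0)`-part of the derivative of the Gram matrix. -/
def dgram (h : HermitianMetric E F B) (x₀ : M) (v u : E) :
    Matrix (Fin (Module.finrank ℂ F)) (Fin (Module.finrank ℂ F)) ℂ :=
  Matrix.of fun i j => part10 (fderiv ℝ (fun u => bgram h x₀ u i j) u).toLinearMap v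

theorem locθ_eq (v : E) : chernForm h x₀ u v = Matrix.toLin (Module.finBasis ℂ F)
    (Module.finBasis ℂ F) ((bgram h x₀ u)⁻¹ * dgram h x₀ v u) := rfl

theorem dgram_apply (hu : u ∈ locU E F B x₀) (v : E) (i j : Fin (Module.finrank ℂ F)) :
    dgram h x₀ v u i j = (1 / 2 : ℂ) *
      (fderiv ℝ (locH h x₀) u v (Module.finBasis ℂ F i) (Module.finBasis ℂ F j)
        - Complex.I * fderiv ℝ (locH h x₀) u (mulI E v) (Module.finBasis ℂ F i)
          (Module.finBasis ℂ F j)) := by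
  rw [← locH_fderiv hu, ← locH_fderiv hu]
  rfl

/-- Both sides are sesquilinear in (a, b), and on a basis the equality is H · H⁻¹∂H = ∂H. -/
theorem locH_locθ (hu : u ∈ locU E F B x₀) (v : E) (a b : F) :
    locH h x₀ u a (locθ h x₀ u v b) = (1 / 2 : ℂ) *
      (fderiv ℝ (locH h x₀) u v a b - Complex.I * fderiv ℝ (locH h x₀) u (mulI E v) a b) := by
  have hb : ∀ i j, locH h x₀ u (Module.finBasis ℂ F i) (locθ h x₀ u v (Module.finBasis ℂ F j))
      = dgram h x₀ v u i j := fun i j => by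
    rw [locθ_apply, locθ_eq, Matrix.toLin_self, locH_sum]
    have h1 := congrFun (congrFun (Matrix.mul_nonsing_inv_cancel_left (A := bgram h x₀ u)
      (dgram h x₀ v u) (isUnit_bgram hu)) i) j
    rw [← h1, Matrix.mul_apply]
    exact Finset.sum_congr rfl fun k _ => mul_comm _ _
  have hl : LinearMap.mk₂'ₛₗ (starRingEnd ℂ) (RingHom.id ℂ)
        (fun a b => locH h x₀ u a (locθ h x₀ u v b))
        (fun a a' b => by simp) (fun c a b => by rw [locH_smul_left]; rfl) (fun a b b' => by simp)
        (fun c a b => by rw [locθ_apply, map_smul, locH_smul]; rfl)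
      = LinearMap.mk₂'ₛₗ (starRingEnd ℂ) (RingHom.id ℂ)
        (fun a b => (1 / 2 : ℂ) * (fderiv ℝ (locH h x₀) u v a b
          - Complex.I * fderiv ℝ (locH h x₀) u (mulI E v) a b))
        (fun a a' b => by simp; ring)
        (fun c a b => by
          rw [locH_fderiv_smul_left hu, locH_fderiv_smul_left hu, smul_eq_mul]
          simp only [RCLike.star_def]; ring)
        (fun a b b' => by simp; ring)
        (fun c a b => by
          rw [locH_fderiv_smul hu, locH_fderiv_smul hu, smul_eq_mul, RingHom.id_apply]; ring) := by
    refine (Module.finBasis ℂ F).ext fun i => (Module.finBasis ℂ F).ext fun j => ?_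
    exact (hb i j).trans (dgram_apply hu v i j)
  exact congrArg (fun f => f a b) hl

/-- The entries of H⁻¹ are quotients of determinants by Cramer's rule, with nonvanishing denominator
on `locU`. -/
theorem locθ_smooth (h : HermitianMetric E F B) (x₀ : M) :
    ContDiffOn ℝ ∞ (locθ h x₀) (locU E F B x₀) := by
  refine contDiffOn_clm_apply.2 fun v => contDiffOn_clm_apply.2 fun b => ?_
  have hH := locH_smooth h x₀
  have hdH : ContDiffOn ℝ ∞ (fderiv ℝ (locH h x₀)) (locU E F B x₀) :=
    hH.fderiv_of_isOpen (isOpen_locU x₀) (by simp)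
  have hG : ∀ i j, ContDiffOn ℝ ∞ (fun u => bgram h x₀ u i j) (locU E F B x₀) := fun i j =>
    (hH.clm_apply contDiffOn_const).clm_apply contDiffOn_const
  have hM : ∀ i j, ContDiffOn ℝ ∞ (fun u => dgram h x₀ v u i j) (locU E F B x₀) := fun i j => by
    refine ContDiffOn.congr ?_ fun u hu => dgram_apply hu v i j
    have h1 : ∀ v, ContDiffOn ℝ ∞ (fun u => fderiv ℝ (locH h x₀) u v (Module.finBasis ℂ F i)
      (Module.finBasis ℂ F j)) (locU E F B x₀) := fun v =>
      ((hdH.clm_apply contDiffOn_const).clm_apply contDiffOn_const).clm_apply contDiffOn_const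
    exact contDiffOn_const.mul ((h1 v).sub (contDiffOn_const.mul (h1 _)))
  have hdet : ∀ A : E → Matrix (Fin (Module.finrank ℂ F)) (Fin (Module.finrank ℂ F)) ℂ,
      (∀ i j, ContDiffOn ℝ ∞ (fun u => A u i j) (locU E F B x₀)) →
      ContDiffOn ℝ ∞ (fun u => (A u).det) (locU E F B x₀) := fun A hA => by
    simp only [Matrix.det_apply]
    exact ContDiffOn.sum fun σ _ => ContDiffOn.const_smul _ (contDiffOn_prod fun i _ => hA _ _)
  have hinv : ∀ i j, ContDiffOn ℝ ∞ (fun u => (bgram h x₀ u)⁻¹ i j) (locU E F B x₀) :=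
    fun i j => by
    have h1 : ∀ u, (bgram h x₀ u)⁻¹ i j = ((bgram h x₀ u).det)⁻¹
        * ((bgram h x₀ u).updateRow j (Pi.single i 1)).det := fun u => by
      rw [Matrix.inv_def, Matrix.smul_apply, Matrix.adjugate_apply, Ring.inverse_eq_inv, smul_eq_mul]
    simp only [h1]
    refine ((hdet _ hG).inv fun u hu => (isUnit_bgram hu).ne_zero).mul (hdet _ fun k l => ?_)
    by_cases hk : k = j
    · subst hk
      simpa using contDiffOn_const
    · simpa [Matrix.updateRow_ne hk] using hG k l
  have h2 : ∀ u, locθ h x₀ u v b = ∑ i, (∑ j, (∑ k, (bgram h x₀ u)⁻¹ i k * dgram h x₀ v u k j)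
      * (Module.finBasis ℂ F).repr b j) • Module.finBasis ℂ F i := fun u => by
    rw [locθ_apply, locθ_eq, Matrix.toLin_apply]
    rfl
  simp only [h2]
  exact ContDiffOn.sum fun i _ => ContDiffOn.smul (ContDiffOn.sum fun j _ =>
    (ContDiffOn.sum fun k _ => (hinv i k).mul (hM k j)).mul contDiffOn_const) contDiffOn_const

variable (X : Hyperkahler E M) (h x₀)

variable (F B) in
/-- The hyperkähler structure in the domain of the chart and trivialization at `x₀`. -/
abbrev hkAt (X : Hyperkahler E M) (x₀ : M) : LocalHK E :=
  X.loc x₀ (locU E F B x₀) (isOpen_locU x₀) (locU_subset x₀)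

/-- The local expression of the Hermitian holomorphic bundle in the chart and trivialization
at `x₀`. -/
def bunAt (h : HermitianMetric E F B) (X : Hyperkahler E M) (x₀ : M) :
    LocalBundle (hkAt F B X x₀) F where
  H := locH h x₀
  θ := locθ h x₀
  H_smooth := locH_smooth h x₀
  θ_smooth := locθ_smooth h x₀
  H_smul _ _ := locH_smul
  H_symm _ _ := locH_symm
  H_pos _ hu _ := locH_pos hu
  H_θ _ hu := locH_locθ hu

end LocalHermitian

/-! ### Smoothness of families of forms, coefficient by coefficient. -/

section SmoothForms

variable {E : Type*} [NormedAddCommGroup E] [NormedSpace ℝ E] [FiniteDimensional ℝ E]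
  {F : Type*} [NormedAddCommGroup F] [NormedSpace ℝ F] [FiniteDimensional ℝ F] {p : ℕ}
  {G : Type*} [NormedAddCommGroup G] [NormedSpace ℝ G]

/-- Multilinear expansion of a form in a basis. -/
theorem form_expand (f : E [⋀^Fin p]→L[ℝ] F) (v : Fin p → E) :
    f v = ∑ r : Fin p → Fin (Module.finrank ℝ E),
        (∏ i, (Module.finBasis ℝ E).repr (v i) (r i)) • f (fun i => Module.finBasis ℝ E (r i)) := by
  have h1 : f v = f.toAlternatingMap.toMultilinearMap
      (fun i => ∑ j, (Module.finBasis ℝ E).repr (v i) j • Module.finBasis ℝ E j) := by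
    simp only [Module.Basis.sum_repr]
    rfl
  rw [h1, MultilinearMap.map_sum]
  refine Finset.sum_congr rfl fun r _ => ?_
  rw [MultilinearMap.map_smul_univ]
  rfl

/-- A family of forms is smooth if its coefficients are. -/
theorem contDiffWithinAt_form {f : G → E [⋀^Fin p]→L[ℝ] F} {s : Set G} {x : G}
    (hf : ∀ v, ContDiffWithinAt ℝ ∞ (fun u => f u v) s x) : ContDiffWithinAt ℝ ∞ f s x := by
  let T : (E [⋀^Fin p]→L[ℝ] F) →ₗ[ℝ] ((Fin p → Fin (Module.finrank ℝ E)) → F) :=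
    { toFun := fun f r => f fun i => Module.finBasis ℝ E (r i)
      map_add' := fun _ _ => rfl
      map_smul' := fun _ _ => rfl }
  have hT : LinearMap.ker T = ⊥ := by
    refine LinearMap.ker_eq_bot'.2 fun f hf => ?_
    ext v
    rw [form_expand]
    exact Finset.sum_eq_zero fun r _ => by
      rw [show f (fun i => Module.finBasis ℝ E (r i)) = 0 from congrFun hf r, smul_zero]
  -- The coefficients in a basis determine the form, and a linear left inverse recovers it from a
  -- finite product of copies of F; its continuity is automatic.
  obtain ⟨S, hS⟩ := T.exists_leftInverse_of_injective hT
  have h1 : f = fun u => LinearMap.toContinuousLinearMap S (T (f u)) := by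
    funext u
    exact (congrArg (fun k => k (f u)) hS).symm
  rw [h1]
  refine (ContinuousLinearMap.contDiff _).comp_contDiffWithinAt ?_
  exact contDiffWithinAt_pi.2 fun r => hf _

theorem contDiffWithinAt_form_apply {f : G → E [⋀^Fin p]→L[ℝ] F} {v : G → Fin p → E}
    {s : Set G} {x : G} (hf : ContDiffWithinAt ℝ ∞ f s x)
    (hv : ∀ i, ContDiffWithinAt ℝ ∞ (fun u => v u i) s x) :
    ContDiffWithinAt ℝ ∞ (fun u => f u (v u)) s x := by
  have h : ∀ u, f u (v u) = _ := fun u => form_expand (f u) (v u)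
  simp only [h]
  refine ContDiffWithinAt.sum fun r _ => ContDiffWithinAt.smul ?_ ?_
  · refine contDiffWithinAt_prod fun i _ => ?_
    exact (LinearMap.toContinuousLinearMap ((Module.finBasis ℝ E).coord (r i))).contDiff
      |>.comp_contDiffWithinAt (hv i)
  · exact (ContinuousLinearMap.contDiff (ContinuousAlternatingMap.apply ℝ E F
      (fun i => Module.finBasis ℝ E (r i)))).comp_contDiffWithinAt hf

theorem contDiffWithinAt_form_comp {f : G → E [⋀^Fin p]→L[ℝ] F} {A : G → E →L[ℝ] E}
    {s : Set G} {x : G} (hf : ContDiffWithinAt ℝ ∞ f s x) (hA : ContDiffWithinAt ℝ ∞ A s x) :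
    ContDiffWithinAt ℝ ∞ (fun u => (f u).compContinuousLinearMap (A u)) s x :=
  contDiffWithinAt_form fun v => contDiffWithinAt_form_apply (v := fun u i => A u (v i)) hf
    fun _ => hA.clm_apply contDiffWithinAt_const

end SmoothForms

/-! ### Changes of chart and trivialization for forms, metrics and endomorphisms. -/

section Transition

variable {E : Type*} [NormedAddCommGroup E] [NormedSpace ℂ E] [FiniteDimensional ℂ E]
  {M : Type*} [TopologicalSpace M] [ChartedSpace E M] [IsManifold 𝓘(ℂ, E) ω M]
  {F : Type*} [NormedAddCommGroup F] [NormedSpace ℂ F] [FiniteDimensional ℂ F]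
  {B : M → Type*} [TopologicalSpace (TotalSpace F B)]
  [∀ x, AddCommGroup (B x)] [∀ x, Module ℂ (B x)] [∀ x, TopologicalSpace (B x)]
  [FiberBundle F B] [VectorBundle ℂ F B] {p : ℕ}

variable (F) in
/-- The expression of a form in the preferred chart and trivialization at `x₀`, as a family of
continuous alternating maps. -/
def locF (η : Form E B p) (x₀ : M) (u : E) : E [⋀^Fin p]→L[ℝ] F := toCont (localForm F η x₀ u)

theorem locF_apply (η : Form E B p) (x₀ : M) (u : E) (v : Fin p → E) : locF F η x₀ u v
    = bcoframe F B x₀ (chartPoint x₀ u)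
      (η (chartPoint x₀ u) fun i => chartFrame x₀ (chartPoint x₀ u) (v i)) := rfl

variable (F B) in
/-- The transition from the trivialization at `y` to the trivialization at `x₀`. -/
def btransC (x₀ y : M) (u : E) : F →L[ℂ] F := LinearMap.toContinuousLinearMap
  (bcoframe F B x₀ (chartPoint x₀ u) ∘ₗ bframe F B y (chartPoint x₀ u))

variable (F B) in
/-- The transition from the trivialization at `y` to the trivialization at `x₀`, as a real-linear
map. -/
def btrans (x₀ y : M) (u : E) : F →L[ℝ] F := (btransC F B x₀ y u).restrictScalars ℝ

theorem btrans_apply (x₀ y : M) (u : E) (b : F) : btrans F B x₀ y u b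
    = bcoframe F B x₀ (chartPoint x₀ u) (bframe F B y (chartPoint x₀ u) b) := rfl

theorem btrans_smul (x₀ y : M) (u : E) (c : ℂ) (b : F) :
    btrans F B x₀ y u (c • b) = c • btrans F B x₀ y u b := map_smul (btransC F B x₀ y u) c b

section

variable {x₀ y : M} {u : E} (hu : u ∈ locU E F B x₀)
  (hy : chartPoint x₀ u ∈ (extChartAt 𝓘(ℝ, E) y).source)
  (hb : chartPoint x₀ u ∈ (trivializationAt F B y).baseSet)
include hu hb

theorem bframe_btrans (b : F) : bframe F B x₀ (chartPoint x₀ u) (btrans F B x₀ y u b)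
    = bframe F B y (chartPoint x₀ u) b := bframe_bcoframe hu.2 _

theorem btrans_surjective : Function.Surjective (btrans F B x₀ y u) := fun b =>
  ⟨bcoframe F B y (chartPoint x₀ u) (bframe F B x₀ (chartPoint x₀ u) b), by
    rw [btrans_apply, bframe_bcoframe hb, bcoframe_bframe hu.2]⟩

include hy

theorem eventually_trans : ∀ᶠ u' in nhds u, u' ∈ locU E F B x₀ ∧
      chartPoint x₀ u' ∈ (extChartAt 𝓘(ℝ, E) y).source ∧
      chartPoint x₀ u' ∈ (trivializationAt F B y).baseSet :=
  Filter.Eventually.and ((isOpen_locU x₀).mem_nhds hu)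
    (((continuousOn_chartPoint x₀).continuousAt (target_nhds hu.1)).eventually
      (((isOpen_extChartAt_source y).inter
        (trivializationAt F B y).open_baseSet).mem_nhds ⟨hy, hb⟩))

theorem transition_mem_locU : transition x₀ y u ∈ locU E F B y :=
  ⟨transition_mem hu.1 hy, by
    rw [Set.mem_preimage, chartPoint_transition hu.1 hy]; exact hb⟩

theorem locF_transition (η : Form E B p) : locF F η x₀ u
    = (btrans F B x₀ y u).compContinuousAlternatingMap
      ((locF F η y (transition x₀ y u)).compContinuousLinearMap (fderiv ℝ (transition x₀ y) u)) := by
  ext v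
  rw [ContinuousLinearMap.compContinuousAlternatingMap_coe, Function.comp_apply,
    ContinuousAlternatingMap.compContinuousLinearMap_apply, btrans_apply, locF_apply, locF_apply,
    chartPoint_transition hu.1 hy, bframe_bcoframe hb]
  simp only [chartFrame_transition hu.1 hy, Function.comp_apply]

theorem locH_transition (h : HermitianMetric E F B) (a b : F) :
    locH h x₀ u (btrans F B x₀ y u a) (btrans F B x₀ y u b)
      = locH h y (transition x₀ y u) a b := by
  rw [locH_apply, bframe_btrans hu hb, bframe_btrans hu hb, locH_apply,
    chartPoint_transition hu.1 hy]

theorem locMet_transition (g : Metric E M) (v w : E) : locMet g x₀ u v w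
    = locMet g y (transition x₀ y u) (fderiv ℝ (transition x₀ y : E → E) u v)
      (fderiv ℝ (transition x₀ y : E → E) u w) := by
  rw [locMet_apply, locMet_apply, chartPoint_transition hu.1 hy, chartFrame_transition hu.1 hy,
    chartFrame_transition hu.1 hy]

theorem transition_locEnd
    (A : ∀ x : M, TangentSpace 𝓘(ℝ, E) x →L[ℝ] TangentSpace 𝓘(ℝ, E) x) (v : E) :
    fderiv ℝ (transition x₀ y : E → E) u (locEnd A x₀ u v)
      = locEnd A y (transition x₀ y u) (fderiv ℝ (transition x₀ y : E → E) u v) := by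
  have h1 := chartFrame_transition hu.1 hy (locEnd A x₀ u v)
  rw [chartFrame_locEnd hu.1, chartFrame_transition hu.1 hy] at h1
  have h2 : ∀ w, locEnd A y (transition x₀ y u) w = chartCoframe y (chartPoint x₀ u)
      (A (chartPoint x₀ u) (chartFrame y (chartPoint x₀ u) w)) := fun w => by
    rw [← chartPoint_transition hu.1 hy]; rfl
  rw [h2, h1, chartCoframe_chartFrame hy]

theorem transition_surjective : Function.Surjective (fderiv ℝ (transition x₀ y : E → E) u) :=
  fun v => by
  refine ⟨chartCoframe x₀ (chartPoint x₀ u) (chartFrame y (chartPoint x₀ u) v), ?_⟩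
  have h1 := chartFrame_transition hu.1 hy
    (chartCoframe x₀ (chartPoint x₀ u) (chartFrame y (chartPoint x₀ u) v))
  rw [chartFrame_chartCoframe (chartPoint_mem hu.1)] at h1
  have h2 := congrArg (chartCoframe y (chartPoint x₀ u)) h1
  rw [chartCoframe_chartFrame hy, chartCoframe_chartFrame hy] at h2
  exact h2.symm

variable [ContMDiffVectorBundle ω F B 𝓘(ℂ, E)]

/-- Holomorphy of the bundle: the transition is a coordinate change of the vector bundle composed
with the inverse chart. -/
theorem btransC_holomorphic : ContDiffAt ℂ ω (btransC F B x₀ y : E → F →L[ℂ] F) u := by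
  have h1 := contMDiffAt_coordChangeL (n := ω) (IB := 𝓘(ℂ, E)) (F := F) (E := B)
    (e := trivializationAt F B y) (e' := trivializationAt F B x₀) hb hu.2
  have h2 : ContMDiffAt 𝓘(ℂ, E) 𝓘(ℂ, E) ω (chartPoint x₀ : E → M) u :=
    (contMDiffOn_extChartAt_symm (I := 𝓘(ℂ, E)) (n := ω) x₀).contMDiffAt (target_nhds hu.1)
  have h3 := contMDiffAt_iff_contDiffAt.1 (ContMDiffAt.comp u h1 h2)
  refine h3.congr_of_eventuallyEq ?_
  filter_upwards [eventually_trans hu hy hb] with u' hu'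
  ext b
  refine Eq.symm ?_
  refine (Trivialization.coordChangeL_apply (R := ℂ) (trivializationAt F B y)
    (trivializationAt F B x₀) ⟨hu'.2.2, hu'.1.2⟩ b).trans ?_
  change _ = (trivializationAt F B x₀).linearMapAt ℂ (chartPoint x₀ u')
    ((trivializationAt F B y).symmₗ ℂ (chartPoint x₀ u') b)
  rw [Trivialization.coe_linearMapAt_of_mem _ hu'.1.2, Trivialization.coe_symmₗ _ hu'.2.2]

theorem btrans_diff : DifferentiableAt ℝ (btrans F B x₀ y : E → F →L[ℝ] F) u := by
  have h := ((btransC_holomorphic hu hy hb).differentiableAt (by simp)).restrictScalars ℝ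
  exact (ContinuousLinearMap.restrictScalarsL ℂ F F ℝ ℝ).differentiableAt.comp u h

theorem btrans_smooth : ContDiffAt ℝ ∞ (btrans F B x₀ y : E → F →L[ℝ] F) u := by
  have h := ((btransC_holomorphic hu hy hb).restrict_scalars ℝ).of_le (m := ∞) le_top
  exact (ContinuousLinearMap.restrictScalarsL ℂ F F ℝ ℝ).contDiff.contDiffAt.comp u h

theorem fderiv_btrans_I (v : E) (b : F) : fderiv ℝ (btrans F B x₀ y : E → F →L[ℝ] F) u (mulI E v) b
    = Complex.I • fderiv ℝ (btrans F B x₀ y : E → F →L[ℝ] F) u v b := by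
  have h := (btransC_holomorphic hu hy hb).differentiableAt (by simp)
  have h1 : HasFDerivAt (btrans F B x₀ y : E → F →L[ℝ] F)
      ((ContinuousLinearMap.restrictScalarsL ℂ F F ℝ ℝ) ∘L
        (fderiv ℂ (btransC F B x₀ y : E → F →L[ℂ] F) u).restrictScalars ℝ) u :=
    (ContinuousLinearMap.restrictScalarsL ℂ F F ℝ ℝ).hasFDerivAt.comp u
      (h.hasFDerivAt.restrictScalars ℝ)
  rw [h1.fderiv]
  exact congrArg (fun k : F →L[ℂ] F => k b)
    (map_smul (fderiv ℂ (btransC F B x₀ y : E → F →L[ℂ] F) u) Complex.I v)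

end

end Transition

/-! ### Comparison of the connection operators with their coordinate expressions. -/

section LocalOperators

variable {E F : Type*} [NormedAddCommGroup E] [NormedSpace ℝ E] [FiniteDimensional ℝ E]
  [NormedAddCommGroup F] [NormedSpace ℂ F]

/-- The form `θ ∧ η`, before alternatization. -/
def thetaForm {p : ℕ} (θ : E →L[ℝ] F →L[ℝ] F) (η : E [⋀^Fin p]→L[ℝ] F) :
    E →L[ℝ] E [⋀^Fin p]→L[ℝ] F :=
  (ContinuousLinearMap.compContinuousAlternatingMapCLM ℝ E F F (Fin p)).flip η ∘L θ

theorem thetaForm_apply {p : ℕ} (θ : E →L[ℝ] F →L[ℝ] F) (η : E [⋀^Fin p]→L[ℝ] F) (v : E) :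
    thetaForm θ η v = (θ v).compContinuousAlternatingMap η := rfl

namespace LocalBundle

variable {D : LocalHK E} (B : LocalBundle D F) {u : E} {p : ℕ} {η : E → E [⋀^Fin p]→L[ℝ] F}

/-- The local expression of `∇^{1,0}`. -/
def nabla10L (p : ℕ) (η : E → E [⋀^Fin p]→L[ℝ] F) (u : E) : E [⋀^Fin (p + 1)]→L[ℝ] F :=
  (1 / 2 : ℂ) • (B.opD p (fun _ => ContinuousLinearMap.id ℝ E) η u
    - Complex.I • B.opD p (fun _ => D.I) η u)

/-- When v, w ↦ Γ(Av)w is symmetric, the Christoffel terms alternate to zero and D_A becomes an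
ordinary first order operator in coordinates. It applies to A = 1 and A = I. -/
theorem opD_eq {A : E →L[ℝ] E} (hA : ∀ v w, D.Gam u (A v) w = D.Gam u (A w) v) :
    B.opD p (fun _ => A) η u = alt p (fderiv ℝ η u ∘L A + thetaForm (B.θ u ∘L A) (η u)) := by
  have h := alt_der_symm (η u) (D.Gam u ∘L A) hA
  rw [opD, ← sub_zero (alt p (_ + _)), ← h, ← alt_sub]
  congr 1
  ext1 v
  simp only [ContinuousLinearMap.comp_apply, add_apply, sub_apply, nab_apply, conn_apply,
    thetaForm_apply, ContinuousLinearMap.flip_apply]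
  abel

/-- θ has type (1,0), so it drops out of the (0,1)-part; what remains is ∂̄ on components. -/
theorem dbarL_eq (hu : u ∈ D.U) : B.dbarL p η u
    = alt p ((1 / 2 : ℂ) • (fderiv ℝ η u + Complex.I • (fderiv ℝ η u ∘L D.I))) := by
  rw [dbarL, opD_eq B (A := ContinuousLinearMap.id ℝ E) (fun v w => D.Gam_symm hu v w),
    opD_eq B (fun v w => by rw [D.Gam_I_left hu, D.Gam_I_left hu, D.Gam_symm hu]), ← alt_smul,
    ← alt_add, ← alt_smul]
  congr 2
  ext v m
  simp only [add_apply, smul_apply, ContinuousLinearMap.comp_apply, thetaForm_apply,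
    ContinuousAlternatingMap.add_apply, ContinuousAlternatingMap.smul_apply,
    ContinuousLinearMap.compContinuousAlternatingMap_coe, Function.comp_apply,
    ContinuousLinearMap.id_apply, B.θ_I hu, smul_add, smul_smul, Complex.I_mul_I]
  module

theorem nabla10L_eq (hu : u ∈ D.U) : B.nabla10L p η u
    = alt p ((1 / 2 : ℂ) • (fderiv ℝ η u - Complex.I • (fderiv ℝ η u ∘L D.I))
      + thetaForm (B.θ u) (η u)) := by
  rw [nabla10L, opD_eq B (A := ContinuousLinearMap.id ℝ E) (fun v w => D.Gam_symm hu v w),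
    opD_eq B (fun v w => by rw [D.Gam_I_left hu, D.Gam_I_left hu, D.Gam_symm hu]), ← alt_smul,
    ← alt_sub, ← alt_smul]
  congr 1
  ext v m
  simp only [add_apply, sub_apply, smul_apply, ContinuousLinearMap.comp_apply, thetaForm_apply,
    ContinuousAlternatingMap.add_apply, ContinuousAlternatingMap.sub_apply,
    ContinuousAlternatingMap.smul_apply,
    ContinuousLinearMap.compContinuousAlternatingMap_coe, Function.comp_apply,
    ContinuousLinearMap.id_apply, B.θ_I hu, smul_add, smul_smul, Complex.I_mul_I]
  module

/-- Covariant derivative of the composition of a form with a parallel endomorphism. -/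
theorem nab_comp {A : E → E →L[ℝ] E} (hA : D.Par A) (hη : ContDiffOn ℝ ∞ η D.U) (hu : u ∈ D.U)
    (v : E) : B.nab p (fun u => (η u).compContinuousLinearMap (A u)) u v
      = (B.nab p η u v).compContinuousLinearMap (A u) := by
  have h := (LocalHK.diff hη hu).hasFDerivAt.continuousAlternatingMapCompContinuousLinearMap
    (hA.diff hu).hasFDerivAt
  have h1 : fderiv ℝ (fun u => (η u).compContinuousLinearMap (A u)) u v
      = (fderiv ℝ η u v).compContinuousLinearMap (A u)
        + (η u).fderivCompContinuousLinearMap (A u) (fderiv ℝ A u v) := by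
    rw [h.fderiv, add_comm]
    first | rfl | (rw [add_comm]; rfl)
  have h2 : fderiv ℝ A u v = A u ∘L D.Gam u v - D.Gam u v ∘L A u := by
    ext w
    exact hA.par u hu v w
  have h3 : (der p (D.Gam u v) (η u)).compContinuousLinearMap (A u)
      = (η u).fderivCompContinuousLinearMap (A u) (D.Gam u v ∘L A u) := by
    change ((η u).fderivCompContinuousLinearMap _ _).compContinuousLinearMap _ = _
    rw [fderivComp_comp, ContinuousLinearMap.id_comp]
  rw [nab_apply, nab_apply, conn_apply, conn_apply, h1, h2, map_sub, der_comp]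
  have h4 : ∀ a b c : E [⋀^Fin p]→L[ℝ] F, (a + (b - c)).compContinuousLinearMap (A u)
      = a.compContinuousLinearMap (A u) + (b.compContinuousLinearMap (A u)
        - c.compContinuousLinearMap (A u)) := fun a b c => rfl
  rw [h4, h3]
  have h5 : (B.θ u v).compContinuousAlternatingMap ((η u).compContinuousLinearMap (A u))
    = ((B.θ u v).compContinuousAlternatingMap (η u)).compContinuousLinearMap (A u) := rfl
  rw [h5]
  abel

/-- J is parallel, so conjugating by J affects only the direction of differentiation: ∇^{1,0} in the
direction -Jv is (∇_{-Jv} - i∇_{-IJv})/2 = (i∇_{Kv} - ∇_{Jv})/2. -/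
theorem dbarJL_eq (hη : ContDiffOn ℝ ∞ η D.U) (hu : u ∈ D.U) : B.dbarJL p η u
    = (B.nabla10L p (fun u => (η u).compContinuousLinearMap (D.J u)) u).compContinuousLinearMap
      (-D.J u) := by
  have h1 : B.nabla10L p (fun u => (η u).compContinuousLinearMap (D.J u)) u = alt p ((1 / 2 : ℂ) •
      (B.nab p (fun u => (η u).compContinuousLinearMap (D.J u)) u
        - Complex.I • (B.nab p (fun u => (η u).compContinuousLinearMap (D.J u)) u ∘L D.I))) := by
    rw [nabla10L, alt_smul, alt_sub, alt_smul]; rfl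
  rw [h1, alt_compContinuousLinearMap, dbarJL_eq_alt]
  congr 1
  ext1 v
  have h2 : ∀ ζ : E [⋀^Fin p]→L[ℝ] F,
      (ζ.compContinuousLinearMap (D.J u)).compContinuousLinearMap (-D.J u) = ζ := fun ζ => by
    ext m
    refine congrArg ζ (funext fun i => ?_)
    change D.J u (-D.J u (m i)) = m i
    rw [map_neg, D.J_sq u hu, neg_neg]
  have h3 : ∀ (a b : E [⋀^Fin p]→L[ℝ] F) (A : E →L[ℝ] E),
      ((1 / 2 : ℂ) • (a - Complex.I • b)).compContinuousLinearMap A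
        = (1 / 2 : ℂ) • (a.compContinuousLinearMap A
          - Complex.I • b.compContinuousLinearMap A) := fun a b A => rfl
  simp only [ContinuousLinearMap.comp_apply, smul_apply, sub_apply, neg_apply,
    ContinuousAlternatingMap.compContinuousLinearMapCLM_apply]
  rw [h3, nab_comp B D.par_J hη hu, nab_comp B D.par_J hη hu, h2, h2, psiJL_apply, D.K_apply,
    map_neg, map_neg, map_neg]
  module

end LocalBundle

end LocalOperators

/-! ### Global forms through their local expressions. -/

section GlobalOperators

variable {E : Type*} [NormedAddCommGroup E] [NormedSpace ℂ E] [FiniteDimensional ℂ E]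
  {M : Type*} [TopologicalSpace M] [ChartedSpace E M] [IsManifold 𝓘(ℂ, E) ω M]
  {F : Type*} [NormedAddCommGroup F] [NormedSpace ℂ F] [FiniteDimensional ℂ F]
  {B : M → Type*} [TopologicalSpace (TotalSpace F B)]
  [∀ x, AddCommGroup (B x)] [∀ x, Module ℂ (B x)] [∀ x, TopologicalSpace (B x)]
  [FiberBundle F B] [VectorBundle ℂ F B] {p q : ℕ}

theorem apply_eq_of_locF {α β : Form E B p} {x : M}
    (h : locF F α x (extChartAt 𝓘(ℝ, E) x x) = locF F β x (extChartAt 𝓘(ℝ, E) x x)) :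
    α x = β x := by
  -- The point with the central coordinates equals `x` only propositionally and the fibre depends on
  -- it, so the point is generalized before the equality is substituted.
  have key : ∀ P : M, P = x → α P = β P → α x = β x := by
    rintro P rfl h
    exact h
  refine key _ (chartPoint_center (E := E) x) ?_
  ext v
  have hm := center_mem_locU (E := E) (F := F) (B := B) x
  have h1 := congrArg (fun f : E [⋀^Fin p]→L[ℝ] F => bframe F B x
    (chartPoint x (extChartAt 𝓘(ℝ, E) x x)) (f fun i =>
      chartCoframe x (chartPoint x (extChartAt 𝓘(ℝ, E) x x)) (v i))) h
  simpa only [locF_apply, chartFrame_chartCoframe (chartPoint_mem hm.1), bframe_bcoframe hm.2]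
    using h1

theorem eq_of_locF {α β : Form E B p}
    (h : ∀ x : M, locF F α x (extChartAt 𝓘(ℝ, E) x x) = locF F β x (extChartAt 𝓘(ℝ, E) x x)) :
    α = β :=
  funext fun x => apply_eq_of_locF (h x)

section

variable {x₀ : M} {u : E}

theorem mem_source_self (x₀ : M) (u : E) :
    chartPoint x₀ u ∈ (extChartAt 𝓘(ℝ, E) (chartPoint x₀ u)).source := mem_extChartAt_source _

theorem mem_baseSet_self (x₀ : M) (u : E) :
    chartPoint x₀ u ∈ (trivializationAt F B (chartPoint x₀ u)).baseSet :=
  FiberBundle.mem_baseSet_trivializationAt' _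

/-- Transformation of the local expression of a form given by its values in the preferred charts. -/
theorem locF_ofLocal (hu : u ∈ locU E F B x₀) {ζ : Form E B p} {α : E [⋀^Fin p]→ₗ[ℝ] F}
    (h : ζ (chartPoint x₀ u) = ofLocal (chartPoint x₀ u) α) :
    locF F ζ x₀ u = (btrans F B x₀ (chartPoint x₀ u) u).compContinuousAlternatingMap
      ((toCont α).compContinuousLinearMap (fderiv ℝ (transition x₀ (chartPoint x₀ u)) u)) := by
  ext v
  rw [locF_apply, h, ContinuousLinearMap.compContinuousAlternatingMap_coe, Function.comp_apply,
    ContinuousAlternatingMap.compContinuousLinearMap_apply, btrans_apply]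
  refine congrArg (fun w => bcoframe F B x₀ (chartPoint x₀ u)
    (bframe F B (chartPoint x₀ u) (chartPoint x₀ u) (α w))) (funext fun i => ?_)
  have h1 := chartFrame_transition hu.1 (mem_source_self x₀ u) (v i)
  change chartCoframe _ _ (chartFrame x₀ (chartPoint x₀ u) (v i)) = _
  rw [h1, chartCoframe_chartFrame (mem_source_self x₀ u)]
  rfl

theorem IsZeroType.locF {η : Form E B p} (hη : IsZeroType η) (hu : u ∈ locU E F B x₀) :
    locF F η x₀ u ∈ zForms F (mulI E) p := by
  intro v i
  rw [locF_apply, locF_apply]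
  have h1 := hη (chartPoint x₀ u) (fun i => chartFrame x₀ (chartPoint x₀ u) (v i)) i
  have h2 : (fun j => chartFrame x₀ (chartPoint x₀ u) (Function.update v i (mulI E (v i)) j))
      = Function.update (fun i => chartFrame x₀ (chartPoint x₀ u) (v i)) i
        (tangentI (chartPoint x₀ u) (chartFrame x₀ (chartPoint x₀ u) (v i))) := funext fun j => by
    by_cases hj : j = i
    · subst hj; simp [chartFrame_I hu.1]
    · simp [Function.update_of_ne hj]
  rw [h2, h1, map_neg, map_smul]

theorem zeroType_of_locF {η : Form E B p} (hm : u ∈ locU E F B x₀)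
    (h : QuatDolbeault.locF F η x₀ u ∈ zForms F (mulI E) p)
    (v : Fin p → TangentSpace 𝓘(ℝ, E) (chartPoint x₀ u)) (i : Fin p) :
    η (chartPoint x₀ u) (Function.update v i (tangentI (chartPoint x₀ u) (v i)))
      = -(Complex.I • η (chartPoint x₀ u) v) := by
  have h1 := congrArg (bframe F B x₀ (chartPoint x₀ u)) (h (fun i => chartCoframe x₀
    (chartPoint x₀ u) (v i)) i)
  rw [map_neg, map_smul, locF_apply, locF_apply, bframe_bcoframe hm.2, bframe_bcoframe hm.2] at h1
  simp only [chartFrame_chartCoframe (chartPoint_mem hm.1)] at h1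
  rw [← h1]
  refine congrArg (η (chartPoint x₀ u)) (funext fun j => ?_)
  by_cases hj : j = i
  · subst hj; simp [chartFrame_I hm.1, chartFrame_chartCoframe (chartPoint_mem hm.1)]
  · simp [Function.update_of_ne hj, chartFrame_chartCoframe (chartPoint_mem hm.1)]

theorem isZeroType_of_locF {η : Form E B p}
    (h : ∀ x : M, QuatDolbeault.locF F η x (extChartAt 𝓘(ℝ, E) x x) ∈ zForms F (mulI E) p) :
    IsZeroType η := by
  intro x
  have key : ∀ P : M, P = x → (∀ (v : Fin p → TangentSpace 𝓘(ℝ, E) P) (i : Fin p),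
      η P (Function.update v i (tangentI P (v i))) = -(Complex.I • η P v)) →
      (∀ (v : Fin p → TangentSpace 𝓘(ℝ, E) x) (i : Fin p),
        η x (Function.update v i (tangentI x (v i))) = -(Complex.I • η x v)) := by
    rintro P rfl h
    exact h
  exact key _ (chartPoint_center (E := E) x) fun v i =>
    zeroType_of_locF (center_mem_locU (E := E) (F := F) (B := B) x) (h x) v i

variable [ContMDiffVectorBundle ω F B 𝓘(ℂ, E)]

/-- `IsSmoothForm` only asks for smoothness at the centres of the preferred charts; near any other
point the local expression is pulled back from the chart centred there. -/
theorem IsSmoothForm.locF {η : Form E B p} (hη : IsSmoothForm F η) (x₀ : M) :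
    ContDiffOn ℝ ∞ (locF F η x₀) (locU E F B x₀) := by
  intro u hu
  refine ContDiffAt.contDiffWithinAt ?_
  set y := chartPoint x₀ u with hy
  have hy : chartPoint x₀ u ∈ (extChartAt 𝓘(ℝ, E) y).source := mem_source_self x₀ u
  have hb : chartPoint x₀ u ∈ (trivializationAt F B y).baseSet := mem_baseSet_self x₀ u
  have hφ : ContDiffAt ℝ ∞ (transition x₀ y : E → E) u :=
    ((transition_holomorphic hu.1 hy).restrict_scalars ℝ).of_le le_top
  have hdφ : ContDiffAt ℝ ∞ (fderiv ℝ (transition x₀ y : E → E)) u :=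
    hφ.fderiv_right (by simp)
  have h1 : ContDiffAt ℝ ∞ (QuatDolbeault.locF F η y) (transition x₀ y u) := hη y
  have h2 : ContDiffAt ℝ ∞ (fun u => (QuatDolbeault.locF F η y (transition x₀ y u))
      |>.compContinuousLinearMap (fderiv ℝ (transition x₀ y) u)) u := by
    rw [← contDiffWithinAt_univ]
    exact contDiffWithinAt_form_comp (h1.comp u hφ).contDiffWithinAt hdφ.contDiffWithinAt
  have h3 : ContDiffAt ℝ ∞ (fun u => (btrans F B x₀ y u).compContinuousAlternatingMap
      ((QuatDolbeault.locF F η y (transition x₀ y u)).compContinuousLinearMap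
        (fderiv ℝ (transition x₀ y) u))) u := by
    rw [← contDiffWithinAt_univ] at h2 ⊢
    refine contDiffWithinAt_form fun v => ?_
    exact (btrans_smooth hu hy hb).contDiffWithinAt.clm_apply
      (contDiffWithinAt_form_apply h2 fun _ => contDiffWithinAt_const)
  refine h3.congr_of_eventuallyEq ?_
  filter_upwards [eventually_trans hu hy hb] with u' hu'
  exact locF_transition hu'.1 hu'.2.1 hu'.2.2 η

theorem isSmoothForm_of_locF {η : Form E B p}
    (h : ∀ x₀ : M, ContDiffOn ℝ ∞ (QuatDolbeault.locF F η x₀) (locU E F B x₀)) :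
    IsSmoothForm F η :=
  fun x₀ => (h x₀).contDiffAt ((isOpen_locU x₀).mem_nhds (center_mem_locU x₀))

variable {y : M} (hu : u ∈ locU E F B x₀)
  (hy : chartPoint x₀ u ∈ (extChartAt 𝓘(ℝ, E) y).source)
  (hb : chartPoint x₀ u ∈ (trivializationAt F B y).baseSet)
include hu hy hb

theorem fderiv_locF {η : Form E B p} (hη : IsSmoothForm F η) (v : E) :
    fderiv ℝ (locF F η x₀) u v
      = (fderiv ℝ (btrans F B x₀ y) u v).compContinuousAlternatingMap
          ((locF F η y (transition x₀ y u)).compContinuousLinearMap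
            (fderiv ℝ (transition x₀ y) u))
        + (btrans F B x₀ y u).compContinuousAlternatingMap
          ((fderiv ℝ (locF F η y) (transition x₀ y u)
            (fderiv ℝ (transition x₀ y : E → E) u v)).compContinuousLinearMap
            (fderiv ℝ (transition x₀ y) u)
          + (locF F η y (transition x₀ y u)).fderivCompContinuousLinearMap
            (fderiv ℝ (transition x₀ y) u) (fderiv ℝ (fderiv ℝ (transition x₀ y)) u v)) := by
  have hφ : ContDiffAt ℝ ∞ (transition x₀ y : E → E) u :=
    ((transition_holomorphic hu.1 hy).restrict_scalars ℝ).of_le le_top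
  have hd : DifferentiableAt ℝ (locF F η y) (transition x₀ y u) :=
    diffAt (hη.locF y) ((isOpen_locU y).mem_nhds (transition_mem_locU hu hy hb))
  have h1 : locF F η x₀ =ᶠ[nhds u] fun u => (btrans F B x₀ y u).compContinuousAlternatingMap
      ((locF F η y (transition x₀ y u)).compContinuousLinearMap (fderiv ℝ (transition x₀ y) u)) := by
    filter_upwards [eventually_trans hu hy hb] with u' hu'
    exact locF_transition hu'.1 hu'.2.1 hu'.2.2 η
  have h2 := (hd.hasFDerivAt.comp u (hφ.differentiableAt (by simp)).hasFDerivAt)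
    |>.continuousAlternatingMapCompContinuousLinearMap (differentiableAt_fderiv hφ).hasFDerivAt
  have h3 := (ContinuousLinearMap.compContinuousAlternatingMapCLM ℝ E F F (Fin p))
    |>.hasFDerivAt_of_bilinear (btrans_diff hu hy hb).hasFDerivAt h2
  rw [h1.fderiv_eq]
  refine (congrArg (fun k => k v) h3.fderiv).trans ?_
  exact add_comm _ _

/-- Transformation of `θ` under a holomorphic change of frame. -/
theorem locθ_transition (h : HermitianMetric E F B) (v : E) (b : F) :
    locθ h x₀ u v (btrans F B x₀ y u b) + fderiv ℝ (btrans F B x₀ y) u v b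
      = btrans F B x₀ y u (locθ h y (transition x₀ y u)
        (fderiv ℝ (transition x₀ y : E → E) u v) b) := by
  have hm := transition_mem_locU hu hy hb
  have hφ := hasFDerivAt_transition hu.1 hy
  have hA := btrans_diff hu hy hb
  have hH : DifferentiableAt ℝ (locH h x₀) u :=
    diffAt (locH_smooth h x₀) ((isOpen_locU x₀).mem_nhds hu)
  have hHy : DifferentiableAt ℝ (locH h y) (transition x₀ y u) :=
    diffAt (locH_smooth h y) ((isOpen_locU y).mem_nhds hm)
  -- Differentiate the transformation rule of the Gram form, H_{x₀}(Aa, Ab) = H_y(a, b), with A the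
  -- change of frame.
  have key : ∀ v a b, fderiv ℝ (locH h x₀) u v (btrans F B x₀ y u a) (btrans F B x₀ y u b)
      + locH h x₀ u (fderiv ℝ (btrans F B x₀ y) u v a) (btrans F B x₀ y u b)
      + locH h x₀ u (btrans F B x₀ y u a) (fderiv ℝ (btrans F B x₀ y) u v b)
      = fderiv ℝ (locH h y) (transition x₀ y u) (fderiv ℝ (transition x₀ y : E → E) u v) a b := by
    intro v a b
    have ha : ∀ a, DifferentiableAt ℝ (fun u => btrans F B x₀ y u a) u := fun a =>
      hA.clm_apply (differentiableAt_const a)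
    have e1 : (fun u => locH h x₀ u (btrans F B x₀ y u a) (btrans F B x₀ y u b)) =ᶠ[nhds u]
        fun u => locH h y (transition x₀ y u) a b := by
      filter_upwards [eventually_trans hu hy hb] with u' hu'
      exact locH_transition hu'.1 hu'.2.1 hu'.2.2 h a b
    have e2 := congrArg (fun k : E →L[ℝ] ℂ => k v) (e1.fderiv_eq (𝕜 := ℝ))
    have e3 := fderiv_apply_fun (hH.clm_apply (ha a)) (ha b) v
    have e4 := fderiv_apply_fun hH (ha a) v
    have e5 : DifferentiableAt ℝ (fun u => locH h y (transition x₀ y u)) u :=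
      hHy.comp u hφ.differentiableAt
    have e6 : fderiv ℝ (fun u => locH h y (transition x₀ y u)) u
        = fderiv ℝ (locH h y) (transition x₀ y u) ∘L fderiv ℝ (transition x₀ y : E → E) u :=
      fderiv_comp u hHy hφ.differentiableAt
    rw [e3, e4, fderiv_apply_const hA, fderiv_apply_const hA,
      fderiv_apply_const (e5.clm_apply (differentiableAt_const a)), fderiv_apply_const e5, e6,
      add_apply] at e2
    exact e2
  have hnd : ∀ {b b' : F}, (∀ c, locH h x₀ u c b = locH h x₀ u c b') → b = b' := fun {b b'} hc => by
    by_contra hne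
    have h1 := locH_pos (h := h) hu (sub_ne_zero.2 hne)
    rw [map_sub, hc, sub_self] at h1
    simp at h1
  refine hnd fun c => ?_
  obtain ⟨a, rfl⟩ := btrans_surjective hu hb c
  have hI : fderiv ℝ (transition x₀ y : E → E) u (mulI E v)
      = mulI E (fderiv ℝ (transition x₀ y : E → E) u v) :=
    fderiv_transition_smul hu.1 hy Complex.I v
  have k1 := key v a b
  -- Half of the identity at v minus i times the one at Iv is its (1,0)-part. The term in which dA
  -- stands in the conjugate-linear slot cancels because A is holomorphic, and the other such term
  -- gains the factor one.
  have k2 := key (mulI E v) a b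
  rw [fderiv_btrans_I hu hy hb, fderiv_btrans_I hu hy hb, hI, locH_smul, locH_smul_left] at k2
  rw [map_add, locH_locθ hu, locH_transition hu hy hb, locH_locθ hm, ← k1, ← k2]
  simp only [RCLike.star_def, Complex.conj_I]
  linear_combination -(1 / 2 : ℂ) *
    (locH h x₀ u (fderiv ℝ (btrans F B x₀ y) u v a) (btrans F B x₀ y u b)
      - locH h x₀ u (btrans F B x₀ y u a) (fderiv ℝ (btrans F B x₀ y) u v b)) * Complex.I_sq

theorem fderiv_locF_apply {η : Form E B p} (hη : IsSmoothForm F η) (v : E) (m : Fin p → E) :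
    fderiv ℝ (locF F η x₀) u v m
      = fderiv ℝ (btrans F B x₀ y) u v (locF F η y (transition x₀ y u)
          fun i => fderiv ℝ (transition x₀ y) u (m i))
        + btrans F B x₀ y u (fderiv ℝ (locF F η y) (transition x₀ y u)
            (fderiv ℝ (transition x₀ y : E → E) u v) fun i => fderiv ℝ (transition x₀ y) u (m i))
        + btrans F B x₀ y u ((locF F η y (transition x₀ y u)).fderivCompContinuousLinearMap
            (fderiv ℝ (transition x₀ y) u) (fderiv ℝ (fderiv ℝ (transition x₀ y)) u v) m) := by
  rw [fderiv_locF hu hy hb hη, add_assoc, ← map_add]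
  rfl

end

end GlobalOperators

/-! ### Naturality of ∂̄, ∇^{1,0} and ∂̄_J, and their formulas on whole charts. -/

section GlobalOperators

variable {E : Type*} [NormedAddCommGroup E] [NormedSpace ℂ E] [FiniteDimensional ℂ E]
  {M : Type*} [TopologicalSpace M] [ChartedSpace E M] [IsManifold 𝓘(ℂ, E) ω M]
  {F : Type*} [NormedAddCommGroup F] [NormedSpace ℂ F] [FiniteDimensional ℂ F]
  {B : M → Type*} [TopologicalSpace (TotalSpace F B)]
  [∀ x, AddCommGroup (B x)] [∀ x, Module ℂ (B x)] [∀ x, TopologicalSpace (B x)]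
  [FiberBundle F B] [VectorBundle ℂ F B] {p q : ℕ}
  [ContMDiffVectorBundle ω F B 𝓘(ℂ, E)]
  (X : Hyperkahler E M) (h : HermitianMetric E F B)

/-- Transport of a form by a linear isomorphism of the base and one of the fibre. -/
theorem alt_transport {V : Type*} [NormedAddCommGroup V] [NormedSpace ℝ V] [FiniteDimensional ℝ V]
    {W : Type*} [NormedAddCommGroup W] [NormedSpace ℝ W] (A : W →L[ℝ] W) (Φ : V →L[ℝ] V)
    (ψ : V →L[ℝ] V [⋀^Fin p]→L[ℝ] W) {ψ' : V →L[ℝ] V [⋀^Fin p]→L[ℝ] W}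
    (hψ : ∀ v, ψ' v = A.compContinuousAlternatingMap ((ψ (Φ v)).compContinuousLinearMap Φ)) :
    alt p ψ' = A.compContinuousAlternatingMap ((alt p ψ).compContinuousLinearMap Φ) := by
  rw [alt_compContinuousLinearMap, compContinuousAlternatingMap_alt]
  congr 1
  ext1 v
  exact hψ v

section

variable {x₀ y : M} {u : E} (hu : u ∈ locU E F B x₀)
  (hy : chartPoint x₀ u ∈ (extChartAt 𝓘(ℝ, E) y).source)
  (hb : chartPoint x₀ u ∈ (trivializationAt F B y).baseSet)
include hu hy hb

/-- Second derivatives of the change of coordinates do not contribute to exterior derivatives. -/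
theorem alt_snd_transition (ζ : E [⋀^Fin p]→L[ℝ] F) (S : E →L[ℝ] E →L[ℝ] E)
    (hS : ∀ v w, S v w = S w v) :
    alt p (ContinuousLinearMap.compContinuousAlternatingMapCLM ℝ E F F (Fin p) (btrans F B x₀ y u)
      ∘L (ζ.fderivCompContinuousLinearMap (fderiv ℝ (transition x₀ y) u) ∘L S)) = 0 := by
  rw [← compContinuousAlternatingMap_alt]
  have : alt p (ζ.fderivCompContinuousLinearMap (fderiv ℝ (transition x₀ y) u) ∘L S) = 0 :=
    ContinuousAlternatingMap.alternatizeUncurryFin_fderivCompContinuousLinearMap_eq_zero ζ _ hS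
  rw [this]
  ext m
  simp

theorem snd_transition_symm (v w : E) : fderiv ℝ (fderiv ℝ (transition x₀ y : E → E)) u v w
    = fderiv ℝ (fderiv ℝ (transition x₀ y : E → E)) u w v :=
  snd_fderiv_symm (((transition_holomorphic hu.1 hy).restrict_scalars ℝ).of_le le_top) v w

theorem snd_transition_I (v w : E) : fderiv ℝ (fderiv ℝ (transition x₀ y : E → E)) u v (mulI E w)
    = mulI E (fderiv ℝ (fderiv ℝ (transition x₀ y : E → E)) u v w) := by
  have hφ : ContDiffAt ℝ ∞ (transition x₀ y : E → E) u :=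
    ((transition_holomorphic hu.1 hy).restrict_scalars ℝ).of_le le_top
  have hd := differentiableAt_fderiv hφ
  have e : (fun u => fderiv ℝ (transition x₀ y : E → E) u (mulI E w)) =ᶠ[nhds u]
      fun u => mulI E (fderiv ℝ (transition x₀ y : E → E) u w) := by
    filter_upwards [eventually_trans hu hy hb] with u' hu'
    exact fderiv_transition_smul hu'.1.1 hu'.2.1 Complex.I w
  have e2 := congrArg (fun k : E →L[ℝ] E => k v) (e.fderiv_eq (𝕜 := ℝ))
  rw [fderiv_apply_const hd, fderiv_clm_left _ (hd.clm_apply (differentiableAt_const w)),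
    fderiv_apply_const hd] at e2
  exact e2

/-- The second derivative of a holomorphic map is symmetric and complex-bilinear, so it stays
symmetric after inserting I in one slot. -/
theorem snd_transition_I_symm (v w : E) :
    fderiv ℝ (fderiv ℝ (transition x₀ y : E → E)) u (mulI E v) w
      = fderiv ℝ (fderiv ℝ (transition x₀ y : E → E)) u (mulI E w) v := by
  rw [snd_transition_symm hu hy hb, snd_transition_I hu hy hb, snd_transition_symm hu hy hb (mulI E w),
    snd_transition_I hu hy hb, snd_transition_symm hu hy hb v w]

/-- Two unwanted terms appear. The derivative of the change of frame has no (0,1)-part, and the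
second derivatives of the coordinate change are symmetric, so they alternate to zero. -/
theorem dbarL_transition {η : Form E B p} (hη : IsSmoothForm F η) :
    (bunAt h X x₀).dbarL p (locF F η x₀) u
      = (btrans F B x₀ y u).compContinuousAlternatingMap
        (((bunAt h X y).dbarL p (locF F η y) (transition x₀ y u)).compContinuousLinearMap
          (fderiv ℝ (transition x₀ y) u)) := by
  have hm := transition_mem_locU hu hy hb
  rw [(bunAt h X x₀).dbarL_eq hu, (bunAt h X y).dbarL_eq hm]
  set A := ContinuousLinearMap.compContinuousAlternatingMapCLM ℝ E F F (Fin p) (btrans F B x₀ y u)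
    with hA
  set ζ := locF F η y (transition x₀ y u) with hζ
  set Φ := fderiv ℝ (transition x₀ y : E → E) u with hΦ
  set S := fderiv ℝ (fderiv ℝ (transition x₀ y : E → E)) u with hS
  have z1 : alt p (A ∘L (ζ.fderivCompContinuousLinearMap Φ ∘L S)) = 0 :=
    alt_snd_transition hu hy hb ζ S (snd_transition_symm hu hy hb)
  have z2 : alt p (A ∘L (ζ.fderivCompContinuousLinearMap Φ ∘L (S ∘L mulI E))) = 0 :=
    alt_snd_transition hu hy hb ζ _ (snd_transition_I_symm hu hy hb)
  have hI : ∀ v, Φ (mulI E v) = mulI E (Φ v) := fderiv_transition_smul hu.1 hy Complex.I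
  -- The symbol is corrected by the second derivative terms, whose alternatization is zero by `z1`
  -- and `z2`. The corrected symbol transforms tensorially before alternatization.
  rw [← alt_transport (btrans F B x₀ y u) Φ _ (ψ' := (1 / 2 : ℂ) • (fderiv ℝ (locF F η x₀) u
    + Complex.I • (fderiv ℝ (locF F η x₀) u ∘L mulI E))
    - (1 / 2 : ℂ) • (A ∘L (ζ.fderivCompContinuousLinearMap Φ ∘L S)
      + Complex.I • (A ∘L (ζ.fderivCompContinuousLinearMap Φ ∘L (S ∘L mulI E)))))]
  · rw [alt_sub, alt_smul _ (A ∘L _ + _), alt_add, alt_smul _ (A ∘L _), z1, z2,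
      smul_zero, add_zero, smul_zero, sub_zero]
    rfl
  · intro v
    ext m
    have e1 := fderiv_locF_apply hu hy hb hη v m
    have e2 := fderiv_locF_apply hu hy hb hη (mulI E v) m
    rw [fderiv_btrans_I hu hy hb, ← hΦ, hI] at e2
    rw [← hΦ] at e1
    change (1 / 2 : ℂ) • (fderiv ℝ (locF F η x₀) u v m
        + Complex.I • fderiv ℝ (locF F η x₀) u (mulI E v) m)
      - (1 / 2 : ℂ) • (btrans F B x₀ y u (ζ.fderivCompContinuousLinearMap Φ (S v) m)
        + Complex.I • btrans F B x₀ y u (ζ.fderivCompContinuousLinearMap Φ (S (mulI E v)) m))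
      = btrans F B x₀ y u ((1 / 2 : ℂ) • (fderiv ℝ (locF F η y) (transition x₀ y u) (Φ v)
          (fun i => Φ (m i)) + Complex.I • fderiv ℝ (locF F η y) (transition x₀ y u)
            (mulI E (Φ v)) fun i => Φ (m i)))
    rw [e1, e2, btrans_smul, map_add, btrans_smul]
    simp only [smul_add, smul_smul, ← hζ, ← hS]
    match_scalars <;> first | ring1 | linear_combination (1 / 2 : ℂ) * Complex.I_sq

/-- As for `dbarL_transition`, except that the derivative of the change of frame is now entirely of
type (1,0) and is absorbed by the transformation rule of θ. -/
theorem nabla10L_transition {η : Form E B p} (hη : IsSmoothForm F η) :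
    (bunAt h X x₀).nabla10L p (locF F η x₀) u
      = (btrans F B x₀ y u).compContinuousAlternatingMap
        (((bunAt h X y).nabla10L p (locF F η y) (transition x₀ y u)).compContinuousLinearMap
          (fderiv ℝ (transition x₀ y) u)) := by
  have hm := transition_mem_locU hu hy hb
  rw [(bunAt h X x₀).nabla10L_eq hu, (bunAt h X y).nabla10L_eq hm]
  set A := ContinuousLinearMap.compContinuousAlternatingMapCLM ℝ E F F (Fin p) (btrans F B x₀ y u)
    with hA
  set ζ := locF F η y (transition x₀ y u) with hζ
  set Φ := fderiv ℝ (transition x₀ y : E → E) u with hΦ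
  set S := fderiv ℝ (fderiv ℝ (transition x₀ y : E → E)) u with hS
  have z1 : alt p (A ∘L (ζ.fderivCompContinuousLinearMap Φ ∘L S)) = 0 :=
    alt_snd_transition hu hy hb ζ S (snd_transition_symm hu hy hb)
  have z2 : alt p (A ∘L (ζ.fderivCompContinuousLinearMap Φ ∘L (S ∘L mulI E))) = 0 :=
    alt_snd_transition hu hy hb ζ _ (snd_transition_I_symm hu hy hb)
  have hI : ∀ v, Φ (mulI E v) = mulI E (Φ v) := fderiv_transition_smul hu.1 hy Complex.I
  rw [← alt_transport (btrans F B x₀ y u) Φ _ (ψ' := (1 / 2 : ℂ) • (fderiv ℝ (locF F η x₀) u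
    - Complex.I • (fderiv ℝ (locF F η x₀) u ∘L mulI E)) + thetaForm (locθ h x₀ u) (locF F η x₀ u)
    - (1 / 2 : ℂ) • (A ∘L (ζ.fderivCompContinuousLinearMap Φ ∘L S)
      - Complex.I • (A ∘L (ζ.fderivCompContinuousLinearMap Φ ∘L (S ∘L mulI E)))))]
  · rw [alt_sub _ (_ • _), alt_smul (1 / 2 : ℂ) (A ∘L _ - _), alt_sub, alt_smul _ (A ∘L _), z1, z2,
      smul_zero, sub_zero, smul_zero, sub_zero]
    rfl
  · intro v
    ext m
    have e1 := fderiv_locF_apply hu hy hb hη v m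
    have e2 := fderiv_locF_apply hu hy hb hη (mulI E v) m
    have e3 := congrArg (fun k => k m) (locF_transition hu hy hb η)
    change locF F η x₀ u m = btrans F B x₀ y u (ζ fun i => Φ (m i)) at e3
    have e4 := locθ_transition hu hy hb h v (ζ fun i => Φ (m i))
    rw [fderiv_btrans_I hu hy hb, ← hΦ, hI] at e2
    rw [← hΦ] at e1
    change (1 / 2 : ℂ) • (fderiv ℝ (locF F η x₀) u v m
        - Complex.I • fderiv ℝ (locF F η x₀) u (mulI E v) m) + locθ h x₀ u v (locF F η x₀ u m)
      - (1 / 2 : ℂ) • (btrans F B x₀ y u (ζ.fderivCompContinuousLinearMap Φ (S v) m)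
        - Complex.I • btrans F B x₀ y u (ζ.fderivCompContinuousLinearMap Φ (S (mulI E v)) m))
      = btrans F B x₀ y u ((1 / 2 : ℂ) • (fderiv ℝ (locF F η y) (transition x₀ y u) (Φ v)
          (fun i => Φ (m i)) - Complex.I • fderiv ℝ (locF F η y) (transition x₀ y u)
            (mulI E (Φ v)) fun i => Φ (m i)) + locθ h y (transition x₀ y u) (Φ v)
              (ζ fun i => Φ (m i)))
    rw [map_add, ← e4, e1, e2, e3, btrans_smul, map_sub, btrans_smul]
    simp only [smul_add, smul_sub, smul_smul, ← hζ, ← hS]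
    match_scalars <;> first | ring1 | linear_combination -(1 / 2 : ℂ) * Complex.I_sq

end

variable {x₀ : M} {u : E} {h X}

/-- `dbar` is defined at each point in the chart centred there. Naturality turns this into one
formula on the chart at `x₀`, as needed to differentiate the result again. -/
theorem locF_dbar {η : Form E B p} (hη : IsSmoothForm F η) (hu : u ∈ locU E F B x₀) :
    locF F (dbar F p η) x₀ u = (bunAt h X x₀).dbarL p (locF F η x₀) u := by
  have hy := mem_source_self x₀ u
  have hb : chartPoint x₀ u ∈ (trivializationAt F B (chartPoint x₀ u)).baseSet :=
    mem_baseSet_self x₀ u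
  rw [dbarL_transition X h hu hy hb hη, (bunAt h X _).dbarL_eq (transition_mem_locU hu hy hb)]
  rw [locF_ofLocal (ζ := dbar F p η) (α := AlternatingMap.alternatizeUncurryFin
    (part01 (localDeriv F η (chartPoint x₀ u)))) hu rfl]
  congr 2
  ext m
  rw [alt_apply]
  exact AlternatingMap.alternatizeUncurryFin_apply _ _

theorem locF_nabla10 {η : Form E B p} (hη : IsSmoothForm F η) (hu : u ∈ locU E F B x₀) :
    locF F (nabla10 h p η) x₀ u = (bunAt h X x₀).nabla10L p (locF F η x₀) u := by
  have hy := mem_source_self x₀ u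
  have hb : chartPoint x₀ u ∈ (trivializationAt F B (chartPoint x₀ u)).baseSet :=
    mem_baseSet_self x₀ u
  rw [nabla10L_transition X h hu hy hb hη,
    (bunAt h X _).nabla10L_eq (transition_mem_locU hu hy hb)]
  rw [locF_ofLocal (ζ := nabla10 h p η) (α := AlternatingMap.alternatizeUncurryFin
      (part10 (localDeriv F η (chartPoint x₀ u)))
    + wedgeOne (chernForm h (chartPoint x₀ u)
        (extChartAt 𝓘(ℝ, E) (chartPoint x₀ u) (chartPoint x₀ u)))
      (localForm F η (chartPoint x₀ u)
        (extChartAt 𝓘(ℝ, E) (chartPoint x₀ u) (chartPoint x₀ u)))) hu rfl]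
  congr 2
  ext m
  rw [alt_apply]
  refine (congrArg₂ (fun a b : F => a + b) (AlternatingMap.alternatizeUncurryFin_apply _ _)
    (AlternatingMap.alternatizeUncurryFin_apply _ _)).trans ?_
  rw [← Finset.sum_add_distrib]
  refine Finset.sum_congr rfl fun i _ => ?_
  rw [← smul_add]
  rfl

theorem locF_comp (η : Form E B p)
    (A : ∀ x : M, TangentSpace 𝓘(ℝ, E) x →L[ℝ] TangentSpace 𝓘(ℝ, E) x)
    (hu : u ∈ locU E F B x₀) :
    locF F (fun y => (η y).compLinearMap (A y).toLinearMap) x₀ u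
      = (locF F η x₀ u).compContinuousLinearMap (locEnd A x₀ u) := by
  ext m
  rw [locF_apply, ContinuousAlternatingMap.compContinuousLinearMap_apply, locF_apply]
  simp only [Function.comp_apply, chartFrame_locEnd hu.1]
  rfl

theorem IsSmoothForm.comp_J {η : Form E B p} (hη : IsSmoothForm F η) :
    IsSmoothForm F (fun y => (η y).compLinearMap (X.J y).toLinearMap) := by
  refine isSmoothForm_of_locF fun x₀ => ?_
  refine ContDiffOn.congr (fun u hu => ?_) fun u hu => locF_comp η X.J hu
  exact contDiffWithinAt_form_comp (hη.locF x₀ u hu) ((hkAt F B X x₀).J_smooth u hu)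

theorem locF_dbarJ {η : Form E B p} (hη : IsSmoothForm F η) (hu : u ∈ locU E F B x₀) :
    locF F (dbarJ X h p η) x₀ u = (bunAt h X x₀).dbarJL p (locF F η x₀) u := by
  rw [LocalBundle.dbarJL_eq _ (hη.locF x₀) hu]
  have h1 := locF_comp (nabla10 h p (fun y => (η y).compLinearMap (X.J y).toLinearMap))
    (fun x => -X.J x) hu
  refine h1.trans ?_
  rw [locF_nabla10 (X := X) (IsSmoothForm.comp_J hη) hu]
  have h2 : locEnd (fun x => -X.J x) x₀ u = -locEnd X.J x₀ u := by
    ext v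
    exact map_neg (chartCoframe x₀ (chartPoint x₀ u)) _
  rw [h2]
  -- The pulled back form has the expected local expression only inside `locU`; the operator depends
  -- only on the germ, so this is enough.
  have h3 : ∀ η' : E → E [⋀^Fin p]→L[ℝ] F, locF F (fun y => (η y).compLinearMap
      (X.J y).toLinearMap) x₀ =ᶠ[nhds u] η' →
      (bunAt h X x₀).nabla10L p (locF F (fun y => (η y).compLinearMap
      (X.J y).toLinearMap) x₀) u = (bunAt h X x₀).nabla10L p η' u := fun η' he => by
    rw [LocalBundle.nabla10L_eq _ hu, LocalBundle.nabla10L_eq _ hu, he.fderiv_eq, he.eq_of_nhds]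
  rw [h3 (fun u => (locF F η x₀ u).compContinuousLinearMap (locEnd X.J x₀ u))]
  · rfl
  · filter_upwards [(isOpen_locU x₀).mem_nhds hu] with u' hu'
    exact locF_comp η X.J hu'

theorem IsDolbeaultForm.locF_mem {η : Form E B p} (hη : IsDolbeaultForm F η) :
    ∀ u ∈ locU E F B x₀, locF F η x₀ u ∈ zForms F (mulI E) p := fun _ hu => hη.2.locF hu

/-- A form whose local expressions are smooth and of type `(0,p)` is a Dolbeault form. -/
theorem isDolbeaultForm_of_locF {η : Form E B p} {ζ : M → E → E [⋀^Fin p]→L[ℝ] F}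
    (he : ∀ x₀, ∀ u ∈ locU E F B x₀, locF F η x₀ u = ζ x₀ u)
    (hs : ∀ x₀, ContDiffOn ℝ ∞ (ζ x₀) (locU E F B x₀))
    (hz : ∀ x₀, ∀ u ∈ locU E F B x₀, ζ x₀ u ∈ zForms F (mulI E) p) : IsDolbeaultForm F η :=
  ⟨isSmoothForm_of_locF fun x₀ => (hs x₀).congr fun u hu => he x₀ u hu,
    isZeroType_of_locF fun x => by
      rw [he x _ (center_mem_locU x)]
      exact hz x _ (center_mem_locU x)⟩

theorem IsDolbeaultForm.dbar (h : HermitianMetric E F B) (X : Hyperkahler E M)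
    {η : Form E B p} (hη : IsDolbeaultForm F η) :
    IsDolbeaultForm F (dbar F p η) :=
  isDolbeaultForm_of_locF (fun _ _ hu => locF_dbar (h := h) (X := X) hη.1 hu)
    (fun x₀ => LocalBundle.dbarL_smooth (hη.1.locF x₀))
    fun x₀ u hu => by
      have h1 : (bunAt h X x₀).dbarL p (locF F η x₀) u ∈ zForms F (hkAt F B X x₀).I (p + 1) :=
        LocalBundle.dbarL_mem_zForms (hη.1.locF x₀) hη.locF_mem hu
      exact h1

theorem IsDolbeaultForm.dbarJ {η : Form E B p} (hη : IsDolbeaultForm F η) :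
    IsDolbeaultForm F (dbarJ X h p η) :=
  isDolbeaultForm_of_locF (fun _ _ hu => locF_dbarJ hη.1 hu)
    (fun x₀ => LocalBundle.dbarJL_smooth (hη.1.locF x₀))
    fun x₀ u hu => by
      have h1 : (bunAt h X x₀).dbarJL p (locF F η x₀) u ∈ zForms F (hkAt F B X x₀).I (p + 1) :=
        LocalBundle.dbarJL_mem_zForms (hη.1.locF x₀) hη.locF_mem hu
      exact h1

end GlobalOperators

/-! ### Naturality of the contraction Λ. -/

section Transport

variable {E : Type*} [NormedAddCommGroup E] [NormedSpace ℝ E] [FiniteDimensional ℝ E]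
  {F : Type*} [NormedAddCommGroup F] [NormedSpace ℂ F] {p : ℕ}

/-- The operator `lam` is natural with respect to isomorphisms. -/
theorem LocalHK.lam_transport {D D' : LocalHK E} {u u' : E} (hu : u ∈ D.U) (hu' : u' ∈ D'.U)
    {Φ : E →L[ℝ] E} (hΦ : Function.Surjective Φ) (hg : ∀ v w, D.g u v w = D'.g u' (Φ v) (Φ w))
    (hJ : ∀ v, Φ (D.J u v) = D'.J u' (Φ v)) (A : F →L[ℝ] F) (ζ : E [⋀^Fin (p + 2)]→L[ℝ] F) :
    D.lam F p u (A.compContinuousAlternatingMap (ζ.compContinuousLinearMap Φ))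
      = A.compContinuousAlternatingMap ((D'.lam F p u' ζ).compContinuousLinearMap Φ) := by
  have h1 : ∑ a, (ζ.curryLeft (Φ (D.du u a))).curryLeft (D'.J u' (Φ (bs a)))
      = ∑ a, (ζ.curryLeft (D'.du u' a)).curryLeft (D'.J u' (bs a)) := by
    refine D'.tr_eq ((IsBilin.contr_contr ζ).comp (ContinuousLinearMap.id ℝ E) (D'.J u'))
      (t := fun a => Φ (D.du u a)) (c := fun a => Φ (bs a)) (fun v' => ?_) hu'
    obtain ⟨v, rfl⟩ := hΦ v'
    conv_rhs => rw [← D.sum_g_bs hu v]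
    simp only [map_sum, map_smul, hg]
  rw [D.lam_apply, D'.lam_apply, ← h1]
  ext m
  have h2 : ∀ x y, (((A.compContinuousAlternatingMap (ζ.compContinuousLinearMap Φ)).curryLeft
      x).curryLeft y) m = A ((ζ.curryLeft (Φ x)).curryLeft (Φ y) fun i => Φ (m i)) := fun x y => by
    refine congrArg (fun k => A (ζ k)) (funext fun i => ?_)
    refine Fin.cases rfl (fun i => ?_) i
    exact Fin.cases rfl (fun i => rfl) i
  change -((1 / 4 : ℝ) • (∑ a, _ : E [⋀^Fin p]→L[ℝ] F) m) = A (-((1 / 4 : ℝ) •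
    (∑ a, _ : E [⋀^Fin p]→L[ℝ] F) fun i => Φ (m i)))
  rw [map_neg, map_smul, ContinuousAlternatingMap.sum_apply, ContinuousAlternatingMap.sum_apply,
    map_sum]
  simp only [h2, hJ]

end Transport

/-! ### The global operators Λ and L_Ω̄ and the pointwise product. -/

section GlobalOperators

variable {E : Type*} [NormedAddCommGroup E] [NormedSpace ℂ E] [FiniteDimensional ℂ E]
  {M : Type*} [TopologicalSpace M] [ChartedSpace E M] [IsManifold 𝓘(ℂ, E) ω M]
  {F : Type*} [NormedAddCommGroup F] [NormedSpace ℂ F] [FiniteDimensional ℂ F]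
  {B : M → Type*} [TopologicalSpace (TotalSpace F B)]
  [∀ x, AddCommGroup (B x)] [∀ x, Module ℂ (B x)] [∀ x, TopologicalSpace (B x)]
  [FiberBundle F B] [VectorBundle ℂ F B] {p : ℕ}
  (X : Hyperkahler E M) {h : HermitianMetric E F B} {x₀ : M} {u : E}

variable (F) in
/-- The contraction with the bivector dual to `Ω̄`. -/
def starLam (p : ℕ) (η : Form E B (p + 2)) : Form E B p := fun x =>
  ofLocal (F := F) x ((hkAt F B X x).lam F p (extChartAt 𝓘(ℝ, E) x x)
    (locF F η x (extChartAt 𝓘(ℝ, E) x x))).toAlternatingMap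

variable {X}

theorem locF_starLam (η : Form E B (p + 2)) (hu : u ∈ locU E F B x₀) :
    locF F (starLam F X p η) x₀ u = (hkAt F B X x₀).lam F p u (locF F η x₀ u) := by
  have hy := mem_source_self x₀ u
  have hb : chartPoint x₀ u ∈ (trivializationAt F B (chartPoint x₀ u)).baseSet :=
    mem_baseSet_self x₀ u
  rw [locF_transition hu hy hb η, LocalHK.lam_transport (D := hkAt F B X x₀)
    (D' := hkAt F B X (chartPoint x₀ u)) hu (transition_mem_locU hu hy hb)
    (transition_surjective hu hy hb) (locMet_transition hu hy hb X.g)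
    (transition_locEnd hu hy hb X.J)]
  exact locF_ofLocal (ζ := starLam F X p η) hu rfl

theorem IsDolbeaultForm.starLam [ContMDiffVectorBundle ω F B 𝓘(ℂ, E)] {η : Form E B (p + 2)}
    (hη : IsDolbeaultForm F η) : IsDolbeaultForm F (starLam F X p η) :=
  isDolbeaultForm_of_locF (fun _ _ hu => locF_starLam η hu)
    (fun x₀ => LocalBundle.lam_smooth (D := hkAt F B X x₀) (hη.1.locF x₀))
    fun x₀ u hu => by
      have h1 : (hkAt F B X x₀).lam F p u (locF F η x₀ u) ∈ zForms F (hkAt F B X x₀).I p :=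
        (hkAt F B X x₀).lam_mem_zForms (hη.locF_mem u hu)
      exact h1

theorem omegaBar_loc (hu : u ∈ locU E F B x₀) (v w : E) :
    (hkAt F B X x₀).omegaBar u v w = X.OmegaBar (chartPoint x₀ u)
      (chartFrame x₀ (chartPoint x₀ u) v) (chartFrame x₀ (chartPoint x₀ u) w) := by
  have h1 : ∀ w, chartFrame x₀ (chartPoint x₀ u) ((hkAt F B X x₀).J u w)
      = X.J (chartPoint x₀ u) (chartFrame x₀ (chartPoint x₀ u) w) := chartFrame_locEnd hu.1
  have h2 : ∀ w, chartFrame x₀ (chartPoint x₀ u) ((hkAt F B X x₀).K u w)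
      = X.K (chartPoint x₀ u) (chartFrame x₀ (chartPoint x₀ u) w) := fun w => by
    refine (chartFrame_I hu.1 ((hkAt F B X x₀).J u w)).trans ?_
    rw [h1]; rfl
  change (locMet X.g x₀ u v ((hkAt F B X x₀).J u w) : ℂ) - Complex.I *
    (locMet X.g x₀ u v ((hkAt F B X x₀).K u w) : ℂ) = (kahlerForm X.g X.J _ _ _ : ℂ) -
      Complex.I * (kahlerForm X.g X.K _ _ _ : ℂ)
  rw [locMet_apply, locMet_apply, h1, h2]
  rfl

/-- The local expression of the exterior product with an `End(B)`-valued 2-form. -/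
theorem locF_wedgeTwo {Θ : ∀ x : M, TangentSpace 𝓘(ℝ, E) x →ₗ[ℝ] TangentSpace 𝓘(ℝ, E) x →ₗ[ℝ]
    (B x →ₗ[ℂ] B x)} (η : Form E B p) {S : E →L[ℝ] E →L[ℝ] E [⋀^Fin p]→L[ℝ] F}
    (hS : ∀ v w m, S v w m = bcoframe F B x₀ (chartPoint x₀ u) (Θ (chartPoint x₀ u)
      (chartFrame x₀ (chartPoint x₀ u) v) (chartFrame x₀ (chartPoint x₀ u) w)
      (η (chartPoint x₀ u) fun i => chartFrame x₀ (chartPoint x₀ u) (m i)))) :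
    locF F (fun x => wedgeTwo (Θ x) (η x)) x₀ u = (1 / 2 : ℂ) • alt (p + 1) (alt p ∘L S) := by
  ext m
  rw [locF_apply, ContinuousAlternatingMap.smul_apply, alt_apply]
  simp only [ContinuousLinearMap.comp_apply, alt_apply, hS]
  simp only [wedgeTwo, AlternatingMap.smul_apply, AlternatingMap.alternatizeUncurryFin_apply,
    map_smul, map_sum]
  congr 1
  refine Finset.sum_congr rfl fun i _ => ?_
  rw [map_zsmul]
  congr 1
  refine (congrArg _ (AlternatingMap.alternatizeUncurryFin_apply _ _)).trans ?_
  rw [map_sum]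
  refine Finset.sum_congr rfl fun j _ => ?_
  rw [map_zsmul]
  rfl

theorem exists_scalar_form (Ω : E →L[ℝ] E →L[ℝ] ℂ) (ζ : E [⋀^Fin p]→L[ℝ] F) :
    ∃ S : E →L[ℝ] E →L[ℝ] E [⋀^Fin p]→L[ℝ] F, ∀ v w, S v w = Ω v w • ζ :=
  ⟨(ContinuousLinearMap.compL ℝ E ℂ _ ((ContinuousLinearMap.toSpanSingleton ℂ ζ).restrictScalars ℝ))
    ∘L Ω, fun _ _ => rfl⟩

/-- The isomorphism of complex vector spaces given by the frame of a chart. -/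
def chartFrameEquiv (hu : u ∈ (extChartAt 𝓘(ℝ, E) x₀).target) : E ≃ₗ[ℂ] E where
  toFun v := chartFrame x₀ (chartPoint x₀ u) v
  invFun v := chartCoframe x₀ (chartPoint x₀ u) v
  map_add' v w := map_add (chartFrame x₀ (chartPoint x₀ u)) v w
  map_smul' c v := chartFrame_smul hu c v
  left_inv v := chartCoframe_chartFrame (chartPoint_mem hu) v
  right_inv v := chartFrame_chartCoframe (chartPoint_mem hu) v

/-- `formInner` uses the standard basis of the model space as a basis of T_xM. Its preimage under
the chart frame is a complex basis of the chart, and `ip_eq_sum` holds in every complex basis. -/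
theorem formInner_eq {α β : Form E B p} (hα : IsZeroType α) (hβ : IsZeroType β)
    (hu : u ∈ locU E F B x₀) : formInner X.g h α β (chartPoint x₀ u)
      = (bunAt h X x₀).ip p u (locF F α x₀ u) (locF F β x₀ u) := by
  set c := (Module.finBasis ℂ E).map (chartFrameEquiv hu.1).symm with hc
  have h1 : ∀ k, chartFrame x₀ (chartPoint x₀ u) (c k) = Module.finBasis ℂ E k := fun k => by
    rw [hc, Module.Basis.map_apply]
    exact (chartFrameEquiv hu.1).apply_symm_apply _
  rw [(bunAt h X x₀).ip_eq_sum c (fun v => rfl) hu (hα.locF hu) (hβ.locF hu), formInner]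
  have h2 : (hkAt F B X x₀).hermGram c u = hermitianGram X.g (chartPoint x₀ u) := by
    ext i j
    change (locMet X.g x₀ u (c i) (c j) : ℂ) - Complex.I *
      (locMet X.g x₀ u (c i) (mulI E (c j)) : ℂ) = _
    rw [locMet_apply, locMet_apply, chartFrame_I hu.1, h1, h1]
    rfl
  rw [h2]
  refine congrArg _ (Finset.sum_congr rfl fun i _ => Finset.sum_congr rfl fun j _ => ?_)
  refine congrArg _ ?_
  change _ = locH h x₀ u _ _
  rw [locH_apply, locF_apply, locF_apply, bframe_bcoframe hu.2, bframe_bcoframe hu.2]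
  simp only [h1]

variable (X) in
theorem exists_locF_lefschetz (α : Form E B p) (hu : u ∈ locU E F B x₀) :
    ∃ S : E →L[ℝ] E →L[ℝ] E [⋀^Fin p]→L[ℝ] F,
      (∀ v w, S v w = (hkAt F B X x₀).omegaBar u v w • locF F α x₀ u) ∧
      locF F (lefschetz X p α) x₀ u = (1 / 2 : ℂ) • alt (p + 1) (alt p ∘L S) := by
  let Ω : E →L[ℝ] E →L[ℝ] ℂ := LinearMap.toContinuousBilinearMap (LinearMap.mk₂ ℝ
    (fun v w => (hkAt F B X x₀).omegaBar u v w)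
    (fun v v' w => by simp [LocalHK.omegaBar]; ring)
    (fun r v w => by simp [LocalHK.omegaBar]; ring)
    (fun v w w' => by simp [LocalHK.omegaBar]; ring)
    (fun r v w => by simp [LocalHK.omegaBar]; ring))
  obtain ⟨S, hS⟩ := exists_scalar_form Ω (locF F α x₀ u)
  refine ⟨S, hS, locF_wedgeTwo α fun v w m => ?_⟩
  rw [hS, ContinuousAlternatingMap.smul_apply, locF_apply, ← map_smul]
  change bcoframe F B x₀ (chartPoint x₀ u) ((hkAt F B X x₀).omegaBar u v w • _) = _
  rw [omegaBar_loc hu]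
  rfl

theorem IsDolbeaultForm.lefschetz [ContMDiffVectorBundle ω F B 𝓘(ℂ, E)] {α : Form E B p}
    (hα : IsDolbeaultForm F α) : IsDolbeaultForm F (lefschetz X p α) := by
  refine isDolbeaultForm_of_locF (fun _ _ _ => rfl) (fun x₀ u hu => ?_) fun x₀ u hu => ?_
  · refine contDiffWithinAt_form fun m => ?_
    have h1 : ∀ v w, ContDiffWithinAt ℝ ∞ (fun u => (hkAt F B X x₀).omegaBar u v w)
        (locU E F B x₀) u := fun v w => by
      have hg := (hkAt F B X x₀).g_smooth u hu
      have hJ := (hkAt F B X x₀).J_smooth u hu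
      have hK := (LocalHK.par_K (hkAt F B X x₀)).smooth u hu
      have hc : ∀ {f : E → ℝ}, ContDiffWithinAt ℝ ∞ f (locU E F B x₀) u →
          ContDiffWithinAt ℝ ∞ (fun u => (f u : ℂ)) (locU E F B x₀) u := fun hf =>
        Complex.ofRealCLM.contDiff.comp_contDiffWithinAt hf
      exact (hc ((hg.clm_apply contDiffWithinAt_const).clm_apply
        (hJ.clm_apply contDiffWithinAt_const))).sub (contDiffWithinAt_const.mul
          (hc ((hg.clm_apply contDiffWithinAt_const).clm_apply
            (hK.clm_apply contDiffWithinAt_const))))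
    have h2 : ∀ m, ContDiffWithinAt ℝ ∞ (fun u => locF F α x₀ u m) (locU E F B x₀) u := fun m =>
      contDiffWithinAt_form_apply (hα.1.locF x₀ u hu) fun _ => contDiffWithinAt_const
    have h3 : ∀ u ∈ locU E F B x₀, locF F (QuatDolbeault.lefschetz X p α) x₀ u m
        = (1 / 2 : ℂ) • ∑ i : Fin (p + 2), (-1 : ℤ) ^ (i : ℕ) • ∑ j : Fin (p + 1),
          (-1 : ℤ) ^ (j : ℕ) • ((hkAt F B X x₀).omegaBar u (m i) (i.removeNth m j) •
            locF F α x₀ u (j.removeNth (i.removeNth m))) := fun u hu => by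
      obtain ⟨S, hS, h⟩ := exists_locF_lefschetz X α hu
      rw [h, ContinuousAlternatingMap.smul_apply, alt_apply]
      simp only [ContinuousLinearMap.comp_apply, alt_apply, hS]
      rfl
    refine ContDiffWithinAt.congr ?_ h3 (h3 u hu)
    have hz : ∀ (k : ℤ) {f : E → F}, ContDiffWithinAt ℝ ∞ f (locU E F B x₀) u →
        ContDiffWithinAt ℝ ∞ (fun u => k • f u) (locU E F B x₀) u := fun k f hf => by
      simp only [← Int.cast_smul_eq_zsmul ℝ k]
      exact contDiffWithinAt_const.smul hf
    exact ContDiffWithinAt.const_smul _ (ContDiffWithinAt.sum fun i _ => hz _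
      (ContDiffWithinAt.sum fun j _ => hz _ ((h1 _ _).smul (h2 _))))
  · obtain ⟨S, hS, h⟩ := exists_locF_lefschetz X α hu
    rw [h]
    -- Ω̄ has type (0,2): moving I across the metric exchanges ω_J and ω_K up to the factor -i.
    have hI : ∀ v w, (hkAt F B X x₀).omegaBar u (mulI E v) w
        = -(Complex.I * (hkAt F B X x₀).omegaBar u v w) := fun v w => by
      have e1 := (hkAt F B X x₀).g_I_left hu v ((hkAt F B X x₀).J u w)
      have e2 := (hkAt F B X x₀).g_I_left hu v ((hkAt F B X x₀).K u w)
      rw [(hkAt F B X x₀).K_apply, (hkAt F B X x₀).I_sq, map_neg] at e2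
      have e3 : (mulI E) = (hkAt F B X x₀).I := rfl
      rw [LocalHK.omegaBar, LocalHK.omegaBar, e3, (hkAt F B X x₀).K_apply, e1, e2]
      push_cast
      linear_combination -((hkAt F B X x₀).g u v ((hkAt F B X x₀).I ((hkAt F B X x₀).J u w)) : ℂ)
        * Complex.I_sq
    have hsk : ∀ v w, (hkAt F B X x₀).omegaBar u v w = -(hkAt F B X x₀).omegaBar u w v :=
        fun v w => by
      rw [LocalHK.omegaBar, LocalHK.omegaBar, (hkAt F B X x₀).g_symm u hu w,
        (hkAt F B X x₀).g_symm u hu w, (hkAt F B X x₀).g_J_left hu, (hkAt F B X x₀).g_K_left hu]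
      push_cast
      ring
    have h1 : alt (p + 1) (alt p ∘L S) ∈ zForms F (mulI E) (p + 2) := by
      refine alt_mem_zForms (fun v => alt_mem_zForms (fun w => ?_) fun w => ?_) fun v => ?_
      · change S v w ∈ _
        rw [hS]
        exact Submodule.smul_mem _ _ (hα.locF_mem u hu)
      · change S v (mulI E w) = -(Complex.I • S v w)
        rw [hS, hS, hsk, hI, hsk w v, smul_smul, ← neg_smul]
        congr 1
        ring
      · rw [ContinuousLinearMap.comp_apply, ContinuousLinearMap.comp_apply, ← alt_smul, ← alt_neg]
        congr 1
        ext1 w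
        rw [neg_apply, smul_apply, hS, hS, hI, smul_smul, neg_smul]
    exact Submodule.smul_mem _ _ h1

theorem formInner_lefschetz {α : Form E B p} {β : Form E B (p + 2)} (hα : IsZeroType α)
    (hL : IsZeroType (lefschetz X p α)) (hLam : IsZeroType (starLam F X p β))
    (hβ : IsZeroType β) (x : M) :
    formInner X.g h (lefschetz X p α) β x = formInner X.g h α (starLam F X p β) x := by
  have hu := center_mem_locU (E := E) (F := F) (B := B) x
  have key : formInner X.g h (lefschetz X p α) β (chartPoint x (extChartAt 𝓘(ℝ, E) x x))
      = formInner X.g h α (starLam F X p β) (chartPoint x (extChartAt 𝓘(ℝ, E) x x)) := by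
    rw [formInner_eq hL hβ hu, formInner_eq hα hLam hu, locF_starLam β hu]
    obtain ⟨S, hS, he⟩ := exists_locF_lefschetz X α hu
    rw [he]
    exact (bunAt h X x).ip_lef hu (hβ.locF hu) hS
  rwa [chartPoint_center] at key

end GlobalOperators

/-! ### The weight decomposition of 2-forms. -/

section PlusPart

variable {U W : Type*} [AddCommGroup U] [AddCommGroup W] [Module ℂ W]

/-- The `Λ²₊`-part of a 2-form of type `(1,1)`. -/
theorem isPlusPart_of_invariant {i j k : U → U} {R P : U → U → W}
    (hi : ∀ v, i (i v) = -v) (hj : ∀ v, j (j v) = -v) (hij : ∀ v, j (i v) = -i (j v))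
    (hk : ∀ v, k v = i (j v)) (hi' : ∀ v, i (-v) = -i v) (hj' : ∀ v, j (-v) = -j v)
    (hl : ∀ v w, R (-v) w = -R v w) (hr : ∀ v w, R v (-w) = -R v w)
    (hR : ∀ v w, R (i v) (i w) = R v w)
    (hP : ∀ v w, P v w = (1 / 2 : ℂ) • (R v w - R (j v) (j w))) : IsPlusPart i j k R P := by
  constructor
  -- The square of the action of L ∈ {I, J, K} on bilinear forms is β ↦ 2(β(L·, L·) - β), that is 0
  -- on L-invariant and -4 on L-anti-invariant forms. P is I-invariant and J-, K-anti-invariant, so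
  -- the Casimir acts by -8 = -2(2 + 2).
  · funext v w
    simp only [casimir, infAction, Pi.add_apply, hP, hk, hi, hj, hij, hi', hj', hl, hr, hR, neg_neg]
    rw [← Nat.cast_smul_eq_nsmul ℂ]
    push_cast
    module
  -- R - P = (R + R(J·, J·))/2 is invariant under I, J and K, so each square vanishes on it.
  · funext v w
    simp only [casimir, infAction, Pi.add_apply, Pi.sub_apply, hP, hk, hi, hj, hij, hi', hj', hl, hr,
      hR, neg_neg]
    rw [← Nat.cast_smul_eq_nsmul ℂ]
    push_cast
    module

end PlusPart

/-! ### The local operators depend only on germs. -/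

namespace LocalBundle

variable {E F : Type*} [NormedAddCommGroup E] [NormedSpace ℝ E] [FiniteDimensional ℝ E]
  [NormedAddCommGroup F] [NormedSpace ℂ F] {D : LocalHK E} {B : LocalBundle D F} {u : E} {p : ℕ}
  {η η' : E → E [⋀^Fin p]→L[ℝ] F}

theorem nab_congr (he : η =ᶠ[nhds u] η') : B.nab p η u = B.nab p η' u := by
  rw [nab, nab, he.fderiv_eq, he.eq_of_nhds]

theorem dbarL_congr (he : η =ᶠ[nhds u] η') : B.dbarL p η u = B.dbarL p η' u := by
  rw [dbarL_eq_alt, dbarL_eq_alt, psiL, psiL, nab_congr he]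

theorem dbarJL_congr (he : η =ᶠ[nhds u] η') : B.dbarJL p η u = B.dbarJL p η' u := by
  rw [dbarJL_eq_alt, dbarJL_eq_alt, psiJL, psiJL, nab_congr he]

end LocalBundle

/-! ### The curvature of B and the form of Θ₊. -/

section Curvature

variable {E : Type*} [NormedAddCommGroup E] [NormedSpace ℂ E] [FiniteDimensional ℂ E]
  {M : Type*} [TopologicalSpace M] [ChartedSpace E M] [IsManifold 𝓘(ℂ, E) ω M]
  {F : Type*} [NormedAddCommGroup F] [NormedSpace ℂ F] [FiniteDimensional ℂ F]
  {B : M → Type*} [TopologicalSpace (TotalSpace F B)]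
  [∀ x, AddCommGroup (B x)] [∀ x, Module ℂ (B x)] [∀ x, TopologicalSpace (B x)]
  [FiberBundle F B] [VectorBundle ℂ F B] {p : ℕ}
  (X : Hyperkahler E M) (h : HermitianMetric E F B)

/-- `chernCurvature` differentiates in the space of complex-linear maps and `curv` in the space of
real-linear ones. The inclusion has a linear left inverse, so differentiability descends and the
derivatives agree. -/
theorem fderiv_chernForm (x : M) {u : E} (hu : u ∈ locU E F B x) (v w : E) (b : F) :
    fderiv ℝ (fun u => LinearMap.toContinuousLinearMap (chernForm h x u w)) u v b
      = fderiv ℝ (locθ h x) u v w b := by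
  let r : (F →L[ℂ] F) →L[ℝ] (F →L[ℝ] F) := ContinuousLinearMap.restrictScalarsL ℂ F F ℝ ℝ
  have hr : LinearMap.ker r.toLinearMap = ⊥ :=
    LinearMap.ker_eq_bot'.2 fun f hf => ContinuousLinearMap.ext fun b =>
      congrArg (fun k : F →L[ℝ] F => k b) hf
  obtain ⟨S, hS⟩ := r.toLinearMap.exists_leftInverse_of_injective hr
  have hθ : DifferentiableAt ℝ (fun u => locθ h x u w) u :=
    (diffAt (locθ_smooth h x) ((isOpen_locU x).mem_nhds hu)).clm_apply (differentiableAt_const w)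
  have h1 : (fun u => LinearMap.toContinuousLinearMap (chernForm h x u w))
      = fun u => LinearMap.toContinuousLinearMap S (locθ h x u w) := by
    funext u
    exact (congrArg (fun k => k (LinearMap.toContinuousLinearMap (chernForm h x u w))) hS).symm
  have hd : DifferentiableAt ℝ (fun u => LinearMap.toContinuousLinearMap (chernForm h x u w)) u := by
    rw [h1]
    exact (LinearMap.toContinuousLinearMap S).differentiableAt.comp u hθ
  have h2 := fderiv_clm_left r hd v
  have h3 : (fun u => r (LinearMap.toContinuousLinearMap (chernForm h x u w)))
      = fun u => locθ h x u w := rfl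
  rw [h3, fderiv_apply_const (diffAt (locθ_smooth h x) ((isOpen_locU x).mem_nhds hu))] at h2
  exact (congrArg (fun k : F →L[ℝ] F => k b) h2).symm

theorem chernCurvature_eq (x : M) (v w : TangentSpace 𝓘(ℝ, E) x) (b : B x) :
    chernCurvature h x v w b = bframe F B x x (curv (locθ h x) (extChartAt 𝓘(ℝ, E) x x)
      (chartCoframe x x v) (chartCoframe x x w) (bcoframe F B x x b)) := by
  have hu := center_mem_locU (E := E) (F := F) (B := B) x
  rw [curv_apply]
  refine congrArg (bframe F B x x) ?_
  rw [← fderiv_chernForm h x hu, ← fderiv_chernForm h x hu, ← add_sub_assoc]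
  rfl

/-- The point `P` is kept separate from `x` because it is later the point with the central
coordinates, which equals `x` only propositionally. -/
theorem curv_loc (x : M) (v w : E) {P : M} (hP : P = x) (b : B P) :
    bcoframe F B x P (chernCurvature h P (chartFrame x P v) (chartFrame x P w) b)
      = curv (locθ h x) (extChartAt 𝓘(ℝ, E) x x) v w (bcoframe F B x P b) := by
  subst hP
  have hb : P ∈ (trivializationAt F B P).baseSet := FiberBundle.mem_baseSet_trivializationAt' P
  rw [chernCurvature_eq, chartCoframe_chartFrame (mem_extChartAt_source P),
    chartCoframe_chartFrame (mem_extChartAt_source P), bcoframe_bframe hb]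

theorem chernCurvature_add_left (x : M) (v v' w : TangentSpace 𝓘(ℝ, E) x) :
    chernCurvature h x (v + v') w = chernCurvature h x v w + chernCurvature h x v' w := by
  ext b
  rw [LinearMap.add_apply, chernCurvature_eq, chernCurvature_eq, chernCurvature_eq, ← map_add,
    map_add (chartCoframe x x)]
  refine congrArg (bframe F B x x) ?_
  exact congrArg (fun k : E →L[ℝ] F →L[ℝ] F => k (chartCoframe x x w) (bcoframe F B x x b))
    (map_add (curvL (locθ h x) (extChartAt 𝓘(ℝ, E) x x)) (chartCoframe x x v) (chartCoframe x x v'))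

theorem chernCurvature_smul_left (x : M) (r : ℝ) (v w : TangentSpace 𝓘(ℝ, E) x) :
    chernCurvature h x (r • v) w = r • chernCurvature h x v w := by
  ext b
  rw [LinearMap.smul_apply, chernCurvature_eq, chernCurvature_eq, ← map_real_smul,
    map_smul (chartCoframe x x)]
  refine congrArg (bframe F B x x) ?_
  exact congrArg (fun k : E →L[ℝ] F →L[ℝ] F => k (chartCoframe x x w) (bcoframe F B x x b))
    (map_smul (curvL (locθ h x) (extChartAt 𝓘(ℝ, E) x x)) r (chartCoframe x x v))

theorem chernCurvature_swap (x : M) (v w : TangentSpace 𝓘(ℝ, E) x) :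
    chernCurvature h x v w = -chernCurvature h x w v := by
  ext b
  rw [LinearMap.neg_apply, chernCurvature_eq, chernCurvature_eq, ← map_neg, curv_swap]
  rfl

theorem chartCoframe_tangentI (x : M) (v : TangentSpace 𝓘(ℝ, E) x) :
    chartCoframe x x (tangentI x v) = mulI E (chartCoframe x x v) :=
  (chartCoframe_self x (tangentI x v)).trans (congrArg (mulI E) (chartCoframe_self x v).symm)

include X in
theorem chernCurvature_I (x : M) (v w : TangentSpace 𝓘(ℝ, E) x) :
    chernCurvature h x (tangentI x v) (tangentI x w) = chernCurvature h x v w := by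
  ext b
  rw [chernCurvature_eq, chernCurvature_eq, chartCoframe_tangentI, chartCoframe_tangentI]
  refine congrArg (bframe F B x x) ?_
  exact congrArg (fun k : F →L[ℝ] F => k (bcoframe F B x x b))
    ((bunAt h X x).curv_I (center_mem_locU (E := E) (F := F) (B := B) x) (chartCoframe x x v)
      (chartCoframe x x w))

/-- The `End(B)`-valued `(0,2)`-form of the operator `Θ₊`. -/
def thetaTwo (x : M) : TangentSpace 𝓘(ℝ, E) x →ₗ[ℝ] TangentSpace 𝓘(ℝ, E) x →ₗ[ℝ]
    (B x →ₗ[ℂ] B x) :=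
  LinearMap.mk₂ ℝ (fun v w => (1 / 2 : ℂ) •
      (Complex.I • (chernCurvature h x v (X.K x w) + chernCurvature h x (X.K x v) w)
        - (chernCurvature h x v (X.J x w) + chernCurvature h x (X.J x v) w)))
    (fun v v' w => by
      simp only [map_add, chernCurvature_add_left]
      module)
    (fun r v w => by
      simp only [map_smul, chernCurvature_smul_left, ← Complex.coe_smul]
      module)
    (fun v w w' => by
      simp only [chernCurvature_swap h x v, chernCurvature_swap h x (X.K x v),
        chernCurvature_swap h x (X.J x v), map_add, chernCurvature_add_left]
      module)
    (fun r v w => by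
      simp only [chernCurvature_swap h x v, chernCurvature_swap h x (X.K x v),
        chernCurvature_swap h x (X.J x v), map_smul, chernCurvature_smul_left, ← Complex.coe_smul]
      module)

theorem thetaTwo_apply (x : M) (v w : TangentSpace 𝓘(ℝ, E) x) : thetaTwo X h x v w = (1 / 2 : ℂ) •
      (Complex.I • (chernCurvature h x v (X.K x w) + chernCurvature h x (X.K x v) w)
        - (chernCurvature h x v (X.J x w) + chernCurvature h x (X.J x v) w)) := rfl

theorem chernCurvature_neg_left (x : M) (v w : TangentSpace 𝓘(ℝ, E) x) :
    chernCurvature h x (-v) w = -chernCurvature h x v w := by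
  rw [← neg_one_smul ℝ v, chernCurvature_smul_left, neg_one_smul]

theorem chernCurvature_neg_right (x : M) (v w : TangentSpace 𝓘(ℝ, E) x) :
    chernCurvature h x v (-w) = -chernCurvature h x v w := by
  rw [chernCurvature_swap, chernCurvature_neg_left, ← chernCurvature_swap]

theorem thetaTwo_self (x : M) (v : TangentSpace 𝓘(ℝ, E) x) : thetaTwo X h x v v = 0 := by
  rw [thetaTwo_apply, chernCurvature_swap h x v, chernCurvature_swap h x v]
  simp

include X in
theorem tangentI_sq (x : M) (v : TangentSpace 𝓘(ℝ, E) x) : tangentI x (tangentI x v) = -v :=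
  X.kahler_I.square x v

theorem K_tangentI (x : M) (v : TangentSpace 𝓘(ℝ, E) x) : X.K x (tangentI x v) = X.J x v := by
  have h1 := X.anticommute x (tangentI x v)
  rw [tangentI_sq X, map_neg, neg_neg] at h1
  exact h1

theorem J_tangentI (x : M) (v : TangentSpace 𝓘(ℝ, E) x) : X.J x (tangentI x v) = -X.K x v := by
  rw [← neg_eq_iff_eq_neg]
  exact (X.anticommute x v).symm

/-- I is skew for R, which has type (1,1); together with KI = J and JI = -K this exchanges the J-
and K-parts up to the factor -i. -/
theorem thetaTwo_I (x : M) (v w : TangentSpace 𝓘(ℝ, E) x) :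
    thetaTwo X h x (tangentI x v) w = -(Complex.I • thetaTwo X h x v w) := by
  have hK : ∀ w, tangentI x (X.J x w) = X.K x w := fun w => rfl
  have hIK : ∀ w, tangentI x (X.K x w) = -X.J x w := fun w => by rw [← hK, tangentI_sq X]
  have e1 : ∀ v w, chernCurvature h x (tangentI x v) w = -chernCurvature h x v (tangentI x w) :=
    fun v w => by
    rw [← chernCurvature_I X h x v, tangentI_sq X, chernCurvature_neg_right, neg_neg]
  rw [thetaTwo_apply, thetaTwo_apply, K_tangentI, J_tangentI, e1, e1, hK, hIK,
    chernCurvature_neg_right, chernCurvature_neg_left]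
  match_scalars <;> first
    | ring1
    | linear_combination (1 / 2 : ℂ) * Complex.I_sq

/-- Inserting J, the terms with coefficient i cancel by the skewness of I for R, and the others add
up to (R - R(J·, J·))/2. -/
theorem isPlusPart_thetaTwo (x : M) : IsPlusPart (tangentI x) (X.J x) (X.K x)
    (chernCurvature h x) (plusIso (X.J x) (fun v w => thetaTwo X h x v w)) := by
  have hJJ : ∀ v, X.J x (X.J x v) = -v := X.kahler_J.square x
  have hKJ : ∀ v, X.K x (X.J x v) = -tangentI x v := fun v => by
    refine (congrArg (tangentI x) (hJJ v)).trans (map_neg _ _)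
  have e1 : ∀ v w, chernCurvature h x (tangentI x v) w = -chernCurvature h x v (tangentI x w) :=
    fun v w => by
    rw [← chernCurvature_I X h x v, tangentI_sq X, chernCurvature_neg_right, neg_neg]
  refine isPlusPart_of_invariant (tangentI_sq X x) hJJ (J_tangentI X x) (fun v => rfl)
    (map_neg (tangentI x)) (map_neg (X.J x)) (chernCurvature_neg_left h x)
    (chernCurvature_neg_right h x) (chernCurvature_I X h x) fun v w => ?_
  have e2 : ∀ v w, chernCurvature h x (X.K x v) w
      = -chernCurvature h x (X.J x v) (tangentI x w) := fun v w => e1 (X.J x v) w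
  have e3 : ∀ w, tangentI x (X.J x w) = X.K x w := fun w => rfl
  rw [plusIso, thetaTwo_apply, thetaTwo_apply, hKJ, hKJ, hJJ, hJJ, e2 v (X.J x w), e3,
    chernCurvature_neg_left, chernCurvature_neg_left, chernCurvature_neg_right,
    chernCurvature_neg_right, e1]
  module

variable {X h}

/-- The computation of `dbarL_dbarJL` read at the centre of each chart. Its coefficient 1/4 splits
into the 1/2 of `wedgeTwo` and the 1/2 of `thetaTwo`. -/
theorem thetaPlus_eq [ContMDiffVectorBundle ω F B 𝓘(ℂ, E)] {η : Form E B p}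
    (hη : IsDolbeaultForm F η) :
    thetaPlus X h p η = fun x => wedgeTwo (thetaTwo X h x) (η x) := by
  refine eq_of_locF (F := F) fun x => ?_
  have hu := center_mem_locU (E := E) (F := F) (B := B) x
  set u := extChartAt 𝓘(ℝ, E) x x with hu'
  have n := (isOpen_locU (E := E) (F := F) (B := B) x).mem_nhds hu
  have h1 : locF F (thetaPlus X h p η) x u = locF F (dbar F (p + 1) (dbarJ X h p η)) x u
      + locF F (dbarJ X h (p + 1) (dbar F p η)) x u := by
    ext m
    exact map_add (bcoframe F B x (chartPoint x u)) _ _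
  rw [h1, locF_dbar (h := h) (X := X) hη.dbarJ.1 hu, locF_dbarJ (hη.dbar h X).1 hu,
    LocalBundle.dbarL_congr (η' := (bunAt h X x).dbarJL p (locF F η x)) (by
      filter_upwards [n] with u' hu'
      exact locF_dbarJ hη.1 hu'),
    LocalBundle.dbarJL_congr (η' := (bunAt h X x).dbarL p (locF F η x)) (by
      filter_upwards [n] with u' hu'
      exact locF_dbar hη.1 hu'),
    (bunAt h X x).dbarL_dbarJL (hη.1.locF x) hu]
  have hJ : ∀ w, chartFrame x (chartPoint x u) ((hkAt F B X x).J u w)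
      = X.J (chartPoint x u) (chartFrame x (chartPoint x u) w) := chartFrame_locEnd hu.1
  have hK : ∀ w, chartFrame x (chartPoint x u) ((hkAt F B X x).K u w)
      = X.K (chartPoint x u) (chartFrame x (chartPoint x u) w) := fun w => by
    refine (chartFrame_I hu.1 ((hkAt F B X x).J u w)).trans ?_
    rw [hJ]; rfl
  rw [locF_wedgeTwo (S := (1 / 2 : ℂ) •
    (Complex.I • (bunAt h X x).curvForm p (ContinuousLinearMap.id ℝ E) ((hkAt F B X x).K u) u
        (locF F η x u)
      - (bunAt h X x).curvForm p (ContinuousLinearMap.id ℝ E) ((hkAt F B X x).J u) u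
        (locF F η x u)))]
  · have h2 : ∀ T : E →L[ℝ] E →L[ℝ] E [⋀^Fin p]→L[ℝ] F,
        alt p ∘L ((1 / 2 : ℂ) • T) = (1 / 2 : ℂ) • (alt p ∘L T) := fun T => by
      ext1 v
      exact alt_smul (1 / 2 : ℂ) (T v)
    rw [h2, alt_smul, smul_smul]
    norm_num
  · intro v w m
    have e := fun v w => curv_loc h x v w (chartPoint_center (E := E) x)
      (η (chartPoint x u) fun i => chartFrame x (chartPoint x u) (m i))
    rw [thetaTwo_apply, ← hK, ← hK, ← hJ, ← hJ]
    simp only [LinearMap.smul_apply, LinearMap.sub_apply, LinearMap.add_apply, map_smul, map_sub,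
      map_add]
    rw [e, e, e, e]
    rfl

end Curvature

/-! ### The Riemannian measure in charts and integration of divergences. -/

section RiemannianMeasure

variable {E : Type*} [NormedAddCommGroup E] [NormedSpace ℂ E] [FiniteDimensional ℂ E]
  [MeasurableSpace E] [BorelSpace E]
  {M : Type*} [TopologicalSpace M] [ChartedSpace E M] [IsManifold 𝓘(ℂ, E) ω M]
  [MeasurableSpace M] [BorelSpace M]

theorem measurableSet_inter_preimage {X Y : Type*} [TopologicalSpace X]
    [MeasurableSpace X] [BorelSpace X] [TopologicalSpace Y] [MeasurableSpace Y] [BorelSpace Y]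
    {f : X → Y} {s : Set X} (hf : ContinuousOn f s) (hs : MeasurableSet s) {A : Set Y}
    (hA : MeasurableSet A) : MeasurableSet (s ∩ f ⁻¹' A) := by
  have h1 : s ∩ f ⁻¹' A = Subtype.val '' (s.domRestrict f ⁻¹' A) := by
    ext x
    simp [Set.domRestrict_apply, and_comm]
  rw [h1]
  exact hs.subtype_image (hf.domRestrict.measurable hA)

/-- The Riemannian density in the chart at `x₀`. -/
def chartDensity (g : Metric E M) (x₀ : M) (u : E) : ℝ :=
  Real.sqrt (Matrix.det (Matrix.of fun i j =>
    locMet g x₀ u (Module.finBasis ℝ E i) (Module.finBasis ℝ E j)))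

/-- The Riemannian measure of the domain of the chart at `x₀`. -/
def chartMeasure (g : Metric E M) (x₀ : M) : Measure M :=
  Measure.map (chartPoint (E := E) x₀)
    (((Module.finBasis ℝ E).addHaar.withDensity fun u =>
      ENNReal.ofReal (chartDensity g x₀ u)).restrict (extChartAt 𝓘(ℝ, E) x₀).target)

theorem riemannianMeasure_eq (g : Metric E M) :
    riemannianMeasure g = ⨆ x₀ : M, chartMeasure g x₀ := by
  simp only [riemannianMeasure, chartMeasure, chartDensity, locMet_apply]

theorem measurableSet_target (x₀ : M) : MeasurableSet (extChartAt 𝓘(ℝ, E) x₀).target :=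
  (isOpen_extChartAt_target x₀).measurableSet

theorem measurableSet_source (x₀ : M) : MeasurableSet (extChartAt 𝓘(ℝ, E) x₀).source :=
  (isOpen_extChartAt_source x₀).measurableSet

theorem chartMeasure_apply (g : Metric E M) (x₀ : M) {A : Set M} (hA : MeasurableSet A) :
    chartMeasure g x₀ A = ∫⁻ u in (extChartAt 𝓘(ℝ, E) x₀).target ∩ chartPoint x₀ ⁻¹' A,
      ENNReal.ofReal (chartDensity g x₀ u) ∂(Module.finBasis ℝ E).addHaar := by
  have ht := measurableSet_target (E := E) x₀
  rw [chartMeasure, Measure.map_apply_of_aemeasurable _ hA, Measure.restrict_apply' ht,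
    Set.inter_comm, withDensity_apply _
      (measurableSet_inter_preimage (continuousOn_chartPoint x₀) ht hA)]
  exact (continuousOn_chartPoint x₀).aemeasurable ht

theorem chartMeasure_inter_source (g : Metric E M) (x₀ : M) {A : Set M} (hA : MeasurableSet A) :
    chartMeasure g x₀ (A ∩ (extChartAt 𝓘(ℝ, E) x₀).source) = chartMeasure g x₀ A := by
  rw [chartMeasure_apply g x₀ hA, chartMeasure_apply g x₀ (hA.inter (measurableSet_source x₀))]
  congr 2
  ext u
  simp only [Set.mem_inter_iff, Set.mem_preimage]
  exact ⟨fun hu => ⟨hu.1, hu.2.1⟩, fun hu => ⟨hu.1, hu.2, chartPoint_mem hu.1⟩⟩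

theorem locMet_change (g : Metric E M) {x₀ y : M} {u : E}
    (hu : u ∈ (extChartAt 𝓘(ℝ, E) x₀).target)
    (hy : chartPoint x₀ u ∈ (extChartAt 𝓘(ℝ, E) y).source) (v w : E) : locMet g x₀ u v w
    = locMet g y (transition x₀ y u) (fderiv ℝ (transition x₀ y : E → E) u v)
      (fderiv ℝ (transition x₀ y : E → E) u w) := by
  rw [locMet_apply, locMet_apply, chartPoint_transition hu hy, chartFrame_transition hu hy,
    chartFrame_transition hu hy]

theorem det_gram_comp {V : Type*} [NormedAddCommGroup V] [NormedSpace ℝ V] {n : ℕ}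
    (b : Module.Basis (Fin n) ℝ V) (A : V →L[ℝ] V) (q : V →L[ℝ] V →L[ℝ] ℝ) :
    Matrix.det (Matrix.of fun i j => q (A (b i)) (A (b j)))
      = A.det ^ 2 * Matrix.det (Matrix.of fun i j => q (b i) (b j)) := by
  have h1 : (Matrix.of fun i j => q (A (b i)) (A (b j)))
      = (LinearMap.toMatrix b b A.toLinearMap).transpose * (Matrix.of fun i j => q (b i) (b j))
        * LinearMap.toMatrix b b A.toLinearMap := by
    ext i j
    have h2 : ∀ i, A (b i) = ∑ k, LinearMap.toMatrix b b A.toLinearMap k i • b k := fun i => by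
      simp only [LinearMap.toMatrix_apply]
      exact (b.sum_repr _).symm
    simp only [Matrix.of_apply, Matrix.mul_apply, Matrix.transpose_apply]
    rw [h2 i, h2 j]
    simp only [map_sum, map_smul, sum_apply, smul_apply, smul_eq_mul, Finset.mul_sum,
      Finset.sum_mul]
    refine Finset.sum_congr rfl fun k _ => Finset.sum_congr rfl fun l _ => by ring
  rw [h1, Matrix.det_mul, Matrix.det_mul, Matrix.det_transpose, LinearMap.det_toMatrix]
  change _ = (LinearMap.det A.toLinearMap) ^ 2 * _
  ring

/-- The Gram matrix changes by AᵗGA, so the root of its determinant changes by |det A|. -/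
theorem chartDensity_transition (g : Metric E M) {x₀ y : M} {u : E}
    (hu : u ∈ (extChartAt 𝓘(ℝ, E) x₀).target)
    (hy : chartPoint x₀ u ∈ (extChartAt 𝓘(ℝ, E) y).source) :
    chartDensity g x₀ u = |(fderiv ℝ (transition x₀ y : E → E) u).det|
      * chartDensity g y (transition x₀ y u) := by
  rw [chartDensity]
  simp only [locMet_change g hu hy]
  rw [det_gram_comp, Real.sqrt_mul (sq_nonneg _), Real.sqrt_sq_eq_abs]
  rfl

/-- Change of variables: the Jacobian of the coordinate change is the ratio of the densities. -/
theorem chartMeasure_eq_of_subset (g : Metric E M) {x₀ y : M} {A : Set M} (hA : MeasurableSet A)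
    (h₀ : A ⊆ (extChartAt 𝓘(ℝ, E) x₀).source) (hy : A ⊆ (extChartAt 𝓘(ℝ, E) y).source) :
    chartMeasure g y A = chartMeasure g x₀ A := by
  rw [chartMeasure_apply g x₀ hA, chartMeasure_apply g y hA]
  have hm := measurableSet_inter_preimage
    (continuousOn_chartPoint (E := E) x₀) (measurableSet_target x₀) hA
  have himg : (extChartAt 𝓘(ℝ, E) y).target ∩ chartPoint y ⁻¹' A
      = transition x₀ y '' ((extChartAt 𝓘(ℝ, E) x₀).target ∩ chartPoint x₀ ⁻¹' A) := by
    ext v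
    constructor
    · rintro ⟨hv, hA'⟩
      refine ⟨extChartAt 𝓘(ℝ, E) x₀ (chartPoint y v),
        ⟨(extChartAt 𝓘(ℝ, E) x₀).map_source (h₀ hA'), ?_⟩, ?_⟩
      · rw [Set.mem_preimage, chartPoint_extChartAt (h₀ hA')]
        exact hA'
      · rw [transition, chartPoint_extChartAt (h₀ hA'), extChartAt_chartPoint hv]
    · rintro ⟨u, ⟨hu, hA'⟩, rfl⟩
      refine ⟨transition_mem hu (hy hA'), ?_⟩
      rw [Set.mem_preimage, chartPoint_transition hu (hy hA')]
      exact hA'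
  have hinj : Set.InjOn (transition x₀ y : E → E)
      ((extChartAt 𝓘(ℝ, E) x₀).target ∩ chartPoint x₀ ⁻¹' A) := by
    rintro u ⟨hu, hA'⟩ v ⟨hv, hB⟩ huv
    have h1 := congrArg (chartPoint (M := M) y) huv
    rw [chartPoint_transition hu (hy hA'), chartPoint_transition hv (hy hB)] at h1
    rw [← extChartAt_chartPoint hu, h1, extChartAt_chartPoint hv]
  rw [himg, lintegral_image_eq_lintegral_abs_det_fderiv_mul _ hm (fun u hu =>
    (hasFDerivAt_transition hu.1 (hy hu.2)).hasFDerivWithinAt) hinj]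
  refine setLIntegral_congr_fun hm fun u hu => ?_
  rw [← ENNReal.ofReal_mul (abs_nonneg _), chartDensity_transition g hu.1 (hy hu.2),
    fderiv_transition hu.1 (hy hu.2)]

theorem chartMeasure_le (g : Metric E M) (x₀ : M) : chartMeasure g x₀ ≤ riemannianMeasure g := by
  rw [riemannianMeasure_eq]
  exact le_iSup (fun x₀ => chartMeasure g x₀) x₀

theorem riemannianMeasure_apply_of_subset (g : Metric E M) {x₀ : M} {A : Set M}
    (hA : MeasurableSet A) (h₀ : A ⊆ (extChartAt 𝓘(ℝ, E) x₀).source) :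
    riemannianMeasure g A = chartMeasure g x₀ A := by
  refine le_antisymm ?_ (chartMeasure_le g x₀ A)
  have hs := measurableSet_source (E := E) x₀
  -- The Riemannian measure is a supremum over all charts. Every chart measure agrees with that of
  -- `x₀` inside the domain of this chart, so the right-hand side bounds all of them, hence their
  -- supremum.
  have h1 : riemannianMeasure g ≤ chartMeasure g x₀
      + (riemannianMeasure g).restrict (extChartAt 𝓘(ℝ, E) x₀).sourceᶜ := by
    conv_lhs => rw [riemannianMeasure_eq]
    refine iSup_le fun y => Measure.le_iff.2 fun S hS => ?_
    rw [Measure.add_apply, Measure.restrict_apply hS,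
      ← measure_inter_add_sdiff S hs (μ := chartMeasure g y)]
    refine add_le_add ?_ (chartMeasure_le g y _)
    rw [← chartMeasure_inter_source g y (hS.inter hs),
      chartMeasure_eq_of_subset g ((hS.inter hs).inter (measurableSet_source y))
        (fun x hx => hx.1.2) (fun x hx => hx.2)]
    exact measure_mono fun x hx => hx.1.1
  have h2 := h1 A
  rwa [Measure.add_apply, Measure.restrict_apply hA, Set.disjoint_compl_right_iff_subset.2 h₀ |>.inter_eq,
    measure_empty, add_zero] at h2

theorem restrict_riemannianMeasure (g : Metric E M) (x₀ : M) :
    (riemannianMeasure g).restrict (extChartAt 𝓘(ℝ, E) x₀).source = chartMeasure g x₀ := by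
  ext A hA
  rw [Measure.restrict_apply hA, riemannianMeasure_apply_of_subset g
    (hA.inter (measurableSet_source x₀)) Set.inter_subset_right, chartMeasure_inter_source g x₀ hA]

theorem continuousOn_chartDensity (g : Metric E M) (x₀ : M) :
    ContinuousOn (chartDensity g x₀) (extChartAt 𝓘(ℝ, E) x₀).target := by
  refine ContinuousOn.sqrt ?_
  simp only [Matrix.det_apply]
  refine continuousOn_finsetSum _ fun σ _ => ContinuousOn.const_smul
    (continuousOn_finsetProd _ fun i _ => ?_) _
  exact ((locMet_smooth g x₀).continuousOn.clm_apply continuousOn_const).clm_apply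
    continuousOn_const

instance isLocallyFiniteMeasure_riemannianMeasure (g : Metric E M) :
    IsLocallyFiniteMeasure (riemannianMeasure g) := by
  refine ⟨fun x => ?_⟩
  have ht : (extChartAt 𝓘(ℝ, E) x).target ∈ nhds (extChartAt 𝓘(ℝ, E) x x) :=
    (isOpen_extChartAt_target x).mem_nhds (mem_extChartAt_target x)
  obtain ⟨K, hK, hKt, hKc⟩ := local_compact_nhds ht
  obtain ⟨O, hOK, hO, hxO⟩ := mem_nhds_iff.1 hK
  have hA : IsOpen ((extChartAt 𝓘(ℝ, E) x).source ∩ extChartAt 𝓘(ℝ, E) x ⁻¹' O) :=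
    (continuousOn_extChartAt x).isOpen_inter_preimage (isOpen_extChartAt_source x) hO
  refine ⟨_, hA.mem_nhds ⟨mem_extChartAt_source x, hxO⟩, ?_⟩
  rw [riemannianMeasure_apply_of_subset g hA.measurableSet Set.inter_subset_left,
    chartMeasure_apply g x hA.measurableSet]
  have hc : IntegrableOn (chartDensity g x) K (Module.finBasis ℝ E).addHaar :=
    ((continuousOn_chartDensity g x).mono hKt).integrableOn_compact hKc
  refine lt_of_le_of_lt (lintegral_mono_set (t := K) ?_) ?_
  · rintro u ⟨hu, -, hu'⟩
    rw [Set.mem_preimage, extChartAt_chartPoint hu] at hu'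
    exact hOK hu'
  · exact hc.lintegral_lt_top

theorem integral_riemannianMeasure_eq (g : Metric E M) (x₀ : M) {f : M → ℂ} (hf : Continuous f)
    (h0 : ∀ x ∉ (extChartAt 𝓘(ℝ, E) x₀).source, f x = 0) :
    ∫ x, f x ∂(riemannianMeasure g) = ∫ u in (extChartAt 𝓘(ℝ, E) x₀).target,
      chartDensity g x₀ u • f (chartPoint x₀ u) ∂(Module.finBasis ℝ E).addHaar := by
  have ht := measurableSet_target (E := E) x₀
  rw [← setIntegral_eq_integral_of_forall_compl_eq_zero h0, restrict_riemannianMeasure,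
    chartMeasure, integral_map ((continuousOn_chartPoint x₀).aemeasurable ht)
      hf.aestronglyMeasurable]
  rw [setIntegral_withDensity_eq_setIntegral_toReal_smul₀ _ _ _ ht]
  · refine setIntegral_congr_fun ht fun u _ => ?_
    rw [ENNReal.toReal_ofReal (by exact Real.sqrt_nonneg _)]
  · exact ((continuousOn_chartDensity g x₀).aemeasurable ht).ennreal_ofReal
  · exact Filter.Eventually.of_forall fun u => ENNReal.ofReal_lt_top

/-- A sum of derivatives of compactly supported functions has zero integral. -/
theorem integral_sum_fderiv_eq_zero {V : Type*} [NormedAddCommGroup V] [NormedSpace ℝ V]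
    [FiniteDimensional ℝ V] [MeasurableSpace V] [BorelSpace V] (μ : Measure V)
    [μ.IsAddHaarMeasure] {ι : Type*} [Fintype ι] {U K : Set V} (hU : IsOpen U) (hK : IsCompact K)
    (hKU : K ⊆ U) {f : ι → V → ℂ} (hf : ∀ a, ContDiffOn ℝ ∞ (f a) U)
    (h0 : ∀ a, ∀ u ∈ U, u ∉ K → f a u = 0) (w : ι → V) :
    ∫ u in U, ∑ a, fderiv ℝ (f a) u (w a) ∂μ = 0 := by
  -- Extension by zero outside U: the functions vanish on U outside the compact K ⊆ U, so the
  -- extensions are smooth on the whole space with compact support.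
  have hout : ∀ a, ∀ u ∉ K, U.indicator (f a) u = 0 := fun a u hu => by
    by_cases huU : u ∈ U
    · rw [Set.indicator_of_mem huU, h0 a u huU hu]
    · rw [Set.indicator_of_notMem huU]
  have hin : ∀ a, ∀ u ∈ U, U.indicator (f a) =ᶠ[nhds u] f a := fun a u hu =>
    Filter.mem_of_superset (hU.mem_nhds hu) fun u' hu' => Set.indicator_of_mem hu' _
  have hex : ∀ a, ∀ u ∉ K, U.indicator (f a) =ᶠ[nhds u] fun _ => 0 := fun a u hu =>
    Filter.mem_of_superset (hK.isClosed.isOpen_compl.mem_nhds hu) fun u' hu' => hout a u' hu'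
  have hsm : ∀ a, ContDiff ℝ ∞ (U.indicator (f a)) := fun a => by
    refine contDiff_iff_contDiffAt.2 fun u => ?_
    by_cases hu : u ∈ K
    · exact ((hf a).contDiffAt (hU.mem_nhds (hKU hu))).congr_of_eventuallyEq (hin a u (hKU hu))
    · exact contDiffAt_const.congr_of_eventuallyEq (hex a u hu)
  have hcs : ∀ a, HasCompactSupport (U.indicator (f a)) := fun a =>
    HasCompactSupport.intro hK fun u hu => hout a u hu
  have hd : ∀ a, Continuous fun u => fderiv ℝ (U.indicator (f a)) u (w a) := fun a =>
    ((hsm a).continuous_fderiv (by simp)).clm_apply continuous_const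
  have hdc : ∀ a, HasCompactSupport fun u => fderiv ℝ (U.indicator (f a)) u (w a) := fun a =>
    (hcs a).fderiv_apply ℝ (w a)
  have h1 : ∫ u in U, ∑ a, fderiv ℝ (f a) u (w a) ∂μ
      = ∫ u, ∑ a, fderiv ℝ (U.indicator (f a)) u (w a) ∂μ := by
    rw [← setIntegral_eq_integral_of_forall_compl_eq_zero (s := U)
      (f := fun u => ∑ a, fderiv ℝ (U.indicator (f a)) u (w a))]
    · refine setIntegral_congr_fun hU.measurableSet fun u hu => Finset.sum_congr rfl fun a _ => ?_
      rw [(hin a u hu).fderiv_eq (𝕜 := ℝ)]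
    · intro u hu
      refine Finset.sum_eq_zero fun a _ => ?_
      rw [(hex a u fun h => hu (hKU h)).fderiv_eq (𝕜 := ℝ)]
      simp
  rw [h1, integral_finsetSum _ fun a _ => (hd a).integrable_of_hasCompactSupport (hdc a)]
  refine Finset.sum_eq_zero fun a _ => ?_
  -- Integration by parts against the constant 1.
  have h2 := integral_mul_fderiv_eq_neg_fderiv_mul_of_integrable (𝕜 := ℂ) (μ := μ) (v := w a)
    (f := fun _ => (1 : ℂ)) (g := U.indicator (f a)) (by simp)
    (by simpa using (hd a).integrable_of_hasCompactSupport (hdc a))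
    (by simpa using (hsm a).continuous.integrable_of_hasCompactSupport (hcs a))
    (fun _ _ => differentiableAt_const _)
    (fun u _ => (hsm a).contDiffAt.differentiableAt (by simp))
  simpa using h2

end RiemannianMeasure

/-! ### Linear operations on global forms; continuity and positivity of the product. -/

section FormAlgebra

variable {E : Type*} [NormedAddCommGroup E] [NormedSpace ℂ E] [FiniteDimensional ℂ E]
  {M : Type*} [TopologicalSpace M] [ChartedSpace E M] [IsManifold 𝓘(ℂ, E) ω M]
  {F : Type*} [NormedAddCommGroup F] [NormedSpace ℂ F] [FiniteDimensional ℂ F]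
  {B : M → Type*} [TopologicalSpace (TotalSpace F B)]
  [∀ x, AddCommGroup (B x)] [∀ x, Module ℂ (B x)] [∀ x, TopologicalSpace (B x)]
  [FiberBundle F B] [VectorBundle ℂ F B] [ContMDiffVectorBundle ω F B 𝓘(ℂ, E)]
  {p q : ℕ} {x₀ : M} {u : E}

theorem locF_add (α β : Form E B p) (x₀ : M) (u : E) :
    locF F (α + β) x₀ u = locF F α x₀ u + locF F β x₀ u := by
  ext v
  exact map_add (bcoframe F B x₀ (chartPoint x₀ u)) _ _

theorem locF_neg (α : Form E B p) (x₀ : M) (u : E) : locF F (-α) x₀ u = -locF F α x₀ u := by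
  ext v
  exact map_neg (bcoframe F B x₀ (chartPoint x₀ u)) _

theorem locF_sub (α β : Form E B p) (x₀ : M) (u : E) :
    locF F (α - β) x₀ u = locF F α x₀ u - locF F β x₀ u := by
  rw [sub_eq_add_neg, locF_add, locF_neg, sub_eq_add_neg]

theorem locF_rsmul (f : M → ℝ) (α : Form E B p) (x₀ : M) (u : E) :
    locF F (fun x => f x • α x) x₀ u = f (chartPoint x₀ u) • locF F α x₀ u := by
  ext v
  exact map_real_smul (bcoframe F B x₀ (chartPoint x₀ u)) _ _

theorem locF_eq_zero {α : Form E B p} (h0 : α (chartPoint x₀ u) = 0) : locF F α x₀ u = 0 := by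
  ext v
  rw [locF_apply, h0]
  exact map_zero (bcoframe F B x₀ (chartPoint x₀ u))

theorem IsDolbeaultForm.add {α β : Form E B p} (hα : IsDolbeaultForm F α)
    (hβ : IsDolbeaultForm F β) : IsDolbeaultForm F (α + β) :=
  isDolbeaultForm_of_locF (fun x₀ u _ => locF_add α β x₀ u)
    (fun x₀ => (hα.1.locF x₀).add (hβ.1.locF x₀))
    fun _ u hu => add_mem (hα.locF_mem u hu) (hβ.locF_mem u hu)

theorem IsDolbeaultForm.neg {α : Form E B p} (hα : IsDolbeaultForm F α) :
    IsDolbeaultForm F (-α) :=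
  isDolbeaultForm_of_locF (fun x₀ u _ => locF_neg α x₀ u) (fun x₀ => (hα.1.locF x₀).neg)
    fun _ u hu => neg_mem (hα.locF_mem u hu)

theorem IsDolbeaultForm.sub {α β : Form E B p} (hα : IsDolbeaultForm F α)
    (hβ : IsDolbeaultForm F β) : IsDolbeaultForm F (α - β) := by
  rw [sub_eq_add_neg]
  exact hα.add hβ.neg

theorem IsDolbeaultForm.zero : IsDolbeaultForm F (0 : Form E B p) :=
  isDolbeaultForm_of_locF (ζ := fun _ _ => 0) (fun _ _ _ => locF_eq_zero rfl)
    (fun _ => contDiffOn_const) fun _ _ _ => zero_mem _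

theorem contDiffOn_comp_chartPoint {f : M → ℝ} (hf : ContMDiff 𝓘(ℝ, E) 𝓘(ℝ, ℝ) ∞ f) (x₀ : M) :
    ContDiffOn ℝ ∞ (fun u : E => f (chartPoint x₀ u)) (extChartAt 𝓘(ℝ, E) x₀).target :=
  contMDiffOn_iff_contDiffOn.1 (hf.comp_contMDiffOn (contMDiffOn_extChartAt_symm x₀))

theorem IsDolbeaultForm.rsmul {α : Form E B p} (hα : IsDolbeaultForm F α) {f : M → ℝ}
    (hf : ContMDiff 𝓘(ℝ, E) 𝓘(ℝ, ℝ) ∞ f) : IsDolbeaultForm F (fun x => f x • α x) :=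
  isDolbeaultForm_of_locF (fun x₀ u _ => locF_rsmul f α x₀ u)
    (fun x₀ => ((contDiffOn_comp_chartPoint hf x₀).mono (locU_subset x₀)).smul (hα.1.locF x₀))
    fun _ u hu => by
      rw [← Complex.coe_smul]
      exact Submodule.smul_mem _ _ (hα.locF_mem u hu)

variable {g : Metric E M} {h : HermitianMetric E F B}

theorem formInner_add_left (α α' β : Form E B p) (x : M) :
    formInner g h (α + α') β x = formInner g h α β x + formInner g h α' β x := by
  simp only [formInner, ← mul_add, ← Finset.sum_add_distrib]
  refine congrArg _ (Finset.sum_congr rfl fun i _ => Finset.sum_congr rfl fun j _ =>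
    congrArg _ ?_)
  exact congrArg (fun T : B x →ₗ[ℂ] ℂ => T _) (map_add (h.inner x) _ _)

theorem formInner_sub_right (α β β' : Form E B p) (x : M) :
    formInner g h α (β - β') x = formInner g h α β x - formInner g h α β' x := by
  simp only [formInner, ← mul_sub, ← Finset.sum_sub_distrib]
  refine congrArg _ (Finset.sum_congr rfl fun i _ => Finset.sum_congr rfl fun j _ =>
    congrArg _ ?_)
  exact map_sub (h.inner x _) _ _

theorem formInner_rsmul_left (f : M → ℝ) (α β : Form E B p) (x : M) :
    formInner g h (fun x => f x • α x) β x = f x * formInner g h α β x := by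
  simp only [formInner, Finset.mul_sum]
  refine Finset.sum_congr rfl fun i _ => Finset.sum_congr rfl fun j _ => ?_
  have e : h.inner x (f x • α x fun k => (Module.finBasis ℂ E (i k) : E))
      = (f x : ℂ) • h.inner x (α x fun k => (Module.finBasis ℂ E (i k) : E)) := by
    rw [← Complex.coe_smul, map_smulₛₗ]
    simp
  have e' := congrArg (fun T : B x →ₗ[ℂ] ℂ => T (β x fun k => (Module.finBasis ℂ E (j k) : E))) e
  refine (congrArg (fun c => _ * (_ * c)) e').trans ?_
  simp only [LinearMap.smul_apply, smul_eq_mul]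
  ring

theorem formInner_eq_zero_left {α β : Form E B p} {x : M} (hx : α x = 0) :
    formInner g h α β x = 0 := by
  have e : ∀ v, h.inner x (α x v) = 0 := fun v => by
    rw [hx]; exact map_zero (h.inner x)
  rw [formInner, Finset.sum_eq_zero, mul_zero]
  refine fun i _ => Finset.sum_eq_zero fun j _ => ?_
  exact (congrArg (fun T : B x →ₗ[ℂ] ℂ => _ * T _) (e _)).trans (mul_zero _)

variable (X : Hyperkahler E M) (h)

theorem continuous_formInner {α β : Form E B p} (hα : IsDolbeaultForm F α)
    (hβ : IsDolbeaultForm F β) : Continuous (formInner X.g h α β) := by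
  refine continuous_iff_continuousAt.2 fun x => ?_
  have hs : ContinuousOn (fun u => (bunAt h X x).ip p u (locF F α x u) (locF F β x u))
      (locU E F B x) :=
    (LocalBundle.ip_smooth (B := bunAt h X x) (hα.1.locF x) (hβ.1.locF x)).continuousOn
  have hc : ContinuousAt (fun y => (bunAt h X x).ip p (extChartAt 𝓘(ℝ, E) x y)
      (locF F α x (extChartAt 𝓘(ℝ, E) x y)) (locF F β x (extChartAt 𝓘(ℝ, E) x y))) x :=
    ContinuousAt.comp (f := extChartAt 𝓘(ℝ, E) x)
      (hs.continuousAt ((isOpen_locU x).mem_nhds (center_mem_locU x))) (continuousAt_extChartAt x)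
  refine hc.congr ?_
  have hO : (extChartAt 𝓘(ℝ, E) x).source ∩ (trivializationAt F B x).baseSet ∈ nhds x :=
    ((isOpen_extChartAt_source x).inter (trivializationAt F B x).open_baseSet).mem_nhds
      ⟨mem_extChartAt_source x, FiberBundle.mem_baseSet_trivializationAt' _⟩
  filter_upwards [hO] with y hy
  have hu : extChartAt 𝓘(ℝ, E) x y ∈ locU E F B x := ⟨(extChartAt 𝓘(ℝ, E) x).map_source hy.1, by
    rw [Set.mem_preimage, chartPoint_extChartAt hy.1]; exact hy.2⟩
  rw [← formInner_eq hα.2 hβ.2 hu, chartPoint_extChartAt hy.1]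

theorem formInner_self_nonneg {α : Form E B p} (hα : IsDolbeaultForm F α) (x : M) :
    0 ≤ (formInner X.g h α α x).re ∧ ((formInner X.g h α α x).re = 0 → α x = 0) ∧
      formInner X.g h α α x = ((formInner X.g h α α x).re : ℂ) := by
  have hu := center_mem_locU (E := E) (F := F) (B := B) x
  have h1 := formInner_eq (X := X) (h := h) hα.2 hα.2 hu
  rw [chartPoint_center] at h1
  rw [h1]
  refine ⟨((bunAt h X x).ip_nonneg_pos hu _).1, fun h0 => ?_, (bunAt h X x).ip_self_ofReal hu _⟩
  exact apply_eq_of_locF (β := 0)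
    ((((bunAt h X x).ip_nonneg_pos hu _).2 h0).trans (locF_eq_zero rfl).symm)

end FormAlgebra

/-! ### Coordinate-free candidates for the adjoints of ∂̄ and ∂̄_J. -/

section AdjointOperators

variable {E : Type*} [NormedAddCommGroup E] [NormedSpace ℂ E] [FiniteDimensional ℂ E]
  {M : Type*} [TopologicalSpace M] [ChartedSpace E M] [IsManifold 𝓘(ℂ, E) ω M]
  {F : Type*} [NormedAddCommGroup F] [NormedSpace ℂ F] [FiniteDimensional ℂ F]
  {B : M → Type*} [TopologicalSpace (TotalSpace F B)]
  [∀ x, AddCommGroup (B x)] [∀ x, Module ℂ (B x)] [∀ x, TopologicalSpace (B x)]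
  [FiberBundle F B] [VectorBundle ℂ F B] [ContMDiffVectorBundle ω F B 𝓘(ℂ, E)]
  (X : Hyperkahler E M) (h : HermitianMetric E F B) {p q : ℕ} {x₀ : M} {u : E}

/-- The formal adjoint of `∂̄`, in terms of `∂̄_J` and the adjoint of multiplication by `Ω̄`. -/
def dbarStar : ∀ p : ℕ, Form E B (p + 1) → Form E B p
  | 0, β => -starLam F X 0 (dbarJ X h 1 β)
  | p + 1, β => -starLam F X (p + 1) (dbarJ X h (p + 2) β) + dbarJ X h p (starLam F X p β)

variable (F) in
/-- The formal adjoint of `∂̄_J`, in terms of `∂̄` and the adjoint of multiplication by `Ω̄`. -/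
def dbarJStar : ∀ p : ℕ, Form E B (p + 1) → Form E B p
  | 0, β => starLam F X 0 (dbar F 1 β)
  | p + 1, β => starLam F X (p + 1) (dbar F (p + 2) β) - dbar F p (starLam F X p β)

variable {X} {h}

/-- The Kähler-type identity shows that the trace operator `qL` patches to a global operator: it is
the local form of -[Λ, ∂̄_J], already known to be global. -/
theorem locF_dbarStar {β : Form E B (p + 1)} (hβ : IsDolbeaultForm F β) (hu : u ∈ locU E F B x₀) :
    locF F (dbarStar X h p β) x₀ u = (bunAt h X x₀).qL p (locF F β x₀) u := by
  cases p with
  | zero =>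
    rw [dbarStar, locF_neg, locF_starLam _ hu, locF_dbarJ hβ.1 hu]
    exact (LocalBundle.qL_zero_eq (hβ.1.locF x₀) hβ.locF_mem hu).symm
  | succ p =>
    rw [dbarStar, locF_add, locF_neg, locF_starLam _ hu, locF_dbarJ hβ.1 hu,
      locF_dbarJ hβ.starLam.1 hu, LocalBundle.dbarJL_congr (Filter.mem_of_superset
        ((isOpen_locU x₀).mem_nhds hu) fun u hu => locF_starLam β hu)]
    exact (LocalBundle.qL_eq (hβ.1.locF x₀) hβ.locF_mem hu).symm

variable (h) in
theorem locF_dbarJStar {β : Form E B (p + 1)} (hβ : IsDolbeaultForm F β)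
    (hu : u ∈ locU E F B x₀) :
    locF F (dbarJStar F X p β) x₀ u = (bunAt h X x₀).qJL p (locF F β x₀) u := by
  cases p with
  | zero =>
    rw [dbarJStar, locF_starLam _ hu, locF_dbar (h := h) (X := X) hβ.1 hu]
    exact (LocalBundle.qJL_zero_eq (hβ.1.locF x₀) hβ.locF_mem hu).symm
  | succ p =>
    rw [dbarJStar, locF_sub, locF_starLam _ hu, locF_dbar (h := h) (X := X) hβ.1 hu,
      locF_dbar (h := h) (X := X) hβ.starLam.1 hu, LocalBundle.dbarL_congr (Filter.mem_of_superset
        ((isOpen_locU x₀).mem_nhds hu) fun u hu => locF_starLam β hu)]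
    exact (LocalBundle.qJL_eq (hβ.1.locF x₀) hβ.locF_mem hu).symm

theorem IsDolbeaultForm.dbarStar {β : Form E B (p + 1)} (hβ : IsDolbeaultForm F β) :
    IsDolbeaultForm F (dbarStar X h p β) := by
  cases p with
  | zero => exact hβ.dbarJ.starLam.neg
  | succ p => exact hβ.dbarJ.starLam.neg.add hβ.starLam.dbarJ

variable (h) in
include h in
theorem IsDolbeaultForm.dbarJStar {β : Form E B (p + 1)} (hβ : IsDolbeaultForm F β) :
    IsDolbeaultForm F (dbarJStar F X p β) := by
  cases p with
  | zero => exact (hβ.dbar h X).starLam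
  | succ p => exact (hβ.dbar h X).starLam.sub (hβ.starLam.dbar h X)

variable (X h) in
include X h in
-- The operators are built from `fderiv`, which has the value 0 at points of non-differentiability,
-- so additivity is only claimed on smooth forms.
theorem dbar_add {α β : Form E B p} (hα : IsDolbeaultForm F α) (hβ : IsDolbeaultForm F β) :
    dbar F p (α + β) = dbar F p α + dbar F p β := by
  refine eq_of_locF (F := F) fun x => ?_
  have hu := center_mem_locU (E := E) (F := F) (B := B) x
  rw [locF_add, locF_dbar (h := h) (X := X) (hα.add hβ).1 hu, locF_dbar (h := h) (X := X) hα.1 hu, locF_dbar (h := h) (X := X) hβ.1 hu,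
    LocalBundle.dbarL_congr (Filter.Eventually.of_forall fun u => locF_add α β x u)]
  simp only [LocalBundle.dbarL]
  rw [LocalBundle.opD_add _ (hα.1.locF x) (hβ.1.locF x) hu,
    LocalBundle.opD_add _ (hα.1.locF x) (hβ.1.locF x) hu]
  module

theorem dbarJ_add {α β : Form E B p} (hα : IsDolbeaultForm F α) (hβ : IsDolbeaultForm F β) :
    dbarJ X h p (α + β) = dbarJ X h p α + dbarJ X h p β := by
  refine eq_of_locF (F := F) fun x => ?_
  have hu := center_mem_locU (E := E) (F := F) (B := B) x
  rw [locF_add, locF_dbarJ (hα.add hβ).1 hu, locF_dbarJ hα.1 hu, locF_dbarJ hβ.1 hu,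
    LocalBundle.dbarJL_congr (Filter.Eventually.of_forall fun u => locF_add α β x u)]
  simp only [LocalBundle.dbarJL]
  rw [LocalBundle.opD_add _ (hα.1.locF x) (hβ.1.locF x) hu,
    LocalBundle.opD_add _ (hα.1.locF x) (hβ.1.locF x) hu]
  module

end AdjointOperators

/-! ### Existence and uniqueness of Hermitian adjoints. -/

section GlobalAdjoints

variable {E : Type*} [NormedAddCommGroup E] [NormedSpace ℂ E] [FiniteDimensional ℂ E]
  [MeasurableSpace E] [BorelSpace E]
  {M : Type*} [TopologicalSpace M] [ChartedSpace E M] [IsManifold 𝓘(ℂ, E) ω M]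
  [MeasurableSpace M] [BorelSpace M]

/-- The density is positive in every chart, so a nonempty open set cannot have measure zero. -/
theorem isOpenPosMeasure_riemannianMeasure (X : Hyperkahler E M) :
    (riemannianMeasure X.g).IsOpenPosMeasure := by
  refine ⟨fun O hO ⟨x, hx⟩ h0 => ?_⟩
  have hA : IsOpen (O ∩ (extChartAt 𝓘(ℝ, E) x).source) := hO.inter (isOpen_extChartAt_source x)
  have h1 := measure_mono_null (Set.inter_subset_left (s := O)
    (t := (extChartAt 𝓘(ℝ, E) x).source)) h0
  rw [riemannianMeasure_apply_of_subset X.g hA.measurableSet Set.inter_subset_right,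
    chartMeasure_apply X.g x hA.measurableSet] at h1
  have hV := (continuousOn_chartPoint (E := E) x).isOpen_inter_preimage
    (isOpen_extChartAt_target x) hA
  set V := (extChartAt 𝓘(ℝ, E) x).target ∩ chartPoint x ⁻¹' (O ∩ (extChartAt 𝓘(ℝ, E) x).source)
  have hc : AEMeasurable (fun u : E => ENNReal.ofReal (chartDensity X.g x u))
      ((Module.finBasis ℝ E).addHaar.restrict V) :=
    (((continuousOn_chartDensity X.g x).mono Set.inter_subset_left).aemeasurable
      hV.measurableSet).ennreal_ofReal
  rw [lintegral_eq_zero_iff' hc, Filter.EventuallyEq, ae_restrict_iff' hV.measurableSet] at h1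
  have h2 : (Module.finBasis ℝ E).addHaar V = 0 := by
    refine measure_mono_null (t := {u | ¬ (u ∈ V → ENNReal.ofReal (chartDensity X.g x u) =
      (0 : E → ENNReal) u)}) (fun u hu h3 => ?_) h1
    have h4 : 0 < chartDensity X.g x u := LocalHK.rho_pos (D := X.loc x _
      (isOpen_extChartAt_target x) subset_rfl) hu.1
    exact (ENNReal.ofReal_pos.2 h4).ne' (h3 hu)
  refine (hV.measure_pos (Module.finBasis ℝ E).addHaar ⟨extChartAt 𝓘(ℝ, E) x x,
    mem_extChartAt_target x, ?_⟩).ne' h2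
  rw [Set.mem_preimage, chartPoint_center]
  exact ⟨hx, mem_extChartAt_source x⟩

variable [T2Space M]
  {F : Type*} [NormedAddCommGroup F] [NormedSpace ℂ F] [FiniteDimensional ℂ F]
  {B : M → Type*} [TopologicalSpace (TotalSpace F B)]
  [∀ x, AddCommGroup (B x)] [∀ x, Module ℂ (B x)] [∀ x, TopologicalSpace (B x)]
  [FiberBundle F B] [VectorBundle ℂ F B] [ContMDiffVectorBundle ω F B 𝓘(ℂ, E)]
  {X : Hyperkahler E M} {h : HermitianMetric E F B} {p q : ℕ}

theorem integrable_formInner {α β : Form E B p} (hα : IsDolbeaultForm F α)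
    (hβ : IsDolbeaultForm F β) {C : Set M} (hC : IsCompact C) (h0 : ∀ x ∉ C, α x = 0) :
    Integrable (formInner X.g h α β) (riemannianMeasure X.g) :=
  (continuous_formInner h X hα hβ).integrable_of_hasCompactSupport
    (HasCompactSupport.intro hC fun x hx => formInner_eq_zero_left (h0 x hx))

/-- Test against fγ with a bump function f at a point where γ ≠ 0: the integrand f|γ|² is
continuous, nonnegative and nonzero there. -/
theorem eq_zero_of_globalInner {γ : Form E B p} (hγ : IsDolbeaultForm F γ)
    (h0 : ∀ α : Form E B p, IsDolbeaultForm F α → (∃ C : Set M, IsCompact C ∧ ∀ x ∉ C, α x = 0) →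
      globalInner X.g h α γ = 0) : γ = 0 := by
  funext x
  by_contra hx
  have f : SmoothBumpFunction 𝓘(ℝ, E) x := Classical.arbitrary _
  have hfγ := hγ.rsmul f.contMDiff
  have hs : ∀ y ∉ tsupport f, f y • γ y = 0 := fun y hy => by
    have h1 : f y = 0 := image_eq_zero_of_notMem_tsupport hy
    rw [h1, zero_smul]
  have h1 := h0 _ hfγ ⟨_, f.hasCompactSupport, hs⟩
  have hi := integrable_formInner (X := X) (h := h) hfγ hγ f.hasCompactSupport hs
  have hre : ∀ y, (formInner X.g h (fun x => f x • γ x) γ y).re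
      = f y * (formInner X.g h γ γ y).re := fun y => by
    rw [formInner_rsmul_left, Complex.re_ofReal_mul]
  have h2 : ∫ y, (formInner X.g h (fun x => f x • γ x) γ y).re ∂(riemannianMeasure X.g) = 0 := by
    have := integral_re (𝕜 := ℂ) hi
    refine this.trans ?_
    rw [globalInner] at h1
    rw [h1, map_zero]
  have := isOpenPosMeasure_riemannianMeasure X
  refine (Continuous.integral_pos_of_hasCompactSupport_nonneg_nonzero (x := x)
    (μ := riemannianMeasure X.g)
    (Complex.continuous_re.comp (continuous_formInner h X hfγ hγ))
    (HasCompactSupport.intro (K := tsupport f) f.hasCompactSupport fun y hy => ?_)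
    (fun y => ?_) ?_).ne' h2
  · change (formInner X.g h (fun x => f x • γ x) γ y).re = 0
    rw [formInner_eq_zero_left (α := fun x => f x • γ x) (hs y hy), Complex.zero_re]
  · change 0 ≤ (formInner X.g h (fun x => f x • γ x) γ y).re
    rw [hre]
    exact mul_nonneg f.nonneg (formInner_self_nonneg h X hγ y).1
  · change (formInner X.g h (fun x => f x • γ x) γ x).re ≠ 0
    rw [hre, f.eq_one, one_mul]
    exact fun h3 => hx ((formInner_self_nonneg h X hγ x).2.1 h3)

theorem IsHermitianAdjoint.hermitianAdjoint {P : Form E B p → Form E B q}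
    {Q : Form E B q → Form E B p} (hPQ : IsHermitianAdjoint X.g h P Q) :
    IsHermitianAdjoint X.g h P (hermitianAdjoint X.g h P) := by
  have hex : ∃ Q, IsHermitianAdjoint X.g h P Q := ⟨Q, hPQ⟩
  rw [QuatDolbeault.hermitianAdjoint, dif_pos hex]
  exact hex.choose_spec

/-- Two adjoints have the same pairings with compactly supported test forms, so on Dolbeault forms
the arbitrary choice in `hermitianAdjoint` is harmless. -/
theorem hermitianAdjoint_eq {P : Form E B p → Form E B q}
    {Q : Form E B q → Form E B p} (hPQ : IsHermitianAdjoint X.g h P Q) {β : Form E B q}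
    (hβ : IsDolbeaultForm F β) : hermitianAdjoint X.g h P β = Q β := by
  have hA := hPQ.hermitianAdjoint
  refine sub_eq_zero.1 (eq_zero_of_globalInner (X := X) (h := h)
    ((hA.2.1 β hβ).sub (hPQ.2.1 β hβ)) fun α hα ⟨C, hC, h0⟩ => ?_)
  have h1 := hA.2.2 α β hα hβ ⟨C, hC, h0⟩
  rw [hPQ.2.2 α β hα hβ ⟨C, hC, h0⟩] at h1
  simp only [globalInner] at h1 ⊢
  simp only [formInner_sub_right]
  rw [integral_sub (integrable_formInner hα (hA.2.1 β hβ) hC h0)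
    (integrable_formInner hα (hPQ.2.1 β hβ) hC h0), h1, sub_self]

theorem isHermitianAdjoint_lefschetz :
    IsHermitianAdjoint X.g h (lefschetz (B := B) X p) (starLam F X p) := by
  refine ⟨fun α hα => hα.lefschetz, fun β hβ => hβ.starLam, fun α β hα hβ _ => ?_⟩
  exact integral_congr_ae (Filter.Eventually.of_forall fun x =>
    formInner_lefschetz hα.2 hα.lefschetz.2 hβ.starLam.2 hβ.2 x)

/-- A pair of first order operators whose difference of pairings is locally a divergence. -/
structure IsDivergencePair (X : Hyperkahler E M) (h : HermitianMetric E F B)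
    (P : Form E B p → Form E B (p + 1)) (Q : Form E B (p + 1) → Form E B p) : Prop where
  left : ∀ α, IsDolbeaultForm F α → IsDolbeaultForm F (P α)
  right : ∀ β, IsDolbeaultForm F β → IsDolbeaultForm F (Q β)
  add : ∀ α β, IsDolbeaultForm F α → IsDolbeaultForm F β → P (α + β) = P α + P β
  eq_zero : ∀ α, IsDolbeaultForm F α → ∀ x, (∀ᶠ y in nhds x, α y = 0) → P α x = 0
  div : ∀ x₀ : M, ∃ A : E → Idx E → E, (∀ a, ContDiffOn ℝ ∞ (fun u => A u a) (locU E F B x₀)) ∧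
    ∀ α β, IsDolbeaultForm F α → IsDolbeaultForm F β → ∀ u ∈ locU E F B x₀,
      ∑ a, fderiv ℝ (fun u => (hkAt F B X x₀).rho u • (bunAt h X x₀).ip p u (locF F α x₀ u)
          ((locF F β x₀ u).curryLeft (A u a))) u (bs a)
        = (2 * (hkAt F B X x₀).rho u) • ((bunAt h X x₀).ip (p + 1) u (locF F (P α) x₀ u)
            (locF F β x₀ u) - (bunAt h X x₀).ip p u (locF F α x₀ u) (locF F (Q β) x₀ u))

namespace IsDivergencePair

variable {P : Form E B p → Form E B (p + 1)} {Q : Form E B (p + 1) → Form E B p}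

theorem eq_zero_of_notMem (H : IsDivergencePair X h P Q) {α : Form E B p}
    (hα : IsDolbeaultForm F α) {C : Set M} (hC : IsCompact C) (h0 : ∀ x ∉ C, α x = 0) :
    ∀ x ∉ C, P α x = 0 := fun x hx =>
  H.eq_zero α hα x (Filter.mem_of_superset (hC.isClosed.isOpen_compl.mem_nhds hx) h0)

/-- For α supported in one trivialized chart the difference of the pairings is half the integral of
a divergence whose fields have compact support there, hence zero. -/
theorem globalInner_eq_of_subset (H : IsDivergencePair X h P Q) {α : Form E B p}
    {β : Form E B (p + 1)} (hα : IsDolbeaultForm F α) (hβ : IsDolbeaultForm F β) {C : Set M}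
    (hC : IsCompact C) (h0 : ∀ x ∉ C, α x = 0) {x₀ : M}
    (hCx : C ⊆ (extChartAt 𝓘(ℝ, E) x₀).source ∩ (trivializationAt F B x₀).baseSet) :
    globalInner X.g h (P α) β = globalInner X.g h α (Q β) := by
  have hP0 := H.eq_zero_of_notMem hα hC h0
  have hPα := H.left α hα
  have hQβ := H.right β hβ
  rw [← sub_eq_zero, globalInner, globalInner, ← integral_sub
    (integrable_formInner hPα hβ hC hP0) (integrable_formInner hα hQβ hC h0)]
  have hout : ∀ x ∉ C, formInner X.g h (P α) β x - formInner X.g h α (Q β) x = 0 := fun x hx => by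
    rw [formInner_eq_zero_left (h0 x hx), formInner_eq_zero_left (hP0 x hx), sub_zero]
  rw [integral_riemannianMeasure_eq X.g x₀ (f := fun x => formInner X.g h (P α) β x
    - formInner X.g h α (Q β) x) ((continuous_formInner h X hPα hβ).sub
    (continuous_formInner h X hα hQβ)) fun x hx => hout x fun hxC => hx (hCx hxC).1]
  rw [setIntegral_eq_of_subset_of_forall_sdiff_eq_zero (measurableSet_target x₀)
    (locU_subset (F := F) (B := B) x₀) fun u hu => by
      rw [hout, smul_zero]
      exact fun hxC => hu.2 ⟨hu.1, (hCx hxC).2⟩]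
  obtain ⟨A, hA, hdiv⟩ := H.div x₀
  have h1 : ∀ u ∈ locU E F B x₀, chartDensity X.g x₀ u • (formInner X.g h (P α) β (chartPoint x₀ u)
      - formInner X.g h α (Q β) (chartPoint x₀ u)) = (1 / 2 : ℝ) •
        ∑ a, fderiv ℝ (fun u => (hkAt F B X x₀).rho u • (bunAt h X x₀).ip p u (locF F α x₀ u)
          ((locF F β x₀ u).curryLeft (A u a))) u (bs a) := fun u hu => by
    rw [formInner_eq hPα.2 hβ.2 hu, formInner_eq hα.2 hQβ.2 hu, hdiv α β hα hβ u hu, smul_smul]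
    have h2 : chartDensity X.g x₀ u = (hkAt F B X x₀).rho u := rfl
    rw [h2]
    congr 1
    ring
  rw [setIntegral_congr_fun (isOpen_locU x₀).measurableSet h1, integral_smul,
    integral_sum_fderiv_eq_zero _ (isOpen_locU x₀) (K := extChartAt 𝓘(ℝ, E) x₀ '' C), smul_zero]
  · exact hC.image_of_continuousOn ((continuousOn_extChartAt x₀).mono fun x hx => (hCx hx).1)
  · rintro _ ⟨x, hx, rfl⟩
    refine ⟨(extChartAt 𝓘(ℝ, E) x₀).map_source (hCx hx).1, ?_⟩
    rw [Set.mem_preimage, chartPoint_extChartAt (hCx hx).1]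
    exact (hCx hx).2
  · intro a
    exact ((hkAt F B X x₀).rho_smooth).smul (LocalBundle.ip_smooth (B := bunAt h X x₀)
      (hα.1.locF x₀) (curryLeft_smooth (hβ.1.locF x₀) (hA a)))
  · intro a u hu huK
    rw [locF_eq_zero (h0 _ fun hxC => huK ⟨_, hxC, extChartAt_chartPoint hu.1⟩), map_zero]
    exact smul_zero _

variable [SecondCountableTopology M]

theorem isHermitianAdjoint (H : IsDivergencePair X h P Q) : IsHermitianAdjoint X.g h P Q := by
  refine ⟨H.left, H.right, fun α β hα hβ ⟨C, hC, h0⟩ => ?_⟩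
  have : LocallyCompactSpace M := ChartedSpace.locallyCompactSpace E M
  obtain ⟨f, hf⟩ := SmoothPartitionOfUnity.exists_isSubordinate 𝓘(ℝ, E) (isClosed_univ (X := M))
    (fun x₀ : M => (extChartAt 𝓘(ℝ, E) x₀).source ∩ (trivializationAt F B x₀).baseSet)
    (fun x₀ => (isOpen_extChartAt_source x₀).inter (trivializationAt F B x₀).open_baseSet)
    fun x _ => Set.mem_iUnion.2
      ⟨x, mem_extChartAt_source x, FiberBundle.mem_baseSet_trivializationAt' _⟩
  -- Only finitely many functions of the partition meet the compact set containing the support of α,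
  -- so α is a finite sum of localized pieces.
  have hfin := f.locallyFinite.finite_nonempty_inter_compact hC
  set α' : M → Form E B p := fun i x => f i x • α x with hα'
  have hd : ∀ i, IsDolbeaultForm F (α' i) := fun i => hα.rsmul (f i).contMDiff
  have hz : ∀ i, ∀ x ∉ C, α' i x = 0 := fun i x hx => by
    simp only [hα', h0 x hx, smul_zero]
  have hz' : ∀ i, ∀ x ∉ C ∩ tsupport (f i), α' i x = 0 := fun i x hx => by
    by_cases hxC : x ∈ C
    · have h1 : f i x = 0 := image_eq_zero_of_notMem_tsupport fun h' => hx ⟨hxC, h'⟩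
      simp only [hα', h1, zero_smul]
    · exact hz i x hxC
  -- Only additivity of `P` is needed, since `Q` acts on the fixed β. Type, smoothness and support
  -- are carried along because additivity and integrability require them.
  have key : ∀ s : Finset M, IsDolbeaultForm F (∑ i ∈ s, α' i) ∧
      (∀ x ∉ C, (∑ i ∈ s, α' i) x = 0) ∧
      globalInner X.g h (P (∑ i ∈ s, α' i)) β = globalInner X.g h (∑ i ∈ s, α' i) (Q β) := by
    classical
    intro s
    induction s using Finset.induction_on with
    | empty =>
      refine ⟨IsDolbeaultForm.zero, fun _ _ => rfl, ?_⟩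
      -- `P 0 = 0` follows from locality.
      have h1 : ∀ x, P (∑ i ∈ ∅, α' i) x = 0 := fun x =>
        H.eq_zero _ IsDolbeaultForm.zero x (Filter.Eventually.of_forall fun _ => rfl)
      exact integral_congr_ae (Filter.Eventually.of_forall fun x =>
        (formInner_eq_zero_left (h1 x)).trans (formInner_eq_zero_left rfl).symm)
    | insert i s hi ih =>
      rw [Finset.sum_insert hi]
      refine ⟨(hd i).add ih.1, fun x hx => ?_, ?_⟩
      · rw [Pi.add_apply, hz i x hx, ih.2.1 x hx, add_zero]
      · have e := H.globalInner_eq_of_subset (hd i) hβ (hC.inter_right (isClosed_tsupport _))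
          (hz' i) (x₀ := i) (Set.inter_subset_right.trans (hf i))
        have e' := ih.2.2
        rw [H.add _ _ (hd i) ih.1]
        simp only [globalInner] at e e' ⊢
        simp only [formInner_add_left]
        rw [integral_add, integral_add, e, e']
        · exact integrable_formInner (hd i) (H.right β hβ) hC (hz i)
        · exact integrable_formInner ih.1 (H.right β hβ) hC ih.2.1
        · exact integrable_formInner (H.left _ (hd i)) hβ hC
            (H.eq_zero_of_notMem (hd i) hC (hz i))
        · exact integrable_formInner (H.left _ ih.1) hβ hC
            (H.eq_zero_of_notMem ih.1 hC ih.2.1)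
  have hsum : ∑ i ∈ hfin.toFinset, α' i = α := by
    funext x
    rw [Finset.sum_apply]
    by_cases hx : x ∈ C
    · have h1 := f.sum_eq_one (Set.mem_univ x)
      rw [finsum_eq_sum_of_support_subset (s := hfin.toFinset)] at h1
      · simp only [hα']
        rw [← Finset.sum_smul, h1, one_smul]
      · intro i hi
        rw [Set.Finite.coe_toFinset]
        exact ⟨x, hi, hx⟩
    · rw [h0 x hx]
      exact Finset.sum_eq_zero fun i _ => hz i x hx
  have := (key hfin.toFinset).2.2
  rwa [hsum] at this

end IsDivergencePair

end GlobalAdjoints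

/-! ### The Laplacian identity from the two expressions for the adjoints. -/

section Identities

variable {E : Type*} [NormedAddCommGroup E] [NormedSpace ℂ E] [FiniteDimensional ℂ E]
  {M : Type*} [TopologicalSpace M] [ChartedSpace E M] [IsManifold 𝓘(ℂ, E) ω M]
  {F : Type*} [NormedAddCommGroup F] [NormedSpace ℂ F] [FiniteDimensional ℂ F]
  {B : M → Type*} [TopologicalSpace (TotalSpace F B)]
  [∀ x, AddCommGroup (B x)] [∀ x, Module ℂ (B x)] [∀ x, TopologicalSpace (B x)]
  [FiberBundle F B] [VectorBundle ℂ F B] [ContMDiffVectorBundle ω F B 𝓘(ℂ, E)]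
  (X : Hyperkahler E M) (h : HermitianMetric E F B) {p q : ℕ}

/-- An operator that is additive on Dolbeault forms. -/
def IsAdditiveOp (P : Form E B p → Form E B q) : Prop :=
  ∀ α β, IsDolbeaultForm F α → IsDolbeaultForm F β → P (α + β) = P α + P β

namespace IsAdditiveOp

variable {P : Form E B p → Form E B q} (H : IsAdditiveOp (F := F) P)
include H

theorem map_zero : P 0 = 0 := by
  have h1 := H 0 0 IsDolbeaultForm.zero IsDolbeaultForm.zero
  rw [add_zero] at h1
  exact left_eq_add.1 h1

theorem map_neg {α : Form E B p} (hα : IsDolbeaultForm F α) : P (-α) = -P α := by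
  have h1 := H α (-α) hα hα.neg
  rw [add_neg_cancel, H.map_zero] at h1
  exact (neg_eq_of_add_eq_zero_right h1.symm).symm

theorem map_sub {α β : Form E B p} (hα : IsDolbeaultForm F α) (hβ : IsDolbeaultForm F β) :
    P (α - β) = P α - P β := by
  rw [sub_eq_add_neg, H _ _ hα hβ.neg, H.map_neg hβ, sub_eq_add_neg]

end IsAdditiveOp

include X h in
theorem isAdditiveOp_dbar : IsAdditiveOp (F := F) (dbar (E := E) (B := B) F p) :=
  fun _ _ hα hβ => dbar_add X h hα hβ

theorem isAdditiveOp_dbarJ : IsAdditiveOp (F := F) (dbarJ X h p) :=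
  fun _ _ hα hβ => dbarJ_add hα hβ

theorem starLam_add (α β : Form E B (p + 2)) :
    starLam F X p (α + β) = starLam F X p α + starLam F X p β := by
  refine eq_of_locF (F := F) fun x => ?_
  have hu := center_mem_locU (E := E) (F := F) (B := B) x
  rw [locF_add, locF_starLam _ hu, locF_starLam _ hu, locF_starLam _ hu, locF_add, map_add]


variable {X h}

/-- In degree 0 the terms with Λ on the right are absent, because Λ vanishes in degrees 0 and 1. -/
theorem laplacian_sub_zero (η : Form E B 0) :
    dbarStar X h 0 (dbar F 0 η) - dbarJStar F X 0 (dbarJ X h 0 η)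
      = -starLam F X 0 (thetaPlus X h 0 η) := by
  simp only [dbarStar, dbarJStar, thetaPlus, starLam_add]
  abel

/-- In degree 1 the cross term ∂̄Λ∂̄_J of the first Laplacian is already present and cancels with
the second; so does ∂̄_JΛ∂̄. -/
theorem laplacian_sub_one {η : Form E B 1} (hη : IsDolbeaultForm F η) :
    dbar F 0 (dbarStar X h 0 η) + dbarStar X h 1 (dbar F 1 η)
      - (dbarJ X h 0 (dbarJStar F X 0 η) + dbarJStar F X 1 (dbarJ X h 1 η))
      = -starLam F X 1 (thetaPlus X h 1 η) := by
  simp only [dbarStar, dbarJStar, thetaPlus, starLam_add]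
  rw [(isAdditiveOp_dbar X h).map_neg hη.dbarJ.starLam]
  abel

/-- Expanding {∂̄, -[Λ, ∂̄_J]} - {∂̄_J, [Λ, ∂̄]}, the terms with Λ in the middle cancel, and those
with Λ at an end combine to Θ₊Λ - ΛΘ₊. -/
theorem laplacian_sub_add_two {η : Form E B (p + 2)} (hη : IsDolbeaultForm F η) :
    dbar F (p + 1) (dbarStar X h (p + 1) η) + dbarStar X h (p + 2) (dbar F (p + 2) η)
      - (dbarJ X h (p + 1) (dbarJStar F X (p + 1) η) + dbarJStar F X (p + 2) (dbarJ X h (p + 2) η))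
      = thetaPlus X h p (starLam F X p η) - starLam F X (p + 2) (thetaPlus X h (p + 2) η) := by
  simp only [dbarStar, dbarJStar, thetaPlus, starLam_add]
  rw [dbar_add X h hη.dbarJ.starLam.neg hη.starLam.dbarJ,
    (isAdditiveOp_dbar X h).map_neg hη.dbarJ.starLam,
    (isAdditiveOp_dbarJ X h).map_sub (hη.dbar h X).starLam (hη.starLam.dbar h X)]
  abel

section Adjoints

variable [MeasurableSpace E] [BorelSpace E] [MeasurableSpace M] [BorelSpace M] [T2Space M]

theorem apply_eq_zero_of_eventually {P : Form E B p → Form E B q}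
    {PL : M → (E → E [⋀^Fin p]→L[ℝ] F) → E → E [⋀^Fin q]→L[ℝ] F}
    (hP : ∀ α, IsDolbeaultForm F α → ∀ x, locF F (P α) x (extChartAt 𝓘(ℝ, E) x x)
      = PL x (locF F α x) (extChartAt 𝓘(ℝ, E) x x))
    (hPL : ∀ x η η', η =ᶠ[nhds (extChartAt 𝓘(ℝ, E) x x)] η' →
      PL x η (extChartAt 𝓘(ℝ, E) x x) = PL x η' (extChartAt 𝓘(ℝ, E) x x))
    (hadd : IsAdditiveOp (F := F) P) {α : Form E B p} (hα : IsDolbeaultForm F α) {x : M}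
    (h0 : ∀ᶠ y in nhds x, α y = 0) : P α x = 0 := by
  -- The local expression depends only on the germ, and near x the form α has the germ of the zero
  -- form.
  have h1 : P α x = P 0 x := by
    refine apply_eq_of_locF (F := F) ?_
    rw [hP α hα, hP 0 IsDolbeaultForm.zero]
    refine hPL x _ _ ?_
    have hc : ContinuousAt (chartPoint (E := E) x) (extChartAt 𝓘(ℝ, E) x x) :=
      (continuousOn_chartPoint x).continuousAt
        ((isOpen_extChartAt_target x).mem_nhds (mem_extChartAt_target x))
    rw [← chartPoint_center (E := E) x] at h0
    filter_upwards [hc.eventually h0] with u hu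
    rw [locF_eq_zero hu, locF_eq_zero rfl]
  rw [h1, hadd.map_zero]
  rfl

theorem isDivergencePair_dbar : IsDivergencePair X h (dbar F p) (dbarStar X h p) where
  left _ hα := hα.dbar h X
  right _ hβ := hβ.dbarStar
  add := isAdditiveOp_dbar X h
  eq_zero _ hα _ h0 := apply_eq_zero_of_eventually
    (PL := fun x η u => (bunAt h X x).dbarL p η u)
    (fun _ hα x => locF_dbar hα.1 (center_mem_locU x)) (fun _ _ _ he => LocalBundle.dbarL_congr he)
    (isAdditiveOp_dbar X h) hα h0
  div x₀ := by
    -- The field to be integrated is dual to v ↦ ⟨α, ι_v β⟩; its components are taken along the dual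
    -- frame.
    refine ⟨fun u a => (hkAt F B X x₀).du u a, fun a => (hkAt F B X x₀).du_smooth a,
      fun α β hα hβ u hu => ?_⟩
    rw [locF_dbar (h := h) (X := X) hα.1 hu, locF_dbarStar hβ hu]
    exact LocalBundle.div_dbarL (B := bunAt h X x₀) (hα.1.locF x₀) (hβ.1.locF x₀) hβ.locF_mem hu

theorem isDivergencePair_dbarJ : IsDivergencePair X h (dbarJ X h p) (dbarJStar F X p) where
  left _ hα := hα.dbarJ
  right _ hβ := hβ.dbarJStar h
  add := isAdditiveOp_dbarJ X h
  eq_zero _ hα _ h0 := apply_eq_zero_of_eventually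
    (PL := fun x η u => (bunAt h X x).dbarJL p η u)
    (fun _ hα x => locF_dbarJ hα.1 (center_mem_locU x))
    (fun _ _ _ he => LocalBundle.dbarJL_congr he) (isAdditiveOp_dbarJ X h) hα h0
  div x₀ := by
    -- For ∂̄_J the field is dual to v ↦ ⟨α, ι_{Jv} β⟩.
    refine ⟨fun u a => (hkAt F B X x₀).J u ((hkAt F B X x₀).du u a),
      fun a => (hkAt F B X x₀).J_smooth.clm_apply ((hkAt F B X x₀).du_smooth a),
      fun α β hα hβ u hu => ?_⟩
    rw [locF_dbarJ (h := h) (X := X) hα.1 hu, locF_dbarJStar h hβ hu]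
    exact LocalBundle.div_dbarJL (B := bunAt h X x₀) (hα.1.locF x₀) (hβ.1.locF x₀) hβ.locF_mem hu

variable [SecondCountableTopology M]

theorem isHermitianAdjoint_dbar (p : ℕ) :
    IsHermitianAdjoint X.g h (dbar (B := B) F p) (dbarStar X h p) :=
  isDivergencePair_dbar.isHermitianAdjoint

theorem isHermitianAdjoint_dbarJ (p : ℕ) :
    IsHermitianAdjoint X.g h (dbarJ X h p) (dbarJStar F X p) :=
  isDivergencePair_dbarJ.isHermitianAdjoint

theorem lambdaOmegaBar_eq {η : Form E B (p + 2)} (hη : IsDolbeaultForm F η) :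
    lambdaOmegaBar X h p η = starLam F X p η :=
  hermitianAdjoint_eq isHermitianAdjoint_lefschetz hη

theorem IsDolbeaultForm.thetaPlus {η : Form E B p} (hη : IsDolbeaultForm F η) :
    IsDolbeaultForm F (thetaPlus X h p η) :=
  (hη.dbarJ.dbar h X).add (hη.dbar h X).dbarJ

theorem laplacian_sub_laplacian (p : ℕ) {η : Form E B p} (hη : IsDolbeaultForm F η) :
    laplacian X.g h (dbar F) p η - laplacian X.g h (dbarJ X h) p η = thetaLambda X h p η := by
  match p with
  | 0 =>
    rw [laplacian, laplacian, thetaLambda, hermitianAdjoint_eq (isHermitianAdjoint_dbar 0)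
      (hη.dbar h X), hermitianAdjoint_eq (isHermitianAdjoint_dbarJ 0) hη.dbarJ,
      lambdaOmegaBar_eq hη.thetaPlus, laplacian_sub_zero]
  | 1 =>
    rw [laplacian, laplacian, thetaLambda, hermitianAdjoint_eq (isHermitianAdjoint_dbar 0) hη,
      hermitianAdjoint_eq (isHermitianAdjoint_dbar 1) (hη.dbar h X),
      hermitianAdjoint_eq (isHermitianAdjoint_dbarJ 0) hη,
      hermitianAdjoint_eq (isHermitianAdjoint_dbarJ 1) hη.dbarJ,
      lambdaOmegaBar_eq hη.thetaPlus, laplacian_sub_one hη]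
  | p + 2 =>
    rw [laplacian, laplacian, thetaLambda, hermitianAdjoint_eq (isHermitianAdjoint_dbar (p + 1)) hη,
      hermitianAdjoint_eq (isHermitianAdjoint_dbar (p + 2)) (hη.dbar h X),
      hermitianAdjoint_eq (isHermitianAdjoint_dbarJ (p + 1)) hη,
      hermitianAdjoint_eq (isHermitianAdjoint_dbarJ (p + 2)) hη.dbarJ,
      lambdaOmegaBar_eq hη.thetaPlus, lambdaOmegaBar_eq hη, laplacian_sub_add_two hη]

end Adjoints

end Identities

end

end QuatDolbeault

/-! ### The theorem. -/

theorem mainTheorem4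
    {E : Type*} [NormedAddCommGroup E] [NormedSpace ℂ E] [FiniteDimensional ℂ E]
    [MeasurableSpace E] [BorelSpace E]
    {M : Type*} [TopologicalSpace M] [T2Space M] [SecondCountableTopology M]
    [MeasurableSpace M] [BorelSpace M]
    [ChartedSpace E M] [IsManifold 𝓘(ℂ, E) ω M]
    {F : Type*} [NormedAddCommGroup F] [NormedSpace ℂ F] [FiniteDimensional ℂ F]
    {B : M → Type*} [TopologicalSpace (TotalSpace F B)]
    [∀ x, AddCommGroup (B x)] [∀ x, Module ℂ (B x)] [∀ x, TopologicalSpace (B x)]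
    [FiberBundle F B] [VectorBundle ℂ F B] [ContMDiffVectorBundle ω F B 𝓘(ℂ, E)]
    (X : QuatDolbeault.Hyperkahler E M) (h : QuatDolbeault.HermitianMetric E F B) :
    -- `∂̄`, `∂̄_J` and `L_Ω̄` have Hermitian adjoints
    (∀ p : ℕ, QuatDolbeault.IsHermitianAdjoint X.g h (QuatDolbeault.dbar (B := B) F p)
      (QuatDolbeault.hermitianAdjoint X.g h (QuatDolbeault.dbar F p))) ∧
    (∀ p : ℕ, QuatDolbeault.IsHermitianAdjoint X.g h (QuatDolbeault.dbarJ X h p)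
      (QuatDolbeault.hermitianAdjoint X.g h (QuatDolbeault.dbarJ X h p))) ∧
    (∀ p : ℕ, QuatDolbeault.IsHermitianAdjoint X.g h (QuatDolbeault.lefschetz (B := B) X p)
      (QuatDolbeault.lambdaOmegaBar X h p)) ∧
    -- `Δ_∂̄ - Δ_∂̄_J = [Θ₊, Λ_Ω̄]`
    (∀ (p : ℕ) (η : QuatDolbeault.Form E B p), QuatDolbeault.IsDolbeaultForm F η →
      QuatDolbeault.laplacian X.g h (QuatDolbeault.dbar F) p η
        - QuatDolbeault.laplacian X.g h (QuatDolbeault.dbarJ X h) p η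
        = QuatDolbeault.thetaLambda X h p η) ∧
    -- `Θ₊` is multiplication by an `End(B)`-valued `(0,2)`-form, which corresponds to the
    -- `Λ²₊`-part of the curvature of `B`
    (∃ Θ : ∀ x : M, TangentSpace 𝓘(ℝ, E) x →ₗ[ℝ] TangentSpace 𝓘(ℝ, E) x →ₗ[ℝ]
        (B x →ₗ[ℂ] B x),
      (∀ x v, Θ x v v = 0) ∧
      (∀ x v w, Θ x (QuatDolbeault.tangentI x v) w = -(Complex.I • Θ x v w)) ∧
      (∀ (p : ℕ) (η : QuatDolbeault.Form E B p), QuatDolbeault.IsDolbeaultForm F η →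
        QuatDolbeault.thetaPlus X h p η = fun x => QuatDolbeault.wedgeTwo (Θ x) (η x)) ∧
      (∀ x : M, QuatDolbeault.IsPlusPart (QuatDolbeault.tangentI x) (X.J x) (X.K x)
        (QuatDolbeault.chernCurvature h x)
        (QuatDolbeault.plusIso (X.J x) (fun v w => Θ x v w)))) := by
  refine ⟨fun p => (QuatDolbeault.isHermitianAdjoint_dbar p).hermitianAdjoint,
    fun p => (QuatDolbeault.isHermitianAdjoint_dbarJ p).hermitianAdjoint,
    fun p => QuatDolbeault.isHermitianAdjoint_lefschetz.hermitianAdjoint,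
    fun p η hη => QuatDolbeault.laplacian_sub_laplacian p hη,
    QuatDolbeault.thetaTwo X h, QuatDolbeault.thetaTwo_self X h, QuatDolbeault.thetaTwo_I X h,
    fun p η hη => QuatDolbeault.thetaPlus_eq hη, QuatDolbeault.isPlusPart_thetaTwo X h⟩
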